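/- Let $q\ge 1$ be an integer, $\rho>0$, and fix a Grassmann algebra with $L\ge 2$ generators. \emph{Algebras.} Let $\mathfrak{osp}(1|2)$ be the complex Lie superalgebra with even basis $J_1,J_2,J_3$, odd basis $J_4,J_5$ and graded bracket $[J_i,J_j]=\mathrm i\sum_k\varepsilon_{ijk}J_k$, $[J_i,J_\alpha]=\tfrac12\sum_\beta(\sigma_i)_{\beta\alpha}J_\beta$, $[J_\alpha,J_\beta]=\tfrac12\sum_i(\mathrm i\sigma_2\sigma_i)_{\alpha\beta}J_i$ ($\sigma_i$ the Pauli matrices), and put $J_\pm=J_1\pm \mathrm iJ_2$. Let $V(\tfrac q2,\bar 1)$ be its irreducible graded representation whose highest weight vector is odd and has weight $\tfrac q2$, of dimension $(q\,|\,q+1)$, and let $\mathrm V(\tfrac q2)$ be the $(q+1)$-dimensional irreducible representation of $\mathfrak{sl}(2)=\langle J_1,J_2,J_3\rangle$. The truncated supersphere is the $\mathbb Z_2$-graded algebra $S_{\rho,q}=\operatorname{End}V(\tfrac q2,\bar 1)$, and the truncated sphere is the algebra $\mathrm S_{\rho,q}=\operatorname{End}\mathrm V(\tfrac q2)$; $\mathfrak{osp}(1|2)$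 and $\mathfrak{sl}(2)$ act on them by $\mathrm{ad}(J)f=[J,f]$ (graded commutator, respectively commutator). Put $\mathfrak X(S_{\rho,q})=\mathrm{ad}(\mathfrak{osp}(1|2))$ and $\mathfrak X(\mathrm S_{\rho,q})=\mathrm{ad}(\mathfrak{sl}(2))$. \emph{Forms and cohomology.} The $p$-superforms on $S_{\rho,q}$ are the graded-alternating $p$-linear maps $\mathfrak X(S_{\rho,q})^p\to S_{\rho,q}$ (for $p=0$: the elements of $S_{\rho,q}$), with differential, for homogeneous $\omega$ and $D_0,\dots,D_p$, \begin{align*} d\omega(D_0,\dots,D_p)={}&\sum_{l}(-1)^{l+\bar D_l(\bar\omega+\bar D_0+\cdots+\bar D_{l-1})}D_l\bigl(\omega(D_0,\dots,\widehat{D_l},\dots,D_p)\bigr)\\ &+\sum_{l<l'}(-1)^{l'+\bar D_{l'}(\bar D_{l+1}+\cdots+\bar D_{l'-1})}\omega(D_0,\dots,D_{l-1},[D_l,D_{l'}],D_{l+1},\dots,\widehat{D_{l'}},\dots,D_p). \end{align*} The forms on $\mathrm S_{\rho,q}$ are defined in the same way with all gradings trivial. The cohomologies are $H^p=\ker d/\operatorname{im}d$;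 the one of $S_{\rho,q}$ is $\mathbb Z_2$-graded in each degree $p$. For any Lie (super)algebra $\mathfrak g$ and graded $\mathfrak g$-module $M$, $H^p(\mathfrak g;M)$ denotes the cohomology of the analogous complex of graded-alternating maps $\mathfrak g^p\to M$. \emph{Body map.} Let $Y^{j}_{l,m}$ be the superspherical harmonics ($j\in\tfrac12\mathbb N_0$, $j\le q$, $l\in\{j,j-\tfrac12\}$, $l\ge 0$, $m\in\{-l,-l+1,\dots,l\}$) on the $(2|2)$-dimensional supersphere $\sum_k(x^k)^2+2\theta^4\theta^5=\rho^2$, and $\mathrm Y^j_m$ ($j\in\mathbb N_0$, $j\le q$) the spherical harmonics on the sphere of radius $\rho$, that is $$Y^j_{l,m}=\sqrt{\tfrac{4^{2(j-l)}(l+m)!}{(2j)!\,(l-m)!}}\;J_-^{\,l-m}J_5^{\,2(j-l)}Y^j,\qquad \mathrm Y^j_m=\sqrt{\tfrac{(j+m)!}{(2j)!\,(j-m)!}}\;J_-^{\,j-m}\,\mathrm Y^j,$$ where $J_i=-\mathrm i\sum\varepsilon_{ijk}x^j\partial_k+\tfrac12\sum(\sigma_i)_{\alpha\beta}\theta^\alpha\partial_\beta$,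 $J_\alpha=\tfrac12\sum\bigl(\mathrm i x^k(\sigma_2\sigma_k)_{\alpha\beta}\partial_\beta-\theta^\beta(\sigma_k)_{\beta\alpha}\partial_k\bigr)$ (without the $\theta$-terms for $\mathrm Y$), and, with $x^+=x^1+\mathrm ix^2$, $a=\lfloor j\rfloor$, $Y^j=\frac{\sqrt{(2j)!}}{2^{a}a!\rho^{a}}(x^+)^{a}$ for $j\in\mathbb N_0$, $Y^j=\frac{\sqrt{(2j)!}}{2^{a}a!\rho^{a+2}}(x^+)^{a}(x^3\theta^4+x^+\theta^5)$ for $j\in\mathbb N_0+\tfrac12$, and $\mathrm Y^j=\frac{\sqrt{(2j+1)!}}{2^jj!\rho^j}(x^+)^j$. Let $\psi_q$ and $\hat\psi_q$ be the linear isomorphisms from the spans of these functions onto $S_{\rho,q}$ and $\mathrm S_{\rho,q}$ taking each harmonic to its noncommutative version, which is given by the same two formulas with $J_-,J_5$ acting by $\mathrm{ad}$ and with $Y^j$ replaced by $\sqrt{\frac{2^{j}(2j-1)!!\,(q-j)!}{j!\,(q+j)!}}\,J_+^{j}$ for $j\in\mathbb N_0$, by $\frac{1}{q+1/2}\sqrt{\frac{2^{a+4}(2a+1)!!\,(q-a-1)!}{a!\,(q+a+1)!}}\,J_+^{a}\bigl((J_3-\tfrac34)J_4+J_+J_5\bigr)$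 for $j=a+\tfrac12$, and $\mathrm Y^j$ replaced by $\sqrt{\frac{2^j(2j+1)!!\,(q+1)(q-j)!}{j!\,(q+j+1)!}}\,J_+^j$. The noncommutative body map is $\beta_q=\hat\psi_q\circ\beta\circ\psi_q^{-1}:S_{\rho,q}\to\mathrm S_{\rho,q}$, where $\beta$ sends a function on the supersphere to its body on the sphere (all Grassmann generators set to $0$). It induces a linear bijection $\tilde\beta_q$ from the even part of $\mathfrak X(S_{\rho,q})$ onto $\mathfrak X(\mathrm S_{\rho,q})$ by $\tilde\beta_q(D)\beta_q(f)=\beta_q(Df)$, and it extends to superforms by $(\beta_q\omega)(\tilde\beta_qD_1,\dots,\tilde\beta_qD_p)=\beta_q(\omega(D_1,\dots,D_p))$ for even $D_1,\dots,D_p$. \textbf{Proposition.} The maps $\beta_q$ and $\tilde\beta_q$ are well defined, $\beta_q$ maps closed superforms to closed forms, and $[\omega]\mapsto[\beta_q\omega]$ is a well-defined isomorphism $H(S_{\rho,q})\to H(\mathrm S_{\rho,q})$ of $(\mathbb N_0\times\mathbb Z_2)$-graded complex vector spaces. Moreover $$H^p(S_{\rho,q})\cong H^p(\mathrm S_{\rho,q})\cong\begin{cases}\mathbb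 C,&p=0,3,\\ \{0\},&p\in\mathbb N_0\setminus\{0,3\},\end{cases}$$ and for every $p\in\mathbb N_0$ $$H^p\bigl(\mathfrak{osp}(1|2);\operatorname{End}V(\tfrac q2,\bar 1)\bigr)\cong H^p\bigl(\mathfrak{sl}(2);\operatorname{End}\mathrm V(\tfrac q2)\bigr)\cong H^p(\mathfrak{sl}(2);\mathbb C).$$ -/

import Mathlib

open scoped Matrix

namespace FuzzySupersphere

noncomputable section

/-! ### `ℤ₂`-graded complex vector spaces -/

/-- The sign `(-1)^i` of a degree `i ∈ ℤ₂`. -/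
def sgn (i : ZMod 2) : ℂ := if i = 0 then 1 else -1

/-- A `ℤ₂`-grading of a complex vector space, encoded by its grading involution
`x ↦ (-1)^{deg x} x`: the even (odd) part is the eigenspace for the eigenvalue `1` (`-1`). -/
class SuperSpace (M : Type*) [AddCommGroup M] [Module ℂ M] where
  par : M →ₗ[ℂ] M
  par_par : ∀ x, par (par x) = x

open SuperSpace (par par_par)

/-- The trivial grading: everything is even. -/
abbrev trivialGrading (M : Type*) [AddCommGroup M] [Module ℂ M] : SuperSpace M where
  par := LinearMap.id
  par_par _ := rfl

section Graded

variable {M : Type*} [AddCommGroup M] [Module ℂ M] [SuperSpace M]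

/-- The projection onto the homogeneous component of degree `i`. -/
def comp (i : ZMod 2) : M →ₗ[ℂ] M := (1 / 2 : ℂ) • (LinearMap.id + sgn i • par)

/-- The subspace of homogeneous elements of degree `i`. -/
def homog (M : Type*) [AddCommGroup M] [Module ℂ M] [SuperSpace M] (i : ZMod 2) :
    Submodule ℂ M :=
  LinearMap.ker (par - sgn i • LinearMap.id)

/-- The induced grading of `End M`: an endomorphism is even (odd) if it preserves (exchanges) the
even and the odd part of `M`. -/
instance instEnd : SuperSpace (Module.End ℂ M) where
  par :=
    { toFun := fun X => par ∘ₗ X ∘ₗ par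
      map_add' := fun X Y => by ext x; simp
      map_smul' := fun c X => by ext x; simp }
  par_par X := by ext x; simp [par_par]

theorem par_end (X : Module.End ℂ M) (x : M) : par X x = par (X (par x)) := rfl

theorem par_mul (X Y : Module.End ℂ M) : par (X * Y) = par X * par Y := by
  ext x; simp [par_end, par_par]

/-- The graded commutator `X Y - (-1)^{deg X deg Y} Y X` on `End M`, extended bilinearly from
homogeneous `X` and `Y`. -/
def superComm : Module.End ℂ M →ₗ[ℂ] Module.End ℂ M →ₗ[ℂ] Module.End ℂ M :=
  LinearMap.mk₂ ℂ
    (fun X Y => ∑ i : ZMod 2, ∑ j : ZMod 2,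
      (comp i X * comp j Y - sgn (i * j) • (comp j Y * comp i X)))
    (fun X X' Y => by
      simp only [map_add, add_mul, mul_add, smul_add, ← Finset.sum_add_distrib]
      exact Finset.sum_congr rfl fun i _ => Finset.sum_congr rfl fun j _ => by abel)
    (fun c X Y => by
      simp only [map_smul, smul_mul_assoc, mul_smul_comm, Finset.smul_sum, smul_sub]
      exact Finset.sum_congr rfl fun i _ => Finset.sum_congr rfl fun j _ => by
        rw [smul_comm c (sgn (i * j))])
    (fun X Y Y' => by
      simp only [map_add, add_mul, mul_add, smul_add, ← Finset.sum_add_distrib]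
      exact Finset.sum_congr rfl fun i _ => Finset.sum_congr rfl fun j _ => by abel)
    (fun c X Y => by
      simp only [map_smul, smul_mul_assoc, mul_smul_comm, Finset.smul_sum, smul_sub]
      exact Finset.sum_congr rfl fun i _ => Finset.sum_congr rfl fun j _ => by
        rw [smul_comm c (sgn (i * j))])

theorem sum_zmod_two {N : Type*} [AddCommMonoid N] (f : ZMod 2 → N) :
    ∑ i : ZMod 2, f i = f 0 + f 1 := Fin.sum_univ_two f

theorem comp_zero_apply (x : M) : comp 0 x = (1 / 2 : ℂ) • (x + par x) := by
  simp [comp, sgn]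

theorem comp_one_apply (x : M) : comp 1 x = (1 / 2 : ℂ) • (x - par x) := by
  simp [comp, sgn, sub_eq_add_neg]

theorem superComm_apply (X Y : Module.End ℂ M) :
    superComm X Y = X * Y - Y * comp 0 X - par Y * comp 1 X := by
  have h : ∀ Z : Module.End ℂ M, comp 0 Z + comp 1 Z = Z := fun Z => by
    rw [comp_zero_apply, comp_one_apply]; module
  have h' : comp 0 Y - comp 1 Y = par Y := by
    rw [comp_zero_apply, comp_one_apply]; module
  have e : superComm X Y = (comp 0 X + comp 1 X) * (comp 0 Y + comp 1 Y)
      - (comp 0 Y + comp 1 Y) * comp 0 X - (comp 0 Y - comp 1 Y) * comp 1 X := by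
    simp only [superComm, LinearMap.mk₂_apply, sum_zmod_two]
    simp [sgn]
    noncomm_ring
  rw [e, h, h, h']

theorem par_superComm (X Y : Module.End ℂ M) :
    par (superComm X Y) = superComm (par X) (par Y) := by
  simp [superComm_apply, comp_zero_apply, comp_one_apply, par_mul, par_par]

theorem par_superComm_left (X : Module.End ℂ M) :
    par (superComm X) = superComm (par X) := by
  ext1 Y
  rw [par_end, par_superComm, par_par]

/-- `X ↦ [X, ·]` intertwines graded commutators (the graded Jacobi identity). -/
theorem superComm_superComm (X Y : Module.End ℂ M) :
    superComm (superComm X) (superComm Y) = superComm (superComm X Y) := by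
  ext1 Z
  rw [superComm_apply (superComm X Y) Z]
  simp only [superComm_apply (superComm X), comp_zero_apply (superComm X),
    comp_one_apply (superComm X), par_superComm_left, LinearMap.sub_apply, Module.End.mul_apply,
    LinearMap.smul_apply, LinearMap.add_apply]
  simp only [superComm_apply, comp_zero_apply, comp_one_apply, par_mul, par_par, map_add, map_sub,
    map_smul, mul_sub, sub_mul, mul_add, add_mul, smul_mul_assoc, mul_smul_comm, mul_assoc]
  module

end Graded

/-! ### Superforms and Lie superalgebra cohomology -/

section Cohomology

variable {L M : Type*} [AddCommGroup L] [Module ℂ L] [SuperSpace L]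
  [AddCommGroup M] [Module ℂ M] [SuperSpace M]

/-- The commutation factor of a permutation `σ` and degrees `i₁, …, i_p`: the product of
`(-1)^{i_r i_s}` over all `r < s` with `σ⁻¹ r > σ⁻¹ s`. -/
def commFactor {p : ℕ} (σ : Equiv.Perm (Fin p)) (i : Fin p → ZMod 2) : ℂ :=
  ∏ r : Fin p, ∏ s : Fin p, if r < s ∧ σ.symm s < σ.symm r then sgn (i r * i s) else 1

/-- The `p`-superforms: graded-alternating `p`-linear maps `L × ⋯ × L → M`. For `p = 0` this is
`M`, each element being identified with the constant map. -/
def Forms (L M : Type*) [AddCommGroup L] [Module ℂ L] [SuperSpace L]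
    [AddCommGroup M] [Module ℂ M] [SuperSpace M] (p : ℕ) :
    Submodule ℂ ((Fin p → L) → M) where
  carrier := {ω | (∃ m : MultilinearMap ℂ (fun _ : Fin p => L) M, ω = m) ∧
    ∀ (σ : Equiv.Perm (Fin p)) (i : Fin p → ZMod 2) (D : Fin p → L),
      (∀ r, D r ∈ homog L (i r)) →
        commFactor σ i • ω (fun r => D (σ r)) = ((Equiv.Perm.sign σ : ℤ) : ℂ) • ω D}
  add_mem' := by
    rintro _ _ ⟨⟨m, rfl⟩, hm⟩ ⟨⟨m', rfl⟩, hm'⟩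
    refine ⟨⟨m + m', rfl⟩, fun σ i D hD => ?_⟩
    simp only [Pi.add_apply, smul_add, hm σ i D hD, hm' σ i D hD]
  zero_mem' := ⟨⟨0, rfl⟩, fun σ i D _ => by simp⟩
  smul_mem' := by
    rintro c _ ⟨⟨m, rfl⟩, hm⟩
    refine ⟨⟨c • m, rfl⟩, fun σ i D hD => ?_⟩
    rw [Pi.smul_apply, Pi.smul_apply, smul_comm, hm σ i D hD, smul_comm]

/-- The grading involution on maps `L × ⋯ × L → M`: a multilinear `ω` is homogeneous of degree `k`
if and only if `ω (D₁, …, D_p)` has degree `k + deg D₁ + ⋯ + deg D_p` for homogeneous `D_r`. -/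
def parForm (L M : Type*) [AddCommGroup L] [Module ℂ L] [SuperSpace L]
    [AddCommGroup M] [Module ℂ M] [SuperSpace M] (p : ℕ) :
    ((Fin p → L) → M) →ₗ[ℂ] ((Fin p → L) → M) :=
  LinearMap.pi fun D => par ∘ₗ LinearMap.proj (φ := fun _ : Fin p → L => M) fun r => par (D r)

/-- The homogeneous component of degree `k` of a map `L × ⋯ × L → M`. -/
def compForm (L M : Type*) [AddCommGroup L] [Module ℂ L] [SuperSpace L]
    [AddCommGroup M] [Module ℂ M] [SuperSpace M] (p : ℕ) (k : ZMod 2) :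
    ((Fin p → L) → M) →ₗ[ℂ] ((Fin p → L) → M) :=
  (1 / 2 : ℂ) • (LinearMap.id + sgn k • parForm L M p)

variable (br : L →ₗ[ℂ] L →ₗ[ℂ] L) (act : L →ₗ[ℂ] Module.End ℂ M)

/-- The exterior derivative on homogeneous arguments: for `ω` of degree `k` and `D_l` of degree
`i_l`, the value of `dω` at `(D_0, …, D_p)` is
`∑_l (-1)^{l + i_l (k + i_0 + ⋯ + i_{l-1})} D_l (ω (D_0, …, omit D_l, …, D_p))
+ ∑_{l<l'} (-1)^{l' + i_{l'} (i_{l+1} + ⋯ + i_{l'-1})}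
    ω (D_0, …, D_{l-1}, [D_l, D_{l'}], D_{l+1}, …, omit D_{l'}, …, D_p)`. -/
def dHom {p : ℕ} (k : ZMod 2) (i : Fin (p + 1) → ZMod 2) (D : Fin (p + 1) → L) :
    ((Fin p → L) → M) →ₗ[ℂ] M :=
  (∑ l : Fin (p + 1), ((-1) ^ (l : ℕ) * sgn (i l * (k + ∑ l' ∈ Finset.Iio l, i l'))) •
    (act (D l) ∘ₗ LinearMap.proj (φ := fun _ : Fin p → L => M) (l.removeNth D))) +
  ∑ l : Fin (p + 1), ∑ l' ∈ Finset.Ioi l,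
    ((-1) ^ (l' : ℕ) * sgn (i l' * ∑ l'' ∈ Finset.Ioo l l', i l'')) •
      LinearMap.proj (φ := fun _ : Fin p → L => M)
        (l'.removeNth (Function.update D l (br (D l) (D l'))))

/-- The exterior derivative: the linear extension of `dHom` from homogeneous forms and homogeneous
arguments (every form and every argument is split into its homogeneous components). -/
def extD (p : ℕ) : ((Fin p → L) → M) →ₗ[ℂ] ((Fin (p + 1) → L) → M) :=
  LinearMap.pi fun D => ∑ k : ZMod 2, ∑ i : Fin (p + 1) → ZMod 2,
    dHom br act k i (fun l => comp (i l) (D l)) ∘ₗ compForm L M p k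

/-- The closed `p`-superforms. -/
def Cocycles (p : ℕ) : Submodule ℂ ((Fin p → L) → M) :=
  Forms L M p ⊓ LinearMap.ker (extD br act p)

/-- The exact `p`-superforms. -/
def Coboundaries : (p : ℕ) → Submodule ℂ ((Fin p → L) → M)
  | 0 => ⊥
  | p + 1 => (Forms L M p).map (extD br act p)

/-- The cohomology `ker d / im d` in degree `p` of a Lie superalgebra `L` with bracket `br` and
coefficients in the graded module `M` with action `act`. -/
abbrev Cohomology (p : ℕ) : Type _ :=
  ↥(Cocycles br act p) ⧸ (Coboundaries br act p).submoduleOf (Cocycles br act p)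

/-- The class of a cocycle. -/
def cls (p : ℕ) : ↥(Cocycles br act p) →ₗ[ℂ] Cohomology br act p :=
  ((Coboundaries br act p).submoduleOf (Cocycles br act p)).mkQ

/-- The part of `ℤ₂`-degree `k` of the cohomology: the classes of the homogeneous cocycles of
degree `k`. -/
def cohomologyPart (p : ℕ) (k : ZMod 2) : Submodule ℂ (Cohomology br act p) :=
  ((LinearMap.ker (parForm L M p - sgn k • LinearMap.id)).comap
    (Cocycles br act p).subtype).map (cls br act p)

end Cohomology

/-! ### The orthosymplectic Lie superalgebra `osp(1|2)` -/

/-- The Pauli matrices `σ₁, σ₂, σ₃`. -/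
def pauli : Fin 3 → Matrix (Fin 2) (Fin 2) ℂ :=
  ![!![0, 1; 1, 0], !![0, -Complex.I; Complex.I, 0], !![1, 0; 0, -1]]

/-- `osp(1|2)`: the pair `(a, u)` stands for `∑ aₖ Jₖ + u₀ J₄ + u₁ J₅`. -/
def Osp : Type := (Fin 3 → ℂ) × (Fin 2 → ℂ)

instance : AddCommGroup Osp := inferInstanceAs (AddCommGroup ((Fin 3 → ℂ) × (Fin 2 → ℂ)))
instance : Module ℂ Osp := inferInstanceAs (Module ℂ ((Fin 3 → ℂ) × (Fin 2 → ℂ)))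

@[ext] theorem Osp.ext {x y : Osp} (h₁ : x.1 = y.1) (h₂ : x.2 = y.2) : x = y := Prod.ext h₁ h₂
@[simp] theorem Osp.add_fst (x y : Osp) : (x + y).1 = x.1 + y.1 := rfl
@[simp] theorem Osp.add_snd (x y : Osp) : (x + y).2 = x.2 + y.2 := rfl
@[simp] theorem Osp.smul_fst (c : ℂ) (x : Osp) : (c • x).1 = c • x.1 := rfl
@[simp] theorem Osp.smul_snd (c : ℂ) (x : Osp) : (c • x).2 = c • x.2 := rfl

/-- `J₁, J₂, J₃` are even, `J₄, J₅` are odd. -/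
instance : SuperSpace Osp where
  par :=
    { toFun := fun x => (x.1, -x.2)
      map_add' := fun x y => Osp.ext rfl (neg_add x.2 y.2)
      map_smul' := fun c x => Osp.ext rfl (smul_neg c x.2).symm }
  par_par x := Osp.ext rfl (neg_neg x.2)

/-- The even part of the bracket of `osp(1|2)`. -/
def Osp.bracketEven (x y : Osp) : Fin 3 → ℂ := fun i =>
  Complex.I * (x.1 ⨯₃ y.1) i + 1 / 2 * (x.2 ⬝ᵥ (Complex.I • (pauli 1 * pauli i)) *ᵥ y.2)

/-- The odd part of the bracket of `osp(1|2)`. -/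
def Osp.bracketOdd (x y : Osp) : Fin 2 → ℂ := fun β =>
  1 / 2 * ∑ i, (x.1 i * (pauli i *ᵥ y.2) β - y.1 i * (pauli i *ᵥ x.2) β)

/-- The graded Lie bracket of `osp(1|2)`, given by `[J_i, J_j] = i ∑ ε_{ijk} J_k`,
`[J_i, J_α] = ½ ∑ (σ_i)_{βα} J_β` and `[J_α, J_β] = ½ ∑ (i σ₂ σ_i)_{αβ} J_i`. -/
def Osp.bracket : Osp →ₗ[ℂ] Osp →ₗ[ℂ] Osp :=
  LinearMap.mk₂ ℂ (fun x y => (Osp.bracketEven x y, Osp.bracketOdd x y))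
    (fun x x' y => Osp.ext
      (funext fun i => by
        change Osp.bracketEven (x + x') y i = Osp.bracketEven x y i + Osp.bracketEven x' y i
        simp only [Osp.bracketEven, Osp.add_fst, Osp.add_snd, map_add, LinearMap.add_apply,
          Pi.add_apply, add_dotProduct]
        ring)
      (funext fun i => by
        change Osp.bracketOdd (x + x') y i = Osp.bracketOdd x y i + Osp.bracketOdd x' y i
        simp only [Osp.bracketOdd, Osp.add_fst, Osp.add_snd, Pi.add_apply, Matrix.mulVec_add,
          Fin.sum_univ_three]
        ring))
    (fun c x y => Osp.ext
      (funext fun i => by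
        change Osp.bracketEven (c • x) y i = c * Osp.bracketEven x y i
        simp only [Osp.bracketEven, Osp.smul_fst, Osp.smul_snd, map_smul, LinearMap.smul_apply,
          Pi.smul_apply, smul_dotProduct, smul_eq_mul]
        ring)
      (funext fun i => by
        change Osp.bracketOdd (c • x) y i = c * Osp.bracketOdd x y i
        simp only [Osp.bracketOdd, Osp.smul_fst, Osp.smul_snd, Pi.smul_apply, Matrix.mulVec_smul,
          Fin.sum_univ_three, smul_eq_mul]
        ring))
    (fun x y y' => Osp.ext
      (funext fun i => by
        change Osp.bracketEven x (y + y') i = Osp.bracketEven x y i + Osp.bracketEven x y' i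
        simp only [Osp.bracketEven, Osp.add_fst, Osp.add_snd, map_add, Pi.add_apply,
          Matrix.mulVec_add, dotProduct_add]
        ring)
      (funext fun i => by
        change Osp.bracketOdd x (y + y') i = Osp.bracketOdd x y i + Osp.bracketOdd x y' i
        simp only [Osp.bracketOdd, Osp.add_fst, Osp.add_snd, Pi.add_apply, Matrix.mulVec_add,
          Fin.sum_univ_three]
        ring))
    (fun c x y => Osp.ext
      (funext fun i => by
        change Osp.bracketEven x (c • y) i = c * Osp.bracketEven x y i
        simp only [Osp.bracketEven, Osp.smul_fst, Osp.smul_snd, map_smul, Pi.smul_apply,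
          Matrix.mulVec_smul, dotProduct_smul, smul_eq_mul]
        ring)
      (funext fun i => by
        change Osp.bracketOdd x (c • y) i = c * Osp.bracketOdd x y i
        simp only [Osp.bracketOdd, Osp.smul_fst, Osp.smul_snd, Pi.smul_apply, Matrix.mulVec_smul,
          Fin.sum_univ_three, smul_eq_mul]
        ring))

/-! ### Irreducible representations -/

/-- The `k`-th coordinate of a vector, zero outside the range. -/
def get {n : ℕ} (v : Fin n → ℂ) (k : ℕ) : ℂ := if h : k < n then v ⟨k, h⟩ else 0

theorem get_add {n : ℕ} (v w : Fin n → ℂ) (k : ℕ) : get (v + w) k = get v k + get w k := by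
  unfold get; split_ifs <;> simp

theorem get_smul {n : ℕ} (c : ℂ) (v : Fin n → ℂ) (k : ℕ) : get (c • v) k = c * get v k := by
  unfold get; split_ifs <;> simp

/-- `J₋` on the irreducible `sl(2)`-module with basis `e_k = J₋ᵏ e_0`, `k < n`. -/
def lower (n : ℕ) : Module.End ℂ (Fin n → ℂ) where
  toFun v k := if (k : ℕ) = 0 then 0 else get v (k - 1)
  map_add' v w := by ext k; simp only [get_add, Pi.add_apply]; split_ifs <;> simp
  map_smul' c v := by
    ext k; simp only [get_smul, Pi.smul_apply, smul_eq_mul, RingHom.id_apply]; split_ifs <;> simp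

/-- `J₊` on the same module: `J₊ e_{k+1} = (k + 1) (n - 1 - k) e_k`. -/
def raise (n : ℕ) : Module.End ℂ (Fin n → ℂ) where
  toFun v k := ((k : ℂ) + 1) * (n - 1 - k) * get v (k + 1)
  map_add' v w := by ext k; simp only [get_add, Pi.add_apply]; ring
  map_smul' c v := by
    ext k; simp only [get_smul, Pi.smul_apply, smul_eq_mul, RingHom.id_apply]; ring

/-- `J₃` on the same module: `J₃ e_k = ((n - 1) / 2 - k) e_k`. -/
def weight (n : ℕ) : Module.End ℂ (Fin n → ℂ) where
  toFun v k := (((n : ℂ) - 1) / 2 - k) * v k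
  map_add' v w := by ext k; simp only [Pi.add_apply]; ring
  map_smul' c v := by
    ext k; simp only [Pi.smul_apply, smul_eq_mul, RingHom.id_apply]; ring

/-- The representation space `V(q/2, 1)` of the irreducible graded representation of `osp(1|2)` of
highest weight `q/2` with odd highest weight vector `v`. The first factor has the basis
`e_k = J₋ᵏ v` (`0 ≤ k ≤ q`) and is odd, the second one has the basis `o_k = J₋ᵏ J₅ v`
(`0 ≤ k < q`) and is even. -/
def V (q : ℕ) : Type := (Fin (q + 1) → ℂ) × (Fin q → ℂ)

instance (q : ℕ) : AddCommGroup (V q) :=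
  inferInstanceAs (AddCommGroup ((Fin (q + 1) → ℂ) × (Fin q → ℂ)))
instance (q : ℕ) : Module ℂ (V q) :=
  inferInstanceAs (Module ℂ ((Fin (q + 1) → ℂ) × (Fin q → ℂ)))

theorem V.ext {q : ℕ} {v w : V q} (h₁ : v.1 = w.1) (h₂ : v.2 = w.2) : v = w := Prod.ext h₁ h₂
@[simp] theorem V.add_fst {q : ℕ} (v w : V q) : (v + w).1 = v.1 + w.1 := rfl
@[simp] theorem V.add_snd {q : ℕ} (v w : V q) : (v + w).2 = v.2 + w.2 := rfl
@[simp] theorem V.sub_fst {q : ℕ} (v w : V q) : (v - w).1 = v.1 - w.1 := rfl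
@[simp] theorem V.sub_snd {q : ℕ} (v w : V q) : (v - w).2 = v.2 - w.2 := rfl
@[simp] theorem V.neg_fst {q : ℕ} (v : V q) : (-v).1 = -v.1 := rfl
@[simp] theorem V.neg_snd {q : ℕ} (v : V q) : (-v).2 = -v.2 := rfl
@[simp] theorem V.smul_fst {q : ℕ} (c : ℂ) (v : V q) : (c • v).1 = c • v.1 := rfl
@[simp] theorem V.smul_snd {q : ℕ} (c : ℂ) (v : V q) : (c • v).2 = c • v.2 := rfl

instance (q : ℕ) : SuperSpace (V q) where
  par :=
    { toFun := fun v => (-v.1, v.2)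
      map_add' := fun v w => V.ext (neg_add v.1 w.1) rfl
      map_smul' := fun c v => V.ext (smul_neg c v.1).symm rfl }
  par_par v := V.ext (neg_neg v.1) rfl

/-- The truncated supersphere: the `ℤ₂`-graded algebra `End V(q/2, 1)`. -/
abbrev S (q : ℕ) : Type := Module.End ℂ (V q)

/-- The operator on `V(q/2, 1)` acting separately on both factors. -/
def diagOp {q : ℕ} (A : Module.End ℂ (Fin (q + 1) → ℂ)) (B : Module.End ℂ (Fin q → ℂ)) : S q where
  toFun v := (A v.1, B v.2)
  map_add' v w := V.ext (map_add A v.1 w.1) (map_add B v.2 w.2)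
  map_smul' c v := V.ext (map_smul A c v.1) (map_smul B c v.2)

def Jminus (q : ℕ) : S q := diagOp (lower (q + 1)) (lower q)
def Jplus (q : ℕ) : S q := diagOp (raise (q + 1)) (raise q)
def J3 (q : ℕ) : S q := diagOp (weight (q + 1)) (weight q)
def J1 (q : ℕ) : S q := (1 / 2 : ℂ) • (Jplus q + Jminus q)
def J2 (q : ℕ) : S q := (1 / (2 * Complex.I) : ℂ) • (Jplus q - Jminus q)

/-- `J₄ e_k = -k o_{k-1}` and `J₄ o_k = -((q - k) / 4) e_k`. -/
def J4 (q : ℕ) : S q where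
  toFun v := (fun k => -(((q : ℂ) - k) / 4) * get v.2 k, fun k => -((k : ℂ) + 1) * get v.1 (k + 1))
  map_add' v w := V.ext (funext fun k => by
      change _ = -(((q : ℂ) - k) / 4) * get v.2 k + -(((q : ℂ) - k) / 4) * get w.2 k
      simp only [V.add_snd, get_add]; ring) (funext fun k => by
      change _ = -((k : ℂ) + 1) * get v.1 (k + 1) + -((k : ℂ) + 1) * get w.1 (k + 1)
      simp only [V.add_fst, get_add]; ring)
  map_smul' c v := V.ext (funext fun k => by
      change _ = c * (-(((q : ℂ) - k) / 4) * get v.2 k)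
      simp only [V.smul_snd, get_smul]; ring) (funext fun k => by
      change _ = c * (-((k : ℂ) + 1) * get v.1 (k + 1))
      simp only [V.smul_fst, get_smul]; ring)

/-- `J₅ e_k = o_k` (zero for `k = q`) and `J₅ o_k = -(1/4) e_{k+1}`. -/
def J5 (q : ℕ) : S q where
  toFun v := (fun k => if (k : ℕ) = 0 then 0 else -(1 / 4) * get v.2 (k - 1), fun k => get v.1 k)
  map_add' v w := V.ext (funext fun k => by
      change _ = (if (k : ℕ) = 0 then 0 else -(1 / 4) * get v.2 (k - 1)) +
        (if (k : ℕ) = 0 then 0 else -(1 / 4) * get w.2 (k - 1))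
      simp only [V.add_snd, get_add]; split_ifs <;> ring) (funext fun k => by
      change _ = get v.1 k + get w.1 k
      simp only [V.add_fst, get_add])
  map_smul' c v := V.ext (funext fun k => by
      change _ = c * (if (k : ℕ) = 0 then 0 else -(1 / 4) * get v.2 (k - 1))
      simp only [V.smul_snd, get_smul]; split_ifs <;> ring) (funext fun k => by
      change _ = c * get v.1 k
      simp only [V.smul_fst, get_smul])

/-- The irreducible graded representation of `osp(1|2)` on `V(q/2, 1)`. -/
def rep (q : ℕ) : Osp →ₗ[ℂ] S q where
  toFun x := x.1 0 • J1 q + x.1 1 • J2 q + x.1 2 • J3 q + x.2 0 • J4 q + x.2 1 • J5 q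
  map_add' x y := by simp only [Osp.add_fst, Osp.add_snd, Pi.add_apply]; module
  map_smul' c x := by
    simp only [Osp.smul_fst, Osp.smul_snd, Pi.smul_apply, smul_eq_mul, RingHom.id_apply]; module

theorem ext_get {n : ℕ} {v w : Fin n → ℂ} (h : ∀ m, m < n → get v m = get w m) : v = w := by
  ext k; simpa [get] using h k k.2

theorem get_ge {n : ℕ} (v : Fin n → ℂ) {m : ℕ} (h : n ≤ m) : get v m = 0 := by
  simp [get, not_lt.mpr h]

theorem get_of_nat {n : ℕ} (f : ℕ → ℂ) (m : ℕ) :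
    get (fun k : Fin n => f k) m = if m < n then f m else 0 := by
  unfold get; split_ifs <;> rfl

theorem get_sub {n : ℕ} (v w : Fin n → ℂ) (k : ℕ) : get (v - w) k = get v k - get w k := by
  unfold get; split_ifs <;> simp

theorem get_neg {n : ℕ} (v : Fin n → ℂ) (k : ℕ) : get (-v) k = -get v k := by
  unfold get; split_ifs <;> simp

theorem get_lower {n : ℕ} (v : Fin n → ℂ) (m : ℕ) :
    get (lower n v) m = if m < n then if m = 0 then 0 else get v (m - 1) else 0 :=
  get_of_nat (fun m => if m = 0 then 0 else get v (m - 1)) m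

theorem get_raise {n : ℕ} (v : Fin n → ℂ) (m : ℕ) :
    get (raise n v) m = ((m : ℂ) + 1) * (n - 1 - m) * get v (m + 1) := by
  refine (get_of_nat (fun m : ℕ => ((m : ℂ) + 1) * (n - 1 - m) * get v (m + 1)) m).trans ?_
  split_ifs with h
  · rfl
  · rw [get_ge v (by omega), mul_zero]

theorem get_weight {n : ℕ} (v : Fin n → ℂ) (m : ℕ) :
    get (weight n v) m = (((n : ℂ) - 1) / 2 - m) * get v m := by
  unfold get; split_ifs <;> simp [weight]

theorem get_J4_fst {q : ℕ} (v : V q) (m : ℕ) :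
    get (J4 q v).1 m = -(((q : ℂ) - m) / 4) * get v.2 m := by
  refine (get_of_nat (fun m : ℕ => -(((q : ℂ) - m) / 4) * get v.2 m) m).trans ?_
  split_ifs with h
  · rfl
  · rw [get_ge v.2 (by omega), mul_zero]

theorem get_J4_snd {q : ℕ} (v : V q) (m : ℕ) :
    get (J4 q v).2 m = -((m : ℂ) + 1) * get v.1 (m + 1) := by
  refine (get_of_nat (fun m : ℕ => -((m : ℂ) + 1) * get v.1 (m + 1)) m).trans ?_
  split_ifs with h
  · rfl
  · rw [get_ge v.1 (by omega), mul_zero]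

theorem get_J5_fst {q : ℕ} (v : V q) (m : ℕ) :
    get (J5 q v).1 m = if m = 0 then 0 else -(1 / 4) * get v.2 (m - 1) := by
  refine (get_of_nat (fun m : ℕ => if m = 0 then 0 else -(1 / 4) * get v.2 (m - 1)) m).trans ?_
  split_ifs with h h'
  · rfl
  · rfl
  · omega
  · rw [get_ge v.2 (by omega), mul_zero]

theorem get_J5_snd {q : ℕ} (v : V q) (m : ℕ) :
    get (J5 q v).2 m = if m < q then get v.1 m else 0 :=
  get_of_nat (fun m : ℕ => get v.1 m) m

theorem Jminus_fst {q : ℕ} (v : V q) : (Jminus q v).1 = lower (q + 1) v.1 := rfl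
theorem Jminus_snd {q : ℕ} (v : V q) : (Jminus q v).2 = lower q v.2 := rfl
theorem Jplus_fst {q : ℕ} (v : V q) : (Jplus q v).1 = raise (q + 1) v.1 := rfl
theorem Jplus_snd {q : ℕ} (v : V q) : (Jplus q v).2 = raise q v.2 := rfl
theorem J3_fst {q : ℕ} (v : V q) : (J3 q v).1 = weight (q + 1) v.1 := rfl
theorem J3_snd {q : ℕ} (v : V q) : (J3 q v).2 = weight q v.2 := rfl

theorem raise_lower (n : ℕ) : raise n * lower n = lower n * raise n + (2 : ℂ) • weight n := by
  refine LinearMap.ext fun v => ext_get fun m hm => ?_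
  simp only [Module.End.mul_apply, LinearMap.add_apply, LinearMap.smul_apply, get_add, get_smul,
    get_raise, get_lower, get_weight]
  rcases m with _ | m
  · rcases Nat.lt_or_ge 1 n with h | h
    · simp [hm, h]; ring
    · obtain rfl : n = 1 := by omega
      simp
  · rcases Nat.lt_or_ge (m + 1 + 1) n with h | h
    · simp [hm, h]; ring
    · obtain rfl : n = m + 2 := by omega
      simp; ring

theorem weight_lower (n : ℕ) : weight n * lower n = lower n * weight n - lower n := by
  refine LinearMap.ext fun v => ext_get fun m hm => ?_
  simp only [Module.End.mul_apply, LinearMap.sub_apply, get_sub, get_lower, get_weight, hm, if_true]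
  rcases m with _ | m
  · simp
  · simp; ring

theorem weight_raise (n : ℕ) : weight n * raise n = raise n * weight n + raise n := by
  refine LinearMap.ext fun v => ext_get fun m hm => ?_
  simp only [Module.End.mul_apply, LinearMap.add_apply, get_add, get_raise, get_weight]
  push_cast; ring

theorem diagOp_mul {q : ℕ} (A A' : Module.End ℂ (Fin (q + 1) → ℂ)) (B B' : Module.End ℂ (Fin q → ℂ)) :
    diagOp A B * diagOp A' B' = diagOp (A * A') (B * B') := rfl
theorem diagOp_add {q : ℕ} (A A' : Module.End ℂ (Fin (q + 1) → ℂ)) (B B' : Module.End ℂ (Fin q → ℂ)) :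
    diagOp A B + diagOp A' B' = diagOp (A + A') (B + B') := rfl
theorem diagOp_sub {q : ℕ} (A A' : Module.End ℂ (Fin (q + 1) → ℂ)) (B B' : Module.End ℂ (Fin q → ℂ)) :
    diagOp A B - diagOp A' B' = diagOp (A - A') (B - B') := rfl
theorem diagOp_smul {q : ℕ} (c : ℂ) (A : Module.End ℂ (Fin (q + 1) → ℂ))
    (B : Module.End ℂ (Fin q → ℂ)) : c • diagOp A B = diagOp (c • A) (c • B) := rfl

theorem Jplus_Jminus (q : ℕ) : Jplus q * Jminus q = Jminus q * Jplus q + (2 : ℂ) • J3 q := by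
  simp only [Jplus, Jminus, J3, diagOp_mul, diagOp_smul, diagOp_add, raise_lower]

theorem J3_Jminus (q : ℕ) : J3 q * Jminus q = Jminus q * J3 q - Jminus q := by
  simp only [Jminus, J3, diagOp_mul, diagOp_sub, weight_lower]

theorem J3_Jplus (q : ℕ) : J3 q * Jplus q = Jplus q * J3 q + Jplus q := by
  simp only [Jplus, J3, diagOp_mul, diagOp_add, weight_raise]

theorem J3_J4 (q : ℕ) : J3 q * J4 q = J4 q * J3 q + (1 / 2 : ℂ) • J4 q := by
  refine LinearMap.ext fun v => V.ext (ext_get fun m hm => ?_) (ext_get fun m hm => ?_) <;>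
  simp only [Module.End.mul_apply, LinearMap.smul_apply, LinearMap.add_apply, V.smul_fst,
    V.smul_snd, V.add_fst, V.add_snd, get_smul, get_add, J3_fst, J3_snd, get_J4_fst, get_J4_snd,
    get_weight] <;> push_cast <;> ring

theorem J3_J5 (q : ℕ) : J3 q * J5 q = J5 q * J3 q - (1 / 2 : ℂ) • J5 q := by
  refine LinearMap.ext fun v => V.ext (ext_get fun m hm => ?_) (ext_get fun m hm => ?_) <;>
  simp only [Module.End.mul_apply, LinearMap.smul_apply, LinearMap.sub_apply, V.smul_fst,
    V.smul_snd, V.sub_fst, V.sub_snd, get_smul, get_sub, J3_fst, J3_snd, get_J5_fst, get_J5_snd,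
    get_weight]
  · rcases m with _ | m
    · simp
    · simp; ring
  · simp [hm]; ring

theorem Jplus_J4 (q : ℕ) : Jplus q * J4 q = J4 q * Jplus q := by
  refine LinearMap.ext fun v => V.ext (ext_get fun m hm => ?_) (ext_get fun m hm => ?_) <;>
  simp only [Module.End.mul_apply, Jplus_fst, Jplus_snd, get_J4_fst, get_J4_snd, get_raise] <;>
  push_cast <;> ring

theorem Jplus_J5 (q : ℕ) : Jplus q * J5 q = J5 q * Jplus q + J4 q := by
  refine LinearMap.ext fun v => V.ext (ext_get fun m hm => ?_) (ext_get fun m hm => ?_) <;>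
  simp only [Module.End.mul_apply, LinearMap.add_apply, V.add_fst, V.add_snd, get_add, Jplus_fst,
    Jplus_snd, get_J4_fst, get_J4_snd, get_J5_fst, get_J5_snd, get_raise]
  · rcases m with _ | m
    · simp; ring
    · simp; ring
  · rcases Nat.lt_or_ge (m + 1) q with h | h
    · simp [hm, h]; ring
    · obtain rfl : q = m + 1 := by omega
      simp; ring

theorem Jminus_J4 (q : ℕ) : Jminus q * J4 q = J4 q * Jminus q + J5 q := by
  refine LinearMap.ext fun v => V.ext (ext_get fun m hm => ?_) (ext_get fun m hm => ?_) <;>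
  simp only [Module.End.mul_apply, LinearMap.add_apply, V.add_fst, V.add_snd, get_add, Jminus_fst,
    Jminus_snd, get_J4_fst, get_J4_snd, get_J5_fst, get_J5_snd, get_lower, hm, if_true]
  · rcases m with _ | m
    · simp
    · rcases Nat.lt_or_ge (m + 1) q with h | h
      · simp [h]; ring
      · obtain rfl : q = m + 1 := by omega
        simp
  · rcases m with _ | m
    · simp [hm]
    · simp [hm]; ring

theorem Jminus_J5 (q : ℕ) : Jminus q * J5 q = J5 q * Jminus q := by
  refine LinearMap.ext fun v => V.ext (ext_get fun m hm => ?_) (ext_get fun m hm => ?_) <;>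
  simp only [Module.End.mul_apply, Jminus_fst,
    Jminus_snd, get_J5_fst, get_J5_snd, get_lower, hm, if_true]
  · rcases m with _ | _ | m
    · simp
    · simp
    · simp; omega
  · rcases m with _ | m
    · simp
    · simp

theorem J4_J4 (q : ℕ) : J4 q * J4 q = (1 / 4 : ℂ) • Jplus q := by
  refine LinearMap.ext fun v => V.ext (ext_get fun m hm => ?_) (ext_get fun m hm => ?_) <;>
  simp only [Module.End.mul_apply, LinearMap.smul_apply, V.smul_fst, V.smul_snd, get_smul,
    Jplus_fst, Jplus_snd, get_J4_fst, get_J4_snd, get_raise] <;> push_cast <;> ring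

theorem J5_J5 (q : ℕ) : J5 q * J5 q = (-(1 / 4) : ℂ) • Jminus q := by
  refine LinearMap.ext fun v => V.ext (ext_get fun m hm => ?_) (ext_get fun m hm => ?_) <;>
  simp only [Module.End.mul_apply, LinearMap.smul_apply, V.smul_fst, V.smul_snd, get_smul,
    Jminus_fst, Jminus_snd, get_J5_fst, get_J5_snd, get_lower, hm, if_true]
  · rcases m with _ | m
    · simp
    · simp; omega
  · rcases m with _ | m <;> simp

theorem J5_J4 (q : ℕ) : J5 q * J4 q = -(J4 q * J5 q) - (1 / 2 : ℂ) • J3 q := by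
  refine LinearMap.ext fun v => V.ext (ext_get fun m hm => ?_) (ext_get fun m hm => ?_) <;>
  simp only [Module.End.mul_apply, LinearMap.smul_apply, LinearMap.sub_apply, LinearMap.neg_apply,
    V.smul_fst, V.smul_snd, V.sub_fst, V.sub_snd, V.neg_fst, V.neg_snd, get_smul, get_sub, get_neg,
    J3_fst, J3_snd, get_J4_fst, get_J4_snd, get_J5_fst, get_J5_snd, get_weight, hm, if_true]
  · rcases Nat.lt_or_ge m q with h | h
    · rcases m with _ | m
      · simp [h]; ring
      · simp [h]; ring
    · obtain rfl : m = q := by omega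
      rcases m with _ | m
      · simp
      · simp; ring
  · simp; ring

theorem par_diagOp {q : ℕ} (A : Module.End ℂ (Fin (q + 1) → ℂ)) (B : Module.End ℂ (Fin q → ℂ)) :
    par (diagOp A B) = diagOp A B :=
  LinearMap.ext fun v => V.ext (show -(A (-v.1)) = A v.1 by simp) rfl

theorem par_J4 (q : ℕ) : par (J4 q) = -J4 q :=
  LinearMap.ext fun v => V.ext rfl (ext_get fun m hm => by
    change get (J4 q (par v)).2 m = get (-(J4 q v).2) m
    rw [get_neg, get_J4_snd, get_J4_snd]
    change -((m : ℂ) + 1) * get (-v.1) (m + 1) = _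
    rw [get_neg]; ring)

theorem par_J5 (q : ℕ) : par (J5 q) = -J5 q :=
  LinearMap.ext fun v => V.ext rfl (ext_get fun m hm => by
    change get (J5 q (par v)).2 m = get (-(J5 q v).2) m
    rw [get_neg, get_J5_snd, get_J5_snd, if_pos hm, if_pos hm]
    change get (-v.1) m = _
    rw [get_neg])

theorem rep_apply (q : ℕ) (x : Osp) : rep q x =
    x.1 0 • J1 q + x.1 1 • J2 q + x.1 2 • J3 q + x.2 0 • J4 q + x.2 1 • J5 q := rfl

theorem par_rep (q : ℕ) (x : Osp) : par (rep q x) = rep q (par x) := by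
  have h1 : (par x).1 = x.1 := rfl
  have h2 : (par x).2 = -x.2 := rfl
  simp only [rep_apply, h1, h2, J1, J2, J3, Jplus, Jminus, map_add, map_sub, map_smul, par_diagOp,
    par_J4, par_J5, Pi.neg_apply]
  module

theorem comp_zero_rep (q : ℕ) (x : Osp) :
    comp 0 (rep q x) = x.1 0 • J1 q + x.1 1 • J2 q + x.1 2 • J3 q := by
  have h1 : (par x).1 = x.1 := rfl
  have h2 : (par x).2 = -x.2 := rfl
  rw [comp_zero_apply, par_rep]
  simp only [rep_apply, h1, h2, Pi.neg_apply]
  module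

theorem comp_one_rep (q : ℕ) (x : Osp) :
    comp 1 (rep q x) = x.2 0 • J4 q + x.2 1 • J5 q := by
  have h1 : (par x).1 = x.1 := rfl
  have h2 : (par x).2 = -x.2 := rfl
  rw [comp_one_apply, par_rep]
  simp only [rep_apply, h1, h2, Pi.neg_apply]
  module

theorem rep_bracket (q : ℕ) (x y : Osp) :
    rep q (Osp.bracket x y) = superComm (rep q x) (rep q y) := by
  have h1 : (Osp.bracket x y).1 = Osp.bracketEven x y := rfl
  have h2 : (Osp.bracket x y).2 = Osp.bracketOdd x y := rfl
  have h3 : (par y).1 = y.1 := rfl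
  have h4 : (par y).2 = -y.2 := rfl
  have hI : Complex.I ^ 2 = -1 := Complex.I_sq
  have hJ2 : J2 q = (-(Complex.I / 2)) • (Jplus q - Jminus q) := by
    rw [J2]; congr 1; field_simp; simp
  rw [superComm_apply, comp_zero_rep, comp_one_rep, par_rep]
  simp only [rep_apply, h1, h2, h3, h4, Osp.bracketEven, Osp.bracketOdd, cross_apply]
  generalize x.1 = a
  generalize x.2 = u
  generalize y.1 = b
  generalize y.2 = v
  simp only [J1, hJ2, Pi.neg_apply, mul_sub, sub_mul, mul_add, add_mul, smul_add, smul_sub,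
    smul_smul, smul_mul_assoc, mul_smul_comm, Jplus_Jminus, J3_Jminus, J3_Jplus, J3_J4, J3_J5,
    Jplus_J4, Jplus_J5, Jminus_J4, Jminus_J5, J4_J4, J5_J5, J5_J4, pauli]
  simp [Fin.sum_univ_three, Matrix.mulVec, dotProduct, Fin.sum_univ_two]
  match_scalars <;> ring_nf <;> (try simp only [hI]) <;> (try ring_nf)

/-! ### Supervector fields on the truncated supersphere -/

/-- The action `J ↦ [J, ·]` of `osp(1|2)` on the truncated supersphere by graded derivations. -/
def adS (q : ℕ) : Osp →ₗ[ℂ] Module.End ℂ (S q) := superComm ∘ₗ rep q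

theorem adS_bracket (q : ℕ) (x y : Osp) :
    superComm (adS q x) (adS q y) = adS q (Osp.bracket x y) := by
  simp only [adS, LinearMap.comp_apply, superComm_superComm, rep_bracket]

theorem par_adS (q : ℕ) (x : Osp) : par (adS q x) = adS q (par x) := by
  simp only [adS, LinearMap.comp_apply, par_superComm_left, par_rep]

/-- The Lie superalgebra of supervector fields on the truncated supersphere: the image of
`osp(1|2)` in the graded derivations of `End V(q/2, 1)`. -/
def SVec (q : ℕ) : Submodule ℂ (Module.End ℂ (S q)) := LinearMap.range (adS q)

instance (q : ℕ) : AddCommGroup (SVec q) := Submodule.addCommGroup (SVec q)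
instance (q : ℕ) : Module ℂ (SVec q) := Submodule.module (SVec q)

instance (q : ℕ) : SuperSpace (SVec q) where
  par := par.restrict (p := SVec q) (q := SVec q) (by
    rintro _ ⟨x, rfl⟩
    exact ⟨par x, (par_adS q x).symm⟩)
  par_par D := Subtype.ext (par_par (D : Module.End ℂ (S q)))

theorem superComm_mem {q : ℕ} {D E : Module.End ℂ (S q)} (hD : D ∈ SVec q) (hE : E ∈ SVec q) :
    superComm D E ∈ SVec q := by
  rcases LinearMap.mem_range.1 hD with ⟨x, hx⟩
  rcases LinearMap.mem_range.1 hE with ⟨y, hy⟩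
  rw [← hx, ← hy, adS_bracket]
  exact LinearMap.mem_range_self (adS q) _

/-- The graded Lie bracket of supervector fields: the graded commutator. -/
def SVec.bracket (q : ℕ) : SVec q →ₗ[ℂ] SVec q →ₗ[ℂ] SVec q :=
  LinearMap.mk₂ ℂ (fun D E => ⟨superComm D.1 E.1, superComm_mem D.2 E.2⟩)
    (fun D D' E => Subtype.ext (LinearMap.map_add₂ superComm D.1 D'.1 E.1))
    (fun c D E => Subtype.ext (LinearMap.map_smul₂ superComm c D.1 E.1))
    (fun D E E' => Subtype.ext (map_add (superComm D.1) E.1 E'.1))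
    (fun c D E => Subtype.ext (map_smul (superComm D.1) c E.1))

/-- The action of supervector fields, as endomorphisms, on the truncated supersphere. -/
def SVec.act (q : ℕ) : SVec q →ₗ[ℂ] Module.End ℂ (S q) where
  toFun D := D.1
  map_add' _ _ := rfl
  map_smul' _ _ := rfl

/-- The even supervector fields. -/
abbrev SVecEven (q : ℕ) : Submodule ℂ (SVec q) := homog (SVec q) 0

/-- The super-deRham cohomology of the truncated supersphere in degree `p`. -/
abbrev HS (q p : ℕ) : Type := Cohomology (SVec.bracket q) (SVec.act q) p

/-! ### The truncated sphere -/

/-- The representation space `V(q/2)` of the irreducible representation of `sl(2)` of highest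
weight `q/2`, with basis `e_k = J₋ᵏ e_0`, `0 ≤ k ≤ q`. -/
abbrev Vb (q : ℕ) : Type := Fin (q + 1) → ℂ

/-- The truncated sphere: the algebra `End V(q/2)`. -/
abbrev Sb (q : ℕ) : Type := Module.End ℂ (Vb q)

/-- The commutator `x y - y x` of an associative algebra, as a bilinear map. -/
def commut (A : Type*) [Ring A] [Algebra ℂ A] : A →ₗ[ℂ] A →ₗ[ℂ] A :=
  LinearMap.mul ℂ A - (LinearMap.mul ℂ A).flip

theorem commut_apply {A : Type*} [Ring A] [Algebra ℂ A] (x y : A) :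
    commut A x y = x * y - y * x := rfl

/-- The Lie algebra `sl(2)` of traceless matrices; `J₁, J₂, J₃` are the halves of the Pauli
matrices. -/
def Sl2 : Submodule ℂ (Matrix (Fin 2) (Fin 2) ℂ) :=
  LinearMap.ker (Matrix.traceLinearMap (Fin 2) ℂ ℂ)

theorem Sl2.apply_one_one (x : Sl2) : x.1 1 1 = -x.1 0 0 := by
  have h : Matrix.trace x.1 = 0 := x.2
  rw [Matrix.trace_fin_two] at h
  linear_combination h

theorem Sl2.commut_mem (x y : Matrix (Fin 2) (Fin 2) ℂ) : commut _ x y ∈ Sl2 := by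
  change Matrix.trace (x * y - y * x) = 0
  rw [Matrix.trace_sub, Matrix.trace_mul_comm, sub_self]

/-- The Lie bracket of `sl(2)`: the commutator of matrices. -/
def Sl2.bracket : Sl2 →ₗ[ℂ] Sl2 →ₗ[ℂ] Sl2 :=
  LinearMap.mk₂ ℂ (fun x y => ⟨commut _ x.1 y.1, Sl2.commut_mem x.1 y.1⟩)
    (fun x x' y => Subtype.ext (LinearMap.map_add₂ (commut _) x.1 x'.1 y.1))
    (fun c x y => Subtype.ext (LinearMap.map_smul₂ (commut _) c x.1 y.1))
    (fun x y y' => Subtype.ext (map_add (commut _ x.1) y.1 y'.1))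
    (fun c x y => Subtype.ext (map_smul (commut _ x.1) c y.1))

/-- The irreducible representation of `sl(2)` on `V(q/2)`, given by `J₊ ↦ raise`, `J₋ ↦ lower` and
`J₃ ↦ weight`, where `(a, b; c, -a) = 2 a J₃ + b J₊ + c J₋`. -/
def repb (q : ℕ) : Sl2 →ₗ[ℂ] Sb q where
  toFun x := (2 * x.1 0 0) • weight (q + 1) + x.1 0 1 • raise (q + 1) + x.1 1 0 • lower (q + 1)
  map_add' x y := by
    simp only [Submodule.coe_add, Matrix.add_apply]; module
  map_smul' c x := by
    simp only [Submodule.coe_smul, Matrix.smul_apply, smul_eq_mul, RingHom.id_apply]; module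

theorem repb_bracket (q : ℕ) (x y : Sl2) :
    repb q (Sl2.bracket x y) = commut _ (repb q x) (repb q y) := by
  have h : (Sl2.bracket x y).1 = x.1 * y.1 - y.1 * x.1 := rfl
  change (2 * (Sl2.bracket x y).1 0 0) • weight (q + 1) +
    (Sl2.bracket x y).1 0 1 • raise (q + 1) + (Sl2.bracket x y).1 1 0 • lower (q + 1) =
    ((2 * x.1 0 0) • weight (q + 1) + x.1 0 1 • raise (q + 1) + x.1 1 0 • lower (q + 1)) *
    ((2 * y.1 0 0) • weight (q + 1) + y.1 0 1 • raise (q + 1) + y.1 1 0 • lower (q + 1)) -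
    ((2 * y.1 0 0) • weight (q + 1) + y.1 0 1 • raise (q + 1) + y.1 1 0 • lower (q + 1)) *
    ((2 * x.1 0 0) • weight (q + 1) + x.1 0 1 • raise (q + 1) + x.1 1 0 • lower (q + 1))
  simp only [h, Matrix.sub_apply, Matrix.mul_apply, Fin.sum_univ_two, Sl2.apply_one_one, mul_add,
    add_mul, smul_mul_assoc, mul_smul_comm, raise_lower, weight_lower, weight_raise, smul_add,
    smul_sub]
  module

/-- The action `J ↦ [J, ·]` of `sl(2)` on the truncated sphere by derivations. -/
def adSb (q : ℕ) : Sl2 →ₗ[ℂ] Module.End ℂ (Sb q) := commut (Sb q) ∘ₗ repb q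

/-- The Lie algebra of vector fields on the truncated sphere: the image of `sl(2)` in the
derivations of `End V(q/2)`. -/
def Vec (q : ℕ) : Submodule ℂ (Module.End ℂ (Sb q)) := LinearMap.range (adSb q)

instance (q : ℕ) : AddCommGroup (Vec q) := 
  Submodule.addCommGroup (R := ℂ) (M := Module.End ℂ (Sb q)) (Vec q)
instance (q : ℕ) : Module ℂ (Vec q) := Submodule.module (Vec q)

theorem commut_mem {q : ℕ} {D E : Module.End ℂ (Sb q)} (hD : D ∈ Vec q) (hE : E ∈ Vec q) :
    commut _ D E ∈ Vec q := by
  obtain ⟨x, rfl⟩ := hD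
  obtain ⟨y, rfl⟩ := hE
  refine ⟨Sl2.bracket x y, LinearMap.ext fun f => ?_⟩
  simp only [adSb, LinearMap.comp_apply, repb_bracket, commut_apply, LinearMap.sub_apply,
    Module.End.mul_apply]
  simp only [mul_sub, sub_mul, mul_assoc]
  abel

/-- The Lie bracket of vector fields: the commutator. -/
def Vec.bracket (q : ℕ) : Vec q →ₗ[ℂ] Vec q →ₗ[ℂ] Vec q :=
  LinearMap.mk₂ ℂ (fun D E => ⟨commut _ D.1 E.1, commut_mem D.2 E.2⟩)
    (fun D D' E => Subtype.ext (LinearMap.map_add₂ (commut _) D.1 D'.1 E.1))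
    (fun c D E => Subtype.ext (LinearMap.map_smul₂ (commut _) c D.1 E.1))
    (fun D E E' => Subtype.ext (map_add (commut _ D.1) E.1 E'.1))
    (fun c D E => Subtype.ext (map_smul (commut _ D.1) c E.1))

/-- The action of vector fields, as endomorphisms, on the truncated sphere. -/
def Vec.act (q : ℕ) : Vec q →ₗ[ℂ] Module.End ℂ (Sb q) where
  toFun D := D.1
  map_add' _ _ := rfl
  map_smul' _ _ := rfl

instance (q : ℕ) : SuperSpace (Sb q) := trivialGrading _
instance (q : ℕ) : SuperSpace (Vec q) := trivialGrading _
instance : SuperSpace Sl2 := trivialGrading _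
instance : SuperSpace ℂ := trivialGrading _

/-- The deRham cohomology of the truncated sphere in degree `p`: all gradings are trivial, so the
forms are the alternating multilinear maps, and the differential is the usual one. -/
abbrev HSb (q p : ℕ) : Type := Cohomology (Vec.bracket q) (Vec.act q) p

/-! ### The supersphere and its body -/

/-- The complex Grassmann algebra with `L` generators. -/
abbrev CL (L : ℕ) : Type := ExteriorAlgebra ℂ (Fin L → ℂ)

/-- The real Grassmann algebra with `L` generators, inside the complex one. -/
def BL (L : ℕ) : Subalgebra ℝ (CL L) :=
  Algebra.adjoin ℝ (Set.range fun k : Fin L => ExteriorAlgebra.ι ℂ (Pi.single k (1 : ℂ)))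

/-- The even (`i = 0`) and the odd (`i = 1`) part of the Grassmann algebra. -/
def CLpart (L : ℕ) (i : ZMod 2) : Submodule ℂ (CL L) :=
  CliffordAlgebra.evenOdd (0 : QuadraticForm ℂ (Fin L → ℂ)) i

/-- The `(2|2)`-dimensional supersphere of radius `ρ`: the points `(x¹, x², x³, θ⁴, θ⁵)` of the
real vector superspace with `∑ (xᵏ)² + 2 θ⁴ θ⁵ = ρ²`. -/
def supersphere (L : ℕ) (ρ : ℝ) : Set ((Fin 3 → CL L) × (Fin 2 → CL L)) :=
  {s | (∀ k, s.1 k ∈ BL L ∧ s.1 k ∈ CLpart L 0) ∧ (∀ α, s.2 α ∈ BL L ∧ s.2 α ∈ CLpart L 1) ∧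
    ∑ k, s.1 k ^ 2 + 2 * (s.2 0 * s.2 1) = algebraMap ℝ (CL L) (ρ ^ 2)}

/-- The sphere of radius `ρ`, the body of the supersphere. -/
def sphere (ρ : ℝ) : Set (Fin 3 → ℝ) := {y | ∑ k, y k ^ 2 = ρ ^ 2}

/-- Polynomials on `ℝ³`. -/
abbrev Poly : Type := MvPolynomial (Fin 3) ℂ

/-- Polynomials on the `(3|2)`-dimensional vector superspace: `f 0, f 1, f 2, f 3` are the
coefficients of `f_∅ + f₄ θ⁴ + f₅ θ⁵ + f₄₅ θ⁴ θ⁵`. -/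
abbrev SPoly : Type := Fin 4 → Poly

/-- The value of a polynomial at three (commuting, even) Grassmann numbers. -/
def evalPoly {L : ℕ} (f : Poly) (x : Fin 3 → CL L) : CL L :=
  ∑ m ∈ f.support, f.coeff m • (x 0 ^ m 0 * x 1 ^ m 1 * x 2 ^ m 2)

/-- The restriction of a superpolynomial to the supersphere. -/
def restrictS (L : ℕ) (ρ : ℝ) (f : SPoly) : supersphere L ρ → CL L := fun s =>
  evalPoly (f 0) s.1.1 + evalPoly (f 1) s.1.1 * s.1.2 0 + evalPoly (f 2) s.1.1 * s.1.2 1 +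
    evalPoly (f 3) s.1.1 * (s.1.2 0 * s.1.2 1)

/-- The restriction of a polynomial to the sphere. -/
def restrictSb (ρ : ℝ) (f : Poly) : sphere ρ → ℂ := fun y =>
  MvPolynomial.eval (fun k => ((y.1 k : ℝ) : ℂ)) f

/-- Multiplication by `xᵏ`. -/
def mulX (k : Fin 3) : Module.End ℂ SPoly :=
  (LinearMap.mulLeft ℂ (MvPolynomial.X k : Poly)).compLeft (Fin 4)

/-- The partial derivative `∂/∂xᵏ`. -/
def dX (k : Fin 3) : Module.End ℂ SPoly :=
  (MvPolynomial.pderiv k : Derivation ℂ Poly Poly).toLinearMap.compLeft (Fin 4)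

/-- Left multiplication by `θ⁴` (`α = 0`) and by `θ⁵` (`α = 1`). -/
def mulTheta (α : Fin 2) : Module.End ℂ SPoly where
  toFun f := if α = 0 then ![0, f 0, 0, f 2] else ![0, 0, f 0, -f 1]
  map_add' f g := by
    split_ifs <;> ext1 i <;> fin_cases i <;> simp [add_comm]
  map_smul' c f := by
    split_ifs <;> ext1 i <;> fin_cases i <;> simp

/-- The (left) partial derivatives `∂/∂θ⁴` (`α = 0`) and `∂/∂θ⁵` (`α = 1`). -/
def dTheta (α : Fin 2) : Module.End ℂ SPoly where
  toFun f := if α = 0 then ![f 1, 0, f 3, 0] else ![f 2, -f 3, 0, 0]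
  map_add' f g := by
    split_ifs <;> ext1 i <;> fin_cases i <;> simp [add_comm]
  map_smul' c f := by
    split_ifs <;> ext1 i <;> fin_cases i <;> simp

/-- The even derivations
`J_i = -i ∑ ε_{ijk} xʲ ∂/∂xᵏ + ½ ∑ (σ_i)_{αβ} θ^α ∂/∂θ^β` (the indices of `x` are taken modulo `3`). -/
def JX (i : Fin 3) : Module.End ℂ SPoly :=
  (-Complex.I) • (mulX (i + 1) * dX (i + 2) - mulX (i + 2) * dX (i + 1)) +
    (1 / 2 : ℂ) • ∑ α, ∑ β, pauli i α β • (mulTheta α * dTheta β)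

/-- The odd derivations
`J_α = ½ ∑ (i xᵏ (σ₂ σ_k)_{αβ} ∂/∂θ^β - θ^β (σ_k)_{βα} ∂/∂xᵏ)`. -/
def JTheta (α : Fin 2) : Module.End ℂ SPoly :=
  (1 / 2 : ℂ) • ∑ k, ∑ β, ((Complex.I * (pauli 1 * pauli k) α β) • (mulX k * dTheta β) -
    pauli k β α • (mulTheta β * dX k))

/-- `J₋ = J₁ - i J₂` on superpolynomials. -/
def JXminus : Module.End ℂ SPoly := JX 0 - Complex.I • JX 1

/-- The derivations `J_i = -i ∑ ε_{ijk} xʲ ∂_k` of the polynomials on `ℝ³`. -/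
def Jb (i : Fin 3) : Module.End ℂ Poly :=
  (-Complex.I) •
    (LinearMap.mulLeft ℂ (MvPolynomial.X (i + 1) : Poly) *
        (MvPolynomial.pderiv (i + 2) : Derivation ℂ Poly Poly).toLinearMap -
      LinearMap.mulLeft ℂ (MvPolynomial.X (i + 2) : Poly) *
        (MvPolynomial.pderiv (i + 1) : Derivation ℂ Poly Poly).toLinearMap)

/-- `J₋ = J₁ - i J₂` on polynomials. -/
def Jbminus : Module.End ℂ Poly := Jb 0 - Complex.I • Jb 1

/-- The polynomial `x¹ + i x²`. -/
def xplus : Poly := MvPolynomial.X 0 + MvPolynomial.C Complex.I * MvPolynomial.X 1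

/-! ### Superspherical harmonics and their noncommutative versions

Throughout, the superspin is `j = n / 2`, `l = j - μ / 2` and `k = l - m`; so `2 j = n`,
`l - m = k` and `l + m = n - μ - k`. -/

/-- The highest weight superspherical harmonic of superspin `n / 2`: with `a = ⌊n/2⌋`, it is
`√(n!) / (2^a a! ρ^a) (x¹ + i x²)^a` for even `n` and
`√(n!) / (2^a a! ρ^(a+2)) (x¹ + i x²)^a (x³ θ⁴ + (x¹ + i x²) θ⁵)` for odd `n`. -/
def highS (ρ : ℝ) (n : ℕ) : SPoly :=
  if Even n then
    ((√(n.factorial) / (2 ^ (n / 2) * (n / 2).factorial * ρ ^ (n / 2)) : ℝ) : ℂ) •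
      ![xplus ^ (n / 2), 0, 0, 0]
  else
    ((√(n.factorial) / (2 ^ (n / 2) * (n / 2).factorial * ρ ^ (n / 2 + 2)) : ℝ) : ℂ) •
      ![0, xplus ^ (n / 2) * MvPolynomial.X 2, xplus ^ (n / 2) * xplus, 0]

/-- The normalization `√(4^{2(j-l)} Γ(l+m+1) / (Γ(2j+1) Γ(l-m+1)))`. -/
def normS (n μ k : ℕ) : ℂ :=
  ((√(4 ^ μ * (n - μ - k).factorial / (n.factorial * k.factorial)) : ℝ) : ℂ)

/-- The index set of the superspherical harmonics of superspin at most `q`: the triples `(n, μ, k)`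
with `n ≤ 2 q`, `μ ∈ {0, 1}` and `0 ≤ k ≤ n - μ`. -/
def IdxS (q : ℕ) : Type := {t : ℕ × ℕ × ℕ // t.1 ≤ 2 * q ∧ t.2.1 ≤ 1 ∧ t.2.1 + t.2.2 ≤ t.1}

/-- The superspherical harmonics, as functions on the supersphere. -/
def harmS (L : ℕ) (ρ : ℝ) (q : ℕ) (t : IdxS q) : supersphere L ρ → CL L :=
  restrictS L ρ (normS t.1.1 t.1.2.1 t.1.2.2 •
    (JXminus ^ t.1.2.2 * JTheta 1 ^ t.1.2.1) (highS ρ t.1.1))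

/-- The truncated module `ℋ_q`, spanned by the superspherical harmonics of superspin at most `q`. -/
def Hq (L : ℕ) (ρ : ℝ) (q : ℕ) : Submodule ℂ (supersphere L ρ → CL L) :=
  Submodule.span ℂ (Set.range (harmS L ρ q))

/-- The highest weight noncommutative superspherical harmonics: with `a = ⌊n/2⌋`, these are
`√(2^j (2j-1)!! Γ(q-j+1) / (Γ(j+1) Γ(q+j+1))) J₊^j` for `j = a` and
`(q+½)⁻¹ √(2^{j+7/2} (2j)!! Γ(q-j+½) / (Γ(j+½) Γ(q+j+3/2))) J₊^{j-½} ((J₃ - ¾) J₄ + J₊ J₅)`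
for `j = a + ½`. -/
def highNS (q n : ℕ) : S q :=
  if Even n then
    ((√(2 ^ (n / 2) * (2 * (n / 2) - 1).doubleFactorial * (q - n / 2).factorial /
      ((n / 2).factorial * (q + n / 2).factorial)) : ℝ) : ℂ) • Jplus q ^ (n / 2)
  else
    ((1 / (q + 1 / 2) * √(2 ^ (n / 2 + 4) * (2 * (n / 2) + 1).doubleFactorial *
      (q - n / 2 - 1).factorial / ((n / 2).factorial * (q + n / 2 + 1).factorial)) : ℝ) : ℂ) •
      (Jplus q ^ (n / 2) * ((J3 q - (3 / 4 : ℂ) • 1) * J4 q + Jplus q * J5 q))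

/-- The noncommutative superspherical harmonics. -/
def harmNS (q : ℕ) (t : IdxS q) : S q :=
  normS t.1.1 t.1.2.1 t.1.2.2 •
    (superComm (Jminus q) ^ t.1.2.2 * superComm (J5 q) ^ t.1.2.1) (highNS q t.1.1)

/-- The index set of the spherical harmonics of spin at most `q`: the pairs `(j, k)` with `j ≤ q`
and `0 ≤ k = j - m ≤ 2 j`. -/
def IdxSb (q : ℕ) : Type := {t : ℕ × ℕ // t.1 ≤ q ∧ t.2 ≤ 2 * t.1}

/-- The normalization `√(Γ(j+m+1) / (Γ(2j+1) Γ(j-m+1)))`. -/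
def normSb (j k : ℕ) : ℂ :=
  ((√((2 * j - k).factorial / ((2 * j).factorial * k.factorial)) : ℝ) : ℂ)

/-- The spherical harmonics, as functions on the sphere. -/
def harmSb (ρ : ℝ) (q : ℕ) (t : IdxSb q) : sphere ρ → ℂ :=
  restrictSb ρ (normSb t.1.1 t.1.2 • (Jbminus ^ t.1.2)
    (((√((2 * t.1.1 + 1).factorial) / (2 ^ t.1.1 * t.1.1.factorial * ρ ^ t.1.1) : ℝ) : ℂ) •
      xplus ^ t.1.1))

/-- The truncated module `𝒞_q`, spanned by the spherical harmonics of spin at most `q`. -/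
def Cq (ρ : ℝ) (q : ℕ) : Submodule ℂ (sphere ρ → ℂ) :=
  Submodule.span ℂ (Set.range (harmSb ρ q))

/-- The noncommutative spherical harmonics. -/
def harmNSb (q : ℕ) (t : IdxSb q) : Sb q :=
  normSb t.1.1 t.1.2 • (commut (Sb q) (lower (q + 1)) ^ t.1.2)
    (((√(2 ^ t.1.1 * (2 * t.1.1 + 1).doubleFactorial * (q + 1) * (q - t.1.1).factorial /
      (t.1.1.factorial * (q + t.1.1 + 1).factorial)) : ℝ) : ℂ) • raise (q + 1) ^ t.1.1)

/-! ### The noncommutative body map -/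

/-- `g` is the body of the function `f` on the supersphere: `g (Φ s) = ε (f s)` for every point `s`
of the supersphere, where `ε` is the augmentation of the Grassmann algebra and `Φ s` is the point
of the sphere with coordinates `ε (xᵏ)`. -/
def IsBodyOf {L : ℕ} {ρ : ℝ} (f : supersphere L ρ → CL L) (g : sphere ρ → ℂ) : Prop :=
  ∀ (s : supersphere L ρ) (y : sphere ρ),
    (∀ k, ExteriorAlgebra.algebraMapInv (s.1.1 k) = ((y.1 k : ℝ) : ℂ)) →
      g y = ExteriorAlgebra.algebraMapInv (f s)

/-- `β` is the noncommutative body map `ψ̂_q ∘ (body map of the supersphere) ∘ ψ_q⁻¹`, where the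
linear isomorphisms `ψ_q : ℋ_q → End V(q/2, 1)` and `ψ̂_q : 𝒞_q → End V(q/2)` take the (super)spherical
harmonics to the noncommutative (super)spherical harmonics. -/
def IsBodyMap (L : ℕ) (ρ : ℝ) (q : ℕ) (β : S q →ₗ[ℂ] Sb q) : Prop :=
  ∃ (ψ : Hq L ρ q ≃ₗ[ℂ] S q) (ψb : Cq ρ q ≃ₗ[ℂ] Sb q),
    (∀ t : IdxS q, ψ ⟨harmS L ρ q t, Submodule.subset_span ⟨t, rfl⟩⟩ = harmNS q t) ∧
    (∀ t : IdxSb q, ψb ⟨harmSb ρ q t, Submodule.subset_span ⟨t, rfl⟩⟩ = harmNSb q t) ∧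
    ∀ f : Hq L ρ q, ∃ g : Cq ρ q, IsBodyOf f.1 g.1 ∧ β (ψ f) = ψb g

/-- `βv` is the map induced by the body map on even supervector fields:
`βv(D) (β f) = β (D f)`. -/
def IsVecBodyMap {q : ℕ} (β : S q →ₗ[ℂ] Sb q) (βv : SVecEven q ≃ₗ[ℂ] Vec q) : Prop :=
  ∀ (D : SVecEven q) (f : S q),
    (βv D : Module.End ℂ (Sb q)) (β f) = β (((D : SVec q) : Module.End ℂ (S q)) f)

/-- The extension of the body map to `p`-superforms:
`(β ω) (βv D₁, …, βv D_p) = β (ω (D₁, …, D_p))` for even `D_r`. -/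
def bodyForm {q : ℕ} (β : S q →ₗ[ℂ] Sb q) (βv : SVecEven q ≃ₗ[ℂ] Vec q) (p : ℕ) :
    ((Fin p → SVec q) → S q) →ₗ[ℂ] ((Fin p → Vec q) → Sb q) :=
  LinearMap.pi fun D =>
    β ∘ₗ LinearMap.proj (φ := fun _ : Fin p → SVec q => S q) fun r => (βv.symm (D r) : SVec q)

end

end FuzzySupersphere

open scoped Matrix

/-! The two algebras of vector fields are faithful copies of `osp(1|2)` and `sl(2)`, so both
complexes compute Lie (super)algebra cohomology with values in an endomorphism algebra. Two facts
determine it: only the constants contribute among the coefficients, and for constant coefficients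
both algebras have one class in degree 0, the Cartan class of `κ(x, [y, z])` in degree 3, and
nothing else.

Cartan calculus. Superforms become functions on lists of arguments of any length. Contraction `ins`,
Lie derivative `lie` and differential `diff` are then defined by recursion on the list, the
differential by solving ι_x d + d ι_x = L_x. All identities follow by induction on the list with few
signs; `extD_toForm` identifies this differential with the explicit formula.

Nontrivial coefficients. For an invariant tensor ∑ e'_a ⊗ e_a the operator h = ∑ e'_a ι_{e_a}
satisfies dh + hd = Casimir operator on the values (`diff_casimirHomotopy`). The noncommutative
harmonics diagonalize the Casimir operator with eigenvalues n(n+1)/4 for `osp(1|2)` and a(a+1) for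
`sl(2)`; these vanish only on the constants. Hence every cocycle is exact up to a cocycle with
constant values (`isReduction_of_diagonal`).

Trivial coefficients. The Lie derivatives act on the finite-dimensional space of p-cocycles, p > 0,
that vanish at (J₋, J₃, J₊), and L_x ω = d ι_x ω is exact. The Casimir operator made of Lie
derivatives is injective on this space, because there are no nonzero invariants in it
(`eq_zero_of_invariant`, `osp_casimir_injective`); so it is surjective and the whole space is exact
(`NormalizedExact`). Evaluation at (J₋, J₃, J₊) kills exact forms but not the Cartan cocycle. All
this is recorded in `HasSphereCohomology`: a class of degree 0 or 3 is one number, the constant part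
of one value.

Body map. The superspherical harmonics are linearly independent on the supersphere and their
noncommutative versions in the matrix algebra, and likewise for the sphere, so the body map is
defined on a basis. The body of a harmonic is zero or a multiple of a spherical harmonic, by a
factor independent of m. Hence the body map intertwines the actions of `sl(2)`
(`IsBodyMap.apply_adS`), ignores the grading and sends 1 to a nonzero multiple of 1. On forms it is
therefore restriction to `sl(2)` followed by an equivariant map of the values, and comparing the
detecting numbers shows that it is bijective on cohomology (`HasSphereCohomology.exists_map_equiv`).
-/

namespace FuzzySupersphere

noncomputable section

set_option linter.unusedSectionVars false

open SuperSpace (par par_par)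

/-! ### Cochains as functions on lists -/

section Twist

variable {M : Type*} [AddCommGroup M] [Module ℂ M] [SuperSpace M]

/-- The `i`-th power of the grading involution. -/
def tw (i : ZMod 2) : M →ₗ[ℂ] M := if i = 0 then LinearMap.id else par

theorem tw_zero (x : M) : tw 0 x = x := by simp [tw]

theorem tw_one (x : M) : tw 1 x = par x := by simp [tw]

theorem zmod_two_cases (i : ZMod 2) : i = 0 ∨ i = 1 := by
  fin_cases i
  · exact Or.inl rfl
  · exact Or.inr rfl

theorem one_add_one_zmod_two : (1 + 1 : ZMod 2) = 0 := rfl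

theorem tw_tw (i j : ZMod 2) (x : M) : tw i (tw j x) = tw (i + j) x := by
  rcases zmod_two_cases i with rfl | rfl <;> rcases zmod_two_cases j with rfl | rfl <;>
    simp [tw_zero, tw_one, par_par, one_add_one_zmod_two]

theorem tw_self (i : ZMod 2) (x : M) : tw i (tw i x) = x := by
  rw [tw_tw, show i + i = 0 from CharTwo.add_self_eq_zero i, tw_zero]

theorem sgn_zero : sgn 0 = 1 := by simp [sgn]

theorem sgn_one : sgn 1 = -1 := by simp [sgn]

theorem sgn_mul_self (i : ZMod 2) : sgn i * sgn i = 1 := by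
  rcases zmod_two_cases i with rfl | rfl <;> simp [sgn]

theorem sgn_add (i j : ZMod 2) : sgn (i + j) = sgn i * sgn j := by
  rcases zmod_two_cases i with rfl | rfl <;> rcases zmod_two_cases j with rfl | rfl <;>
    simp [sgn, one_add_one_zmod_two]

theorem mem_homog {i : ZMod 2} {x : M} : x ∈ homog M i ↔ par x = sgn i • x := by
  simp [homog, sub_eq_zero]

theorem mem_homog_zero {x : M} : x ∈ homog M 0 ↔ par x = x := by
  simp [mem_homog, sgn_zero]

theorem mem_homog_one {x : M} : x ∈ homog M 1 ↔ par x = -x := by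
  simp [mem_homog, sgn_one]

/-- On homogeneous elements the twist is the usual sign. With `tw` in place of that sign, the sign
rules below can be stated with only one of the two elements homogeneous. -/
theorem tw_of_mem {i j : ZMod 2} {x : M} (hx : x ∈ homog M j) : tw i x = sgn (i * j) • x := by
  rcases zmod_two_cases i with rfl | rfl
  · simp [tw_zero, sgn_zero]
  · rw [tw_one, mem_homog.1 hx, one_mul]

theorem comp_mem (i : ZMod 2) (x : M) : comp i x ∈ homog M i := by
  rw [mem_homog]
  rcases zmod_two_cases i with rfl | rfl
  · simp [comp_zero_apply, sgn_zero, par_par, add_comm]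
  · simp only [comp_one_apply, sgn_one, par_par, map_sub, map_smul]; module

theorem comp_add_comp (x : M) : comp 0 x + comp 1 x = x := by
  rw [comp_zero_apply, comp_one_apply]; module

theorem comp_of_mem {i : ZMod 2} {x : M} (hx : x ∈ homog M i) (j : ZMod 2) :
    comp j x = if j = i then x else 0 := by
  rw [mem_homog] at hx
  rcases zmod_two_cases i with rfl | rfl <;> rcases zmod_two_cases j with rfl | rfl <;>
    simp only [comp_zero_apply, comp_one_apply, hx, sgn_zero, sgn_one] <;> simp
  all_goals module

theorem tw_mem {i j : ZMod 2} {x : M} (hx : x ∈ homog M j) : tw i x ∈ homog M j := by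
  rw [tw_of_mem hx]; exact Submodule.smul_mem _ _ hx

end Twist

/-! ### Contraction, Lie derivative and differential by Cartan calculus. -/

section Cochains

variable {L M : Type*} [AddCommGroup L] [Module ℂ L] [SuperSpace L]
  [AddCommGroup M] [Module ℂ M] [SuperSpace M]

/-- The axioms of a Lie superalgebra with bracket `br` and of a graded module over it with action
`act`. -/
structure IsLieModule (br : L →ₗ[ℂ] L →ₗ[ℂ] L) (act : L →ₗ[ℂ] Module.End ℂ M) : Prop where
  par_br : ∀ x y, par (br x y) = br (par x) (par y)
  par_act : ∀ x m, par (act x m) = act (par x) (par m)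
  skew : ∀ (i : ZMod 2), ∀ w ∈ homog L i, ∀ x, br (tw i x) w = -br w x
  jacobi : ∀ (i : ZMod 2), ∀ w ∈ homog L i, ∀ y z,
    br w (br y z) = br (br w y) z + br (tw i y) (br w z)
  act_br : ∀ (i : ZMod 2), ∀ w ∈ homog L i, ∀ y m,
    act (br w y) m = act w (act y m) - act (tw i y) (act w m)

/-- Contraction with `x`. -/
def ins (x : L) : (List L → M) →ₗ[ℂ] (List L → M) where
  toFun ω l := ω (x :: l)
  map_add' _ _ := rfl
  map_smul' _ _ := rfl

@[simp] theorem ins_apply (x : L) (ω : List L → M) (l : List L) : ins x ω l = ω (x :: l) := rfl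

variable (L M) in
/-- The multilinear cochains. -/
def Multilin : Submodule ℂ (List L → M) where
  carrier := {ω | ∀ (l₁ l₂ : List L) (c : ℂ) (x y : L),
    ω (l₁ ++ (c • x + y) :: l₂) = c • ω (l₁ ++ x :: l₂) + ω (l₁ ++ y :: l₂)}
  add_mem' := by
    intro ω η hω hη l₁ l₂ c x y
    simp only [Pi.add_apply, hω l₁ l₂ c x y, hη l₁ l₂ c x y]; module
  zero_mem' := by intro l₁ l₂ c x y; simp
  smul_mem' := by
    intro b ω hω l₁ l₂ c x y
    simp only [Pi.smul_apply, hω l₁ l₂ c x y]; module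

variable (L M) in
/-- The graded-alternating multilinear cochains. -/
def Altern : Submodule ℂ (List L → M) where
  carrier := {ω | ω ∈ Multilin L M ∧ ∀ (l₁ l₂ : List L) (i : ZMod 2), ∀ x ∈ homog L i, ∀ y,
    ω (l₁ ++ tw i y :: x :: l₂) = -ω (l₁ ++ x :: y :: l₂)}
  add_mem' := by
    intro ω η hω hη
    refine ⟨add_mem hω.1 hη.1, fun l₁ l₂ i x hx y => ?_⟩
    simp only [Pi.add_apply, hω.2 l₁ l₂ i x hx y, hη.2 l₁ l₂ i x hx y]; abel
  zero_mem' := ⟨zero_mem _, by intros; simp⟩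
  smul_mem' := by
    intro b ω hω
    refine ⟨Submodule.smul_mem _ _ hω.1, fun l₁ l₂ i x hx y => ?_⟩
    simp only [Pi.smul_apply, hω.2 l₁ l₂ i x hx y, smul_neg]

variable {ω : List L → M}

theorem ins_mem (hω : ω ∈ Multilin L M) (x : L) : ins x ω ∈ Multilin L M :=
  fun l₁ l₂ c y z => hω (x :: l₁) l₂ c y z

theorem ins_mem_altern (hω : ω ∈ Altern L M) (x : L) : ins x ω ∈ Altern L M :=
  ⟨ins_mem hω.1 x, fun l₁ l₂ i y hy z => hω.2 (x :: l₁) l₂ i y hy z⟩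

theorem ins_smul_add (hω : ω ∈ Multilin L M) (c : ℂ) (x y : L) :
    ins (c • x + y) ω = c • ins x ω + ins y ω := by
  ext l; exact hω [] l c x y

theorem ins_zero (hω : ω ∈ Multilin L M) : ins (0 : L) ω = 0 := by
  have h := ins_smul_add hω (-1) (0 : L) 0
  simpa using h

theorem ins_add (hω : ω ∈ Multilin L M) (x y : L) : ins (x + y) ω = ins x ω + ins y ω := by
  simpa using ins_smul_add hω 1 x y

theorem ins_smul (hω : ω ∈ Multilin L M) (c : ℂ) (x : L) : ins (c • x) ω = c • ins x ω := by
  simpa [ins_zero hω] using ins_smul_add hω c x 0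

theorem ins_neg (hω : ω ∈ Multilin L M) (x : L) : ins (-x) ω = -ins x ω := by
  simpa using ins_smul hω (-1) x

theorem ins_sub (hω : ω ∈ Multilin L M) (x y : L) : ins (x - y) ω = ins x ω - ins y ω := by
  rw [sub_eq_add_neg, ins_add hω, ins_neg hω, sub_eq_add_neg]

theorem mem_multilin_iff : ω ∈ Multilin L M ↔
    (∀ (c : ℂ) (x y : L), ins (c • x + y) ω = c • ins x ω + ins y ω) ∧
      ∀ x, ins x ω ∈ Multilin L M := by
  refine ⟨fun h => ⟨ins_smul_add h, ins_mem h⟩, fun h l₁ l₂ c x y => ?_⟩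
  rcases l₁ with _ | ⟨z, l₁⟩
  · exact congrFun (h.1 c x y) l₂
  · exact h.2 z l₁ l₂ c x y

theorem ins_ins (hω : ω ∈ Altern L M) {i : ZMod 2} {x : L} (hx : x ∈ homog L i) (y : L) :
    ins x (ins (tw i y) ω) = -ins y (ins x ω) := by
  ext l; exact hω.2 [] l i x hx y

/-- A multilinear cochain is determined by its values on lists with homogeneous head. -/
theorem eq_of_homog_head {η : List L → M} (hω : ω ∈ Multilin L M) (hη : η ∈ Multilin L M)
    (l : List L) (h : ∀ i, ∀ x ∈ homog L i, ω (x :: l) = η (x :: l)) (x : L) :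
    ω (x :: l) = η (x :: l) := by
  have h1 := congrFun (ins_add hω (comp 0 x) (comp 1 x)) l
  have h2 := congrFun (ins_add hη (comp 0 x) (comp 1 x)) l
  simp only [comp_add_comp, ins_apply, Pi.add_apply] at h1 h2
  rw [h1, h2, h 0 _ (comp_mem 0 x), h 1 _ (comp_mem 1 x)]

variable (br : L →ₗ[ℂ] L →ₗ[ℂ] L) (act : L →ₗ[ℂ] Module.End ℂ M)

/-- The value of the Lie derivative along `x`, of degree `i`, at a list. -/
def lieAux (i : ZMod 2) (x : L) : List L → (List L → M) → M
  | [], ω => act x (tw i (ω []))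
  -- Moving `x` past `y` costs the sign that `tw i` puts on `y`, so neither `y` nor `ω` has to be
  -- homogeneous.
  | y :: l, ω => lieAux i x l (ins (tw i y) ω) - ω (br x y :: l)

theorem lieAux_smul_add (i : ZMod 2) (x : L) (l : List L) (c : ℂ) (ω η : List L → M) :
    lieAux br act i x l (c • ω + η) = c • lieAux br act i x l ω + lieAux br act i x l η := by
  induction l generalizing ω η with
  | nil => simp [lieAux]
  | cons y l ih =>
    simp only [lieAux, map_add, map_smul, ih, Pi.add_apply, Pi.smul_apply]; module

/-- The Lie derivative along an element `x` of degree `i`. -/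
def lie (i : ZMod 2) (x : L) : (List L → M) →ₗ[ℂ] (List L → M) where
  toFun ω l := lieAux br act i x l ω
  map_add' ω η := by ext l; simpa using lieAux_smul_add br act i x l 1 ω η
  map_smul' c ω := by
    ext l
    have h0 : lieAux br act i x l 0 = 0 := by
      simpa using lieAux_smul_add br act i x l (-1) 0 0
    simpa [h0] using lieAux_smul_add br act i x l c ω 0

theorem lie_nil (i : ZMod 2) (x : L) (ω : List L → M) :
    lie br act i x ω [] = act x (tw i (ω [])) := rfl

theorem lie_cons (i : ZMod 2) (x y : L) (l : List L) (ω : List L → M) :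
    lie br act i x ω (y :: l) = lie br act i x (ins (tw i y) ω) l - ω (br x y :: l) := rfl

theorem ins_lie (i : ZMod 2) (x y : L) (ω : List L → M) :
    ins y (lie br act i x ω) = lie br act i x (ins (tw i y) ω) - ins (br x y) ω := rfl

theorem lie_smul_add_left (hω : ω ∈ Multilin L M) (i : ZMod 2) (c : ℂ) (x y : L) :
    lie br act i (c • x + y) ω = c • lie br act i x ω + lie br act i y ω := by
  ext l
  induction l generalizing ω with
  | nil => simp [lie_nil]
  | cons z l ih =>
    have h := congrFun (ins_smul_add hω c (br x z) (br y z)) l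
    simp only [ins_apply, Pi.add_apply, Pi.smul_apply] at h
    simp only [lie_cons, ih (ins_mem hω _), Pi.add_apply, Pi.smul_apply, map_add, map_smul,
      LinearMap.add_apply, LinearMap.smul_apply, h]
    module

theorem lie_zero_left (hω : ω ∈ Multilin L M) (i : ZMod 2) : lie br act i 0 ω = 0 := by
  have h := lie_smul_add_left br act hω i (-1) 0 0
  simpa using h

theorem lie_smul_left (hω : ω ∈ Multilin L M) (i : ZMod 2) (c : ℂ) (x : L) :
    lie br act i (c • x) ω = c • lie br act i x ω := by
  simpa [lie_zero_left br act hω] using lie_smul_add_left br act hω i c x 0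

theorem lie_mem (hω : ω ∈ Multilin L M) (i : ZMod 2) (x : L) :
    lie br act i x ω ∈ Multilin L M := by
  intro l₁ l₂ c y z
  induction l₁ generalizing ω with
  | nil =>
    have h := congrFun (ins_smul_add hω c (br x y) (br x z)) l₂
    simp only [ins_apply, Pi.add_apply, Pi.smul_apply] at h
    simp only [List.nil_append, lie_cons, map_add, map_smul, ins_smul_add hω, Pi.add_apply,
      Pi.smul_apply, h]
    module
  | cons w l₁ ih =>
    simp only [List.cons_append, lie_cons, ih (ins_mem hω _)]
    have h := hω (br x w :: l₁) l₂ c y z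
    simp only [List.cons_append] at h
    rw [h]; module

/-- The value of the exterior derivative at a list, determined by Cartan's formula. -/
def diffAux : List L → (List L → M) → M
  | [], _ => 0
  | x :: l, ω => lie br act 0 (comp 0 x) ω l + lie br act 1 (comp 1 x) ω l - diffAux l (ins x ω)

theorem diffAux_smul_add (l : List L) (c : ℂ) (ω η : List L → M) :
    diffAux br act l (c • ω + η) = c • diffAux br act l ω + diffAux br act l η := by
  induction l generalizing ω η with
  | nil => simp [diffAux]
  | cons y l ih =>
    simp only [diffAux, map_add, map_smul, ih, Pi.add_apply, Pi.smul_apply]; module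

/-- The exterior derivative of cochains. -/
def diff : (List L → M) →ₗ[ℂ] (List L → M) where
  toFun ω l := diffAux br act l ω
  map_add' ω η := by ext l; simpa using diffAux_smul_add br act l 1 ω η
  map_smul' c ω := by
    ext l
    have h0 : diffAux br act l 0 = 0 := by simpa using diffAux_smul_add br act l (-1) 0 0
    simpa [h0] using diffAux_smul_add br act l c ω 0

theorem diff_nil (ω : List L → M) : diff br act ω [] = 0 := rfl

theorem diff_cons (x : L) (l : List L) (ω : List L → M) :
    diff br act ω (x :: l) = lie br act 0 (comp 0 x) ω l + lie br act 1 (comp 1 x) ω l -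
      diff br act (ins x ω) l := rfl

/-- Cartan's formula. -/
theorem ins_diff (hω : ω ∈ Multilin L M) {i : ZMod 2} {x : L} (hx : x ∈ homog L i) :
    ins x (diff br act ω) = lie br act i x ω - diff br act (ins x ω) := by
  ext l
  rw [ins_apply, diff_cons, comp_of_mem hx, comp_of_mem hx]
  rcases zmod_two_cases i with rfl | rfl <;> simp [lie_zero_left br act hω]

theorem diff_mem (hω : ω ∈ Multilin L M) : diff br act ω ∈ Multilin L M := by
  intro l₁ l₂ c y z
  induction l₁ generalizing ω with
  | nil =>
    simp only [List.nil_append, diff_cons, map_add, map_smul, ins_smul_add hω, Pi.add_apply,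
      Pi.smul_apply, lie_smul_add_left br act hω]
    module
  | cons w l₁ ih =>
    simp only [List.cons_append, diff_cons, ih (ins_mem hω _), lie_mem br act hω _ _ l₁ l₂ c y z]
    module

variable {br act}

theorem IsLieModule.tw_br (h : IsLieModule br act) (i : ZMod 2) (x y : L) :
    tw i (br x y) = br (tw i x) (tw i y) := by
  rcases zmod_two_cases i with rfl | rfl <;> simp [tw_zero, tw_one, h.par_br]

theorem IsLieModule.tw_act (h : IsLieModule br act) (i : ZMod 2) (x : L) (m : M) :
    tw i (act x m) = act (tw i x) (tw i m) := by
  rcases zmod_two_cases i with rfl | rfl <;> simp [tw_zero, tw_one, h.par_act]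

theorem IsLieModule.br_mem (h : IsLieModule br act) {i j : ZMod 2} {x y : L}
    (hx : x ∈ homog L i) (hy : y ∈ homog L j) : br x y ∈ homog L (i + j) := by
  rw [mem_homog] at *
  rw [h.par_br, hx, hy, sgn_add]
  simp only [map_smul, LinearMap.smul_apply, smul_smul, mul_comm]

/-- Lie derivatives represent the Lie superalgebra, up to a sign. -/
theorem lie_lie (h : IsLieModule br act) (hω : ω ∈ Multilin L M) {i j : ZMod 2} {x y : L}
    (hx : x ∈ homog L i) (hy : y ∈ homog L j) :
    lie br act i x (lie br act j y ω) = sgn (i * j) • lie br act j y (lie br act i x ω) +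
      sgn (i * j) • lie br act (i + j) (br x y) ω := by
  have hs := sgn_mul_self (i * j)
  ext l
  induction l generalizing ω with
  | nil =>
    simp only [lie_nil, Pi.add_apply, Pi.smul_apply, h.tw_act, tw_tw, h.act_br i x hx,
      tw_of_mem hy, tw_of_mem hx, map_smul, LinearMap.smul_apply, mul_comm j i, add_comm j i]
    module
  | cons z l ih =>
    have e1 : ∀ z, tw j (br x z) = sgn (i * j) • br x (tw j z) := fun z => by
      rw [h.tw_br, tw_of_mem hx, map_smul, LinearMap.smul_apply, mul_comm j i]
    have e2 : ∀ z, tw i (br y z) = sgn (i * j) • br y (tw i z) := fun z => by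
      rw [h.tw_br, tw_of_mem hy, map_smul, LinearMap.smul_apply]
    have e3 : br y (br x z) = sgn (i * j) • br x (br y z) - sgn (i * j) • br (br x y) z := by
      have := h.jacobi i x hx y z
      rw [tw_of_mem hy] at this
      rw [this, map_smul, LinearMap.smul_apply, smul_add, smul_smul, hs]; module
    have e4 := congrFun (ins_sub hω (sgn (i * j) • br x (br y z)) (sgn (i * j) • br (br x y) z)) l
    simp only [ins_smul hω, Pi.sub_apply, Pi.smul_apply, ins_apply] at e4
    simp only [Pi.add_apply, Pi.smul_apply, lie_cons, ins_lie, map_sub, Pi.sub_apply, e1, e2,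
      ins_smul hω, map_smul, tw_tw, ih (ins_mem hω _), e3, e4]
    simp only [add_comm j i, smul_sub, smul_smul, hs, one_smul]
    abel

/-- After contraction with a homogeneous `z`, Cartan's formula reduces the claim to `lie_lie` for
`z` and `x` and to the same claim for `ins z ω` on a shorter list. -/
theorem lie_diff (h : IsLieModule br act) (hω : ω ∈ Multilin L M) {i : ZMod 2} {x : L}
    (hx : x ∈ homog L i) :
    lie br act i x (diff br act ω) = diff br act (lie br act i x ω) := by
  ext l
  induction l generalizing ω with
  | nil => simp [lie_nil, diff_nil]
  | cons z l ih =>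
    refine eq_of_homog_head (lie_mem br act (diff_mem br act hω) i x)
      (diff_mem br act (lie_mem br act hω i x)) l (fun j z hz => ?_) z
    have hs := sgn_mul_self (i * j)
    have e1 := congrFun (ins_lie br act i x z (diff br act ω)) l
    have e2 := congrFun (ins_diff br act (lie_mem br act hω i x) hz) l
    have e3 := congrFun (lie_lie h hω hz hx) l
    rw [mul_comm j i, add_comm j i] at e3
    have e4 : br z x = -(sgn (i * j) • br x z) := by
      have := h.skew i x hx z
      rw [tw_of_mem hz, map_smul, LinearMap.smul_apply] at this
      rw [← smul_neg, ← this, smul_smul, hs, one_smul]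
    rw [ins_diff br act hω (h.br_mem hx hz), tw_of_mem hz, ins_smul (diff_mem br act hω),
      ins_diff br act hω hz, map_smul, map_sub] at e1
    rw [ins_lie, tw_of_mem hz, ins_smul hω, map_smul, map_sub, map_smul] at e2
    rw [e4, ← neg_one_smul ℂ, lie_smul_left _ _ hω, lie_smul_left _ _ hω] at e3
    simp only [ins_apply, Pi.sub_apply, Pi.smul_apply, Pi.add_apply, ih (ins_mem hω _)] at e1 e2 e3
    rw [e1, e2, e3]
    simp only [smul_smul]
    linear_combination (norm := module) hs • lie br act (i + j) (br x z) ω l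

/-- Contraction with `z` gives L_z d - d(L_z - d ι_z) = d d ι_z, since L_z commutes with d;
induction on the length of the list does the rest. -/
theorem diff_diff (h : IsLieModule br act) (hω : ω ∈ Multilin L M) :
    diff br act (diff br act ω) = 0 := by
  ext l
  induction l generalizing ω with
  | nil => rfl
  | cons z l ih =>
    refine eq_of_homog_head (diff_mem br act (diff_mem br act hω)) (zero_mem _) l
      (fun j z hz => ?_) z
    have e1 := congrFun (ins_diff br act (diff_mem br act hω) hz) l
    rw [ins_diff br act hω hz, map_sub, lie_diff h hω hz] at e1
    refine Eq.trans e1 ?_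
    simp [ih (ins_mem hω z)]

/-- Only the exchange of the first two arguments `y`, `z` has content. There the alternation of `ω`
is needed at the pairs (y, z), (y, [x, z]) and ([x, y], z). -/
theorem lie_mem_altern (h : IsLieModule br act) (hω : ω ∈ Altern L M) {i : ZMod 2} {x : L}
    (hx : x ∈ homog L i) : lie br act i x ω ∈ Altern L M := by
  refine ⟨lie_mem br act hω.1 i x, fun l₁ l₂ j y hy z => ?_⟩
  induction l₁ generalizing ω with
  | nil =>
    have e1 := congrArg (lie br act i x) (ins_ins hω (tw_mem (i := i) hy) (tw i z : L))
    have e2 := ins_ins hω hy (br x z)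
    have e3 := ins_ins hω (h.br_mem hx hy) z
    have e4 : tw j (br x z) = sgn (i * j) • br x (tw j z) := by
      rw [h.tw_br, tw_of_mem hx, map_smul, LinearMap.smul_apply, mul_comm j i]
    have hs := sgn_mul_self (i * j)
    rw [← tw_tw] at e3
    rw [e4, ins_smul hω.1, map_smul] at e2
    have e6 := congrFun e1 l₂
    have e7 := congrFun e2 l₂
    have e8 := congrFun e3 l₂
    have e9 : ∀ z : L, tw j (tw i z) = tw i (tw j z) := fun z => by rw [tw_tw, tw_tw, add_comm]
    simp only [ins_apply, Pi.smul_apply, map_neg, Pi.neg_apply, e9] at e6 e7 e8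
    have e12 : ins (tw i y) ω = sgn (i * j) • ins y ω := by rw [tw_of_mem hy, ins_smul hω.1]
    have e14 := congrFun e12 (br x z :: l₂)
    simp only [ins_apply, Pi.smul_apply] at e14
    simp only [List.nil_append, lie_cons, ins_apply, e6]
    rw [e14, e8]
    linear_combination (norm := module) (-sgn (i * j)) • e7 +
      hs • ω (br x (tw j z) :: y :: l₂)
  | cons w l₁ ih =>
    simp only [List.cons_append, lie_cons, ih (ins_mem_altern hω _)]
    have := hω.2 (br x w :: l₁) l₂ j y hy z
    simp only [List.cons_append] at this
    rw [this]; abel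

/-- For homogeneous `y` and `z`, two applications of Cartan's formula express the exchange on `dω`
by the alternation of `ω` and the skew symmetry of the bracket. A general `z` is the sum of its
components. -/
theorem diff_mem_altern (h : IsLieModule br act) (hω : ω ∈ Altern L M) :
    diff br act ω ∈ Altern L M := by
  refine ⟨diff_mem br act hω.1, fun l₁ l₂ j y hy z => ?_⟩
  induction l₁ generalizing ω with
  | nil =>
    have key : ∀ k, ∀ z ∈ homog L k,
        ins y (ins (tw j z) (diff br act ω)) = -ins z (ins y (diff br act ω)) := by
      intro k z hz
      have hs := sgn_mul_self (j * k)
      have e1 := congrArg (diff br act) (ins_ins hω hy z)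
      have e2 := congrArg (fun v => ins v ω) (h.skew j y hy z)
      simp only [tw_of_mem hz, map_smul, LinearMap.smul_apply, ins_smul hω.1, ins_neg hω.1,
        map_neg] at e1 e2
      rw [tw_of_mem hz, ins_smul (diff_mem br act hω.1), ins_diff br act hω.1 hy,
        ins_diff br act hω.1 hz, map_smul, map_sub, map_sub, ins_lie, ins_lie,
        ins_diff br act (ins_mem hω.1 _) hy, ins_diff br act (ins_mem hω.1 _) hz,
        tw_of_mem hz, tw_of_mem hy, ins_smul hω.1, ins_smul hω.1, map_smul, map_smul,
        mul_comm k j]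
      linear_combination (norm := module) e1 - e2 + hs • lie br act k z (ins y ω)
    have e0 := congrFun (key 0 _ (comp_mem 0 z)) l₂
    have e1 := congrFun (key 1 _ (comp_mem 1 z)) l₂
    have hd := diff_mem br act hω.1
    have e2 := congrFun (ins_add hd (tw j (comp 0 z)) (tw j (comp 1 z))) (y :: l₂)
    have e3 := congrFun (ins_add (ins_mem hd y) (comp 0 z) (comp 1 z)) l₂
    rw [← map_add, comp_add_comp] at e2
    rw [comp_add_comp] at e3
    simp only [ins_apply, Pi.add_apply, Pi.neg_apply] at e0 e1 e2 e3
    simp only [List.nil_append]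
    rw [e2, e3, e0, e1]; abel
  | cons w l₁ ih =>
    have h0 := (lie_mem_altern h hω (comp_mem 0 w)).2 l₁ l₂ j y hy z
    have h1 := (lie_mem_altern h hω (comp_mem 1 w)).2 l₁ l₂ j y hy z
    simp only [List.cons_append, diff_cons, ih (ins_mem_altern hω _), h0, h1]
    abel

end Cochains

/-! ### Superforms as alternating cochains -/

section CommFactor

theorem prod_prod_ite_single {n : ℕ} (a b : Fin n) (u : ℂ) :
    ∏ r : Fin n, ∏ s : Fin n, (if r = a ∧ s = b then u else 1) = u := by
  rw [Finset.prod_eq_single a, Finset.prod_eq_single b]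
  · simp
  · intro s _ hs; simp [hs]
  · simp
  · intro r _ hr; simp [hr]
  · simp

theorem commFactor_one {p : ℕ} (i : Fin p → ZMod 2) : commFactor 1 i = 1 := by
  refine Finset.prod_eq_one fun r _ => Finset.prod_eq_one fun s _ => if_neg ?_
  rintro ⟨h1, h2⟩
  exact absurd (lt_trans h1 h2) (lt_irrefl _)

theorem swap_lt_swap_iff {p : ℕ} (k : Fin p) (r s : Fin (p + 1))
    (h : ¬(r = k.castSucc ∧ s = k.succ)) (h' : ¬(r = k.succ ∧ s = k.castSucc)) :
    Equiv.swap k.castSucc k.succ r < Equiv.swap k.castSucc k.succ s ↔ r < s := by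
  simp only [Equiv.swap_apply_def, Fin.ext_iff, Fin.lt_def, Fin.val_castSucc, Fin.val_succ] at *
  split_ifs <;> simp only [Fin.val_castSucc, Fin.val_succ] <;> omega

/-- After reindexing by the transposition, the factors agree for all pairs other than the two
orderings of the neighbours. Exactly one of these two contributes the extra sign, depending on the
order in which `σ` places the neighbours. -/
theorem commFactor_swap_mul {p : ℕ} (k : Fin p) (σ : Equiv.Perm (Fin (p + 1)))
    (i : Fin (p + 1) → ZMod 2) :
    commFactor (Equiv.swap k.castSucc k.succ * σ) i = sgn (i k.castSucc * i k.succ) *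
      commFactor σ (fun r => i (Equiv.swap k.castSucc k.succ r)) := by
  set τ := Equiv.swap k.castSucc k.succ with hτ
  have hne : k.castSucc ≠ k.succ := (Fin.castSucc_lt_succ (i := k)).ne
  have hlt : k.castSucc < k.succ := Fin.castSucc_lt_succ (i := k)
  have ha : τ k.castSucc = k.succ := Equiv.swap_apply_left _ _
  have hb : τ k.succ = k.castSucc := Equiv.swap_apply_right _ _
  have hs := sgn_mul_self (i k.castSucc * i k.succ)
  have hσ : σ.symm k.castSucc ≠ σ.symm k.succ := fun h => hne (σ.symm.injective h)
  unfold commFactor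
  rw [← Equiv.prod_comp τ]
  simp_rw [← Equiv.prod_comp τ (fun s => if τ _ < s ∧ _ then _ else _)]
  have hsymm : ∀ s, (τ * σ).symm (τ s) = σ.symm s := fun s => by
    simp [Equiv.symm_apply_eq]
  simp only [hsymm]
  have key : ∀ r s, (if τ r < τ s ∧ σ.symm s < σ.symm r then sgn (i (τ r) * i (τ s)) else 1) =
      (if r < s ∧ σ.symm s < σ.symm r then sgn (i (τ r) * i (τ s)) else 1) *
      ((if r = k.castSucc ∧ s = k.succ then
          (if σ.symm k.succ < σ.symm k.castSucc then sgn (i k.castSucc * i k.succ) else 1) else 1) *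
        (if r = k.succ ∧ s = k.castSucc then
          (if σ.symm k.castSucc < σ.symm k.succ then sgn (i k.castSucc * i k.succ) else 1)
            else 1)) := by
    intro r s
    by_cases h1 : r = k.castSucc ∧ s = k.succ
    · obtain ⟨rfl, rfl⟩ := h1
      simp only [ha, hb, hlt, hlt.not_gt, hne, true_and, false_and, if_false, and_self, if_true,
        mul_one, hne.symm]
      rw [mul_comm (i k.succ)]
      split_ifs <;> simp [hs]
    · by_cases h2 : r = k.succ ∧ s = k.castSucc
      · obtain ⟨rfl, rfl⟩ := h2
        simp only [ha, hb, hlt, hlt.not_gt, hne, true_and, false_and, if_false, and_self, if_true,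
          one_mul, hne.symm]
      · simp only [hτ, swap_lt_swap_iff k r s h1 h2, h1, h2, if_false, mul_one]
  simp only [key, Finset.prod_mul_distrib, prod_prod_ite_single]
  rw [mul_comm]
  congr 1
  rcases lt_or_gt_of_ne hσ with h | h
  · simp [h, h.not_gt]
  · simp [h, h.not_gt]

theorem commFactor_swap {p : ℕ} (k : Fin p) (i : Fin (p + 1) → ZMod 2) :
    commFactor (Equiv.swap k.castSucc k.succ) i = sgn (i k.castSucc * i k.succ) := by
  have := commFactor_swap_mul k 1 i
  rwa [mul_one, commFactor_one, mul_one] at this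

end CommFactor

/-! ### The dictionary between superforms and alternating cochains. -/

section Transfer

variable {L M : Type*} [AddCommGroup L] [Module ℂ L] [SuperSpace L]
  [AddCommGroup M] [Module ℂ M] [SuperSpace M]

/-- It suffices to test graded alternation on transpositions of neighbours. -/
theorem mem_forms_iff {p : ℕ} (ω : (Fin (p + 1) → L) → M) : ω ∈ Forms L M (p + 1) ↔
    (∃ m : MultilinearMap ℂ (fun _ : Fin (p + 1) => L) M, ω = ⇑m) ∧
      ∀ (k : Fin p) (i : Fin (p + 1) → ZMod 2) (D : Fin (p + 1) → L), (∀ r, D r ∈ homog L (i r)) →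
        ω (fun r => D (Equiv.swap k.castSucc k.succ r)) =
          -(sgn (i k.castSucc * i k.succ) • ω D) := by
  refine and_congr_right fun _ => ⟨fun h k i D hD => ?_, fun h σ => ?_⟩
  · have := h (Equiv.swap k.castSucc k.succ) i D hD
    rw [commFactor_swap, Equiv.Perm.sign_swap (Fin.castSucc_lt_succ (i := k)).ne] at this
    have h2 := congrArg (fun m => sgn (i k.castSucc * i k.succ) • m) this
    simp only [smul_smul, sgn_mul_self, one_smul] at h2
    rw [h2]
    push_cast
    module
  -- Neighbour transpositions generate the symmetric group even as a monoid. Induction by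
  -- multiplication on the left matches the cocycle rule `commFactor_swap_mul`.
  · refine Submonoid.induction_of_closure_eq_top_left
      (Equiv.Perm.mclosure_swap_castSucc_succ p) σ ?_ ?_
    · intro i D _
      simp [commFactor_one]
    · rintro _ ⟨k, rfl⟩ σ ih i D hD
      have h1 := ih (fun r => i (Equiv.swap k.castSucc k.succ r))
        (fun r => D (Equiv.swap k.castSucc k.succ r)) (fun r => hD _)
      have h2 := h k i D hD
      rw [h2] at h1
      rw [commFactor_swap_mul, mul_smul, Equiv.Perm.sign_mul,
        Equiv.Perm.sign_swap (Fin.castSucc_lt_succ (i := k)).ne]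
      simp only [Equiv.Perm.mul_apply]
      rw [h1, smul_comm, smul_neg, smul_smul, sgn_mul_self]
      push_cast
      module

/-- The cochain of degree `p` given by a function of `p` arguments. -/
def ofForm : (p : ℕ) → ((Fin p → L) → M) → List L → M
  | 0, ω, [] => ω ![]
  | 0, _, _ :: _ => 0
  | _ + 1, _, [] => 0
  | p + 1, ω, x :: l => ofForm p (fun D => ω (Fin.cons x D)) l

/-- The restriction of a cochain to lists of length `p`. -/
def toForm (p : ℕ) : (List L → M) →ₗ[ℂ] ((Fin p → L) → M) where
  toFun W D := W (List.ofFn D)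
  map_add' _ _ := rfl
  map_smul' _ _ := rfl

theorem toForm_apply (p : ℕ) (W : List L → M) (D : Fin p → L) :
    toForm p W D = W (List.ofFn D) := rfl

theorem ofFn_cons {p : ℕ} (x : L) (D : Fin p → L) :
    List.ofFn (Fin.cons x D : Fin (p + 1) → L) = x :: List.ofFn D := by
  simp [List.ofFn_succ]

theorem toForm_ofForm (p : ℕ) (ω : (Fin p → L) → M) : toForm p (ofForm p ω) = ω := by
  induction p with
  | zero =>
    ext D
    simp only [toForm_apply, List.ofFn_zero, ofForm]
    congr 1; exact Subsingleton.elim _ _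
  | succ p ih =>
    ext D
    rw [← Fin.cons_self_tail D, toForm_apply, ofFn_cons]
    exact congrFun (ih fun D' => ω (Fin.cons (D 0) D')) (Fin.tail D)

theorem ofForm_of_length_ne {p : ℕ} {l : List L} (h : l.length ≠ p) (ω : (Fin p → L) → M) :
    ofForm p ω l = 0 := by
  induction p generalizing l with
  | zero =>
    rcases l with _ | ⟨x, l⟩
    · exact absurd rfl h
    · rfl
  | succ p ih =>
    rcases l with _ | ⟨x, l⟩
    · rfl
    · exact ih (by simpa using h) _

theorem ofForm_ofFn {p : ℕ} (ω : (Fin p → L) → M) (D : Fin p → L) :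
    ofForm p ω (List.ofFn D) = ω D := congrFun (toForm_ofForm p ω) D

theorem exists_eq_ofFn {p : ℕ} {l : List L} (h : l.length = p) :
    ∃ D : Fin p → L, l = List.ofFn D := by
  subst h
  exact ⟨l.get, (List.ofFn_get l).symm⟩

theorem ofForm_toForm {p : ℕ} (W : List L → M) (hW : ∀ l, l.length ≠ p → W l = 0) :
    ofForm p (toForm p W) = W := by
  ext l
  by_cases h : l.length = p
  · obtain ⟨D, rfl⟩ := exists_eq_ofFn h
    rw [ofForm_ofFn, toForm_apply]
  · rw [ofForm_of_length_ne h, hW l h]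

theorem ofForm_smul_add (p : ℕ) (c : ℂ) (ω η : (Fin p → L) → M) (l : List L) :
    ofForm p (c • ω + η) l = c • ofForm p ω l + ofForm p η l := by
  by_cases h : l.length = p
  · obtain ⟨D, rfl⟩ := exists_eq_ofFn h
    rw [ofForm_ofFn, ofForm_ofFn, ofForm_ofFn]
    rfl
  · simp [ofForm_of_length_ne h]

theorem ofForm_mem_multilin {p : ℕ} (m : MultilinearMap ℂ (fun _ : Fin p => L) M) :
    ofForm p m ∈ Multilin L M := by
  induction p with
  | zero =>
    intro l₁ l₂ c x y
    simp [ofForm_of_length_ne]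
  | succ p ih =>
    have h : ∀ x, ins x (ofForm (p + 1) m) = ofForm p (m.curryLeft x) := fun x => rfl
    refine mem_multilin_iff.2 ⟨fun c x y => ?_, fun x => h x ▸ ih _⟩
    simp only [h]
    ext l
    rw [map_add, map_smul]
    exact ofForm_smul_add p c _ _ l

/-- A multilinear cochain that vanishes on lists of homogeneous elements vanishes. -/
theorem eq_zero_of_homog {W : List L → M} (hW : W ∈ Multilin L M)
    (h : ∀ l : List L, (∀ x ∈ l, ∃ i, x ∈ homog L i) → W l = 0) (l : List L) : W l = 0 := by
  induction l generalizing W with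
  | nil => exact h [] (by simp)
  | cons x l ih =>
    refine eq_of_homog_head hW (zero_mem _) l (fun i x hx => ?_) x
    refine ih (ins_mem hW x) fun l hl => h _ fun y hy => ?_
    rcases List.mem_cons.1 hy with rfl | hy
    · exact ⟨i, hx⟩
    · exact hl y hy

/-- It suffices to test graded alternation on lists of homogeneous elements. -/
theorem mem_altern_of_homog {W : List L → M} (hW : W ∈ Multilin L M)
    (h : ∀ l₁ l₂ : List L, (∀ x ∈ l₁, ∃ i, x ∈ homog L i) → (∀ x ∈ l₂, ∃ i, x ∈ homog L i) →
      ∀ i, ∀ x ∈ homog L i, ∀ j, ∀ y ∈ homog L j,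
        W (l₁ ++ y :: x :: l₂) = -(sgn (i * j) • W (l₁ ++ x :: y :: l₂))) :
    W ∈ Altern L M := by
  refine ⟨hW, fun l₁ l₂ i x hx y => ?_⟩
  induction l₁ generalizing W with
  | nil =>
    -- The defect of alternation, as a function of `y` and the later arguments, is itself a
    -- multilinear cochain (zero on the empty list), so it vanishes once it vanishes on homogeneous
    -- lists.
    have hV : (fun l : List L => l.casesOn 0 fun y l =>
        W (tw i y :: x :: l) + W (x :: y :: l) : List L → M) ∈ Multilin L M := by
      refine mem_multilin_iff.2 ⟨fun c z w => ?_, fun z l₁ l₂ c u w => ?_⟩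
      · ext l
        have h1 := hW [] (x :: l) c (tw i z) (tw i w)
        have h2 := hW [x] l c z w
        simp only [List.nil_append, List.cons_append] at h1 h2
        simp only [ins_apply, Pi.add_apply, Pi.smul_apply, map_add, map_smul, h1, h2]
        module
      · have h1 := hW (tw i z :: x :: l₁) l₂ c u w
        have h2 := hW (x :: z :: l₁) l₂ c u w
        simp only [List.cons_append] at h1 h2
        simp only [ins_apply, h1, h2]
        module
    refine eq_neg_of_add_eq_zero_left (eq_zero_of_homog hV ?_ (y :: l₂))
    intro l hl
    rcases l with _ | ⟨z, l⟩
    · rfl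
    · obtain ⟨j, hz⟩ := hl z (by simp)
      have h1 := h [] l (by simp) (fun w hw => hl w (by simp [hw])) i x hx j z hz
      have h2 := congrFun (ins_smul hW (sgn (i * j)) z) (x :: l)
      simp only [ins_apply, Pi.smul_apply, List.nil_append] at h1 h2
      change W (tw i z :: x :: l) + W (x :: z :: l) = 0
      rw [tw_of_mem hz, h2, h1, smul_neg, smul_smul, sgn_mul_self]
      module
  | cons z l₁ ih =>
    -- The head is split into homogeneous components, because the induction hypothesis is available
    -- for contractions with homogeneous elements.
    have e1 : ∀ l : List L, W (z :: l) = W (comp 0 z :: l) + W (comp 1 z :: l) := fun l => by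
      have := congrFun (ins_add hW (comp 0 z) (comp 1 z)) l
      rwa [comp_add_comp] at this
    have e2 : ∀ k, W (comp k z :: (l₁ ++ tw i y :: x :: l₂)) =
        -W (comp k z :: (l₁ ++ x :: y :: l₂)) := fun k => by
      refine ih (W := ins (comp k z) W) (ins_mem hW _) fun l₁ l₂ h₁ h₂ => ?_
      refine h (comp k z :: l₁) l₂ (fun w hw => ?_) h₂
      rcases List.mem_cons.1 hw with rfl | hw
      · exact ⟨k, comp_mem k z⟩
      · exact h₁ w hw
    simp only [List.cons_append]
    rw [e1, e1, e2, e2]; abel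

theorem cons_swap_succ {p : ℕ} (x : L) (D : Fin (p + 1) → L) (k : Fin p) :
    (fun r => (Fin.cons x D : Fin (p + 2) → L) (Equiv.swap k.succ.castSucc k.succ.succ r)) =
      Fin.cons x fun r => D (Equiv.swap k.castSucc k.succ r) := by
  funext r
  refine Fin.cases ?_ (fun r => ?_) r
  · rw [Equiv.swap_apply_of_ne_of_ne]
    · rfl
    · exact fun h => absurd (congrArg Fin.val h) (by simp)
    · exact (Fin.succ_ne_zero _).symm
  · have : Equiv.swap k.succ.castSucc k.succ.succ r.succ =
        (Equiv.swap k.castSucc k.succ r).succ := by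
      simp only [Equiv.swap_apply_def, ← Fin.succ_castSucc, Fin.succ_inj]
      split_ifs <;> rfl
    rw [this]; simp

theorem cons_cons_swap_zero {p : ℕ} (x y : L) (D : Fin p → L) :
    (fun r => (Fin.cons x (Fin.cons y D : Fin (p + 1) → L) : Fin (p + 2) → L)
      (Equiv.swap (0 : Fin (p + 1)).castSucc (0 : Fin (p + 1)).succ r)) =
      Fin.cons y (Fin.cons x D : Fin (p + 1) → L) := by
  funext r
  refine Fin.cases ?_ (fun r => Fin.cases ?_ (fun r => ?_) r) r
  · simp
  · simp
  · rw [Equiv.swap_apply_of_ne_of_ne]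
    · rfl
    · exact Fin.succ_ne_zero _
    · exact fun h => absurd (congrArg Fin.val h) (by simp)

/-- A neighbour transposition of the remaining arguments is one of all arguments that fixes the
first. The degree of `x` enters since the alternation of forms is stated on homogeneous arguments.
-/
theorem contract_mem_forms {p : ℕ} {ω : (Fin (p + 1) → L) → M} (hω : ω ∈ Forms L M (p + 1))
    {j : ZMod 2} {x : L} (hx : x ∈ homog L j) :
    (fun D : Fin p → L => ω (Fin.cons x D)) ∈ Forms L M p := by
  obtain ⟨⟨m, rfl⟩, h⟩ := (mem_forms_iff ω).1 hω
  rcases p with _ | p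
  · refine ⟨⟨m.curryLeft x, rfl⟩, fun σ i D _ => ?_⟩
    obtain rfl : σ = 1 := Subsingleton.elim _ _
    simp [commFactor_one]
  · refine (mem_forms_iff _).2 ⟨⟨m.curryLeft x, rfl⟩, fun k i D hD => ?_⟩
    have := h k.succ (Fin.cons j i) (Fin.cons x D) (fun r => Fin.cases hx hD r)
    rw [cons_swap_succ] at this
    rw [this, ← Fin.succ_castSucc]
    simp

/-- By multilinearity homogeneous arguments suffice. Contraction of the arguments in front reduces
to an exchange of the first two, which is transposition number 0 in `mem_forms_iff`. -/
theorem ofForm_mem {p : ℕ} {ω : (Fin p → L) → M} (hω : ω ∈ Forms L M p) :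
    ofForm p ω ∈ Altern L M := by
  have hm : ofForm p ω ∈ Multilin L M := by
    obtain ⟨⟨m, rfl⟩, -⟩ := hω
    exact ofForm_mem_multilin m
  refine mem_altern_of_homog hm fun l₁ l₂ h₁ h₂ i x hx j y hy => ?_
  clear hm
  induction l₁ generalizing p ω with
  | nil =>
    by_cases hp : l₂.length + 2 = p
    · obtain ⟨n, hn⟩ : ∃ n, l₂.length = n := ⟨_, rfl⟩
      obtain ⟨D, rfl⟩ := exists_eq_ofFn hn
      obtain rfl : n + 2 = p := by rw [← hn]; exact hp
      obtain ⟨i', hi'⟩ : ∃ i' : Fin n → ZMod 2, ∀ r, D r ∈ homog L (i' r) := by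
        have : ∀ r, ∃ i, D r ∈ homog L i := fun r => h₂ _ (by simp [List.mem_ofFn])
        exact ⟨fun r => (this r).choose, fun r => (this r).choose_spec⟩
      have := ((mem_forms_iff ω).1 hω).2 0 (Fin.cons i (Fin.cons j i'))
        (Fin.cons x (Fin.cons y D)) (fun r => Fin.cases hx (fun r => Fin.cases hy hi' r) r)
      rw [cons_cons_swap_zero] at this
      have e : ∀ u v : L, [] ++ u :: v :: List.ofFn D =
          List.ofFn (Fin.cons u (Fin.cons v D : Fin (n + 1) → L) : Fin (n + 2) → L) := fun u v => by
        rw [ofFn_cons, ofFn_cons]; rfl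
      rw [e, e, ofForm_ofFn, ofForm_ofFn, this]
      simp
    · rw [ofForm_of_length_ne (by simpa using hp), ofForm_of_length_ne (by simpa using hp)]
      simp
  | cons z l₁ ih =>
    rcases p with _ | p
    · rw [ofForm_of_length_ne (by simp), ofForm_of_length_ne (by simp)]; simp
    · obtain ⟨k, hz⟩ := h₁ z (by simp)
      exact ih (contract_mem_forms hω hz) fun w hw => h₁ w (by simp [hw])

theorem ofFn_update {p : ℕ} (D : Fin p → L) (k : Fin p) (x : L) :
    List.ofFn (Function.update D k x) = (List.ofFn D).take k ++ x :: (List.ofFn D).drop (k + 1) := by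
  have h : List.ofFn (Function.update D k x) = (List.ofFn D).set k x := by
    refine List.ext_get (by simp) fun n h1 h2 => ?_
    simp only [List.get_eq_getElem, List.getElem_ofFn, List.getElem_set, Function.update_apply,
      Fin.ext_iff, eq_comm]
  rw [h, List.set_eq_take_append_cons_drop, if_pos (by simp)]

/-- The multilinear map given by a multilinear cochain. -/
def mkMultilin (p : ℕ) {W : List L → M} (hW : W ∈ Multilin L M) :
    MultilinearMap ℂ (fun _ : Fin p => L) M :=
  MultilinearMap.mk' (fun D => W (List.ofFn D))
    (fun D k x y => by
      have := hW ((List.ofFn D).take k) ((List.ofFn D).drop (k + 1)) 1 x y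
      simpa only [ofFn_update, one_smul] using this)
    (fun D k c x => by
      have h := hW ((List.ofFn D).take k) ((List.ofFn D).drop (k + 1)) c x 0
      have h0 := hW ((List.ofFn D).take k) ((List.ofFn D).drop (k + 1)) (-1) 0 0
      simp only [smul_zero, add_zero, neg_smul, one_smul, neg_add_cancel] at h h0
      simpa only [ofFn_update, h0, add_zero] using h)

/-- Again the arguments in front are contracted away until the transposition concerns the first two.
-/
theorem toForm_mem {W : List L → M} (hW : W ∈ Altern L M) (p : ℕ) :
    toForm p W ∈ Forms L M p := by
  rcases p with _ | p
  · refine ⟨⟨mkMultilin 0 hW.1, rfl⟩, fun σ i D _ => ?_⟩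
    obtain rfl : σ = 1 := Subsingleton.elim _ _
    simp [commFactor_one]
  · refine (mem_forms_iff _).2 ⟨⟨mkMultilin (p + 1) hW.1, rfl⟩, fun k => ?_⟩
    induction p generalizing W with
    | zero => exact k.elim0
    | succ p ih =>
      intro i D hD
      rw [← Fin.cons_self_tail D]
      refine Fin.cases ?_ (fun k => ?_) k
      · rw [← Fin.cons_self_tail (Fin.tail D), cons_cons_swap_zero, toForm_apply, toForm_apply]
        simp only [ofFn_cons]
        have h1 := hW.2 [] (List.ofFn (Fin.tail (Fin.tail D))) (i 0) (D 0) (hD 0) (Fin.tail D 0)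
        have h2 := congrFun (ins_smul hW.1 (sgn (i 0 * i 1)) (Fin.tail D 0))
          (D 0 :: List.ofFn (Fin.tail (Fin.tail D)))
        rw [tw_of_mem (show Fin.tail D 0 ∈ homog L (i 1) from hD 1)] at h1
        simp only [ins_apply, Pi.smul_apply, List.nil_append] at h1 h2
        rw [h2] at h1
        have h3 := congrArg (fun m => sgn (i 0 * i 1) • m) h1
        simp only [smul_smul, sgn_mul_self, one_smul, smul_neg] at h3
        exact h3
      · rw [cons_swap_succ, toForm_apply, toForm_apply, ofFn_cons, ofFn_cons]
        have := ih (ins_mem_altern hW (D 0)) k (Fin.tail i) (Fin.tail D) (fun r => hD r.succ)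
        rw [← Fin.succ_castSucc]
        exact this

end Transfer

/-! ### The exterior derivative of superforms -/

section ExteriorDerivative

variable {L M : Type*} [AddCommGroup L] [Module ℂ L] [SuperSpace L]
  [AddCommGroup M] [Module ℂ M] [SuperSpace M]

/-- The grading involution on cochains. -/
def parCochain : (List L → M) →ₗ[ℂ] (List L → M) where
  toFun W l := par (W (l.map par))
  map_add' _ _ := by ext l; simp
  map_smul' _ _ := by ext l; simp

theorem parCochain_apply (W : List L → M) (l : List L) :
    parCochain W l = par (W (l.map par)) := rfl

theorem parCochain_parCochain (W : List L → M) : parCochain (parCochain W) = W := by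
  ext l
  have h : (par : L → L) ∘ par = id := funext par_par
  simp [parCochain_apply, par_par, h]

theorem ins_parCochain (x : L) (W : List L → M) :
    ins x (parCochain W) = parCochain (ins (par x) W) := rfl

theorem parCochain_mem {W : List L → M} (hW : W ∈ Altern L M) : parCochain W ∈ Altern L M := by
  refine ⟨fun l₁ l₂ c x y => ?_, fun l₁ l₂ i x hx y => ?_⟩
  · have := hW.1 (l₁.map par) (l₂.map par) c (par x) (par y)
    simp [parCochain_apply, this]
  · have e : par (tw i y) = tw i (par y) := by rw [← tw_one, ← tw_one, tw_tw, tw_tw, add_comm]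
    have := hW.2 (l₁.map par) (l₂.map par) i (par x) (by rw [← tw_one]; exact tw_mem hx) (par y)
    simp [parCochain_apply, e, this]

/-- The homogeneous component of degree `k` of a cochain. -/
def compCochain (k : ZMod 2) : (List L → M) →ₗ[ℂ] (List L → M) :=
  (1 / 2 : ℂ) • (LinearMap.id + sgn k • parCochain)

theorem compCochain_mem {W : List L → M} (hW : W ∈ Altern L M) (k : ZMod 2) :
    compCochain k W ∈ Altern L M :=
  Submodule.smul_mem _ _ (add_mem hW (Submodule.smul_mem _ _ (parCochain_mem hW)))

theorem parCochain_compCochain (W : List L → M) (k : ZMod 2) :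
    parCochain (compCochain k W) = sgn k • compCochain k W := by
  have := sgn_mul_self k
  simp only [compCochain, LinearMap.smul_apply, LinearMap.add_apply, LinearMap.id_apply, map_smul,
    map_add, parCochain_parCochain]
  linear_combination (norm := module) (-(1 / 2 : ℂ) * this) • parCochain W

theorem compCochain_add (W : List L → M) : compCochain 0 W + compCochain 1 W = W := by
  simp only [compCochain, LinearMap.smul_apply, LinearMap.add_apply, LinearMap.id_apply, sgn_zero,
    sgn_one]
  module

theorem parForm_toForm (p : ℕ) (W : List L → M) :
    parForm L M p (toForm p W) = toForm p (parCochain W) := by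
  ext D
  simp only [parForm, LinearMap.pi_apply, LinearMap.comp_apply, LinearMap.proj_apply,
    toForm_apply, parCochain_apply, List.map_ofFn]
  rfl

theorem compForm_toForm (p : ℕ) (W : List L → M) (k : ZMod 2) :
    compForm L M p k (toForm p W) = toForm p (compCochain k W) := by
  simp only [compForm, compCochain, LinearMap.smul_apply, LinearMap.add_apply, LinearMap.id_apply,
    parForm_toForm, map_smul, map_add]

theorem tw_eq_of_par {W : List L → M} {k : ZMod 2} (hW : parCochain W = sgn k • W)
    (i : ZMod 2) : tw i (W []) = sgn (i * k) • W [] := by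
  rcases zmod_two_cases i with rfl | rfl
  · simp [tw_zero, sgn_zero]
  · rw [tw_one, one_mul]
    exact congrFun hW []

theorem parCochain_ins {W : List L → M} (hm : W ∈ Multilin L M) {k j : ZMod 2}
    (hW : parCochain W = sgn k • W) {x : L} (hx : x ∈ homog L j) :
    parCochain (ins x W) = sgn (k + j) • ins x W := by
  have h := congrArg (ins x) hW
  rw [ins_parCochain, mem_homog.1 hx, ins_smul hm, map_smul, map_smul] at h
  have h2 := congrArg (fun V => sgn j • V) h
  simp only [smul_smul, sgn_mul_self, one_smul] at h2
  rw [h2, sgn_add, mul_comm]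

theorem Iio_zero (p : ℕ) : Finset.Iio (0 : Fin (p + 1)) = ∅ :=
  Finset.eq_empty_of_forall_notMem fun r hr => Fin.not_lt_zero r (Finset.mem_Iio.1 hr)

theorem sum_Iio_succ {N : Type*} [AddCommMonoid N] {p : ℕ} (l : Fin p) (f : Fin (p + 1) → N) :
    ∑ r ∈ Finset.Iio l.succ, f r = f 0 + ∑ r ∈ Finset.Iio l, f r.succ := by
  have h : ∀ (n : ℕ) (l : Fin n) (f : Fin n → N),
      ∑ r ∈ Finset.Iio l, f r = ∑ r, if r < l then f r else 0 := fun n l f => by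
    rw [← Finset.sum_filter]; congr 1; ext r; simp
  rw [h, h, Fin.sum_univ_succ]
  simp

theorem sum_Ioi_succ {N : Type*} [AddCommMonoid N] {p : ℕ} (l : Fin p) (f : Fin (p + 1) → N) :
    ∑ r ∈ Finset.Ioi l.succ, f r = ∑ r ∈ Finset.Ioi l, f r.succ := by
  have h : ∀ (n : ℕ) (l : Fin n) (f : Fin n → N),
      ∑ r ∈ Finset.Ioi l, f r = ∑ r, if l < r then f r else 0 := fun n l f => by
    rw [← Finset.sum_filter]; congr 1; ext r; simp
  rw [h, h, Fin.sum_univ_succ]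
  simp

theorem sum_Ioi_zero {N : Type*} [AddCommMonoid N] {p : ℕ} (f : Fin (p + 1) → N) :
    ∑ r ∈ Finset.Ioi 0, f r = ∑ r : Fin p, f r.succ := by
  have h : ∀ (n : ℕ) (l : Fin n) (f : Fin n → N),
      ∑ r ∈ Finset.Ioi l, f r = ∑ r, if l < r then f r else 0 := fun n l f => by
    rw [← Finset.sum_filter]; congr 1; ext r; simp
  rw [h, Fin.sum_univ_succ]
  simp

theorem sum_Ioo_succ {N : Type*} [AddCommMonoid N] {p : ℕ} (l l' : Fin p) (f : Fin (p + 1) → N) :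
    ∑ r ∈ Finset.Ioo l.succ l'.succ, f r = ∑ r ∈ Finset.Ioo l l', f r.succ := by
  have h : ∀ (n : ℕ) (l l' : Fin n) (f : Fin n → N),
      ∑ r ∈ Finset.Ioo l l', f r = ∑ r, if l < r ∧ r < l' then f r else 0 := fun n l l' f => by
    rw [← Finset.sum_filter]; congr 1; ext r; simp
  rw [h, h, Fin.sum_univ_succ]
  simp

theorem sum_Ioo_zero_succ {N : Type*} [AddCommMonoid N] {p : ℕ} (l : Fin p) (f : Fin (p + 1) → N) :
    ∑ r ∈ Finset.Ioo 0 l.succ, f r = ∑ r ∈ Finset.Iio l, f r.succ := by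
  have h : ∀ (n : ℕ) (l l' : Fin n) (f : Fin n → N),
      ∑ r ∈ Finset.Ioo l l', f r = ∑ r, if l < r ∧ r < l' then f r else 0 := fun n l l' f => by
    rw [← Finset.sum_filter]; congr 1; ext r; simp
  have h' : ∀ (n : ℕ) (l : Fin n) (f : Fin n → N),
      ∑ r ∈ Finset.Iio l, f r = ∑ r, if r < l then f r else 0 := fun n l f => by
    rw [← Finset.sum_filter]; congr 1; ext r; simp
  rw [h, h', Fin.sum_univ_succ]
  simp

variable {br : L →ₗ[ℂ] L →ₗ[ℂ] L} {act : L →ₗ[ℂ] Module.End ℂ M}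

/-- The Lie derivative of an alternating cochain, with the brackets moved to the front. -/
theorem lie_ofFn (h : IsLieModule br act) {p : ℕ} {W : List L → M} (hW : W ∈ Altern L M)
    {k j : ZMod 2} (hk : parCochain W = sgn k • W) {x : L} (hx : x ∈ homog L j)
    (i : Fin p → ZMod 2) (D : Fin p → L) (hD : ∀ r, D r ∈ homog L (i r)) :
    lie br act j x W (List.ofFn D) = sgn (j * k) • act x (W (List.ofFn D)) +
      ∑ l : Fin p, ((-1) ^ ((l : ℕ) + 1) * sgn (i l * ∑ r ∈ Finset.Iio l, i r)) •
        W (br x (D l) :: (List.ofFn D).eraseIdx l) := by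
  induction p generalizing W k with
  | zero => simp [lie_nil, tw_eq_of_par hk]
  | succ p ih =>
    have hy := hD 0
    rw [Fin.sum_univ_succ]
    simp only [sum_Iio_succ]
    rw [List.ofFn_succ, lie_cons, tw_of_mem hy, ins_smul hW.1, map_smul, Pi.smul_apply,
      ih (ins_mem_altern hW _) (parCochain_ins hW.1 hk hy) (fun r => i r.succ)
        (fun r => D r.succ) (fun r => hD r.succ)]
    -- Alternation moves the bracket in front of `D 0`. The bracket has degree `j + i l.succ`,
    -- whence the sign.
    have e : ∀ l : Fin p, W (br x (D l.succ) :: D 0 :: (List.ofFn fun r => D r.succ).eraseIdx l) =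
        -(sgn ((j + i l.succ) * i 0) •
          W (D 0 :: br x (D l.succ) :: (List.ofFn fun r => D r.succ).eraseIdx l)) := fun l => by
      have h1 := hW.2 [] ((List.ofFn fun r => D r.succ).eraseIdx l) (i 0) _ hy (br x (D l.succ))
      have h2 := h.br_mem hx (hD l.succ)
      have h3 := congrFun (ins_smul hW.1 (sgn (i 0 * (j + i l.succ))) (br x (D l.succ)))
        (D 0 :: (List.ofFn fun r => D r.succ).eraseIdx l)
      rw [tw_of_mem h2] at h1
      simp only [ins_apply, Pi.smul_apply, List.nil_append] at h1 h3
      rw [h3] at h1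
      have h4 := congrArg (fun m => sgn (i 0 * (j + i l.succ)) • m) h1
      simp only [smul_smul, sgn_mul_self, one_smul, smul_neg] at h4
      rw [h4, mul_comm]
    simp only [Fin.val_zero, Fin.val_succ, List.eraseIdx_cons_zero, List.eraseIdx_cons_succ, e,
      ins_apply, smul_add, Finset.smul_sum, smul_smul]
    have hs := sgn_mul_self (j * i 0)
    have e1 : sgn (j * i 0) * sgn (j * (k + i 0)) = sgn (j * k) := by
      rw [mul_add, sgn_add, mul_comm (sgn (j * k)), ← mul_assoc, hs, one_mul]
    have e2 : ∀ l : Fin p, (((-1 : ℂ) ^ ((l : ℕ) + 1 + 1) *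
        sgn (i l.succ * (i 0 + ∑ r ∈ Finset.Iio l, i r.succ))) •
        -(sgn ((j + i l.succ) * i 0) •
          W (D 0 :: br x (D l.succ) :: (List.ofFn fun r => D r.succ).eraseIdx l))) =
        (sgn (j * i 0) * ((-1 : ℂ) ^ ((l : ℕ) + 1) *
          sgn (i l.succ * ∑ r ∈ Finset.Iio l, i r.succ))) •
          W (D 0 :: br x (D l.succ) :: (List.ofFn fun r => D r.succ).eraseIdx l) := fun l => by
      rw [smul_neg, smul_smul, ← neg_smul]
      congr 1
      rw [mul_add, add_mul, sgn_add, sgn_add, pow_succ _ ((l : ℕ) + 1)]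
      linear_combination ((-1 : ℂ) ^ ((l : ℕ) + 1) * sgn (i l.succ * ∑ r ∈ Finset.Iio l, i r.succ) *
        sgn (j * i 0)) * sgn_mul_self (i l.succ * i 0)
    simp only [e2, e1]
    simp only [zero_add, pow_one, Iio_zero, Finset.sum_empty, mul_zero, sgn_zero, mul_one, neg_smul, one_smul]
    abel

theorem ofFn_eraseIdx {p : ℕ} (D : Fin (p + 1) → L) (l : Fin (p + 1)) :
    (List.ofFn D).eraseIdx l = List.ofFn (l.removeNth D) := by
  induction p with
  | zero =>
    obtain rfl : l = 0 := Fin.fin_one_eq_zero l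
    simp [List.ofFn_succ]
  | succ p ih =>
    refine Fin.cases ?_ (fun l => ?_) l
    · rw [List.ofFn_succ]; simp only [Fin.val_zero, List.eraseIdx_cons_zero, Fin.removeNth_zero]; rfl
    · rw [List.ofFn_succ, Fin.val_succ, List.eraseIdx_cons_succ, ih, List.ofFn_succ (f := l.succ.removeNth D)]
      congr 2
      funext r
      simp [Fin.removeNth]

theorem removeNth_succ_cons {p : ℕ} (x : L) (D : Fin (p + 1) → L) (l : Fin (p + 1)) :
    l.succ.removeNth (Fin.cons x D : Fin (p + 2) → L) = Fin.cons x (l.removeNth D) :=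
  funext fun r => Fin.cases rfl (fun r => by simp [Fin.removeNth]) r

/-- The terms in which the first argument acts or enters a bracket are split off. The others form
the same expression for `ins x W`: all positions shift by one, which gives the minus sign, and the
degree of the form grows by that of `x`. This is the recursion that defines `diff`. -/
theorem dHom_cons {p : ℕ} (W : List L → M) (k : ZMod 2)
    (i : Fin (p + 2) → ZMod 2) (x : L) (D : Fin (p + 1) → L) :
    dHom br act k i (Fin.cons x D) (toForm (p + 1) W) =
      sgn (i 0 * k) • act x (W (List.ofFn D)) +
      ∑ l : Fin (p + 1), ((-1) ^ ((l : ℕ) + 1) * sgn (i l.succ * ∑ r ∈ Finset.Iio l, i r.succ)) •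
        W (br x (D l) :: (List.ofFn D).eraseIdx l) -
      dHom br act (k + i 0) (fun r => i r.succ) D (toForm p (ins x W)) := by
  have h1 : ∀ l : Fin (p + 1), toForm (p + 1) W (l.succ.removeNth (Fin.cons x D : Fin (p + 2) → L)) =
      toForm p (ins x W) (l.removeNth D) := fun l => by
    rw [removeNth_succ_cons, toForm_apply, ofFn_cons]; rfl
  have h2 : ∀ (l l' : Fin (p + 1)) (y : L), toForm (p + 1) W (l'.succ.removeNth
      (Function.update (Fin.cons x D : Fin (p + 2) → L) l.succ y)) =
      toForm p (ins x W) (l'.removeNth (Function.update D l y)) := fun l l' y => by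
    rw [← Fin.cons_update, removeNth_succ_cons, toForm_apply, ofFn_cons]; rfl
  have h3 : ∀ (l' : Fin (p + 1)) (y : L), toForm (p + 1) W (l'.succ.removeNth
      (Function.update (Fin.cons x D : Fin (p + 2) → L) 0 y)) =
      W (y :: (List.ofFn D).eraseIdx l') := fun l' y => by
    rw [Fin.update_cons_zero, removeNth_succ_cons, toForm_apply, ofFn_cons, ofFn_eraseIdx]
  simp only [dHom, LinearMap.add_apply, LinearMap.sum_apply, LinearMap.smul_apply,
    LinearMap.comp_apply, LinearMap.proj_apply]
  rw [Fin.sum_univ_succ (n := p + 1), Fin.sum_univ_succ (n := p + 1)]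
  simp only [sum_Iio_succ, sum_Ioi_succ, sum_Ioi_zero, sum_Ioo_succ, sum_Ioo_zero_succ, Iio_zero,
    Finset.sum_empty, Fin.cons_zero, Fin.cons_succ, h1, h2, h3, Fin.removeNth_zero, Fin.tail_cons,
    Fin.val_zero, Fin.val_succ, pow_zero, one_mul, add_zero]
  simp only [toForm_apply, pow_succ, mul_neg, mul_one, neg_mul, neg_smul, Finset.sum_neg_distrib,
    ← add_assoc]
  abel

/-- Both sides obey the same recursion in the first argument: `dHom_cons` for the explicit formula,
Cartan's formula with `lie_ofFn` for `diff`. -/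
theorem dHom_eq_diff (h : IsLieModule br act) {p : ℕ} {W : List L → M} (hW : W ∈ Altern L M)
    {k : ZMod 2} (hk : parCochain W = sgn k • W) (i : Fin (p + 1) → ZMod 2)
    (D : Fin (p + 1) → L) (hD : ∀ r, D r ∈ homog L (i r)) :
    dHom br act k i D (toForm p W) = diff br act W (List.ofFn D) := by
  induction p generalizing W k with
  | zero =>
    have e4 : Finset.Ioi (0 : Fin 1) = ∅ := by decide
    have := congrFun (ins_diff br act hW.1 (hD 0)) []
    rw [ins_apply, Pi.sub_apply, diff_nil, lie_nil, tw_eq_of_par hk] at this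
    simp only [dHom, LinearMap.add_apply, LinearMap.sum_apply, LinearMap.smul_apply,
      LinearMap.comp_apply, LinearMap.proj_apply, toForm_apply, List.ofFn_succ, List.ofFn_zero,
      Nat.zero_add]
    rw [Fin.sum_univ_one, Fin.sum_univ_one, e4, Iio_zero]
    simpa using this.symm
  | succ p ih =>
    rw [← Fin.cons_self_tail D, dHom_cons, ih (ins_mem_altern hW _)
      (parCochain_ins hW.1 hk (hD 0)) _ (Fin.tail D) (fun r => hD r.succ), ofFn_cons]
    have := congrFun (ins_diff br act hW.1 (hD 0)) (List.ofFn (Fin.tail D))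
    rw [ins_apply, Pi.sub_apply, lie_ofFn h hW hk (hD 0) (fun r => i r.succ) (Fin.tail D)
      (fun r => hD r.succ)] at this
    exact this.symm

theorem sum_homog {p : ℕ} {W : List L → M} (hW : W ∈ Multilin L M) (D : Fin p → L) :
    W (List.ofFn D) = ∑ i : Fin p → ZMod 2, W (List.ofFn fun r => comp (i r) (D r)) := by
  have := (mkMultilin p hW).map_sum (fun r (i : ZMod 2) => comp i (D r))
  simp only [sum_zmod_two, comp_add_comp] at this
  exact this

/-- The exterior derivative of superforms in terms of cochains. -/
theorem extD_toForm (h : IsLieModule br act) (p : ℕ) {W : List L → M} (hW : W ∈ Altern L M) :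
    extD br act p (toForm p W) = toForm (p + 1) (diff br act W) := by
  ext D
  have e : ∀ k, ∑ i : Fin (p + 1) → ZMod 2, dHom br act k i (fun l => comp (i l) (D l))
      (compForm L M p k (toForm p W)) = diff br act (compCochain k W) (List.ofFn D) := fun k => by
    rw [sum_homog (diff_mem br act (compCochain_mem hW k).1)]
    refine Finset.sum_congr rfl fun i _ => ?_
    rw [compForm_toForm, dHom_eq_diff h (compCochain_mem hW k) (parCochain_compCochain W k) i _
      (fun r => comp_mem _ _)]
  simp only [extD, LinearMap.pi_apply, LinearMap.sum_apply, LinearMap.comp_apply]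
  rw [Finset.sum_congr rfl fun k _ => e k, sum_zmod_two, ← Pi.add_apply, ← map_add,
    compCochain_add, toForm_apply]

/-- `extD_toForm` settles lists of length p + 1. It remains to see that `diff` raises the degree by
exactly one, so that both sides vanish on all other lists. -/
theorem extD_ofForm (h : IsLieModule br act) {p : ℕ} {ω : (Fin p → L) → M}
    (hω : ω ∈ Forms L M p) : ofForm (p + 1) (extD br act p ω) = diff br act (ofForm p ω) := by
  conv_lhs => rw [← toForm_ofForm p ω, extD_toForm h p (ofForm_mem hω)]
  refine ofForm_toForm _ fun l hl => ?_
  have key : ∀ (l : List L) (W : List L → M) (p : ℕ), (∀ l, l.length ≠ p → W l = 0) →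
      ∀ i x, l.length ≠ p → lie br act i x W l = 0 := by
    intro l
    induction l with
    | nil => intro W p hW i x hl; simp [lie_nil, hW [] hl]
    | cons y l ih =>
      intro W p hW i x hl
      rcases p with _ | p
      · have : ins (tw i y) W = 0 := funext fun l => hW _ (by simp)
        simp [lie_cons, this, hW (br x y :: l) (by simp)]
      · rw [lie_cons, ih (ins (tw i y) W) p (fun l hl => hW _ (by simpa using hl)) i x
          (by simpa using hl), hW _ (by simpa using hl), sub_zero]
  have key2 : ∀ (l : List L) (W : List L → M) (p : ℕ), (∀ l, l.length ≠ p → W l = 0) →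
      l.length ≠ p + 1 → diff br act W l = 0 := by
    intro l
    induction l with
    | nil => intro W p hW hl; rfl
    | cons y l ih =>
      intro W p hW hl
      have hl' : l.length ≠ p := by simpa using hl
      rw [diff_cons, key l W p hW _ _ hl', key l W p hW _ _ hl']
      rcases p with _ | p
      · have : ins y W = 0 := funext fun l => hW _ (by simp)
        simp [this]
      · rw [ih (ins y W) p (fun l hl => hW _ (by simpa using hl)) (by simpa using hl)]
        simp
  exact key2 l _ p (fun l hl => ofForm_of_length_ne hl ω) hl

end ExteriorDerivative

/-! ### Naturality of superforms and of the exterior derivative. -/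

section Functoriality

variable {L M L' M' : Type*} [AddCommGroup L] [Module ℂ L] [SuperSpace L]
  [AddCommGroup M] [Module ℂ M] [SuperSpace M] [AddCommGroup L'] [Module ℂ L'] [SuperSpace L']
  [AddCommGroup M'] [Module ℂ M'] [SuperSpace M']

/-- The map on forms induced by linear maps of the arguments and of the values. -/
def mapForm (j : L' →ₗ[ℂ] L) (m : M →ₗ[ℂ] M') (p : ℕ) :
    ((Fin p → L) → M) →ₗ[ℂ] ((Fin p → L') → M') where
  toFun ω D := m (ω fun r => j (D r))
  map_add' _ _ := by ext D; simp
  map_smul' _ _ := by ext D; simp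

theorem mapForm_apply (j : L' →ₗ[ℂ] L) (m : M →ₗ[ℂ] M') (p : ℕ) (ω : (Fin p → L) → M)
    (D : Fin p → L') : mapForm j m p ω D = m (ω fun r => j (D r)) := rfl

variable {j : L' →ₗ[ℂ] L} {m : M →ₗ[ℂ] M'}

theorem map_comp (hj : ∀ x, j (par x) = par (j x)) (i : ZMod 2) (x : L') :
    j (comp i x) = comp i (j x) := by
  simp [comp, hj]

theorem mapForm_mem (hj : ∀ x, j (par x) = par (j x)) {p : ℕ} {ω : (Fin p → L) → M}
    (hω : ω ∈ Forms L M p) : mapForm j m p ω ∈ Forms L' M' p := by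
  obtain ⟨⟨μ, rfl⟩, h⟩ := hω
  refine ⟨⟨m.compMultilinearMap (μ.compLinearMap fun _ => j), rfl⟩, fun σ i D hD => ?_⟩
  have := h σ i (fun r => j (D r)) fun r => by
    rw [mem_homog, ← hj, mem_homog.1 (hD r), map_smul]
  simp only [mapForm_apply]
  rw [← map_smul, this, map_smul]

/-- Every term of `dHom` is natural in the algebra and in the coefficients. This serves both for the
transport along isomorphisms and for the body map on forms. -/
theorem extD_mapForm {br : L →ₗ[ℂ] L →ₗ[ℂ] L} {act : L →ₗ[ℂ] Module.End ℂ M}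
    {br' : L' →ₗ[ℂ] L' →ₗ[ℂ] L'} {act' : L' →ₗ[ℂ] Module.End ℂ M'}
    (hj : ∀ x, j (par x) = par (j x)) (hm : ∀ x, m (par x) = par (m x))
    (hbr : ∀ x y, j (br' x y) = br (j x) (j y)) (hact : ∀ x f, m (act (j x) f) = act' x (m f))
    (p : ℕ) (ω : (Fin p → L) → M) :
    extD br' act' p (mapForm j m p ω) = mapForm j m (p + 1) (extD br act p ω) := by
  have hc : ∀ k, compForm L' M' p k (mapForm j m p ω) = mapForm j m p (compForm L M p k ω) := by
    intro k
    ext D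
    simp only [compForm, parForm, LinearMap.smul_apply, LinearMap.add_apply, LinearMap.id_apply,
      Pi.smul_apply, Pi.add_apply, LinearMap.pi_apply, LinearMap.comp_apply, LinearMap.proj_apply,
      mapForm_apply, map_smul, map_add, hm, hj]
  ext D
  simp only [extD, LinearMap.pi_apply, LinearMap.sum_apply, LinearMap.comp_apply, mapForm_apply,
    map_sum, hc]
  refine Finset.sum_congr rfl fun k _ => Finset.sum_congr rfl fun i _ => ?_
  simp only [dHom, LinearMap.add_apply, LinearMap.sum_apply, LinearMap.smul_apply,
    LinearMap.comp_apply, LinearMap.proj_apply, map_add, map_sum, map_smul, mapForm_apply, ← hact,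
    map_comp hj]
  have e1 : ∀ l : Fin (p + 1), (fun r => j (l.removeNth (fun l => comp (i l) (D l)) r)) =
      l.removeNth fun l => comp (i l) (j (D l)) := fun l => funext fun r => map_comp hj _ _
  have e2 : ∀ l l' : Fin (p + 1), (fun r => j (l'.removeNth (Function.update
      (fun l => comp (i l) (D l)) l (br' (comp (i l) (D l)) (comp (i l') (D l')))) r)) =
      l'.removeNth (Function.update (fun l => comp (i l) (j (D l))) l
        (br (comp (i l) (j (D l))) (comp (i l') (j (D l'))))) := fun l l' => by
    funext r
    simp only [Fin.removeNth, Function.update_apply]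
    split_ifs
    · rw [hbr, map_comp hj, map_comp hj]
    · exact map_comp hj _ _
  simp only [e1, e2]

end Functoriality

/-! ### Casimir homotopies -/

section Casimir

variable {L M : Type*} [AddCommGroup L] [Module ℂ L] [SuperSpace L]
  [AddCommGroup M] [Module ℂ M] [SuperSpace M]

/-- Post-composition of cochains with a linear map of the values. -/
def postcomp {M' : Type*} [AddCommGroup M'] [Module ℂ M'] (m : M →ₗ[ℂ] M') :
    (List L → M) →ₗ[ℂ] (List L → M') where
  toFun ω l := m (ω l)
  map_add' _ _ := by ext l; simp
  map_smul' _ _ := by ext l; simp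

theorem postcomp_apply {M' : Type*} [AddCommGroup M'] [Module ℂ M'] (m : M →ₗ[ℂ] M')
    (ω : List L → M) (l : List L) : postcomp m ω l = m (ω l) := rfl

theorem postcomp_mem {M' : Type*} [AddCommGroup M'] [Module ℂ M'] [SuperSpace M'] (m : M →ₗ[ℂ] M')
    {ω : List L → M} (hω : ω ∈ Altern L M) : postcomp m ω ∈ Altern L M' :=
  ⟨fun l₁ l₂ c x y => by simp [postcomp_apply, hω.1 l₁ l₂ c x y],
    fun l₁ l₂ i x hx y => by simp [postcomp_apply, hω.2 l₁ l₂ i x hx y]⟩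

variable (br : L →ₗ[ℂ] L →ₗ[ℂ] L) (act : L →ₗ[ℂ] Module.End ℂ M)

theorem lie_postcomp {M' : Type*} [AddCommGroup M'] [Module ℂ M'] [SuperSpace M']
    {act' : L →ₗ[ℂ] Module.End ℂ M'} {m : M →ₗ[ℂ] M'} (hm : ∀ x, m (par x) = par (m x))
    (hact : ∀ x f, m (act x f) = act' x (m f)) (i : ZMod 2) (x : L) (ω : List L → M) :
    lie br act' i x (postcomp m ω) = postcomp m (lie br act i x ω) := by
  have htw : ∀ f, m (tw i f) = tw i (m f) := fun f => by
    rcases zmod_two_cases i with rfl | rfl <;> simp [tw_zero, tw_one, hm]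
  ext l
  induction l generalizing ω with
  | nil => simp [lie_nil, postcomp_apply, hact, htw]
  | cons y l ih =>
    have := ih (ins (tw i y) ω)
    simp only [lie_cons, postcomp_apply, map_sub] at this ⊢
    rw [← this]; rfl

theorem diff_postcomp {M' : Type*} [AddCommGroup M'] [Module ℂ M'] [SuperSpace M']
    {act' : L →ₗ[ℂ] Module.End ℂ M'} {m : M →ₗ[ℂ] M'} (hm : ∀ x, m (par x) = par (m x))
    (hact : ∀ x f, m (act x f) = act' x (m f)) (ω : List L → M) :
    diff br act' (postcomp m ω) = postcomp m (diff br act ω) := by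
  ext l
  induction l generalizing ω with
  | nil => simp [diff_nil, postcomp_apply]
  | cons y l ih =>
    have := ih (ins y ω)
    simp only [diff_cons, postcomp_apply, map_sub, map_add, lie_postcomp br act hm hact] at this ⊢
    rw [← this]; rfl

/-- The action of an element `x` of degree `i` on the values of a cochain. -/
def valueAct (i : ZMod 2) (x : L) : (List L → M) →ₗ[ℂ] (List L → M) where
  toFun ω l := act x (tw i (ω (l.map (tw i))))
  map_add' _ _ := by ext l; simp
  map_smul' _ _ := by ext l; simp

theorem valueAct_nil (i : ZMod 2) (x : L) (ω : List L → M) :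
    valueAct act i x ω [] = act x (tw i (ω [])) := rfl

theorem ins_valueAct (i : ZMod 2) (x y : L) (ω : List L → M) :
    ins y (valueAct act i x ω) = valueAct act i x (ins (tw i y) ω) := rfl

theorem valueAct_cons (i : ZMod 2) (x y : L) (l : List L) (ω : List L → M) :
    valueAct act i x ω (y :: l) = valueAct act i x (ins (tw i y) ω) l := rfl

theorem valueAct_smul_add_left (i : ZMod 2) (c : ℂ) (x y : L) (ω : List L → M) :
    valueAct act i (c • x + y) ω = c • valueAct act i x ω + valueAct act i y ω := by
  ext l; simp [valueAct]

theorem valueAct_zero_left (i : ZMod 2) (ω : List L → M) : valueAct act i 0 ω = 0 := by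
  ext l; simp [valueAct]

theorem valueAct_mem {ω : List L → M} (hω : ω ∈ Altern L M) (i : ZMod 2) (x : L) :
    valueAct act i x ω ∈ Altern L M := by
  refine ⟨fun l₁ l₂ c y z => ?_, fun l₁ l₂ j y hy z => ?_⟩
  · have := hω.1 (l₁.map (tw i)) (l₂.map (tw i)) c (tw i y) (tw i z)
    simp [valueAct, this]
  · have e : tw i (tw j z) = tw j (tw i z) := by rw [tw_tw, tw_tw, add_comm]
    simp [valueAct, e, hω.2 _ _ j (tw i y) (tw_mem hy)]

variable {br act}

/-- On the empty list this is the module axiom `act_br`; contraction carries it to longer lists,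
because `valueAct` passes a twisted argument on just as `lie` does. -/
theorem lie_valueAct (h : IsLieModule br act) {ω : List L → M} (hω : ω ∈ Multilin L M)
    {i j : ZMod 2} {x y : L} (hx : x ∈ homog L i) (hy : y ∈ homog L j) :
    lie br act j y (valueAct act i x ω) = sgn (j * i) • valueAct act i x (lie br act j y ω) +
      sgn (j * i) • valueAct act (j + i) (br y x) ω := by
  have hs := sgn_mul_self (j * i)
  ext l
  induction l generalizing ω with
  | nil =>
    simp only [lie_nil, valueAct_nil, Pi.add_apply, Pi.smul_apply, h.tw_act, tw_tw,
      h.act_br j y hy, tw_of_mem hy, tw_of_mem hx, map_smul, LinearMap.smul_apply, mul_comm i j,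
      add_comm i j]
    module
  | cons z l ih =>
    have e2 : tw i (br y z) = sgn (j * i) • br y (tw i z) := by
      rw [h.tw_br, tw_of_mem hy, map_smul, LinearMap.smul_apply, mul_comm i j]
    simp only [Pi.add_apply, Pi.smul_apply, lie_cons, valueAct_cons, ins_valueAct, ins_lie, map_sub,
      Pi.sub_apply, e2, ins_smul hω, map_smul, tw_tw, ih (ins_mem hω _), add_comm i j, smul_sub]
    abel

/-- A graded-invariant tensor `∑ e'_a ⊗ e_a` (up to the sign convention for odd terms). -/
structure IsInvariantTensor (br : L →ₗ[ℂ] L →ₗ[ℂ] L) {α : Type} [Fintype α] (dg : α → ZMod 2)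
    (e' e : α → L) : Prop where
  left_mem : ∀ a, e' a ∈ homog L (dg a)
  right_mem : ∀ a, e a ∈ homog L (dg a)
  invariant : ∀ (j : ZMod 2), ∀ y ∈ homog L j, ∀ β : L →ₗ[ℂ] L →ₗ[ℂ] ℂ,
    ∑ a, (β (e' a) (br y (e a)) + sgn (j * dg a) * β (br y (e' a)) (e a)) = 0

variable {α : Type} [Fintype α] {dg : α → ZMod 2} {e' e : α → L}

/-- The Casimir operator of an invariant tensor. -/
def casimir (act : L →ₗ[ℂ] Module.End ℂ M) (dg : α → ZMod 2) (e' e : α → L) : Module.End ℂ M :=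
  ∑ a, sgn (dg a) • (act (e' a) * act (e a))

/-- The homotopy that contracts the Casimir operator. -/
def casimirHomotopy (act : L →ₗ[ℂ] Module.End ℂ M) (dg : α → ZMod 2) (e' e : α → L) :
    (List L → M) →ₗ[ℂ] (List L → M) :=
  ∑ a, valueAct act (dg a) (e' a) ∘ₗ ins (e a)

theorem casimirHomotopy_apply (ω : List L → M) : casimirHomotopy act dg e' e ω =
    ∑ a, valueAct act (dg a) (e' a) (ins (e a) ω) := by
  simp [casimirHomotopy]

theorem casimirHomotopy_mem {ω : List L → M} (hω : ω ∈ Altern L M) :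
    casimirHomotopy act dg e' e ω ∈ Altern L M := by
  rw [casimirHomotopy_apply]
  exact Submodule.sum_mem _ fun a _ => valueAct_mem act (ins_mem_altern hω _) _ _

/-- The twist in `valueAct` cancels the sign in the graded anticommutation of `ins y` with `ins (e
a)`, so a plain minus remains. -/
theorem ins_casimirHomotopy (ht : IsInvariantTensor br dg e' e) {ω : List L → M}
    (hω : ω ∈ Altern L M) (y : L) :
    ins y (casimirHomotopy act dg e' e ω) = -casimirHomotopy act dg e' e (ins y ω) := by
  rw [casimirHomotopy_apply, casimirHomotopy_apply, map_sum, ← Finset.sum_neg_distrib]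
  refine Finset.sum_congr rfl fun a _ => ?_
  have := ins_ins hω (ht.right_mem a) (tw (dg a) y)
  rw [tw_self] at this
  rw [ins_valueAct, this, map_neg, neg_neg]

/-- Linear functionals separate the points of `N`, so scalar-valued forms are enough for testing
invariance. Below, `N` is a space of cochains or of operators. -/
theorem IsInvariantTensor.invariant_apply {N : Type*} [AddCommGroup N] [Module ℂ N]
    (ht : IsInvariantTensor br dg e' e) {j : ZMod 2} {y : L} (hy : y ∈ homog L j)
    (β : L →ₗ[ℂ] L →ₗ[ℂ] N) :
    ∑ a, (β (e' a) (br y (e a)) + sgn (j * dg a) • β (br y (e' a)) (e a)) = 0 := by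
  refine (Module.forall_dual_apply_eq_zero_iff ℂ _).1 fun f => ?_
  have := ht.invariant j y hy (β.compr₂ f)
  simpa only [map_sum, map_add, map_smul, LinearMap.compr₂_apply, smul_eq_mul] using this

/-- The Lie derivative produces brackets with both legs of the tensor, and their sum is the
expression that vanishes by invariance. -/
theorem lie_casimirHomotopy (h : IsLieModule br act) (ht : IsInvariantTensor br dg e' e)
    {ω : List L → M} (hω : ω ∈ Altern L M) {j : ZMod 2} {y : L} (hy : y ∈ homog L j) :
    lie br act j y (casimirHomotopy act dg e' e ω) =
      casimirHomotopy act dg e' e (lie br act j y ω) := by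
  have key : ∑ a, (valueAct act (dg a) (e' a) (ins (br y (e a)) ω) +
      sgn (j * dg a) • valueAct act (j + dg a) (br y (e' a)) (ins (e a) ω)) = 0 := by
    -- `valueAct` needs a degree, so its element is split into components; the result is bilinear
    -- and the invariance of the tensor applies to it.
    let β : L →ₗ[ℂ] L →ₗ[ℂ] (List L → M) := LinearMap.mk₂ ℂ
      (fun x z => valueAct act 0 (comp 0 x) (ins z ω) + valueAct act 1 (comp 1 x) (ins z ω))
      (fun x x' z => by
        have := fun i => valueAct_smul_add_left act i 1 (comp i x) (comp i x') (ins z ω)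
        simp only [one_smul] at this
        simp only [map_add, this]; abel)
      (fun c x z => by
        have := fun i => valueAct_smul_add_left act i c (comp i x) 0 (ins z ω)
        simp only [add_zero, valueAct_zero_left] at this
        simp only [map_smul, this, smul_add])
      (fun x z z' => by simp only [ins_add hω.1, map_add]; abel)
      (fun c x z => by simp only [ins_smul hω.1, map_smul, smul_add])
    have hβ : ∀ i x z, x ∈ homog L i → β x z = valueAct act i x (ins z ω) := by
      intro i x z hx
      simp only [β, LinearMap.mk₂_apply, comp_of_mem hx]
      rcases zmod_two_cases i with rfl | rfl <;> simp [valueAct_zero_left]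
    rw [← ht.invariant_apply hy β]
    refine Finset.sum_congr rfl fun a _ => ?_
    rw [hβ _ _ _ (ht.left_mem a), hβ _ _ _ (h.br_mem hy (ht.left_mem a))]
  rw [casimirHomotopy_apply, casimirHomotopy_apply, map_sum, ← sub_eq_zero,
    ← Finset.sum_sub_distrib, ← key]
  refine Finset.sum_congr rfl fun a _ => ?_
  have hs := sgn_mul_self (j * dg a)
  have e1 : lie br act j y (ins (e a) ω) = sgn (j * dg a) • (ins (e a) (lie br act j y ω) +
      ins (br y (e a)) ω) := by
    rw [ins_lie, sub_add_cancel, tw_of_mem (ht.right_mem a), ins_smul hω.1, map_smul, smul_smul,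
      hs, one_smul]
  rw [lie_valueAct h (ins_mem hω.1 _) (ht.left_mem a) hy, e1, map_smul, map_add, smul_smul, hs]
  module

/-- The Casimir operator on the values is homotopic to zero. -/
theorem diff_casimirHomotopy (h : IsLieModule br act) (ht : IsInvariantTensor br dg e' e)
    {ω : List L → M} (hω : ω ∈ Altern L M) :
    diff br act (casimirHomotopy act dg e' e ω) + casimirHomotopy act dg e' e (diff br act ω) =
      postcomp (casimir act dg e' e) ω := by
  -- Since h anticommutes with ι_y and commutes with L_y, Cartan's formula shows that dh + hd
  -- commutes with ι_y for homogeneous `y`. So only the empty list has to be computed; there the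
  -- twist inside `valueAct` produces the factor `sgn (dg a)` of the Casimir operator.
  ext l
  induction l generalizing ω with
  | nil =>
    rw [Pi.add_apply, diff_nil, zero_add, casimirHomotopy_apply, Finset.sum_apply, postcomp_apply,
      casimir, LinearMap.sum_apply]
    refine Finset.sum_congr rfl fun a _ => ?_
    have hdd : dg a + dg a = 0 := CharTwo.add_self_eq_zero _
    have hdm : dg a * dg a = dg a := by rcases zmod_two_cases (dg a) with h | h <;> rw [h] <;> rfl
    rw [ins_diff br act hω.1 (ht.right_mem a), map_sub, Pi.sub_apply, valueAct_nil, valueAct_nil,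
      lie_nil, diff_nil, h.tw_act, tw_tw, hdd, tw_zero, tw_of_mem (ht.right_mem a), hdm]
    simp
  | cons y l ih =>
    refine eq_of_homog_head (add_mem (diff_mem br act (casimirHomotopy_mem hω).1)
      (casimirHomotopy_mem (diff_mem_altern h hω)).1) (postcomp_mem _ hω).1 l (fun j y hy => ?_) y
    have e1 := congrFun (ins_diff br act (casimirHomotopy_mem (act := act) (dg := dg) (e' := e')
      (e := e) hω).1 hy) l
    have e2 := congrFun (ins_casimirHomotopy (act := act) ht (diff_mem_altern h hω) y) l
    have e3 := ih (ins_mem_altern hω y)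
    rw [ins_casimirHomotopy ht hω, lie_casimirHomotopy h ht hω hy, map_neg] at e1
    rw [ins_diff br act hω.1 hy, map_sub] at e2
    simp only [ins_apply, Pi.sub_apply, Pi.neg_apply, Pi.add_apply] at e1 e2 e3
    rw [Pi.add_apply, e1, e2]
    refine Eq.trans ?_ e3
    abel

/-- On closed cochains, an equivariant operator of the form `Ω G`, where `Ω` is the Casimir
operator, is homotopic to zero. -/
theorem casimir_comp_exact (h : IsLieModule br act) (ht : IsInvariantTensor br dg e' e)
    {G : Module.End ℂ M} (hG : ∀ x, G (par x) = par (G x))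
    (hact : ∀ x f, G (act x f) = act x (G f)) {ω : List L → M} (hω : ω ∈ Altern L M)
    (hd : diff br act ω = 0) :
    postcomp (casimir act dg e' e * G) ω =
      diff br act (casimirHomotopy act dg e' e (postcomp G ω)) := by
  have := diff_casimirHomotopy h ht (postcomp_mem G hω)
  rw [diff_postcomp br act hG hact, hd, map_zero, map_zero, add_zero] at this
  rw [this]; rfl

end Casimir

/-! ### Primitive vectors -/

section Primitive

variable {V : Type*} [AddCommGroup V] [Module ℂ V] {E F H : Module.End ℂ V}

/-- Over `sl(2)`, `J₃` acts on `J₋ᵏ v` by the weight of `v` minus `k`. -/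
theorem weight_pow (hHF : H * F = F * H - F) {v : V} {c : ℂ} (hv : H v = c • v) (k : ℕ) :
    H ((F ^ k) v) = (c - k) • (F ^ k) v := by
  induction k with
  | zero => simp [hv]
  | succ k ih =>
    have := congrArg (fun X : Module.End ℂ V => X ((F ^ k) v)) hHF
    simp only [Module.End.mul_apply, LinearMap.sub_apply, ih, map_smul] at this
    rw [pow_succ', Module.End.mul_apply, this]
    push_cast; module

theorem raise_pow_succ (hEF : E * F = F * E + (2 : ℂ) • H) (hHF : H * F = F * H - F) {v : V}
    {c : ℂ} (hE : E v = 0) (hv : H v = c • v) (k : ℕ) :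
    E ((F ^ (k + 1)) v) = (((k : ℂ) + 1) * (2 * c - k)) • (F ^ k) v := by
  induction k with
  | zero =>
    have := congrArg (fun X : Module.End ℂ V => X v) hEF
    simp only [Module.End.mul_apply, LinearMap.add_apply, LinearMap.smul_apply, hE, hv,
      map_zero] at this
    simp [this]; module
  | succ k ih =>
    have := congrArg (fun X : Module.End ℂ V => X ((F ^ (k + 1)) v)) hEF
    simp only [Module.End.mul_apply, LinearMap.add_apply, LinearMap.smul_apply, ih,
      weight_pow hHF hv, map_smul] at this
    rw [pow_succ' F (k + 1), Module.End.mul_apply, this]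
    rw [← Module.End.mul_apply, ← pow_succ']
    push_cast; module

/-- For `k = 0` the truncated exponent `k - 1` does no harm, because the coefficient vanishes. -/
theorem raise_pow (hEF : E * F = F * E + (2 : ℂ) • H) (hHF : H * F = F * H - F) {v : V}
    {c : ℂ} (hE : E v = 0) (hv : H v = c • v) (k : ℕ) :
    E ((F ^ k) v) = ((k : ℂ) * (2 * c - k + 1)) • (F ^ (k - 1)) v := by
  rcases k with _ | k
  · simp [hE]
  · rw [raise_pow_succ hEF hHF hE hv, Nat.add_sub_cancel]; push_cast; congr 1; ring

/-- In a finite-dimensional representation of `sl(2)`, the weight of a primitive vector is half a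
natural number `k`, and `J₋^(k+1)` kills the vector. -/
theorem primitive_weight [FiniteDimensional ℂ V] (hEF : E * F = F * E + (2 : ℂ) • H)
    (hHF : H * F = F * H - F) {v : V} {c : ℂ} (hv0 : v ≠ 0) (hE : E v = 0) (hv : H v = c • v) :
    ∃ k : ℕ, 2 * c = k ∧ (F ^ (k + 1)) v = 0 := by
  have hex : ∃ k, (F ^ k) v = 0 := by
    by_contra hne
    push Not at hne
    -- Otherwise the numbers c - k would be infinitely many eigenvalues of `H`.
    have hfin := Module.End.finite_hasEigenvalue H
    refine Set.infinite_of_injective_forall_mem (f := fun k : ℕ => c - (k : ℂ)) ?_ ?_ hfin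
    · intro a b hab
      simpa using hab
    · intro k
      exact Module.End.hasEigenvalue_of_hasEigenvector
        ⟨Module.End.mem_eigenspace_iff.2 (weight_pow hHF hv k), hne k⟩
  -- At the last nonzero `(F ^ k) v`, applying `E` to the next power forces (k + 1)(2c - k) = 0.
  obtain ⟨k, hk, hmin⟩ : ∃ k, (F ^ (k + 1)) v = 0 ∧ (F ^ k) v ≠ 0 := by
    classical
    have hn0 : Nat.find hex ≠ 0 := fun h => hv0 (by simpa [h] using Nat.find_spec hex)
    obtain ⟨k, hk⟩ := Nat.exists_eq_succ_of_ne_zero hn0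
    have hs := Nat.find_spec hex
    rw [hk] at hs
    exact ⟨k, hs, Nat.find_min hex (by omega)⟩
  refine ⟨k, ?_, hk⟩
  have h := raise_pow_succ hEF hHF hE hv k
  rw [hk, map_zero] at h
  have h2 := (smul_eq_zero.1 h.symm).resolve_right hmin
  have h3 : (k : ℂ) + 1 ≠ 0 := by exact_mod_cast Nat.succ_ne_zero k
  have h4 := (mul_eq_zero.1 h2).resolve_left h3
  linear_combination h4

theorem raise_pow_lt (hEF : E * F = F * E + (2 : ℂ) • H) (hHF : H * F = F * H - F) {v : V}
    {c : ℂ} (hE : E v = 0) (hv : H v = c • v) {k K : ℕ} (h : k < K) :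
    (E ^ K) ((F ^ k) v) = 0 := by
  induction K generalizing k with
  | zero => omega
  | succ K ih =>
    rw [pow_succ, Module.End.mul_apply, raise_pow hEF hHF hE hv, map_smul]
    rcases k with _ | k
    · simp
    · rw [ih (by omega), smul_zero]

/-- The factor γ is the product of (i + 1)(d - i) over i < k, which is nonzero as long as k ≤ d. -/
theorem raise_pow_self (hEF : E * F = F * E + (2 : ℂ) • H) (hHF : H * F = F * H - F) {v : V}
    {d : ℕ} (hE : E v = 0) (hv : H v = ((d : ℂ) / 2) • v) {k : ℕ} (h : k ≤ d) :
    ∃ γ : ℂ, γ ≠ 0 ∧ (E ^ k) ((F ^ k) v) = γ • v := by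
  induction k with
  | zero => exact ⟨1, one_ne_zero, by simp⟩
  | succ k ih =>
    obtain ⟨γ, hγ, hk⟩ := ih (by omega)
    refine ⟨((k : ℂ) + 1) * (2 * ((d : ℂ) / 2) - k) * γ, mul_ne_zero (mul_ne_zero ?_ ?_) hγ, ?_⟩
    · exact_mod_cast Nat.succ_ne_zero k
    · have : (d : ℂ) - k ≠ 0 := sub_ne_zero.2 (by exact_mod_cast (by omega : d ≠ k))
      rwa [mul_div_cancel₀ _ (two_ne_zero)]
    · rw [pow_succ, Module.End.mul_apply, raise_pow_succ hEF hHF hE hv, map_smul, hk, smul_smul]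

theorem exists_coordinate {ι : Type*} {v : ι → V} (hv : LinearIndependent ℂ v) (i : ι) :
    ∃ f : V →ₗ[ℂ] ℂ, f (v i) = 1 ∧ ∀ j, j ≠ i → f (v j) = 0 := by
  obtain ⟨f, hf⟩ := LinearMap.exists_extend (Finsupp.lapply i ∘ₗ hv.repr)
  have h : ∀ j, f (v j) = (Finsupp.single j (1 : ℂ)) i := fun j => by
    have := congrArg (fun g => g (⟨v j, Submodule.subset_span ⟨j, rfl⟩⟩ :
      Submodule.span ℂ (Set.range v))) hf
    refine this.trans ?_
    rw [LinearMap.comp_apply, hv.repr_eq_single j _ rfl]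
    rfl
  exact ⟨f, by rw [h]; simp, fun j hj => by rw [h]; simp [hj]⟩

/-- The descendants of linearly independent primitive vectors are linearly independent. -/
theorem linearIndependent_descendants (hEF : E * F = F * E + (2 : ℂ) • H)
    (hHF : H * F = F * H - F) {ι τ : Type*} {v : ι → V} {d : ι → ℕ} (hE : ∀ i, E (v i) = 0)
    (hH : ∀ i, H (v i) = ((d i : ℂ) / 2) • v i) (hv : LinearIndependent ℂ v) (i : τ → ι)
    (k : τ → ℕ) (hk : ∀ t, k t ≤ d (i t)) (hinj : ∀ t t', i t = i t' → k t = k t' → t = t') :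
    LinearIndependent ℂ fun t => (F ^ k t) (v (i t)) := by
  classical
  rw [linearIndependent_iff']
  intro s g hg
  by_contra hne
  push Not at hne
  obtain ⟨t₁, ht₁, hgt₁⟩ := hne
  -- Among the nonzero coefficients of a relation one with the largest power of `F` is chosen. That
  -- power of `E` kills the terms with smaller powers and returns the others to multiples of
  -- primitive vectors, whose independence isolates the chosen coefficient.
  obtain ⟨t₀, ht₀, hmax⟩ := (s.filter fun t => g t ≠ 0).exists_max_image k
    ⟨t₁, Finset.mem_filter.2 ⟨ht₁, hgt₁⟩⟩
  obtain ⟨hts, hgt₀⟩ := Finset.mem_filter.1 ht₀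
  obtain ⟨f, hf1, hf0⟩ := exists_coordinate hv (i t₀)
  obtain ⟨γ, hγ, hγk⟩ := raise_pow_self hEF hHF (hE (i t₀)) (hH (i t₀)) (hk t₀)
  have h := congrArg (fun w => f ((E ^ k t₀) w)) hg
  simp only [map_sum, map_smul, map_zero] at h
  rw [Finset.sum_eq_single t₀] at h
  · rw [hγk, map_smul, hf1] at h
    simp [hγ, hgt₀] at h
  · intro t ht hne
    by_cases hgt : g t = 0
    · simp [hgt]
    · rcases (hmax t (Finset.mem_filter.2 ⟨ht, hgt⟩)).lt_or_eq with hlt | heq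
      · rw [raise_pow_lt hEF hHF (hE _) (hH _) hlt]; simp
      · obtain ⟨γ', -, hγ'⟩ := raise_pow_self hEF hHF (hE (i t)) (hH (i t)) (hk t)
        rw [← heq, hγ', map_smul, hf0 _ fun hi => hne (hinj t t₀ hi heq)]
        simp
  · exact fun h => absurd hts h

/-- If an endomorphism `Ω` of a finite-dimensional space commutes with `H` and is not injective, its
kernel contains an eigenvector of `H` which is killed by all endomorphisms commuting with `Ω` and
raising the eigenvalues of `H`. -/
theorem exists_top_eigenvector [FiniteDimensional ℂ V] {Ω : Module.End ℂ V} (hΩH : Ω * H = H * Ω)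
    (hker : ¬Function.Injective Ω) :
    ∃ (v : V) (μ : ℂ), v ≠ 0 ∧ Ω v = 0 ∧ H v = μ • v ∧ ∀ (X : Module.End ℂ V) (c : ℂ),
      Ω * X = X * Ω → H * X = X * H + c • X → 0 < c.re → X v = 0 := by
  have appl : ∀ {X Y : Module.End ℂ V}, X = Y → ∀ v, X v = Y v := fun h v => by rw [h]
  rw [← LinearMap.ker_eq_bot] at hker
  have hHk : ∀ v ∈ LinearMap.ker Ω, H v ∈ LinearMap.ker Ω := fun v hv => by
    have := appl hΩH v
    simp only [Module.End.mul_apply, LinearMap.mem_ker.1 hv, map_zero] at this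
    exact this
  have : Nontrivial (LinearMap.ker Ω) := Submodule.nontrivial_iff_ne_bot.2 hker
  obtain ⟨μ₀, hμ₀⟩ := Module.End.exists_eigenvalue (H.restrict hHk)
  -- An eigenvalue of `H` on the kernel of Ω with maximal real part: an operator that preserves the
  -- kernel and raises the real part must kill its eigenvectors.
  obtain ⟨μ, hμ, hmax⟩ := Set.exists_max_image _ Complex.re
    (Module.End.finite_hasEigenvalue (H.restrict hHk)) ⟨μ₀, hμ₀⟩
  obtain ⟨⟨v, hvk⟩, hv⟩ := Module.End.HasEigenvalue.exists_hasEigenvector hμ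
  have hHv : H v = μ • v := congrArg Subtype.val (Module.End.mem_eigenspace_iff.1 hv.1)
  have hv0 : v ≠ 0 := fun h => hv.2 (Subtype.ext h)
  have hΩv : Ω v = 0 := hvk
  refine ⟨v, μ, hv0, hΩv, hHv, fun X c hX hc hpos => ?_⟩
  by_contra hXv
  have hmem : X v ∈ LinearMap.ker Ω := by
    have := appl hX v
    simp only [Module.End.mul_apply, hΩv, map_zero] at this
    exact this
  have heig : H (X v) = (μ + c) • X v := by
    have := appl hc v
    simp only [Module.End.mul_apply, LinearMap.add_apply, LinearMap.smul_apply, hHv,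
      map_smul] at this
    rw [this]; module
  have hval : Module.End.HasEigenvalue (H.restrict hHk) (μ + c) :=
    Module.End.hasEigenvalue_of_hasEigenvector (x := ⟨X v, hmem⟩)
      ⟨Module.End.mem_eigenspace_iff.2 (Subtype.ext heig), fun h => hXv (congrArg Subtype.val h)⟩
  have := hmax _ hval
  rw [Complex.add_re] at this
  linarith

/-- If a finite-dimensional representation of `osp(1|2)` contains no nonzero invariant vector, then
its Casimir operator is injective. (The odd generators are rescaled by `√-1`.) -/
theorem osp_casimir_injective [FiniteDimensional ℂ V] {A B : Module.End ℂ V}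
    (hEF : E * F = F * E + (2 : ℂ) • H) (hHE : H * E = E * H + E) (hHF : H * F = F * H - F)
    (hHA : H * A = A * H + (1 / 2 : ℂ) • A) (hHB : H * B = B * H - (1 / 2 : ℂ) • B)
    (hEA : E * A = A * E) (hFA : F * A = A * F + B) (hAB : A * B = -(B * A) + (1 / 2 : ℂ) • H)
    (hAA : A * A = (-(1 / 4) : ℂ) • E)
    (hinv : ∀ v, E v = 0 → F v = 0 → H v = 0 → A v = 0 → B v = 0 → v = 0) :
    Function.Injective (H * H + (1 / 2 : ℂ) • H + F * E + (2 : ℂ) • (B * A)) := by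
  set Ω := H * H + (1 / 2 : ℂ) • H + F * E + (2 : ℂ) • (B * A) with hΩ
  have hΩH : Ω * H = H * Ω := by
    have h1 : F * E * H = H * (F * E) := by
      have : E * H = H * E - E := by rw [hHE]; abel
      rw [mul_assoc, this, ← mul_assoc, hHF]; noncomm_ring
    have h2 : B * A * H = H * (B * A) := by
      have : A * H = H * A - (1 / 2 : ℂ) • A := by rw [hHA]; module
      rw [mul_assoc, this, ← mul_assoc, hHB, mul_sub, sub_mul, mul_smul_comm, smul_mul_assoc,
        ← mul_assoc]
    simp only [hΩ, add_mul, mul_add, smul_mul_assoc, mul_smul_comm, h1, h2, mul_assoc]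
  have hΩA : Ω * A = A * Ω := by
    have h1 : H * H * A = A * (H * H) + A * H + (1 / 4 : ℂ) • A := by
      rw [mul_assoc, hHA, mul_add, ← mul_assoc, hHA, mul_smul_comm, hHA, add_mul, smul_mul_assoc,
        mul_assoc]; module
    have h2 : F * E * A = A * (F * E) + B * E := by
      rw [mul_assoc, hEA, ← mul_assoc, hFA, add_mul, mul_assoc]
    have h3 : B * A * A = (-(1 / 4) : ℂ) • (B * E) := by
      rw [mul_assoc, hAA, mul_smul_comm]
    have h4 : A * (B * A) = (1 / 4 : ℂ) • (B * E) + (1 / 2 : ℂ) • (A * H) + (1 / 4 : ℂ) • A := by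
      rw [← mul_assoc, hAB, add_mul, neg_mul, h3, smul_mul_assoc, hHA]; module
    simp only [hΩ, add_mul, mul_add, smul_mul_assoc, mul_smul_comm, h1, h2, h3, h4, hHA]
    module
  have hΩE : Ω * E = E * Ω := by
    have hE : E = (-4 : ℂ) • (A * A) := by rw [hAA, smul_smul]; norm_num
    rw [hE, mul_smul_comm, smul_mul_assoc, ← mul_assoc, hΩA, mul_assoc, hΩA, mul_assoc]
  have appl : ∀ {X Y : Module.End ℂ V}, X = Y → ∀ v, X v = Y v := fun h v => by rw [h]
  by_contra hker
  obtain ⟨v, μ, hv0, hΩv, hHv, top⟩ := exists_top_eigenvector hΩH hker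
  have hEv : E v = 0 := top E 1 hΩE (by simpa using hHE) (by simp)
  have hAv : A v = 0 := top A (1 / 2) hΩA hHA (by norm_num)
  -- On a vector killed by `E` and `A` only the terms in `H` of the Casimir operator survive.
  have hμ2 : μ * (μ + 1 / 2) = 0 := by
    have : (μ * (μ + 1 / 2)) • v = 0 := by
      rw [← hΩv, hΩ]
      simp only [LinearMap.add_apply, LinearMap.smul_apply, Module.End.mul_apply, hHv, hEv, hAv,
        map_smul, map_zero]
      module
    exact (smul_eq_zero.1 this).resolve_right hv0
  -- Since 2μ is a natural number, the root μ = -1/2 is impossible. At weight 0 the vector is killed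
  -- by `F`, hence also by B = FA - AF, so it is invariant.
  obtain ⟨k, hk, hFk⟩ := primitive_weight hEF hHF hv0 hEv hHv
  have hμ0 : μ = 0 := by
    rcases mul_eq_zero.1 hμ2 with h | h
    · exact h
    · exfalso
      have h3 : (k : ℂ) + 1 = 0 := by linear_combination 2 * h - hk
      exact (by exact_mod_cast Nat.succ_ne_zero k : (k : ℂ) + 1 ≠ 0) h3
  have hk0 : k = 0 := by
    rw [hμ0] at hk
    exact_mod_cast (by simpa using hk.symm : (k : ℂ) = 0)
  have hFv : F v = 0 := by simpa [hk0] using hFk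
  refine hv0 (hinv v hEv hFv (by rw [hHv, hμ0, zero_smul]) hAv ?_)
  have := appl hFA v
  simpa [hAv, hFv] using this.symm

/-- The Casimir operator of `sl(2)` is injective on a finite-dimensional representation without
invariants. -/
theorem sl_casimir_injective [FiniteDimensional ℂ V] (hEF : E * F = F * E + (2 : ℂ) • H)
    (hHE : H * E = E * H + E) (hHF : H * F = F * H - F)
    (hinv : ∀ v, E v = 0 → F v = 0 → H v = 0 → v = 0) :
    Function.Injective (H * H + H + F * E) := by
  set Ω := H * H + H + F * E with hΩ
  have hFE : F * E = E * F - (2 : ℂ) • H := by rw [hEF]; abel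
  have hΩH : Ω * H = H * Ω := by
    have h1 : F * E * H = H * (F * E) := by
      have : E * H = H * E - E := by rw [hHE]; abel
      rw [mul_assoc, this, ← mul_assoc, hHF]; noncomm_ring
    simp only [hΩ, add_mul, mul_add, h1, mul_assoc]
  have hΩE : Ω * E = E * Ω := by
    have h1 : H * H * E = E * (H * H) + (2 : ℂ) • (E * H) + E := by
      rw [mul_assoc, hHE, mul_add, ← mul_assoc, hHE, add_mul, mul_assoc]; module
    have h2 : F * E * E = E * (F * E) - (2 : ℂ) • (E * H) - (2 : ℂ) • E := by
      rw [hFE, sub_mul, smul_mul_assoc, hHE, mul_assoc, hFE]; module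
    simp only [hΩ, add_mul, mul_add, h1, h2, hHE]
    module
  by_contra hker
  obtain ⟨v, μ, hv0, hΩv, hHv, top⟩ := exists_top_eigenvector hΩH hker
  have hEv : E v = 0 := top E 1 hΩE (by simpa using hHE) (by simp)
  have hμ2 : μ * (μ + 1) = 0 := by
    have : (μ * (μ + 1)) • v = 0 := by
      rw [← hΩv, hΩ]
      simp only [LinearMap.add_apply, Module.End.mul_apply, hHv, hEv, map_smul, map_zero]
      module
    exact (smul_eq_zero.1 this).resolve_right hv0
  obtain ⟨k, hk, hFk⟩ := primitive_weight hEF hHF hv0 hEv hHv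
  -- The root μ = -1 is excluded because 2μ is a natural number.
  have hμ0 : μ = 0 := by
    rcases mul_eq_zero.1 hμ2 with h | h
    · exact h
    · exfalso
      have h3 : (k : ℂ) + 2 = 0 := by linear_combination 2 * h - hk
      exact (by exact_mod_cast Nat.succ_ne_zero (k + 1) : (k : ℂ) + 2 ≠ 0) h3
  have hk0 : k = 0 := by
    rw [hμ0] at hk
    exact_mod_cast (by simpa using hk.symm : (k : ℂ) = 0)
  exact hv0 (hinv v hEv (by simpa [hk0] using hFk) (by rw [hHv, hμ0, zero_smul]))

end Primitive

/-! ### Invariant cochains with trivial coefficients -/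

section Frame

variable {L : Type*} [AddCommGroup L] [Module ℂ L] [SuperSpace L]

/-- Elements spanning a Lie superalgebra, which satisfy the relations between the even and all
generators of `osp(1|2)`. -/
structure IsFrame (br : L →ₗ[ℂ] L →ₗ[ℂ] L) (E F H A B : L) : Prop where
  E_mem : E ∈ homog L 0
  F_mem : F ∈ homog L 0
  H_mem : H ∈ homog L 0
  A_mem : A ∈ homog L 1
  B_mem : B ∈ homog L 1
  EE : br E E = 0
  FF : br F F = 0
  HH : br H H = 0
  EF : br E F = (2 : ℂ) • H
  FE : br F E = -((2 : ℂ) • H)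
  HE : br H E = E
  EH : br E H = -E
  HF : br H F = -F
  FH : br F H = F
  EA : br E A = 0
  EB : br E B = A
  FA : br F A = B
  FB : br F B = 0
  HA : br H A = (1 / 2 : ℂ) • A
  HB : br H B = -((1 / 2 : ℂ) • B)
  span : ∀ x, ∃ a b c r s : ℂ, x = a • E + (b • F + (c • H + (r • A + s • B)))

variable {br : L →ₗ[ℂ] L →ₗ[ℂ] L} {E F H A B : L}

/-- This is the Chevalley involution. It transfers statements about `E` and `A` to `F` and `B`. -/
theorem IsFrame.symm (h : IsFrame br E F H A B) : IsFrame br F E (-H) B A where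
  E_mem := h.F_mem
  F_mem := h.E_mem
  H_mem := neg_mem h.H_mem
  A_mem := h.B_mem
  B_mem := h.A_mem
  EE := h.FF
  FF := h.EE
  HH := by simp [h.HH]
  EF := by simp [h.FE]
  FE := by simp [h.EF]
  HE := by simp [h.HF]
  EH := by simp [h.FH]
  HF := by simp [h.HE]
  FH := by simp [h.EH]
  EA := h.FB
  EB := h.FA
  FA := h.EB
  FB := h.EA
  HA := by simp [h.HB]
  HB := by simp [h.HA]
  span x := by
    obtain ⟨a, b, c, r, s, rfl⟩ := h.span x
    exact ⟨b, a, -c, s, r, by module⟩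

/-- The Lie derivative of cochains with trivial coefficients. -/
abbrev lie₀ (br : L →ₗ[ℂ] L →ₗ[ℂ] L) (i : ZMod 2) (x : L) : (List L → ℂ) →ₗ[ℂ] (List L → ℂ) :=
  lie br (0 : L →ₗ[ℂ] Module.End ℂ ℂ) i x

theorem lie₀_nil (i : ZMod 2) (x : L) (ω : List L → ℂ) : lie₀ br i x ω [] = 0 := by
  simp [lie_nil]

theorem lie₀_ins (x y : L) (ω : List L → ℂ) :
    lie₀ br 0 x (ins y ω) = ins y (lie₀ br 0 x ω) + ins (br x y) ω := by
  rw [ins_lie, tw_zero, sub_add_cancel]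

theorem lie₀_cons (x y : L) (l : List L) (ω : List L → ℂ) :
    lie₀ br 0 x ω (y :: l) = lie₀ br 0 x (ins y ω) l - ω (br x y :: l) := by
  rw [lie_cons, tw_zero]

variable {ω : List L → ℂ}

theorem ins_even (hω : ω ∈ Altern L ℂ) {x : L} (hx : x ∈ homog L 0) (y : L) :
    ins x (ins y ω) = -ins y (ins x ω) := by
  have := ins_ins hω hx y
  rwa [tw_zero] at this

theorem ins_even_self (hω : ω ∈ Altern L ℂ) {x : L} (hx : x ∈ homog L 0) :
    ins x (ins x ω) = 0 := self_eq_neg.1 (ins_even hω hx x)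

theorem ins_odd (hω : ω ∈ Altern L ℂ) {x y : L} (hx : x ∈ homog L 1) (hy : y ∈ homog L 1) :
    ins x (ins y ω) = ins y (ins x ω) := by
  have := ins_ins hω hx (-y)
  rwa [tw_one, map_neg, mem_homog_one.1 hy, neg_neg, ins_neg (ins_mem hω.1 _), neg_neg] at this

/-- An alternating cochain which is killed by contractions with the even elements of the frame. -/
structure OddSupported (E F H : L) (ω : List L → ℂ) : Prop where
  mem : ω ∈ Altern L ℂ
  ins_E : ins E ω = 0
  ins_F : ins F ω = 0
  ins_H : ins H ω = 0

theorem OddSupported.ins (h : OddSupported E F H ω) (hf : IsFrame br E F H A B) (x : L) :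
    OddSupported E F H (ins x ω) where
  mem := ins_mem_altern h.mem x
  ins_E := by rw [ins_even h.mem hf.E_mem, h.ins_E, map_zero, neg_zero]
  ins_F := by rw [ins_even h.mem hf.F_mem, h.ins_F, map_zero, neg_zero]
  ins_H := by rw [ins_even h.mem hf.H_mem, h.ins_H, map_zero, neg_zero]

theorem OddSupported.symm (h : OddSupported E F H ω) : OddSupported F E (-H) ω where
  mem := h.mem
  ins_E := h.ins_F
  ins_F := h.ins_E
  ins_H := by rw [ins_neg h.mem.1, h.ins_H, neg_zero]

theorem ins_frame (hf : IsFrame br E F H A B) (hω : ω ∈ Altern L ℂ) (x : L) :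
    ∃ a b c r s : ℂ, ins x ω = a • ins E ω + (b • ins F ω + (c • ins H ω +
      (r • ins A ω + s • ins B ω))) := by
  obtain ⟨a, b, c, r, s, rfl⟩ := hf.span x
  refine ⟨a, b, c, r, s, ?_⟩
  rw [ins_smul_add hω.1, ins_smul_add hω.1, ins_smul_add hω.1, ins_smul_add hω.1, ins_smul hω.1]

theorem eq_zero_of_ins (hf : IsFrame br E F H A B) (hω : ω ∈ Altern L ℂ) (h0 : ω [] = 0)
    (hE : ins E ω = 0) (hF : ins F ω = 0) (hH : ins H ω = 0) (hA : ins A ω = 0)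
    (hB : ins B ω = 0) : ω = 0 := by
  ext l
  rcases l with _ | ⟨x, l⟩
  · exact h0
  · obtain ⟨a, b, c, r, s, h⟩ := ins_frame hf hω x
    rw [hE, hF, hH, hA, hB] at h
    simpa using congrFun h l

/-- Contractions with odd elements commute: alternating cochains are symmetric in odd arguments. -/
theorem replicate_commute (hω : ω ∈ Altern L ℂ) (hA : A ∈ homog L 1) (hB : B ∈ homog L 1) (r : ℕ)
    (l : List L) : ω (B :: (List.replicate r A ++ l)) = ω (List.replicate r A ++ B :: l) := by
  induction r generalizing ω with
  | zero => rfl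
  | succ r ih =>
    have h := congrFun (ins_odd hω hA hB) (List.replicate r A ++ l)
    simp only [ins_apply] at h
    rw [List.replicate_succ, List.cons_append, List.cons_append, h]
    exact ih (ins_mem_altern hω A)

/-- Such a cochain is a polynomial on the odd part, with the values at `A, …, A, B, …, B` as
coefficients. -/
theorem OddSupported.eq_zero (hf : IsFrame br E F H A B) (h : OddSupported E F H ω)
    (hc : ∀ r s, ω (List.replicate r A ++ List.replicate s B) = 0) : ω = 0 := by
  ext l
  induction l generalizing ω with
  | nil => exact hc 0 0
  | cons x l ih =>
    obtain ⟨a, b, c, r, s, hx⟩ := ins_frame hf h.mem x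
    have hA := ih (h.ins hf A) fun r s => hc (r + 1) s
    have hB := ih (h.ins hf B) fun r s => by
      rw [ins_apply, replicate_commute h.mem hf.A_mem hf.B_mem]
      exact hc r (s + 1)
    have := congrFun hx l
    simp only [h.ins_E, h.ins_F, h.ins_H, smul_zero, zero_add, Pi.add_apply, Pi.smul_apply, hA,
      hB, Pi.zero_apply, add_zero] at this
    exact this

/-- By [E, B] = A each of the s + 1 entries `B` is replaced by `A` in turn; symmetry in the odd
arguments makes all results equal. -/
theorem lie₀_E_replicate (hf : IsFrame br E F H A B) (hω : ω ∈ Altern L ℂ) (s : ℕ) :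
    lie₀ br 0 E ω (List.replicate (s + 1) B) = -((s : ℂ) + 1) * ω (A :: List.replicate s B) := by
  induction s generalizing ω with
  | zero => simp [lie₀_cons, lie₀_nil, hf.EB]
  | succ s ih =>
    have h := congrFun (ins_odd hω hf.A_mem hf.B_mem) (List.replicate s B)
    simp only [ins_apply] at h
    rw [List.replicate_succ, lie₀_cons, ih (ins_mem_altern hω B), hf.EB, ins_apply,
      List.replicate_succ, h]
    push_cast; ring

theorem lie₀_E_replicate_append (hf : IsFrame br E F H A B) (hω : ω ∈ Altern L ℂ) (r s : ℕ) :
    lie₀ br 0 E ω (List.replicate r A ++ List.replicate (s + 1) B) =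
      -((s : ℂ) + 1) * ω (List.replicate (r + 1) A ++ List.replicate s B) := by
  induction r generalizing ω with
  | zero => exact lie₀_E_replicate hf hω s
  | succ r ih =>
    have h0 := congrFun (ins_zero hω.1) (List.replicate r A ++ List.replicate (s + 1) B)
    simp only [ins_apply, Pi.zero_apply] at h0
    rw [List.replicate_succ, List.cons_append, lie₀_cons, hf.EA, h0, sub_zero,
      ih (ins_mem_altern hω A)]
    rfl

/-- Each value with at least one `A` is, up to a nonzero integer, a value of the Lie derivative
along `E` with one more `B`. -/
theorem OddSupported.ins_A_eq_zero (hf : IsFrame br E F H A B) (h : OddSupported E F H ω)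
    (hE : lie₀ br 0 E ω = 0) : FuzzySupersphere.ins A ω = 0 := by
  refine (h.ins hf A).eq_zero hf fun r s => ?_
  have h1 := lie₀_E_replicate_append hf h.mem r s
  rw [hE, Pi.zero_apply] at h1
  have h2 : -((s : ℂ) + 1) ≠ 0 := neg_ne_zero.2 (by exact_mod_cast Nat.succ_ne_zero s)
  exact (mul_eq_zero.1 h1.symm).resolve_left h2

theorem OddSupported.ins_B_eq_zero (hf : IsFrame br E F H A B) (h : OddSupported E F H ω)
    (hF : lie₀ br 0 F ω = 0) : FuzzySupersphere.ins B ω = 0 :=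
  h.symm.ins_A_eq_zero hf.symm hF

theorem lie₀_H_replicate (hf : IsFrame br E F H A B) (hω : ω ∈ Altern L ℂ) (r : ℕ) :
    lie₀ br 0 H ω (List.replicate r A) = -((r : ℂ) / 2) * ω (List.replicate r A) := by
  induction r generalizing ω with
  | zero => simp [lie₀_nil]
  | succ r ih =>
    have h := congrFun (ins_smul hω.1 (1 / 2) A) (List.replicate r A)
    simp only [ins_apply, Pi.smul_apply, smul_eq_mul] at h
    rw [List.replicate_succ, lie₀_cons, ih (ins_mem_altern hω A), hf.HA, h, ins_apply]
    push_cast; ring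

/-- Without `B` only the values at `A, …, A` remain. As `A` has weight 1/2, the condition on `H`
leaves just the one with two entries. -/
theorem OddSupported.eq_zero_of_weight (hf : IsFrame br E F H A B) (h : OddSupported E F H ω)
    (hB : FuzzySupersphere.ins B ω = 0) (hH : lie₀ br 0 H ω = -ω) (hAA : ω [A, A] = 0) :
    ω = 0 := by
  refine h.eq_zero hf fun r s => ?_
  rcases s with _ | s
  · rw [List.replicate_zero, List.append_nil]
    have h1 := lie₀_H_replicate hf h.mem r
    rw [hH, Pi.neg_apply] at h1
    by_cases hr : r = 2
    · subst hr; exact hAA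
    · have h2 : ((r : ℂ) / 2 - 1) * ω (List.replicate r A) = 0 := by linear_combination h1
      refine (mul_eq_zero.1 h2).resolve_left fun h3 => hr ?_
      have h4 : (r : ℂ) = 2 := by linear_combination 2 * h3
      exact_mod_cast h4
  · rw [List.replicate_succ, ← replicate_commute h.mem hf.A_mem hf.B_mem]
    exact congrFun hB _

/-- An invariant cochain with trivial coefficients is determined by four of its values. -/
theorem eq_zero_of_invariant (hf : IsFrame br E F H A B) (hω : ω ∈ Altern L ℂ)
    (hE : lie₀ br 0 E ω = 0) (hF : lie₀ br 0 F ω = 0) (hH : lie₀ br 0 H ω = 0) (h0 : ω [] = 0)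
    (h3 : ω [F, H, E] = 0) (h4 : ω [F, H, A, A] = 0) (h5 : ω [F, A, A] = 0) : ω = 0 := by
  have sub : ∀ η : List L → ℂ, (2 : ℂ) • η = 0 → η = 0 := fun η h =>
    (smul_eq_zero.1 h).resolve_left two_ne_zero
  -- contractions with two or three even elements
  have hEE := ins_even_self hω hf.E_mem
  have hFF := ins_even_self hω hf.F_mem
  have hHH := ins_even_self hω hf.H_mem
  have mF := ins_mem_altern hω F
  have mH := ins_mem_altern hω H
  have mHF := ins_mem_altern mF H
  -- The threefold even contraction is killed by the Lie derivatives along `E` and `F`, hence by the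
  -- contractions with `A` and `B`. What remains is its value on the empty list, which is `ω [F, H,
  -- E]`.
  have z1 : ins E (ins H (ins F ω)) = 0 := by
    have lE : lie₀ br 0 E (ins E (ins H (ins F ω))) = 0 := by
      simp only [lie₀_ins, hE, hf.EE, hf.EH, hf.EF, ins_neg mF.1, ins_smul hω.1, map_add, map_neg,
        map_smul, map_zero, ins_zero mHF.1, hHH, ins_even_self mF hf.E_mem, smul_zero, neg_zero,
        add_zero]
    have lF : lie₀ br 0 F (ins E (ins H (ins F ω))) = 0 := by
      simp only [lie₀_ins, hF, hf.FE, hf.FH, hf.FF, ins_neg mHF.1, ins_smul mHF.1,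
        map_zero, ins_zero hω.1, hFF, ins_even_self mF hf.H_mem, smul_zero, neg_zero, add_zero]
    have os : OddSupported E F H (ins E (ins H (ins F ω))) := by
      refine ⟨ins_mem_altern mHF E, ins_even_self mHF hf.E_mem, ?_, ?_⟩
      · rw [ins_even mHF hf.F_mem, ins_even mF hf.F_mem, hFF]; simp
      · rw [ins_even mHF hf.H_mem, ins_even_self mF hf.H_mem]; simp
    exact eq_zero_of_ins hf os.mem h3 os.ins_E os.ins_F os.ins_H (os.ins_A_eq_zero hf lE)
      (os.ins_B_eq_zero hf lF)
  -- This contraction is killed by the Lie derivative along `F` and is an eigenvector for `H`, so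
  -- only `ω [F, H, A, A]` is left.
  have z2 : ins H (ins F ω) = 0 := by
    have os : OddSupported E F H (ins H (ins F ω)) := by
      refine ⟨mHF, z1, ?_, ins_even_self mF hf.H_mem⟩
      rw [ins_even mF hf.F_mem, hFF]; simp
    have lF : lie₀ br 0 F (ins H (ins F ω)) = 0 := by
      simp only [lie₀_ins, hF, hf.FH, hf.FF, map_zero, ins_zero hω.1, hFF, add_zero]
    have lH : lie₀ br 0 H (ins H (ins F ω)) = -ins H (ins F ω) := by
      simp only [lie₀_ins, hH, hf.HH, hf.HF, map_zero, ins_zero mF.1, ins_neg hω.1,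
        map_neg, add_zero, zero_add]
    exact os.eq_zero_of_weight hf (os.ins_B_eq_zero hf lF) lH h4
  -- The Lie derivative along `E` of a vanishing contraction yields the next contraction, here and
  -- in the steps that use [E, F] = 2H and [E, H] = -E.
  have z3 : ins E (ins F ω) = 0 := by
    have h : lie₀ br 0 E (ins H (ins F ω)) = -ins E (ins F ω) := by
      simp only [lie₀_ins, hE, hf.EH, hf.EF, ins_neg mF.1, ins_smul hω.1, map_zero,
        map_smul, hHH, smul_zero, zero_add]
    rw [z2, map_zero] at h
    exact neg_eq_zero.1 h.symm
  have z4 : ins E (ins H ω) = 0 := by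
    have h : lie₀ br 0 E (ins E (ins F ω)) = (2 : ℂ) • ins E (ins H ω) := by
      simp only [lie₀_ins, hE, hf.EE, hf.EF, ins_zero mF.1, ins_smul hω.1, map_zero,
        map_smul, add_zero, zero_add]
    rw [z3, map_zero] at h
    exact sub _ h.symm
  -- contractions with one even element
  have w1 : ins F ω = 0 := by
    have os : OddSupported E F H (ins F ω) := ⟨mF, z3, hFF, z2⟩
    have lF : lie₀ br 0 F (ins F ω) = 0 := by
      simp only [lie₀_ins, hF, hf.FF, map_zero, ins_zero hω.1, add_zero]
    have lH : lie₀ br 0 H (ins F ω) = -ins F ω := by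
      simp only [lie₀_ins, hH, hf.HF, map_zero, ins_neg hω.1, zero_add]
    exact os.eq_zero_of_weight hf (os.ins_B_eq_zero hf lF) lH h5
  have w2 : ins H ω = 0 := by
    have h : lie₀ br 0 E (ins F ω) = (2 : ℂ) • ins H ω := by
      simp only [lie₀_ins, hE, hf.EF, map_zero, ins_smul hω.1, zero_add]
    rw [w1, map_zero] at h
    exact sub _ h.symm
  have w3 : ins E ω = 0 := by
    have h : lie₀ br 0 E (ins H ω) = -ins E ω := by
      simp only [lie₀_ins, hE, hf.EH, map_zero, ins_neg hω.1, zero_add]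
    rw [w2, map_zero] at h
    exact neg_eq_zero.1 h.symm
  have os : OddSupported E F H ω := ⟨hω, w3, w1, w2⟩
  exact eq_zero_of_ins hf hω h0 w3 w1 w2 (os.ins_A_eq_zero hf hE) (os.ins_B_eq_zero hf hF)

/-- The differential of a `2`-cochain vanishes at `(F, H, E)`. -/
theorem diff_apply_frame (hf : IsFrame br E F H A B) (hω : ω ∈ Altern L ℂ) :
    diff br (0 : L →ₗ[ℂ] Module.End ℂ ℂ) ω [F, H, E] = 0 := by
  have c0 : ∀ x ∈ homog L 0, comp 0 x = x := fun x hx => by simp [comp_of_mem hx]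
  have c1 : ∀ x ∈ homog L 0, comp 1 x = 0 := fun x hx => by simp [comp_of_mem hx]
  have e2 := congrFun (ins_even_self hω hf.H_mem) []
  have e3 := congrFun (ins_smul (ins_mem hω.1 H) (-2) H) []
  simp only [ins_apply, Pi.zero_apply, Pi.smul_apply] at e2 e3
  have m := fun x => ins_mem hω.1 x
  -- The bracket terms are ω(F, E) twice with opposite signs and a multiple of ω(H, H) = 0.
  simp only [diff_cons, c0 _ hf.E_mem, c0 _ hf.F_mem, c0 _ hf.H_mem, c1 _ hf.E_mem, c1 _ hf.F_mem,
    c1 _ hf.H_mem, lie_zero_left _ _ hω.1, lie_zero_left _ _ (m _),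
    lie₀_cons, lie₀_nil, hf.FH, hf.FE, hf.HE, diff_nil, Pi.zero_apply, ins_apply]
  rw [← neg_smul, e3, e2]
  simp

end Frame

/-! ### Cohomology with trivial coefficients -/

section TrivialCoefficients

variable {L : Type*} [AddCommGroup L] [Module ℂ L] [SuperSpace L]
  {br : L →ₗ[ℂ] L →ₗ[ℂ] L} {E F H A B : L} {ω : List L → ℂ}

/-- The relations between all generators of `osp(1|2)`. -/
structure IsOspFrame (br : L →ₗ[ℂ] L →ₗ[ℂ] L) (E F H A B : L) : Prop
    extends IsFrame br E F H A B where
  AE : br A E = 0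
  AF : br A F = -B
  AH : br A H = -((1 / 2 : ℂ) • A)
  AA : br A A = (1 / 2 : ℂ) • E
  AB : br A B = -((1 / 2 : ℂ) • H)
  BA : br B A = -((1 / 2 : ℂ) • H)
  BE : br B E = -A
  BF : br B F = 0
  BH : br B H = (1 / 2 : ℂ) • B
  BB : br B B = -((1 / 2 : ℂ) • F)

/-- Invariance under `B` supplies the values that the even part leaves open: at the arguments (F, E,
A) it ties `ω [F, A, A]` to `ω [F, H, E]`, and at (F, H, E, A) it helps to determine `ω [F, H, A,
A]`. -/
theorem IsOspFrame.eq_zero_of_invariant (hf : IsOspFrame br E F H A B) (hω : ω ∈ Altern L ℂ)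
    (hE : lie₀ br 0 E ω = 0) (hF : lie₀ br 0 F ω = 0) (hH : lie₀ br 0 H ω = 0)
    (hB : lie₀ br 1 B ω = 0) (h0 : ω [] = 0) (h3 : ω [F, H, E] = 0) : ω = 0 := by
  have m1 := fun x => ins_mem_altern hω x
  have m2 := fun x y => ins_mem_altern (m1 x) y
  have m3 := fun x y z => ins_mem_altern (m2 x y) z
  have n1 : ∀ x (c : ℂ) y l, ω (x :: (c • y) :: l) = c * ω (x :: y :: l) := fun x c y l =>
    congrFun (ins_smul (m1 x).1 c y) l
  have n2 : ∀ x y (c : ℂ) z l, ω (x :: y :: (c • z) :: l) = c * ω (x :: y :: z :: l) :=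
    fun x y c z l => congrFun (ins_smul (m2 x y).1 c z) l
  have n3 : ∀ x y z (c : ℂ) w l, ω (x :: y :: z :: (c • w) :: l) =
      c * ω (x :: y :: z :: w :: l) := fun x y z c w l => congrFun (ins_smul (m3 x y z).1 c w) l
  have tE : tw 1 E = E := by rw [tw_of_mem hf.E_mem]; simp [sgn_zero]
  have tF : tw 1 F = F := by rw [tw_of_mem hf.F_mem]; simp [sgn_zero]
  have tH : tw 1 H = H := by rw [tw_of_mem hf.H_mem]; simp [sgn_zero]
  have z0 : ∀ l, ω (0 :: l) = 0 := fun l => congrFun (ins_zero hω.1) l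
  have neg1 : ∀ x y l, ω (x :: -y :: l) = -ω (x :: y :: l) := fun x y l =>
    congrFun (ins_neg (m1 x).1 y) l
  have neg2 : ∀ x y z l, ω (x :: y :: -z :: l) = -ω (x :: y :: z :: l) := fun x y z l =>
    congrFun (ins_neg (m2 x y).1 z) l
  have neg3 : ∀ x y z w l, ω (x :: y :: z :: -w :: l) = -ω (x :: y :: z :: w :: l) :=
    fun x y z w l => congrFun (ins_neg (m3 x y z).1 w) l
  have z3 : ω [F, H, B, 0] = 0 := congrFun (ins_zero (m3 F H B).1) []
  have sHE : ∀ l, ω (F :: E :: H :: l) = -ω (F :: H :: E :: l) := fun l =>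
    congrFun (ins_even (m1 F) hf.H_mem E) l
  have h5 : ω [F, A, A] = 0 := by
    have h := congrFun hB [F, E, A]
    simp only [lie_cons, lie_nil, tF, tE, ins_apply, hf.BF, hf.BE, hf.BA, z0, neg1, neg2, n2, sHE,
      h3, LinearMap.zero_apply, Pi.zero_apply] at h
    linear_combination h
  -- Invariance under `B` at (F, H, E, A) and under `E` at (F, H, B, A) are two independent linear
  -- equations in `ω [F, H, A, A]` and `ω [F, E, B, A]`.
  have h4 : ω [F, H, A, A] = 0 := by
    have h := congrFun hB [F, H, E, A]
    have h' := congrFun hE [F, H, B, A]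
    have e1 : ω [F, B, E, A] = -ω [F, E, B, A] := by
      have := congrFun (ins_even (m1 F) hf.E_mem B) [A]
      exact this
    have e2 : ω [F, H, E, H] = 0 := by
      have := congrFun (ins_even (m2 F H) hf.H_mem E) []
      simp only [ins_apply, Pi.neg_apply] at this
      have e := congrFun (ins_even_self (m1 F) hf.H_mem) [E]
      simp only [ins_apply, Pi.zero_apply] at e
      linear_combination this - e
    have e3 : ω [(2 : ℂ) • H, H, B, A] = 0 := by
      have := congrFun (ins_smul hω.1 2 H) [H, B, A]
      have e := congrFun (ins_even_self hω hf.H_mem) [B, A]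
      simp only [ins_apply, Pi.zero_apply, Pi.smul_apply, smul_eq_mul] at this e
      rw [this, e, mul_zero]
    simp only [lie_cons, lie_nil, tF, tE, tH, ins_apply, hf.BF, hf.BE, hf.BA, hf.BH, z0, neg2,
      neg3, n1, n3, e1, e2, LinearMap.zero_apply, Pi.zero_apply] at h
    simp only [lie_cons, lie_nil, tw_zero, ins_apply, hf.EF, hf.EH, hf.EB, hf.EA, e3, z3, neg1,
      LinearMap.zero_apply, Pi.zero_apply] at h'
    linear_combination (2 / 3 : ℂ) * h - (1 / 3 : ℂ) * h'
  exact FuzzySupersphere.eq_zero_of_invariant hf.toIsFrame hω hE hF hH h0 h3 h4 h5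

/-! ### Cochains concentrated in one degree. -/

section Support

variable {M : Type*} [AddCommGroup M] [Module ℂ M] [SuperSpace M]

/-- The value of a Lie derivative at a list depends on the values at lists of the same length. -/
theorem lie_eq_zero_of_length (br : L →ₗ[ℂ] L →ₗ[ℂ] L) (act : L →ₗ[ℂ] Module.End ℂ M) (i : ZMod 2)
    (x : L) {W : List L → M} {l : List L} (h : ∀ l', l'.length = l.length → W l' = 0) :
    lie br act i x W l = 0 := by
  induction l generalizing W with
  | nil => simp [lie_nil, h [] rfl]
  | cons y l ih =>
    rw [lie_cons, ih (W := ins (tw i y) W) fun l' hl' => h (_ :: l') (by simp [hl']),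
      h _ (by simp), sub_zero]

/-- The value of a differential at a list depends on the values at lists of length one less. -/
theorem diff_eq_zero_of_length (br : L →ₗ[ℂ] L →ₗ[ℂ] L) (act : L →ₗ[ℂ] Module.End ℂ M)
    {W : List L → M} {l : List L} (h : ∀ l', l'.length + 1 = l.length → W l' = 0) :
    diff br act W l = 0 := by
  induction l generalizing W with
  | nil => rfl
  | cons y l ih =>
    have h' : ∀ i x, lie br act i x W l = 0 := fun i x =>
      lie_eq_zero_of_length _ _ _ _ fun l' hl' => h l' (by simp [hl'])
    rw [diff_cons, h', h', ih (W := ins y W) fun l' hl' => h (_ :: l') (by simp [hl'])]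
    simp

variable (L M) in
/-- The cochains concentrated in degree `p`. -/
def OfDegree (p : ℕ) : Submodule ℂ (List L → M) where
  carrier := {W | ∀ l, l.length ≠ p → W l = 0}
  add_mem' h h' l hl := by rw [Pi.add_apply, h l hl, h' l hl, add_zero]
  zero_mem' _ _ := rfl
  smul_mem' c W h l hl := by rw [Pi.smul_apply, h l hl, smul_zero]

theorem lie_mem_ofDegree (br : L →ₗ[ℂ] L →ₗ[ℂ] L) (act : L →ₗ[ℂ] Module.End ℂ M) (i : ZMod 2)
    (x : L) {p : ℕ} {W : List L → M} (h : W ∈ OfDegree L M p) :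
    lie br act i x W ∈ OfDegree L M p := fun l hl =>
  lie_eq_zero_of_length br act i x fun l' hl' => h l' (by rwa [hl'])

/-- Extension of multilinear maps to cochains, as a linear map. -/
def ofMultilinear (p : ℕ) :
    MultilinearMap ℂ (fun _ : Fin p => L) M →ₗ[ℂ] (List L → M) where
  toFun m := ofForm p m
  map_add' m m' := by
    ext l
    have := ofForm_smul_add p 1 (m : (Fin p → L) → M) m' l
    rw [one_smul, one_smul] at this
    exact this
  map_smul' c m := by
    ext l
    have := ofForm_smul_add p c (m : (Fin p → L) → M) 0 l
    have h0 := ofForm_smul_add p (0 : ℂ) (0 : (Fin p → L) → M) 0 l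
    rw [zero_smul, zero_smul, zero_add, zero_add] at h0
    rw [add_zero] at this
    refine this.trans ?_
    by_cases h : l.length = p
    · obtain ⟨D, rfl⟩ := exists_eq_ofFn h
      simp [ofForm_ofFn]
    · simp [ofForm_of_length_ne h]

theorem finiteDimensional_multilin_ofDegree [FiniteDimensional ℂ L] [FiniteDimensional ℂ M] (p : ℕ)
    {K : Submodule ℂ (List L → M)} (hK : K ≤ Multilin L M ⊓ OfDegree L M p) :
    FiniteDimensional ℂ K := by
  have : K ≤ LinearMap.range (ofMultilinear p) := fun W hW =>
    ⟨mkMultilin p (hK hW).1, ofForm_toForm W (hK hW).2⟩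
  exact Submodule.finiteDimensional_of_le this

theorem diff_ins_of_closed (act : L →ₗ[ℂ] Module.End ℂ M) {W : List L → M}
    (hW : W ∈ Multilin L M) (hd : diff br act W = 0) {i : ZMod 2} {x : L} (hx : x ∈ homog L i) :
    diff br act (ins x W) = lie br act i x W := by
  have := ins_diff br act hW hx
  rw [hd, map_zero] at this
  exact (sub_eq_zero.1 this.symm).symm

end Support

/-- The differential of cochains with trivial coefficients. -/
abbrev diff₀ (br : L →ₗ[ℂ] L →ₗ[ℂ] L) : (List L → ℂ) →ₗ[ℂ] (List L → ℂ) :=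
  diff br (0 : L →ₗ[ℂ] Module.End ℂ ℂ)

/-- The closed cochains of degree `p` which vanish at `(F, H, E)`. -/
def Normalized (br : L →ₗ[ℂ] L →ₗ[ℂ] L) (E F H : L) (p : ℕ) : Submodule ℂ (List L → ℂ) :=
  Altern L ℂ ⊓ OfDegree L ℂ p ⊓ LinearMap.ker (diff₀ br) ⊓
    LinearMap.ker (LinearMap.proj (φ := fun _ : List L => ℂ) [F, H, E])

/-- The closed normalized cochains of positive degree are exact. -/
def NormalizedExact (br : L →ₗ[ℂ] L →ₗ[ℂ] L) (E F H : L) : Prop :=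
  ∀ p, p ≠ 0 → Normalized br E F H p ≤ (Altern L ℂ).map (diff₀ br)

/-- For a cocycle the Lie derivative is the differential of a contraction, and differentials vanish
at `(F, H, E)`. -/
theorem lie_mem_normalized (h : IsLieModule br (0 : L →ₗ[ℂ] Module.End ℂ ℂ))
    (hf : IsFrame br E F H A B) {p : ℕ} (hω : ω ∈ Normalized br E F H p) {i : ZMod 2} {x : L}
    (hx : x ∈ homog L i) : lie₀ br i x ω ∈ Normalized br E F H p := by
  obtain ⟨⟨⟨h1, h2⟩, h3⟩, h4⟩ := hω
  have h3 : diff₀ br ω = 0 := h3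
  refine ⟨⟨⟨lie_mem_altern h h1 hx, lie_mem_ofDegree _ _ _ _ h2⟩, ?_⟩, ?_⟩
  · change diff₀ br (lie₀ br i x ω) = 0
    rw [← lie_diff h h1.1 hx, h3, map_zero]
  · change lie₀ br i x ω [F, H, E] = 0
    rw [← diff_ins_of_closed _ h1.1 h3 hx]
    exact diff_apply_frame hf (ins_mem_altern h1 x)

theorem lie_mem_exact {p : ℕ}
    (hω : ω ∈ Normalized br E F H p) {i : ZMod 2} {x : L} (hx : x ∈ homog L i) :
    lie₀ br i x ω ∈ (Altern L ℂ).map (diff₀ br) :=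
  ⟨ins x ω, ins_mem_altern hω.1.1.1 x, diff_ins_of_closed _ hω.1.1.1.1 hω.1.2 hx⟩

/-- Normalized cocycles of degree p > 0 form a finite-dimensional module under Lie derivatives. It
has no nonzero invariants, so its Casimir operator is injective, hence surjective. Its values are
sums of Lie derivatives of cocycles, which are exact. -/
theorem sl_normalizedExact [FiniteDimensional ℂ L]
    (h : IsLieModule br (0 : L →ₗ[ℂ] Module.End ℂ ℂ)) (hf : IsFrame br E F H 0 0) :
    NormalizedExact br E F H := by
  intro p hp
  set K := Normalized br E F H p with hK
  have fin : FiniteDimensional ℂ K :=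
    finiteDimensional_multilin_ofDegree p fun W hW => ⟨hW.1.1.1.1, hW.1.1.2⟩
  let R (x : L) (hx : x ∈ homog L 0) : Module.End ℂ K :=
    (lie₀ br 0 x).restrict fun ω hω => lie_mem_normalized h hf hω hx
  have comm : ∀ x y, x ∈ homog L 0 → y ∈ homog L 0 → ∀ (ω : K),
      lie₀ br 0 x (lie₀ br 0 y ω.1) =
      lie₀ br 0 y (lie₀ br 0 x ω.1) + lie₀ br 0 (br x y) ω.1 := fun x y hx hy ω => by
    have := lie_lie h ω.2.1.1.1.1 (i := 0) (j := 0) hx hy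
    rwa [mul_zero, sgn_zero, one_smul, one_smul, add_zero] at this
  have inj := sl_casimir_injective (E := R E hf.E_mem) (F := R F hf.F_mem) (H := R H hf.H_mem)
    (LinearMap.ext fun ω => Subtype.ext <| by
      refine (comm E F hf.E_mem hf.F_mem ω).trans ?_
      rw [hf.EF, lie_smul_left _ _ ω.2.1.1.1.1]; rfl)
    (LinearMap.ext fun ω => Subtype.ext <| by
      refine (comm H E hf.H_mem hf.E_mem ω).trans ?_
      rw [hf.HE]; rfl)
    (LinearMap.ext fun ω => Subtype.ext <| by
      refine (comm H F hf.H_mem hf.F_mem ω).trans ?_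
      rw [hf.HF, ← neg_one_smul ℂ, lie_smul_left _ _ ω.2.1.1.1.1, neg_one_smul,
        ← sub_eq_add_neg]; rfl)
    (fun ω hE hF hH => Subtype.ext <| by
      -- With `A = B = 0` the values with odd arguments required by `eq_zero_of_invariant` vanish
      -- trivially; `ω [] = 0` holds because p ≠ 0.
      have m2 := ins_mem (ins_mem ω.2.1.1.1.1 F) H
      have n0 : ω.1 [F, H, 0, 0] = 0 := congrFun (ins_zero m2) [0]
      have n1 : ω.1 [F, 0, 0] = 0 := congrFun (ins_zero (ins_mem ω.2.1.1.1.1 F)) [0]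
      exact eq_zero_of_invariant hf ω.2.1.1.1 (congrArg Subtype.val hE) (congrArg Subtype.val hF)
        (congrArg Subtype.val hH) (ω.2.1.1.2 [] (Ne.symm hp)) ω.2.2 n0 n1)
  intro ω hω
  obtain ⟨η, hη⟩ := LinearMap.surjective_of_injective inj ⟨ω, hω⟩
  have hη' : lie₀ br 0 H (R H hf.H_mem η).1 + lie₀ br 0 H η.1 +
      lie₀ br 0 F (R E hf.E_mem η).1 = ω := congrArg Subtype.val hη
  rw [← hη']
  exact add_mem (add_mem (lie_mem_exact (R H hf.H_mem η).2 hf.H_mem)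
    (lie_mem_exact η.2 hf.H_mem)) (lie_mem_exact (R E hf.E_mem η).2 hf.F_mem)

/-- The argument is that for `sl(2)`. The graded commutator of two odd Lie derivatives is minus the
Lie derivative along their bracket, and this sign is the one in the hypotheses of
`osp_casimir_injective`. -/
theorem osp_normalizedExact [FiniteDimensional ℂ L]
    (h : IsLieModule br (0 : L →ₗ[ℂ] Module.End ℂ ℂ)) (hf : IsOspFrame br E F H A B) :
    NormalizedExact br E F H := by
  intro p hp
  set K := Normalized br E F H p with hK
  have fin : FiniteDimensional ℂ K :=
    finiteDimensional_multilin_ofDegree p fun W hW => ⟨hW.1.1.1.1, hW.1.1.2⟩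
  let R (i : ZMod 2) (x : L) (hx : x ∈ homog L i) : Module.End ℂ K :=
    (lie₀ br i x).restrict fun ω hω => lie_mem_normalized h hf.toIsFrame hω hx
  have comm : ∀ x y, x ∈ homog L 0 → ∀ j, y ∈ homog L j → ∀ (ω : K),
      lie₀ br 0 x (lie₀ br j y ω.1) =
      lie₀ br j y (lie₀ br 0 x ω.1) + lie₀ br j (br x y) ω.1 := fun x y hx j hy ω => by
    have := lie_lie h ω.2.1.1.1.1 (i := 0) (j := j) hx hy
    rwa [zero_mul, sgn_zero, one_smul, one_smul, zero_add] at this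
  have anti : ∀ x y, x ∈ homog L 1 → y ∈ homog L 1 → ∀ (ω : K),
      lie₀ br 1 x (lie₀ br 1 y ω.1) =
      -lie₀ br 1 y (lie₀ br 1 x ω.1) - lie₀ br 0 (br x y) ω.1 := fun x y hx hy ω => by
    have := lie_lie h ω.2.1.1.1.1 hx hy
    rwa [mul_one, sgn_one, neg_one_smul, neg_one_smul, one_add_one_zmod_two,
      ← sub_eq_add_neg] at this
  have inj := osp_casimir_injective (E := R 0 E hf.E_mem) (F := R 0 F hf.F_mem)
    (H := R 0 H hf.H_mem) (A := R 1 A hf.A_mem) (B := R 1 B hf.B_mem)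
    (LinearMap.ext fun ω => Subtype.ext <| by
      refine (comm E F hf.E_mem 0 hf.F_mem ω).trans ?_
      rw [hf.EF, lie_smul_left _ _ ω.2.1.1.1.1]; rfl)
    (LinearMap.ext fun ω => Subtype.ext <| by
      refine (comm H E hf.H_mem 0 hf.E_mem ω).trans ?_
      rw [hf.HE]; rfl)
    (LinearMap.ext fun ω => Subtype.ext <| by
      refine (comm H F hf.H_mem 0 hf.F_mem ω).trans ?_
      rw [hf.HF, ← neg_one_smul ℂ, lie_smul_left _ _ ω.2.1.1.1.1, neg_one_smul,
        ← sub_eq_add_neg]; rfl)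
    (LinearMap.ext fun ω => Subtype.ext <| by
      refine (comm H A hf.H_mem 1 hf.A_mem ω).trans ?_
      rw [hf.HA, lie_smul_left _ _ ω.2.1.1.1.1]; rfl)
    (LinearMap.ext fun ω => Subtype.ext <| by
      refine (comm H B hf.H_mem 1 hf.B_mem ω).trans ?_
      rw [hf.HB, ← neg_smul, lie_smul_left _ _ ω.2.1.1.1.1, neg_smul, ← sub_eq_add_neg]; rfl)
    (LinearMap.ext fun ω => Subtype.ext <| by
      refine (comm E A hf.E_mem 1 hf.A_mem ω).trans ?_
      rw [hf.EA, lie_zero_left _ _ ω.2.1.1.1.1, add_zero]; rfl)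
    (LinearMap.ext fun ω => Subtype.ext <| by
      refine (comm F A hf.F_mem 1 hf.A_mem ω).trans ?_
      rw [hf.FA]; rfl)
    (LinearMap.ext fun ω => Subtype.ext <| by
      refine (anti A B hf.A_mem hf.B_mem ω).trans ?_
      rw [hf.AB, ← neg_smul, lie_smul_left _ _ ω.2.1.1.1.1, neg_smul, sub_neg_eq_add]; rfl)
    (LinearMap.ext fun ω => Subtype.ext <| by
      have := anti A A hf.A_mem hf.A_mem ω
      rw [hf.AA, lie_smul_left _ _ ω.2.1.1.1.1] at this
      change lie₀ br 1 A (lie₀ br 1 A ω.1) = (-(1 / 4) : ℂ) • lie₀ br 0 E ω.1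
      -- The graded commutator of an odd operator with itself is twice its square, which turns the
      -- coefficient 1/2 of `AA` into 1/4.
      have e : (2 : ℂ) • lie₀ br 1 A (lie₀ br 1 A ω.1) = -((1 / 2 : ℂ) • lie₀ br 0 E ω.1) := by
        rw [two_smul]; nth_rewrite 1 [this]; abel
      have e2 := congrArg (fun z => (1 / 2 : ℂ) • z) e
      simp only [smul_smul] at e2
      norm_num at e2
      rw [e2, neg_smul, smul_smul]
      norm_num)
    (fun ω hE hF hH _ hB => Subtype.ext <|
      hf.eq_zero_of_invariant ω.2.1.1.1 (congrArg Subtype.val hE) (congrArg Subtype.val hF)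
        (congrArg Subtype.val hH) (congrArg Subtype.val hB) (ω.2.1.1.2 [] (Ne.symm hp)) ω.2.2)
  intro ω hω
  obtain ⟨η, hη⟩ := LinearMap.surjective_of_injective inj ⟨ω, hω⟩
  have hη' : lie₀ br 0 H (R 0 H hf.H_mem η).1 + (1 / 2 : ℂ) • lie₀ br 0 H η.1 +
      lie₀ br 0 F (R 0 E hf.E_mem η).1 + (2 : ℂ) • lie₀ br 1 B (R 1 A hf.A_mem η).1 = ω :=
    congrArg Subtype.val hη
  rw [← hη']
  exact add_mem (add_mem (add_mem (lie_mem_exact (R 0 H hf.H_mem η).2 hf.H_mem)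
    (Submodule.smul_mem _ _ (lie_mem_exact η.2 hf.H_mem)))
    (lie_mem_exact (R 0 E hf.E_mem η).2 hf.F_mem))
    (Submodule.smul_mem _ _ (lie_mem_exact (R 1 A hf.A_mem η).2 hf.B_mem))

/-- The `3`-cochain `κ(x, [y, z])` of a bilinear form `κ`. -/
def cartanCochain (br : L →ₗ[ℂ] L →ₗ[ℂ] L) (κ : L →ₗ[ℂ] L →ₗ[ℂ] ℂ) : List L → ℂ
  | [x, y, z] => κ x (br y z)
  | _ => 0

variable {κ : L →ₗ[ℂ] L →ₗ[ℂ] ℂ}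

theorem cartanCochain_of_length_ne {l : List L} (hl : l.length ≠ 3) :
    cartanCochain br κ l = 0 := by
  rcases l with _ | ⟨a, _ | ⟨b, _ | ⟨c, _ | ⟨d, l⟩⟩⟩⟩ <;> simp [cartanCochain] at hl ⊢

theorem cartanCochain_mem (h : IsLieModule br (0 : L →ₗ[ℂ] Module.End ℂ ℂ))
    (hκ : ∀ x y z, κ (br x y) z = κ x (br y z)) : cartanCochain br κ ∈ Altern L ℂ := by
  refine ⟨fun l₁ l₂ c x y => ?_, fun l₁ l₂ i x hx y => ?_⟩
  · rcases l₁ with _ | ⟨a, _ | ⟨b, _ | ⟨d, l₁⟩⟩⟩ <;> rcases l₂ with _ | ⟨e, _ | ⟨f, _ | ⟨g, l₂⟩⟩⟩ <;>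
      simp [cartanCochain]
  · rcases l₁ with _ | ⟨a, _ | ⟨b, l₁⟩⟩
    rotate_left 2
    · rw [cartanCochain_of_length_ne (by simp; omega), cartanCochain_of_length_ne (by simp; omega),
        neg_zero]
    all_goals rcases l₂ with _ | ⟨e, _ | ⟨f, l₂⟩⟩ <;>
      simp only [cartanCochain, List.nil_append, List.cons_append, neg_zero]
    · rw [← hκ, ← hκ, h.skew i x hx]; simp
    · rw [h.skew i x hx, map_neg]

/-- The Jacobi identity in the bracketed pair and the invariance of κ in the outer pair combine. -/
theorem lie_cartanCochain (h : IsLieModule br (0 : L →ₗ[ℂ] Module.End ℂ ℂ))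
    (hκ : ∀ x y z, κ (br x y) z = κ x (br y z)) {i : ZMod 2} {x : L} (hx : x ∈ homog L i) :
    lie₀ br i x (cartanCochain br κ) = 0 := by
  ext l
  by_cases hl : l.length = 3
  · obtain ⟨a, b, c, rfl⟩ := List.length_eq_three.1 hl
    simp only [lie_cons, lie_nil, ins_apply, cartanCochain, LinearMap.zero_apply, Pi.zero_apply]
    have e1 := congrArg (κ (tw i a)) (h.jacobi i x hx b c)
    have e2 := hκ (tw i a) x (br b c)
    rw [h.skew i x hx] at e2
    simp only [map_add, map_neg, LinearMap.neg_apply] at e1 e2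
    linear_combination e1 + e2
  · refine lie_eq_zero_of_length _ _ _ _ fun l' hl' =>
      cartanCochain_of_length_ne (by rwa [hl'])

/-- For the cochain Φ, the contraction ι_x Φ is minus the differential of the 1-cochain κ(x, ·).
Cartan's formula then gives ι_x dΦ = L_x Φ + d d κ(x, ·) = 0. -/
theorem diff_cartanCochain (h : IsLieModule br (0 : L →ₗ[ℂ] Module.End ℂ ℂ))
    (hκ : ∀ x y z, κ (br x y) z = κ x (br y z)) : diff₀ br (cartanCochain br κ) = 0 := by
  have mem := cartanCochain_mem h hκ
  ext l
  rcases l with _ | ⟨x, l⟩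
  · rfl
  refine eq_of_homog_head (diff_mem _ _ mem.1) (zero_mem _) l (fun i x hx => ?_) x
  let b : List L → ℂ := fun l => match l with
    | [y] => κ x y
    | _ => 0
  have hb : b ∈ Multilin L ℂ := fun l₁ l₂ c y z => by
    rcases l₁ with _ | ⟨a, l₁⟩ <;> rcases l₂ with _ | ⟨e, l₂⟩ <;> simp [b]
  have e : ins x (cartanCochain br κ) = -diff₀ br b := by
    ext l
    by_cases hl : l.length = 2
    · obtain ⟨y, z, rfl⟩ := List.length_eq_two.1 hl
      have := congrArg (fun y => κ x (br y z)) (comp_add_comp y)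
      simp only [map_add, LinearMap.add_apply] at this
      simp only [diff_cons, lie_cons, lie_nil, diff_nil, ins_apply, Pi.neg_apply, cartanCochain, b,
        LinearMap.zero_apply]
      linear_combination -this
    · rw [ins_apply, cartanCochain_of_length_ne (by simpa using hl), Pi.neg_apply,
        diff_eq_zero_of_length _ _ fun l' hl' => ?_, neg_zero]
      rcases l' with _ | ⟨a, _ | ⟨c, l'⟩⟩
      · rfl
      · exact absurd hl'.symm (by simpa using hl)
      · rfl
  have := ins_diff br 0 mem.1 hx
  rw [e, map_neg, diff_diff h hb, lie_cartanCochain h hκ hx] at this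
  simpa using congrFun this l

end TrivialCoefficients

/-! ### Cohomology concentrated in the degrees `0` and `3` -/

section SphereCohomology

variable {L M : Type*} [AddCommGroup L] [Module ℂ L] [SuperSpace L]
  [AddCommGroup M] [Module ℂ M] [SuperSpace M]
  {br : L →ₗ[ℂ] L →ₗ[ℂ] L} {act : L →ₗ[ℂ] Module.End ℂ M} {E F H A B : L}
  {ℓ : M →ₗ[ℂ] ℂ} {u : M}

/-- The values of cocycles in a module `M` can be retracted to the trivial submodule spanned by
`u`, by means of the invariant functional `ℓ`. -/
structure IsReduction (br : L →ₗ[ℂ] L →ₗ[ℂ] L) (act : L →ₗ[ℂ] Module.End ℂ M) (ℓ : M →ₗ[ℂ] ℂ)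
    (u : M) : Prop where
  act_unit : ∀ x, act x u = 0
  apply_act : ∀ x f, ℓ (act x f) = 0
  apply_unit : ℓ u = 1
  apply_par : ∀ f, ℓ (par f) = ℓ f
  par_unit : par u = u
  exists_eq : ∀ W ∈ Altern L M, diff br act W = 0 →
    ∃ η ∈ Altern L M, W = diff br act η + postcomp (ℓ.smulRight u) W

theorem isReduction_trivial (br : L →ₗ[ℂ] L →ₗ[ℂ] L) :
    IsReduction br (0 : L →ₗ[ℂ] Module.End ℂ ℂ) LinearMap.id 1 where
  act_unit _ := rfl
  apply_act _ _ := rfl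
  apply_unit := rfl
  apply_par _ := rfl
  par_unit := rfl
  exists_eq W _ _ := ⟨0, zero_mem _, by ext l; simp [postcomp_apply]⟩

/-- The identity operator splits into Casimir times `G` plus the projection to `u`, and the first
part of a cocycle is exact by the Casimir homotopy. -/
theorem isReduction_of_casimir {α : Type} [Fintype α] {dg : α → ZMod 2} {e' e : α → L}
    (h : IsLieModule br act) (ht : IsInvariantTensor br dg e' e)
    {G : Module.End ℂ M} (hG : ∀ x, G (par x) = par (G x))
    (hact : ∀ x f, G (act x f) = act x (G f)) (hu : ∀ x, act x u = 0)
    (hℓ : ∀ x f, ℓ (act x f) = 0) (hℓu : ℓ u = 1) (hp : ∀ f, ℓ (par f) = ℓ f) (hpu : par u = u)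
    (hGℓ : casimir act dg e' e * G + ℓ.smulRight u = 1) : IsReduction br act ℓ u where
  act_unit := hu
  apply_act := hℓ
  apply_unit := hℓu
  apply_par := hp
  par_unit := hpu
  exists_eq W hW hd := by
    refine ⟨_, casimirHomotopy_mem (act := act) (dg := dg) (e' := e') (e := e) (postcomp_mem G hW), ?_⟩
    rw [← casimir_comp_exact h ht hG hact hW hd]
    ext l
    have := congrArg (fun X : Module.End ℂ M => X (W l)) hGℓ
    exact this.symm

theorem ofForm_zero (p : ℕ) : ofForm p (0 : (Fin p → L) → M) = 0 := by
  ext l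
  by_cases h : l.length = p
  · obtain ⟨D, rfl⟩ := exists_eq_ofFn h
    rw [ofForm_ofFn]; rfl
  · exact ofForm_of_length_ne h 0

/-- If the Casimir operator is diagonalizable with a one-dimensional kernel, cocycles can be reduced
to the kernel. -/
theorem isReduction_of_diagonal {α ι : Type} [Fintype α] {dg : α → ZMod 2} {e' e : α → L}
    (h : IsLieModule br act) (ht : IsInvariantTensor br dg e' e) (b : Module.Basis ι ℂ M)
    {c : ι → ℂ} (hb : ∀ i, casimir act dg e' e (b i) = c i • b i) {i₀ : ι}
    (h0 : ∀ i, c i = 0 ↔ i = i₀) (hu : ∀ x, act x (b i₀) = 0) (hpu : par (b i₀) = b i₀)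
    (hΩ : ∀ x f, casimir act dg e' e (act x f) = act x (casimir act dg e' e f))
    (hΩp : ∀ f, casimir act dg e' e (par f) = par (casimir act dg e' e f)) :
    IsReduction br act (b.coord i₀) (b i₀) := by
  classical
  set Ω := casimir act dg e' e with hΩdef
  -- Because of 0⁻¹ = 0 this is the pseudoinverse of the Casimir operator, zero on its kernel.
  let G : Module.End ℂ M := b.constr ℂ fun i => (c i)⁻¹ • b i
  have hGb : ∀ i, G (b i) = (c i)⁻¹ • b i := fun i => b.constr_basis ℂ _ i
  have hcoord : ∀ f i, b.coord i (Ω f) = c i * b.coord i f := fun f i => by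
    have : b.coord i ∘ₗ Ω = c i • b.coord i := b.ext fun j => by
      simp only [LinearMap.comp_apply, hb, map_smul, LinearMap.smul_apply, smul_eq_mul,
        Module.Basis.coord_apply, Module.Basis.repr_self, Finsupp.single_apply]
      split_ifs with hij
      · rw [hij]
      · simp
    exact congrArg (fun X : M →ₗ[ℂ] ℂ => X f) this
  have hGcoord : ∀ f i, b.coord i (G f) = (c i)⁻¹ * b.coord i f := fun f i => by
    have : b.coord i ∘ₗ G = (c i)⁻¹ • b.coord i := b.ext fun j => by
      simp only [LinearMap.comp_apply, hGb, map_smul, LinearMap.smul_apply, smul_eq_mul,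
        Module.Basis.coord_apply, Module.Basis.repr_self, Finsupp.single_apply]
      split_ifs with hij
      · rw [hij]
      · simp
    exact congrArg (fun X : M →ₗ[ℂ] ℂ => X f) this
  -- An operator that commutes with Ω has no matrix entries between different eigenvalues, so it
  -- commutes with every function of Ω and in particular with `G`.
  have hGX : ∀ X : Module.End ℂ M, (∀ f, Ω (X f) = X (Ω f)) → ∀ f, G (X f) = X (G f) := by
    intro X hX f
    have : G ∘ₗ X = X ∘ₗ G := b.ext fun j => b.ext_elem fun i => by
      have e1 := hcoord (X (b j)) i
      rw [hX, hb, map_smul, map_smul, smul_eq_mul] at e1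
      change b.coord i (G (X (b j))) = b.coord i (X (G (b j)))
      rw [hGcoord, hGb, map_smul, map_smul, smul_eq_mul]
      by_cases hij : c i = c j
      · rw [hij]
      · have : b.coord i (X (b j)) = 0 := by
          have e2 : (c i - c j) * b.coord i (X (b j)) = 0 := by linear_combination -e1
          exact (mul_eq_zero.1 e2).resolve_left (sub_ne_zero.2 hij)
        rw [this, mul_zero, mul_zero]
    exact congrArg (fun X : M →ₗ[ℂ] M => X f) this
  have hℓΩ : ∀ f, b.coord i₀ (Ω f) = 0 := fun f => by rw [hcoord, (h0 i₀).2 rfl, zero_mul]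
  have hred : ∀ f, f = Ω (G f) + b.coord i₀ f • b i₀ := fun f => b.ext_elem fun i => by
    change b.coord i f = b.coord i (Ω (G f) + b.coord i₀ f • b i₀)
    have e : b.coord i (b i₀) = if i₀ = i then 1 else 0 := by simp [Finsupp.single_apply]
    rw [map_add, hcoord, hGcoord, map_smul, e]
    by_cases hi : i = i₀
    · subst hi
      simp [(h0 i).2 rfl]
    · have : c i ≠ 0 := fun h => hi ((h0 i).1 h)
      rw [if_neg (Ne.symm hi), smul_zero, add_zero, mul_inv_cancel_left₀ this]
  refine isReduction_of_casimir h ht (G := G) (hGX par hΩp) (fun x => hGX (act x) (hΩ x)) hu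
    (fun x f => ?_) (by simp) (fun f => ?_) hpu (LinearMap.ext fun f => (hred f).symm)
  · rw [hred f, map_add, map_smul, hu, smul_zero, add_zero, ← hΩ, hℓΩ]
  · conv_lhs => rw [hred f, map_add, map_smul, hpu, ← hΩp, map_add, hℓΩ, zero_add]
    simp

/-- The arguments `(F, H, E)` of a `3`-form, and the empty list of arguments of a `0`-form. -/
def frameArgs (E F H : L) (p : ℕ) : Fin p → L := fun r => [F, H, E].getD r 0

theorem ofFn_frameArgs_three : List.ofFn (frameArgs E F H 3) = [F, H, E] := by
  simp [frameArgs, List.ofFn_succ]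

/-- The cohomology is `ℂ` in the degrees `0` and `3`, where it is detected by the value of `ℓ` at
`(F, H, E)` and generated by a cocycle with the value `u`, and it vanishes in all other degrees. -/
structure HasSphereCohomology (br : L →ₗ[ℂ] L →ₗ[ℂ] L) (act : L →ₗ[ℂ] Module.End ℂ M)
    (E F H : L) (ℓ : M →ₗ[ℂ] ℂ) (u : M) : Prop where
  E_mem : E ∈ homog L 0
  F_mem : F ∈ homog L 0
  H_mem : H ∈ homog L 0
  apply_par : ∀ f, ℓ (par f) = ℓ f
  apply_unit : ℓ u = 1
  exact_of_ne : ∀ p, ¬(p = 0 ∨ p = 3) → ∀ ω ∈ Cocycles br act p, ω ∈ Coboundaries br act p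
  exact_iff : ∀ p, p = 0 ∨ p = 3 → ∀ ω ∈ Cocycles br act p,
    ω ∈ Coboundaries br act p ↔ ℓ (ω (frameArgs E F H p)) = 0
  exists_cocycle : ∀ p, p = 0 ∨ p = 3 →
    ∃ ω ∈ Cocycles br act p, parForm L M p ω = ω ∧ ω (frameArgs E F H p) = u

theorem IsReduction.diff_postcomp_apply (hr : IsReduction br act ℓ u) (W : List L → M) :
    diff₀ br (postcomp ℓ W) = postcomp ℓ (diff br act W) :=
  diff_postcomp br act hr.apply_par (fun x f => by simp [hr.apply_act]) W

theorem IsReduction.diff_postcomp_unit (hr : IsReduction br act ℓ u) (W : List L → ℂ) :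
    diff br act (postcomp (LinearMap.toSpanSingleton ℂ M u) W) =
      postcomp (LinearMap.toSpanSingleton ℂ M u) (diff₀ br W) :=
  diff_postcomp br _ (fun c => by simp [hr.par_unit]; rfl) (fun x f => by simp [hr.act_unit]) W

/-- Up to an exact form the cocycle is `u` times the scalar cocycle obtained by applying `ℓ`. That
one is normalized by hypothesis `h3`, hence exact, and a primitive of it is multiplied by `u`. -/
theorem IsReduction.mem_coboundaries (h : IsLieModule br act) (hr : IsReduction br act ℓ u)
    (hN : NormalizedExact br E F H) {p : ℕ} {ω : (Fin (p + 1) → L) → M}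
    (hω : ω ∈ Cocycles br act (p + 1))
    (h3 : ℓ (ofForm (p + 1) ω [F, H, E]) = 0) : ω ∈ Coboundaries br act (p + 1) := by
  set W := ofForm (p + 1) ω with hWdef
  have hW : W ∈ Altern L M := ofForm_mem hω.1
  have hd : diff br act W = 0 := by
    rw [hWdef, ← extD_ofForm h hω.1, LinearMap.mem_ker.1 hω.2]
    exact ofForm_zero _
  obtain ⟨η, hη, hWη⟩ := hr.exists_eq W hW hd
  have hmem : postcomp ℓ W ∈ Normalized br E F H (p + 1) := by
    refine ⟨⟨⟨postcomp_mem ℓ hW, fun l hl => ?_⟩, ?_⟩, h3⟩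
    · rw [postcomp_apply, hWdef, ofForm_of_length_ne hl, map_zero]
    · change diff₀ br (postcomp ℓ W) = 0
      rw [hr.diff_postcomp_apply, hd, map_zero]
  obtain ⟨ζ, hζ, hζW⟩ := hN (p + 1) p.succ_ne_zero hmem
  set θ := η + postcomp (LinearMap.toSpanSingleton ℂ M u) ζ with hθdef
  have hθ : θ ∈ Altern L M := add_mem hη (postcomp_mem _ hζ)
  have hWθ : W = diff br act θ := by
    rw [hθdef, map_add, hr.diff_postcomp_unit, hζW]
    exact hWη
  refine ⟨toForm p θ, toForm_mem hθ p, ?_⟩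
  rw [extD_toForm h p hθ, ← hWθ, hWdef, toForm_ofForm]

theorem toForm_mem_cocycles (h : IsLieModule br act) {p : ℕ} {W : List L → M}
    (hW : W ∈ Altern L M) (hd : diff br act W = 0) : toForm p W ∈ Cocycles br act p := by
  refine ⟨toForm_mem hW p, ?_⟩
  change extD br act p (toForm p W) = 0
  rw [extD_toForm h p hW, hd, map_zero]

/-- In degree 0 there are no coboundaries and closed elements are multiples of `u`. In degree 3 the
value at `(F, H, E)` kills exact forms, and the Cartan cocycle takes there the value κ(F, [H, E]) =
κ(F, E), by which it is divided. -/
theorem IsReduction.hasSphereCohomology (h : IsLieModule br act)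
    (h0 : IsLieModule br (0 : L →ₗ[ℂ] Module.End ℂ ℂ)) (hr : IsReduction br act ℓ u)
    (hf : IsFrame br E F H A B) (hN : NormalizedExact br E F H) {κ : L →ₗ[ℂ] L →ₗ[ℂ] ℂ}
    (hκ : ∀ x y z, κ (br x y) z = κ x (br y z)) (hκp : ∀ x y, κ (par x) (par y) = κ x y)
    (hκ0 : κ F E ≠ 0) : HasSphereCohomology br act E F H ℓ u where
  E_mem := hf.E_mem
  F_mem := hf.F_mem
  H_mem := hf.H_mem
  apply_par := hr.apply_par
  apply_unit := hr.apply_unit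
  exact_of_ne p hp ω hω := by
    rcases p with _ | p
    · exact absurd (Or.inl rfl) hp
    · refine hr.mem_coboundaries h hN hω ?_
      rw [ofForm_of_length_ne (by simpa using fun h => hp (Or.inr (by omega))), map_zero]
  exact_iff p hp ω hω := by
    rcases hp with rfl | rfl
    · have hW : ofForm 0 ω ∈ Altern L M := ofForm_mem hω.1
      have hd : diff br act (ofForm 0 ω) = 0 := by
        rw [← extD_ofForm h hω.1, LinearMap.mem_ker.1 hω.2]
        exact ofForm_zero _
      obtain ⟨η, hη, hWη⟩ := hr.exists_eq _ hW hd
      have e := congrFun hWη []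
      have e1 : ∀ D, ω D = ofForm 0 ω [] := fun D => congrArg ω (Subsingleton.elim _ _)
      rw [Pi.add_apply, diff_nil, zero_add, postcomp_apply, ← e1 (frameArgs E F H 0)] at e
      constructor
      · intro h'
        rw [(Submodule.mem_bot ℂ).1 h', Pi.zero_apply, map_zero]
      · intro h'
        refine (Submodule.mem_bot ℂ).2 (funext fun D => ?_)
        rw [Subsingleton.elim D (frameArgs E F H 0), e]
        simp [h']
    · have e : ω (frameArgs E F H 3) = ofForm 3 ω [F, H, E] := by
        rw [← ofFn_frameArgs_three, ofForm_ofFn]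
      rw [e]
      refine ⟨?_, fun h' => hr.mem_coboundaries h hN hω h'⟩
      rintro ⟨η, hη, rfl⟩
      rw [extD_ofForm h hη, ← postcomp_apply, ← hr.diff_postcomp_apply]
      exact diff_apply_frame hf (postcomp_mem ℓ (ofForm_mem hη))
  exists_cocycle p hp := by
    have hc : ∀ {W : List L → ℂ}, W ∈ Altern L ℂ →
        postcomp (LinearMap.toSpanSingleton ℂ M u) W ∈ Altern L M := fun hW => postcomp_mem _ hW
    rcases hp with rfl | rfl
    · let W : List L → ℂ := fun l => match l with
        | [] => 1
        | _ => 0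
      have hW : W ∈ Altern L ℂ := by
        refine ⟨fun l₁ l₂ c x y => ?_, fun l₁ l₂ i x hx y => ?_⟩ <;> rcases l₁ with _ | ⟨a, l₁⟩ <;>
          simp [W]
      have hd : diff₀ br W = 0 := by
        ext l
        rcases l with _ | ⟨x, _ | ⟨y, l⟩⟩
        · rfl
        · simp [diff_cons, lie_nil, diff_nil]
        · exact diff_eq_zero_of_length _ _ fun l' hl' => by
            rcases l' with _ | ⟨z, l'⟩
            · simp at hl'
            · rfl
      refine ⟨toForm 0 (postcomp (LinearMap.toSpanSingleton ℂ M u) W),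
        toForm_mem_cocycles h (hc hW) (by rw [hr.diff_postcomp_unit, hd, map_zero]), ?_, ?_⟩
      · funext D
        change par ((1 : ℂ) • u) = (1 : ℂ) • u
        rw [one_smul, hr.par_unit]
      · exact one_smul ℂ u
    · have hd := diff_cartanCochain h0 hκ
      refine ⟨(κ F E)⁻¹ • toForm 3 (postcomp (LinearMap.toSpanSingleton ℂ M u)
        (cartanCochain br κ)), Submodule.smul_mem _ _ (toForm_mem_cocycles h
          (hc (cartanCochain_mem h0 hκ)) (by rw [hr.diff_postcomp_unit, hd, map_zero])), ?_, ?_⟩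
      · rw [map_smul]
        congr 1
        funext D
        have e : ∀ D : Fin 3 → L, List.ofFn D = [D 0, D 1, D 2] := fun D => by
          simp [List.ofFn_succ]
        change par (toForm 3 (postcomp (LinearMap.toSpanSingleton ℂ M u) (cartanCochain br κ))
          fun r => par (D r)) = _
        simp only [toForm_apply, e, postcomp_apply, cartanCochain, ← h0.par_br, hκp,
          LinearMap.toSpanSingleton_apply, map_smul, hr.par_unit]
      · simp only [Pi.smul_apply, toForm_apply, ofFn_frameArgs_three, postcomp_apply,
          cartanCochain, hf.HE, LinearMap.toSpanSingleton_apply, smul_smul]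
        rw [inv_mul_cancel₀ hκ0, one_smul]

variable {L' : Type*} [AddCommGroup L'] [Module ℂ L'] [SuperSpace L']
  {br' : L' →ₗ[ℂ] L' →ₗ[ℂ] L'} {act' : L' →ₗ[ℂ] Module.End ℂ M}

/-! ### Induced maps on cocycles and coboundaries. -/

section Functoriality

variable {M' : Type*} [AddCommGroup M'] [Module ℂ M'] [SuperSpace M']
  {act'' : L' →ₗ[ℂ] Module.End ℂ M'} {j : L' →ₗ[ℂ] L} {m : M →ₗ[ℂ] M'}

theorem mapForm_mem_cocycles (hj : ∀ x, j (par x) = par (j x)) (hm : ∀ x, m (par x) = par (m x))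
    (hbr : ∀ x y, j (br' x y) = br (j x) (j y)) (hact : ∀ x f, m (act (j x) f) = act'' x (m f))
    {p : ℕ} {ω : (Fin p → L) → M} (hω : ω ∈ Cocycles br act p) :
    mapForm j m p ω ∈ Cocycles br' act'' p := by
  refine ⟨mapForm_mem hj hω.1, ?_⟩
  change extD br' act'' p (mapForm j m p ω) = 0
  rw [extD_mapForm hj hm hbr hact, LinearMap.mem_ker.1 hω.2, map_zero]

theorem mapForm_mem_coboundaries (hj : ∀ x, j (par x) = par (j x))
    (hm : ∀ x, m (par x) = par (m x)) (hbr : ∀ x y, j (br' x y) = br (j x) (j y))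
    (hact : ∀ x f, m (act (j x) f) = act'' x (m f)) {p : ℕ} {ω : (Fin p → L) → M}
    (hω : ω ∈ Coboundaries br act p) : mapForm j m p ω ∈ Coboundaries br' act'' p := by
  rcases p with _ | p
  · rw [(Submodule.mem_bot ℂ).1 hω, map_zero]
    exact zero_mem _
  · obtain ⟨η, hη, rfl⟩ := hω
    exact ⟨mapForm j m p η, mapForm_mem hj hη, extD_mapForm hj hm hbr hact p η⟩

end Functoriality

theorem HasSphereCohomology.transport (hc : HasSphereCohomology br act E F H ℓ u) (e : L ≃ₗ[ℂ] L')
    (he : ∀ x, e (par x) = par (e x)) (hbr : ∀ x y, e (br x y) = br' (e x) (e y))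
    (hact : ∀ x f, act' (e x) f = act x f) :
    HasSphereCohomology br' act' (e E) (e F) (e H) ℓ u := by
  have he' : ∀ x, e.symm (par x) = par (e.symm x) := fun x => e.injective (by simp [he])
  have hbr' : ∀ x y, e.symm (br' x y) = br (e.symm x) (e.symm y) := fun x y =>
    e.injective (by simp [hbr])
  have hact' : ∀ x f, act (e.symm x) f = act' x f := fun x f => by
    rw [← hact, e.apply_symm_apply]
  have inv : ∀ {p : ℕ} (ω : (Fin p → L') → M), mapForm e.symm.toLinearMap LinearMap.id p
      (mapForm e.toLinearMap LinearMap.id p ω) = ω := fun ω => by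
    ext D; simp [mapForm_apply]
  have cyc : ∀ {p : ℕ} {ω : (Fin p → L') → M}, ω ∈ Cocycles br' act' p →
      mapForm e.toLinearMap LinearMap.id p ω ∈ Cocycles br act p := fun hω =>
    mapForm_mem_cocycles (m := LinearMap.id) he (fun _ => rfl) hbr hact hω
  have cyc' : ∀ {p : ℕ} {ω : (Fin p → L) → M}, ω ∈ Cocycles br act p →
      mapForm e.symm.toLinearMap LinearMap.id p ω ∈ Cocycles br' act' p := fun hω =>
    mapForm_mem_cocycles (m := LinearMap.id) he' (fun _ => rfl) hbr' hact' hω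
  have bdy : ∀ {p : ℕ} {ω : (Fin p → L') → M}, ω ∈ Coboundaries br' act' p →
      mapForm e.toLinearMap LinearMap.id p ω ∈ Coboundaries br act p := fun hω =>
    mapForm_mem_coboundaries (m := LinearMap.id) he (fun _ => rfl) hbr hact hω
  have bdy' : ∀ {p : ℕ} {ω : (Fin p → L) → M}, ω ∈ Coboundaries br act p →
      mapForm e.symm.toLinearMap LinearMap.id p ω ∈ Coboundaries br' act' p := fun hω =>
    mapForm_mem_coboundaries (m := LinearMap.id) he' (fun _ => rfl) hbr' hact' hω
  have args : ∀ p, frameArgs (e E) (e F) (e H) p = fun r => e (frameArgs E F H p r) := fun p => by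
    ext r
    unfold frameArgs
    rcases (r : ℕ) with _ | _ | _ | n <;> simp
  have ev : ∀ x ∈ homog L 0, e x ∈ homog L' 0 := fun x hx => by
    rw [mem_homog_zero, ← he, mem_homog_zero.1 hx]
  refine ⟨ev _ hc.E_mem, ev _ hc.F_mem, ev _ hc.H_mem, hc.apply_par, hc.apply_unit,
    fun p hp ω hω => ?_, fun p hp ω hω => ?_, fun p hp => ?_⟩
  · rw [← inv ω]
    exact bdy' (hc.exact_of_ne p hp _ (cyc hω))
  · have := hc.exact_iff p hp _ (cyc hω)
    rw [args]
    refine ⟨fun h => this.1 (bdy h), fun h => ?_⟩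
    rw [← inv ω]
    exact bdy' (this.2 h)
  · obtain ⟨ω, hω, hpar, h1⟩ := hc.exists_cocycle p hp
    refine ⟨mapForm e.symm.toLinearMap LinearMap.id p ω, cyc' hω, ?_, ?_⟩
    · ext D
      have := congrFun hpar fun r => e.symm (D r)
      change par (ω fun r => par (e.symm (D r))) = ω fun r => e.symm (D r) at this
      change par (ω fun r => e.symm (par (D r))) = ω fun r => e.symm (D r)
      simpa only [he'] using this
    · rw [args]
      simpa [mapForm_apply] using h1

/-! ### Dimension and grading of the cohomology. -/

section Consequences

theorem HasSphereCohomology.subsingleton (hc : HasSphereCohomology br act E F H ℓ u) {p : ℕ}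
    (hp : ¬(p = 0 ∨ p = 3)) : Subsingleton (Cohomology br act p) :=
  Submodule.Quotient.subsingleton_iff.2
    (eq_top_iff.2 fun ω _ => hc.exact_of_ne p hp ω.1 ω.2)

theorem HasSphereCohomology.exists_equiv (hc : HasSphereCohomology br act E F H ℓ u) {p : ℕ}
    (hp : p = 0 ∨ p = 3) : ∃ e : Cohomology br act p ≃ₗ[ℂ] ℂ,
      ∀ ω : Cocycles br act p, e (cls br act p ω) = ℓ (ω.1 (frameArgs E F H p)) := by
  let f : Cocycles br act p →ₗ[ℂ] ℂ :=
    ℓ ∘ₗ LinearMap.proj (φ := fun _ : Fin p → L => M) (frameArgs E F H p) ∘ₗ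
      (Cocycles br act p).subtype
  have hf : (Coboundaries br act p).submoduleOf (Cocycles br act p) = LinearMap.ker f := by
    ext ω
    exact hc.exact_iff p hp ω.1 ω.2
  have hs : Function.Surjective f := by
    obtain ⟨ω, hω, -, h1⟩ := hc.exists_cocycle p hp
    intro c
    refine ⟨c • ⟨ω, hω⟩, ?_⟩
    rw [map_smul]
    change c • ℓ (ω (frameArgs E F H p)) = c
    rw [h1, hc.apply_unit, smul_eq_mul, mul_one]
  exact ⟨(Submodule.quotEquivOfEq _ _ hf).trans (f.quotKerEquivOfSurjective hs), fun ω => rfl⟩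

/-- The generating cocycles are even. -/
theorem HasSphereCohomology.cohomologyPart_zero (hc : HasSphereCohomology br act E F H ℓ u) (p : ℕ) :
    cohomologyPart br act p 0 = ⊤ := by
  by_cases hp : p = 0 ∨ p = 3
  · obtain ⟨e, he⟩ := hc.exists_equiv hp
    obtain ⟨ω, hω, hpar, h1⟩ := hc.exists_cocycle p hp
    refine eq_top_iff.2 fun c _ => ?_
    have : c = e c • cls br act p ⟨ω, hω⟩ := e.injective (by
      rw [map_smul, he, congrArg ℓ h1, hc.apply_unit, smul_eq_mul, mul_one])
    rw [this]
    refine Submodule.smul_mem _ _ ⟨⟨ω, hω⟩, ?_, rfl⟩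
    change parForm L M p ω - sgn 0 • ω = 0
    rw [hpar, sgn_zero, one_smul, sub_self]
  · have := hc.subsingleton hp
    exact Subsingleton.elim _ _

/-- The detecting arguments are even and `ℓ` ignores the grading involution, so the detecting number
of an odd cocycle equals its own negative. -/
theorem HasSphereCohomology.cohomologyPart_one (hc : HasSphereCohomology br act E F H ℓ u) (p : ℕ) :
    cohomologyPart br act p 1 = ⊥ := by
  by_cases hp : p = 0 ∨ p = 3
  · obtain ⟨e, he⟩ := hc.exists_equiv hp
    refine eq_bot_iff.2 ?_
    rintro _ ⟨ω, hω, rfl⟩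
    refine (Submodule.mem_bot ℂ).2 (e.injective ?_)
    have h1 : parForm L M p ω.1 - sgn 1 • ω.1 = 0 := hω
    rw [sgn_one, neg_one_smul, sub_neg_eq_add] at h1
    have h2 := congrArg ℓ (congrFun h1 (frameArgs E F H p))
    have args : (fun r => par (frameArgs E F H p r)) = frameArgs E F H p := by
      ext r
      unfold frameArgs
      rcases (r : ℕ) with _ | _ | _ | n <;>
        simp [mem_homog_zero.1 hc.E_mem, mem_homog_zero.1 hc.F_mem, mem_homog_zero.1 hc.H_mem]
    change ℓ (par (ω.1 fun r => par (frameArgs E F H p r)) + ω.1 (frameArgs E F H p)) = ℓ 0 at h2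
    rw [args, map_add, hc.apply_par, map_zero] at h2
    rw [he, map_zero]
    linear_combination h2 / 2
  · have := hc.subsingleton hp
    exact Subsingleton.elim _ _

end Consequences

end SphereCohomology

/-! ### The Lie superalgebras `osp(1|2)` and `sl(2)` -/

section Modules

variable {M : Type*} [AddCommGroup M] [Module ℂ M] [SuperSpace M]

theorem superComm_of_mem {i : ZMod 2} {X : Module.End ℂ M} (hX : X ∈ homog (Module.End ℂ M) i)
    (Y : Module.End ℂ M) : superComm X Y = X * Y - tw i Y * X := by
  rw [superComm_apply, comp_of_mem hX, comp_of_mem hX]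
  rcases zmod_two_cases i with rfl | rfl <;> simp [tw_zero, tw_one]

theorem superComm_tw {i : ZMod 2} {X : Module.End ℂ M} (hX : X ∈ homog (Module.End ℂ M) i)
    (Y : Module.End ℂ M) : superComm (tw i Y) X = -superComm X Y := by
  rw [superComm_of_mem hX, superComm_apply, comp_zero_apply, comp_one_apply]
  rcases zmod_two_cases i with rfl | rfl
  · rw [tw_zero, mem_homog_zero.1 hX]
    simp only [mul_smul_comm, mul_add, mul_sub]; module
  · rw [tw_one, mem_homog_one.1 hX, par_par]
    simp only [mul_smul_comm, mul_add, mul_sub, neg_mul]; module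

theorem superComm_mem_homog {i : ZMod 2} {X : Module.End ℂ M}
    (hX : X ∈ homog (Module.End ℂ M) i) :
    superComm X ∈ homog (Module.End ℂ (Module.End ℂ M)) i := by
  rw [mem_homog, par_superComm_left, mem_homog.1 hX, map_smul]

theorem superComm_superComm_apply {i : ZMod 2} {X : Module.End ℂ M}
    (hX : X ∈ homog (Module.End ℂ M) i) (Y Z : Module.End ℂ M) :
    superComm (superComm X Y) Z =
      superComm X (superComm Y Z) - superComm (tw i Y) (superComm X Z) := by
  have := congrArg (fun W : Module.End ℂ (Module.End ℂ M) => W Z) (superComm_superComm X Y)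
  rw [superComm_of_mem (superComm_mem_homog hX)] at this
  have e : tw i (superComm Y) = superComm (tw i Y) := by
    rcases zmod_two_cases i with rfl | rfl
    · rw [tw_zero, tw_zero]
    · rw [tw_one, tw_one, par_superComm_left]
  rw [e] at this
  exact this.symm

/-- `End M` is a Lie superalgebra under the graded commutator. -/
theorem isLieModule_end : IsLieModule (superComm (M := M)) superComm where
  par_br := par_superComm
  par_act := par_superComm
  skew _ _ hX Y := superComm_tw hX Y
  jacobi _ _ hX Y Z := by rw [superComm_superComm_apply hX]; abel
  act_br _ _ hX Y Z := superComm_superComm_apply hX Y Z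

variable {L L' : Type*} [AddCommGroup L] [Module ℂ L] [SuperSpace L] [AddCommGroup L'] [Module ℂ L']
  [SuperSpace L'] {br : L →ₗ[ℂ] L →ₗ[ℂ] L} {br' : L' →ₗ[ℂ] L' →ₗ[ℂ] L'}
  {act : L →ₗ[ℂ] Module.End ℂ M}

theorem IsLieModule.trivial (h : IsLieModule br act) :
    IsLieModule br (0 : L →ₗ[ℂ] Module.End ℂ ℂ) where
  par_br := h.par_br
  par_act _ _ := rfl
  skew := h.skew
  jacobi := h.jacobi
  act_br _ _ _ _ _ := by simp

/-- In this way `osp(1|2)` inherits the graded Lie axioms from the operators on V, and the Jacobi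
identity need not be checked on structure constants. -/
theorem IsLieModule.comap (h : IsLieModule br act) {j : L' →ₗ[ℂ] L} (hj : Function.Injective j)
    (hp : ∀ x, j (par x) = par (j x)) (hbr : ∀ x y, j (br' x y) = br (j x) (j y)) :
    IsLieModule br' (act ∘ₗ j) := by
  have htw : ∀ i x, j (tw i x) = tw i (j x) := fun i x => by
    rcases zmod_two_cases i with rfl | rfl <;> simp [tw_zero, tw_one, hp]
  have hm : ∀ i, ∀ w ∈ homog L' i, j w ∈ homog L i := fun i w hw => by
    rw [mem_homog, ← hp, mem_homog.1 hw, map_smul]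
  refine ⟨fun x y => hj ?_, fun x f => ?_, fun i w hw x => hj ?_, fun i w hw y z => hj ?_,
    fun i w hw y f => ?_⟩
  · simp only [hp, hbr, h.par_br]
  · simp only [LinearMap.comp_apply, hp, h.par_act]
  · simp only [hbr, htw, map_neg, h.skew i _ (hm i w hw)]
  · simp only [hbr, htw, map_add, h.jacobi i _ (hm i w hw)]
  · simp only [LinearMap.comp_apply, hbr, htw, h.act_br i _ (hm i w hw)]

end Modules

/-! ### Quadratic Casimir tensors. -/

section InvariantTensors

variable {L : Type*} [AddCommGroup L] [Module ℂ L] [SuperSpace L]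
  {br : L →ₗ[ℂ] L →ₗ[ℂ] L} {E F H A B : L}

theorem IsFrame.span_even (hf : IsFrame br E F H A B) {x : L} (hx : x ∈ homog L 0) :
    ∃ a b c : ℂ, x = a • E + (b • F + c • H) := by
  obtain ⟨a, b, c, r, s, h⟩ := hf.span x
  refine ⟨a, b, c, ?_⟩
  have h1 := mem_homog_zero.1 hx
  rw [h] at h1
  simp only [map_add, map_smul, mem_homog_zero.1 hf.E_mem, mem_homog_zero.1 hf.F_mem,
    mem_homog_zero.1 hf.H_mem, mem_homog_one.1 hf.A_mem, mem_homog_one.1 hf.B_mem] at h1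
  have h2 : (2 : ℂ) • (r • A + s • B) = 0 := by
    linear_combination (norm := module) -h1
  rw [h, (smul_eq_zero.1 h2).resolve_left two_ne_zero, add_zero]

theorem IsFrame.span_odd (hf : IsFrame br E F H A B) {x : L} (hx : x ∈ homog L 1) :
    ∃ r s : ℂ, x = r • A + s • B := by
  obtain ⟨a, b, c, r, s, h⟩ := hf.span x
  refine ⟨r, s, ?_⟩
  have h1 := mem_homog_one.1 hx
  rw [h] at h1
  simp only [map_add, map_smul, mem_homog_zero.1 hf.E_mem, mem_homog_zero.1 hf.F_mem,
    mem_homog_zero.1 hf.H_mem, mem_homog_one.1 hf.A_mem, mem_homog_one.1 hf.B_mem] at h1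
  have h2 : (2 : ℂ) • (a • E + (b • F + c • H)) = 0 := by
    linear_combination (norm := module) h1
  have h3 := (smul_eq_zero.1 h2).resolve_left two_ne_zero
  rw [h]
  linear_combination (norm := module) h3

theorem IsFrame.isInvariantTensor (hf : IsFrame br E F H 0 0) :
    IsInvariantTensor br (α := Fin 3) 0 ![(1 / 2 : ℂ) • E, (1 / 2 : ℂ) • F, H] ![F, E, H] where
  left_mem a := by
    fin_cases a
    · exact Submodule.smul_mem _ _ hf.E_mem
    · exact Submodule.smul_mem _ _ hf.F_mem
    · exact hf.H_mem
  right_mem a := by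
    fin_cases a
    · exact hf.F_mem
    · exact hf.E_mem
    · exact hf.H_mem
  invariant j y hy β := by
    rcases zmod_two_cases j with rfl | rfl
    · obtain ⟨a, b, c, rfl⟩ := hf.span_even hy
      simp [Fin.sum_univ_three, hf.EE, hf.EF, hf.EH, hf.FE, hf.FF, hf.FH, hf.HE, hf.HF, hf.HH,
        sgn_zero]
      ring
    · obtain ⟨r, s, rfl⟩ := hf.span_odd hy
      simp

/-- The tensor is symmetric on the even and skew on the odd generators. The factor `sgn 1` in
`casimir` turns its odd terms into AB - BA. -/
theorem IsOspFrame.isInvariantTensor (hf : IsOspFrame br E F H A B) :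
    IsInvariantTensor br (α := Fin 5) ![0, 0, 0, 1, 1]
      ![(1 / 2 : ℂ) • E, (1 / 2 : ℂ) • F, H, -A, B] ![F, E, H, B, A] where
  left_mem a := by
    fin_cases a
    · exact Submodule.smul_mem _ _ hf.E_mem
    · exact Submodule.smul_mem _ _ hf.F_mem
    · exact hf.H_mem
    · exact neg_mem hf.A_mem
    · exact hf.B_mem
  right_mem a := by
    fin_cases a
    · exact hf.F_mem
    · exact hf.E_mem
    · exact hf.H_mem
    · exact hf.B_mem
    · exact hf.A_mem
  invariant j y hy β := by
    rcases zmod_two_cases j with rfl | rfl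
    · obtain ⟨a, b, c, rfl⟩ := hf.span_even hy
      simp [Fin.sum_univ_five, hf.EE, hf.EF, hf.EH, hf.FE, hf.FF, hf.FH, hf.HE, hf.HF, hf.HH,
        hf.EA, hf.EB, hf.FA, hf.FB, hf.HA, hf.HB, sgn_zero]
      ring
    · obtain ⟨r, s, rfl⟩ := hf.span_odd hy
      simp [Fin.sum_univ_five, hf.AE, hf.AF, hf.AH, hf.BE, hf.BF, hf.BH, hf.AA, hf.AB, hf.BA,
        hf.BB, sgn_zero, sgn_one]
      ring

end InvariantTensors

/-! ### Generators of `osp(1|2)` and faithfulness of the representation. -/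

section Osp

/-- `J₊`, `J₋`, `J₃`, `J₄`, `J₅` as elements of `osp(1|2)`. -/
def oE : Osp := (![1, Complex.I, 0], 0)
def oF : Osp := (![1, -Complex.I, 0], 0)
def oH : Osp := (![0, 0, 1], 0)
def oA : Osp := (0, ![1, 0])
def oB : Osp := (0, ![0, 1])

@[simp] theorem oE_fst : oE.1 = ![1, Complex.I, 0] := rfl
@[simp] theorem oE_snd : oE.2 = 0 := rfl
@[simp] theorem oF_fst : oF.1 = ![1, -Complex.I, 0] := rfl
@[simp] theorem oF_snd : oF.2 = 0 := rfl
@[simp] theorem oH_fst : oH.1 = ![0, 0, 1] := rfl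
@[simp] theorem oH_snd : oH.2 = 0 := rfl
@[simp] theorem oA_fst : oA.1 = 0 := rfl
@[simp] theorem oA_snd : oA.2 = ![1, 0] := rfl
@[simp] theorem oB_fst : oB.1 = 0 := rfl
@[simp] theorem oB_snd : oB.2 = ![0, 1] := rfl

theorem rep_eq (q : ℕ) (x : Osp) : rep q x =
    ((x.1 0 - Complex.I * x.1 1) / 2) • Jplus q + ((x.1 0 + Complex.I * x.1 1) / 2) • Jminus q +
      x.1 2 • J3 q + x.2 0 • J4 q + x.2 1 • J5 q := by
  have hJ2 : J2 q = (-(Complex.I / 2)) • (Jplus q - Jminus q) := by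
    rw [J2]; congr 1; field_simp; simp
  rw [rep_apply, J1, hJ2]
  module

theorem rep_oE (q : ℕ) : rep q oE = Jplus q := by
  rw [rep_eq]
  have : Complex.I * Complex.I = -1 := Complex.I_mul_I
  simp [this]

theorem rep_oF (q : ℕ) : rep q oF = Jminus q := by
  rw [rep_eq]
  have : Complex.I * Complex.I = -1 := Complex.I_mul_I
  simp [this]

theorem rep_oH (q : ℕ) : rep q oH = J3 q := by rw [rep_eq]; simp

theorem rep_oA (q : ℕ) : rep q oA = J4 q := by rw [rep_eq]; simp

theorem rep_oB (q : ℕ) : rep q oB = J5 q := by rw [rep_eq]; simp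

theorem osp_span (x : Osp) : x = ((x.1 0 - Complex.I * x.1 1) / 2) • oE +
    (((x.1 0 + Complex.I * x.1 1) / 2) • oF + (x.1 2 • oH + (x.2 0 • oA + x.2 1 • oB))) := by
  have : Complex.I ^ 2 = -1 := Complex.I_sq
  refine Osp.ext ?_ ?_
  · ext i
    fin_cases i <;> simp
    · ring
    · linear_combination x.1 1 * this
  · ext i
    fin_cases i <;> simp

/-- The images of the two basis vectors e_0 and e_1 of the odd factor reveal all five coefficients;
e_1 exists because q ≥ 1. -/
theorem rep_injective {q : ℕ} (hq : 1 ≤ q) : Function.Injective (rep q) := by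
  rw [injective_iff_map_eq_zero]
  intro x hx
  rw [osp_span x]
  rw [rep_eq] at hx
  set a := (x.1 0 - Complex.I * x.1 1) / 2
  set b := (x.1 0 + Complex.I * x.1 1) / 2
  set c := x.1 2
  set r := x.2 0
  set s := x.2 1
  have h1 : ∀ v : V q, ∀ m, get ((a • Jplus q + b • Jminus q + c • J3 q + r • J4 q + s • J5 q) v).1 m
      = 0 := fun v m => by rw [hx]; unfold get; split_ifs <;> rfl
  have h2 : ∀ v : V q, ∀ m, get ((a • Jplus q + b • Jminus q + c • J3 q + r • J4 q + s • J5 q) v).2 m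
      = 0 := fun v m => by rw [hx]; unfold get; split_ifs <;> rfl
  simp only [LinearMap.add_apply, LinearMap.smul_apply, V.add_fst, V.add_snd, V.smul_fst,
    V.smul_snd, get_add, get_smul, Jplus_fst, Jplus_snd, Jminus_fst, Jminus_snd, J3_fst, J3_snd,
    get_raise, get_lower, get_weight, get_J4_fst, get_J4_snd, get_J5_fst, get_J5_snd] at h1 h2
  have hg : ∀ (n k m : ℕ), get (fun i : Fin n => if (i : ℕ) = k then (1 : ℂ) else 0) m =
      if m < n then if m = k then 1 else 0 else 0 := fun n k m =>
    get_of_nat (fun m => if m = k then 1 else 0) m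
  have hg0 : ∀ (n m : ℕ), get (fun _ : Fin n => (0 : ℂ)) m = 0 := fun n m => by
    unfold get; split_ifs <;> rfl
  let e0 : V q := (fun i => if (i : ℕ) = 0 then 1 else 0, fun _ => 0)
  let e1 : V q := (fun i => if (i : ℕ) = 1 then 1 else 0, fun _ => 0)
  have q0 : (q : ℂ) ≠ 0 := by exact_mod_cast (by omega : q ≠ 0)
  have hb := h1 e0 1
  have hc := h1 e0 0
  have hs := h2 e0 0
  have ha := h1 e1 0
  have hr := h2 e1 0
  have l1 : 1 < q + 1 := by omega
  have l0 : 0 < q := by omega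
  simp only [e0, e1, hg, hg0] at ha hb hc hr hs
  simp [l0] at ha hb hc hr hs
  rw [ha.resolve_right l0.ne', hb, hc.resolve_right l0.ne', hr, hs]
  simp

end Osp

/-! ### Structure, invariant form and cohomology of `osp(1|2)`. -/

section OspFrame

theorem isLieModule_osp {q : ℕ} (hq : 1 ≤ q) : IsLieModule Osp.bracket (adS q) :=
  isLieModule_end.comap (rep_injective hq) (fun x => (par_rep q x).symm) (rep_bracket q)

theorem superComm_even {M : Type*} [AddCommGroup M] [Module ℂ M] [SuperSpace M]
    {X : Module.End ℂ M} (hX : par X = X) (Y : Module.End ℂ M) :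
    superComm X Y = X * Y - Y * X := by
  rw [superComm_of_mem (mem_homog_zero.2 hX), tw_zero]

theorem superComm_odd {M : Type*} [AddCommGroup M] [Module ℂ M] [SuperSpace M]
    {X : Module.End ℂ M} (hX : par X = -X) (Y : Module.End ℂ M) :
    superComm X Y = X * Y - par Y * X := by
  rw [superComm_of_mem (mem_homog_one.2 hX), tw_one]

theorem par_Jplus (q : ℕ) : par (Jplus q) = Jplus q := par_diagOp _ _
theorem par_Jminus (q : ℕ) : par (Jminus q) = Jminus q := par_diagOp _ _
theorem par_J3 (q : ℕ) : par (J3 q) = J3 q := par_diagOp _ _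

/-- All relations are compared after the faithful representation `rep 1`, where they are the known
operator identities. -/
theorem isOspFrame : IsOspFrame Osp.bracket oE oF oH oA oB := by
  have inj := rep_injective (le_refl 1)
  refine ⟨⟨?_, ?_, ?_, ?_, ?_, ?_, ?_, ?_, ?_, ?_, ?_, ?_, ?_, ?_, ?_, ?_, ?_, ?_, ?_, ?_,
    fun x => ⟨_, _, _, _, _, osp_span x⟩⟩, ?_, ?_, ?_, ?_, ?_, ?_, ?_, ?_, ?_, ?_⟩
  · exact mem_homog_zero.2 (inj (by rw [← par_rep, rep_oE, par_Jplus]))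
  · exact mem_homog_zero.2 (inj (by rw [← par_rep, rep_oF, par_Jminus]))
  · exact mem_homog_zero.2 (inj (by rw [← par_rep, rep_oH, par_J3]))
  · exact mem_homog_one.2 (inj (by rw [← par_rep, map_neg, rep_oA, par_J4]))
  · exact mem_homog_one.2 (inj (by rw [← par_rep, map_neg, rep_oB, par_J5]))
  all_goals
    apply inj
    simp only [rep_bracket, map_neg, map_smul, map_zero, rep_oE, rep_oF, rep_oH, rep_oA, rep_oB,
      superComm_even (par_Jplus _), superComm_even (par_Jminus _), superComm_even (par_J3 _),
      superComm_odd (par_J4 _), superComm_odd (par_J5 _), par_Jplus, par_Jminus, par_J3, par_J4,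
      par_J5, Jplus_Jminus, J3_Jminus, J3_Jplus, J3_J4, J3_J5, Jplus_J4, Jplus_J5, Jminus_J4,
      Jminus_J5, J4_J4, J5_J5, J5_J4, neg_mul]
    module

/-- The invariant bilinear form of `osp(1|2)`. -/
def kappaOsp : Osp →ₗ[ℂ] Osp →ₗ[ℂ] ℂ :=
  LinearMap.mk₂ ℂ (fun x y => x.1 0 * y.1 0 + x.1 1 * y.1 1 + x.1 2 * y.1 2 -
      (x.2 0 * y.2 1 - x.2 1 * y.2 0))
    (fun x x' y => by simp; ring) (fun c x y => by simp; ring) (fun x y y' => by simp; ring)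
    (fun c x y => by simp; ring)

theorem kappaOsp_apply (x y : Osp) : kappaOsp x y =
    x.1 0 * y.1 0 + x.1 1 * y.1 1 + x.1 2 * y.1 2 - (x.2 0 * y.2 1 - x.2 1 * y.2 0) := rfl

theorem kappaOsp_bracket (x y z : Osp) :
    kappaOsp (Osp.bracket x y) z = kappaOsp x (Osp.bracket y z) := by
  have h1 : ∀ x y, (Osp.bracket x y).1 = Osp.bracketEven x y := fun _ _ => rfl
  have h2 : ∀ x y, (Osp.bracket x y).2 = Osp.bracketOdd x y := fun _ _ => rfl
  have hI : Complex.I ^ 2 = -1 := Complex.I_sq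
  simp only [kappaOsp_apply, h1, h2, Osp.bracketEven, Osp.bracketOdd, cross_apply, pauli]
  generalize x.1 = a
  generalize x.2 = u
  generalize y.1 = b
  generalize y.2 = v
  generalize z.1 = c
  generalize z.2 = w
  simp [Fin.sum_univ_three, Matrix.mulVec, dotProduct, Fin.sum_univ_two]
  ring_nf
  try simp only [hI]
  try ring_nf

theorem kappaOsp_par (x y : Osp) : kappaOsp (par x) (par y) = kappaOsp x y := by
  have h1 : ∀ x : Osp, (par x).1 = x.1 := fun _ => rfl
  have h2 : ∀ x : Osp, (par x).2 = -x.2 := fun _ => rfl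
  simp [kappaOsp_apply, h1, h2]

theorem kappaOsp_oF_oE : kappaOsp oF oE ≠ 0 := by
  simp [kappaOsp_apply]

instance : FiniteDimensional ℂ Osp :=
  inferInstanceAs (FiniteDimensional ℂ ((Fin 3 → ℂ) × (Fin 2 → ℂ)))

/-- The centre is trivial. Together with the faithfulness of `rep q` this makes the adjoint action
on the truncated supersphere faithful. -/
theorem eq_zero_of_bracket {x : Osp} (h : ∀ y, Osp.bracket x y = 0) : x = 0 := by
  have h1 : ∀ x y, (Osp.bracket x y).1 = Osp.bracketEven x y := fun _ _ => rfl
  have h2 : ∀ x y, (Osp.bracket x y).2 = Osp.bracketOdd x y := fun _ _ => rfl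
  have z1 : (0 : Osp).1 = 0 := rfl
  have z2 : (0 : Osp).2 = 0 := rfl
  have e0 := congrArg (fun z : Osp => z.1 0) (h oH)
  have e1 := congrArg (fun z : Osp => z.1 1) (h oH)
  have e2 := congrArg (fun z : Osp => z.1 1) (h oE)
  have e3 := congrArg (fun z : Osp => z.2 0) (h oH)
  have e4 := congrArg (fun z : Osp => z.2 1) (h oH)
  simp [h1, h2, z1, z2, Osp.bracketEven, Osp.bracketOdd, cross_apply, pauli, Fin.sum_univ_three,
    Matrix.mulVec, dotProduct, Fin.sum_univ_two] at e0 e1 e2 e3 e4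
  refine Osp.ext (funext fun i => ?_) (funext fun i => ?_) <;> fin_cases i <;> simp_all

theorem adS_injective {q : ℕ} (hq : 1 ≤ q) : Function.Injective (adS q) := by
  rw [injective_iff_map_eq_zero]
  intro x hx
  refine eq_zero_of_bracket fun y => rep_injective hq ?_
  rw [rep_bracket, map_zero]
  exact congrArg (fun X : Module.End ℂ (S q) => X (rep q y)) hx

theorem osp_hasSphereCohomology {q : ℕ} (hq : 1 ≤ q) {ℓ : S q →ₗ[ℂ] ℂ} {u : S q}
    (hr : IsReduction Osp.bracket (adS q) ℓ u) :
    HasSphereCohomology Osp.bracket (adS q) oE oF oH ℓ u :=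
  hr.hasSphereCohomology (isLieModule_osp hq) (isLieModule_osp hq).trivial isOspFrame.toIsFrame
    (osp_normalizedExact (isLieModule_osp hq).trivial isOspFrame) kappaOsp_bracket kappaOsp_par
    kappaOsp_oF_oE

end OspFrame

/-! ### Structure, invariant form and cohomology of `sl(2)`. -/

section Sl2Frame

/-- `J₊`, `J₋`, `J₃` as elements of `sl(2)`. -/
def sE : Sl2 := ⟨!![0, 1; 0, 0], by simp [Sl2, Matrix.trace_fin_two]⟩
def sF : Sl2 := ⟨!![0, 0; 1, 0], by simp [Sl2, Matrix.trace_fin_two]⟩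
def sH : Sl2 := ⟨!![1 / 2, 0; 0, -(1 / 2)], by simp [Sl2, Matrix.trace_fin_two]⟩

theorem tw_of_trivial {M : Type*} [AddCommGroup M] [Module ℂ M] [SuperSpace M]
    (h : ∀ x : M, par x = x) (i : ZMod 2) (x : M) : tw i x = x := by
  rcases zmod_two_cases i with rfl | rfl
  · rw [tw_zero]
  · rw [tw_one, h]

theorem isLieModule_sl2 (q : ℕ) : IsLieModule Sl2.bracket (adSb q) where
  par_br _ _ := rfl
  par_act _ _ := rfl
  skew i w _ x := by
    rw [tw_of_trivial fun _ => rfl]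
    exact Subtype.ext (neg_sub _ _).symm
  jacobi i w _ y z := by
    rw [tw_of_trivial fun _ => rfl]
    refine Subtype.ext ?_
    change w.1 * (y.1 * z.1 - z.1 * y.1) - (y.1 * z.1 - z.1 * y.1) * w.1 =
      ((w.1 * y.1 - y.1 * w.1) * z.1 - z.1 * (w.1 * y.1 - y.1 * w.1)) +
        (y.1 * (w.1 * z.1 - z.1 * w.1) - (w.1 * z.1 - z.1 * w.1) * y.1)
    noncomm_ring
  act_br i w _ y f := by
    rw [tw_of_trivial fun _ => rfl]
    simp only [adSb, LinearMap.comp_apply, repb_bracket, commut_apply]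
    simp only [mul_sub, sub_mul, mul_assoc]
    abel

theorem sl2_span (x : Sl2) : x = x.1 0 1 • sE + (x.1 1 0 • sF + ((2 * x.1 0 0) • sH +
    ((0 : ℂ) • (0 : Sl2) + (0 : ℂ) • (0 : Sl2)))) := by
  refine Subtype.ext ?_
  ext i j
  fin_cases i <;> fin_cases j <;> simp [sE, sF, sH, Sl2.apply_one_one] <;> ring

theorem isFrame_sl2 : IsFrame Sl2.bracket sE sF sH 0 0 := by
  have h : ∀ x y, (Sl2.bracket x y).1 = x.1 * y.1 - y.1 * x.1 := fun _ _ => rfl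
  refine ⟨?_, ?_, ?_, ?_, ?_, ?_, ?_, ?_, ?_, ?_, ?_, ?_, ?_, ?_, ?_, ?_, ?_, ?_, ?_, ?_,
    fun x => ⟨_, _, _, _, _, sl2_span x⟩⟩
  · exact mem_homog_zero.2 rfl
  · exact mem_homog_zero.2 rfl
  · exact mem_homog_zero.2 rfl
  · exact zero_mem _
  · exact zero_mem _
  all_goals
    refine Subtype.ext ?_
    rw [h]
    ext i j
    fin_cases i <;> fin_cases j <;> simp [sE, sF, sH] <;>
      norm_num

theorem repb_apply (q : ℕ) (x : Sl2) : repb q x =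
    (2 * x.1 0 0) • weight (q + 1) + x.1 0 1 • raise (q + 1) + x.1 1 0 • lower (q + 1) := rfl

theorem repb_sE (q : ℕ) : repb q sE = raise (q + 1) := by simp [repb_apply, sE]
theorem repb_sF (q : ℕ) : repb q sF = lower (q + 1) := by simp [repb_apply, sF]
theorem repb_sH (q : ℕ) : repb q sH = weight (q + 1) := by simp [repb_apply, sH]

/-- The trace form of `sl(2)`. -/
def kappaSl2 : Sl2 →ₗ[ℂ] Sl2 →ₗ[ℂ] ℂ :=
  LinearMap.mk₂ ℂ (fun x y => Matrix.trace (x.1 * y.1))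
    (fun x x' y => by simp [add_mul]) (fun c x y => by simp) (fun x y y' => by simp [mul_add])
    (fun c x y => by simp)

theorem kappaSl2_bracket (x y z : Sl2) :
    kappaSl2 (Sl2.bracket x y) z = kappaSl2 x (Sl2.bracket y z) := by
  change Matrix.trace ((x.1 * y.1 - y.1 * x.1) * z.1) =
    Matrix.trace (x.1 * (y.1 * z.1 - z.1 * y.1))
  rw [sub_mul, mul_sub, Matrix.trace_sub, Matrix.trace_sub, mul_assoc, mul_assoc,
    Matrix.trace_mul_comm y.1, mul_assoc]

theorem kappaSl2_sF_sE : kappaSl2 sF sE ≠ 0 := by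
  change Matrix.trace (sF.1 * sE.1) ≠ 0
  simp [sF, sE, Matrix.trace_fin_two]

theorem sl2_hasSphereCohomology {M : Type*} [AddCommGroup M] [Module ℂ M] [SuperSpace M]
    {act : Sl2 →ₗ[ℂ] Module.End ℂ M} (h : IsLieModule Sl2.bracket act) {ℓ : M →ₗ[ℂ] ℂ} {u : M}
    (hr : IsReduction Sl2.bracket act ℓ u) :
    HasSphereCohomology Sl2.bracket act sE sF sH ℓ u :=
  hr.hasSphereCohomology h h.trivial isFrame_sl2
    (sl_normalizedExact h.trivial isFrame_sl2) kappaSl2_bracket (fun _ _ => rfl) kappaSl2_sF_sE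

theorem repb_injective {q : ℕ} (hq : 1 ≤ q) : Function.Injective (repb q) := by
  rw [injective_iff_map_eq_zero]
  intro x hx
  rw [sl2_span x]
  have h1 : ∀ v : Vb q, ∀ m, get (repb q x v) m = 0 := fun v m => by
    rw [hx]; unfold get; split_ifs <;> rfl
  simp only [repb_apply, LinearMap.add_apply, LinearMap.smul_apply, get_add, get_smul, get_raise,
    get_lower, get_weight] at h1
  have hg : ∀ (n k m : ℕ), get (fun i : Fin n => if (i : ℕ) = k then (1 : ℂ) else 0) m =
      if m < n then if m = k then 1 else 0 else 0 := fun n k m =>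
    get_of_nat (fun m => if m = k then 1 else 0) m
  have ha := h1 (fun i => if (i : ℕ) = 1 then 1 else 0) 0
  have hb := h1 (fun i => if (i : ℕ) = 0 then 1 else 0) 1
  have hc := h1 (fun i => if (i : ℕ) = 0 then 1 else 0) 0
  have l1 : 0 < q := by omega
  simp only [hg] at ha hb hc
  simp [l1, l1.ne'] at ha hb hc
  simp [ha, hb, hc]

theorem adSb_injective {q : ℕ} (hq : 1 ≤ q) : Function.Injective (adSb q) := by
  rw [injective_iff_map_eq_zero]
  intro x hx
  have h0 : ∀ y, Sl2.bracket x y = 0 := fun y => repb_injective hq (by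
    rw [repb_bracket, map_zero]
    exact congrArg (fun X : Module.End ℂ (Sb q) => X (repb q y)) hx)
  have h : ∀ x y, (Sl2.bracket x y).1 = x.1 * y.1 - y.1 * x.1 := fun _ _ => rfl
  have e0 := congrArg (fun z : Sl2 => z.1 0 1) (h0 sH)
  have e1 := congrArg (fun z : Sl2 => z.1 1 0) (h0 sH)
  have e2 := congrArg (fun z : Sl2 => z.1 0 1) (h0 sE)
  simp [h, sE, sH, Matrix.mul_apply, Matrix.vecMul, dotProduct, Fin.sum_univ_two, Sl2.apply_one_one] at e0 e1 e2
  have d0 : x.1 0 1 = 0 := by linear_combination -e0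
  have d1 : x.1 1 0 = 0 := by linear_combination e1
  have d2 : x.1 0 0 = 0 := by linear_combination e2
  rw [sl2_span x, d0, d1, d2]
  simp

end Sl2Frame

/-! ### Casimir operators on modules -/

section CasimirCommute

variable {L M : Type*} [AddCommGroup L] [Module ℂ L] [SuperSpace L]
  [AddCommGroup M] [Module ℂ M] [SuperSpace M]
  {br : L →ₗ[ℂ] L →ₗ[ℂ] L} {act : L →ₗ[ℂ] Module.End ℂ M} {α : Type} [Fintype α]
  {dg : α → ZMod 2} {e' e : α → L}

theorem IsLieModule.act_mul (h : IsLieModule br act) {i j : ZMod 2} {w y : L}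
    (hw : w ∈ homog L i) (hy : y ∈ homog L j) :
    act w * act y = sgn (i * j) • (act y * act w) + act (br w y) := by
  ext1 f
  have := h.act_br i w hw y f
  rw [tw_of_mem hy, map_smul, LinearMap.smul_apply] at this
  rw [LinearMap.add_apply, this]
  simp only [Module.End.mul_apply, LinearMap.smul_apply]
  abel

/-- Moving `act y` past both factors of each term leaves brackets of `y` with both legs of the
tensor, and these cancel by invariance. -/
theorem casimir_act (h : IsLieModule br act) (ht : IsInvariantTensor br dg e' e) (x : L) (f : M) :
    casimir act dg e' e (act x f) = act x (casimir act dg e' e f) := by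
  have key : ∀ j, ∀ y ∈ homog L j, casimir act dg e' e * act y = act y * casimir act dg e' e := by
    intro j y hy
    have step : ∀ a, act y * (act (e' a) * act (e a)) = act (e' a) * act (e a) * act y +
        (act (br y (e' a)) * act (e a) + sgn (j * dg a) • (act (e' a) * act (br y (e a)))) := by
      intro a
      have hs := sgn_mul_self (j * dg a)
      rw [← mul_assoc, h.act_mul hy (ht.left_mem a), add_mul, smul_mul_assoc, mul_assoc,
        h.act_mul hy (ht.right_mem a), mul_add, mul_smul_comm, smul_add, smul_smul, hs, one_smul,
        mul_assoc]
      abel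
    have zero : ∑ a, sgn (dg a) • (act (br y (e' a)) * act (e a) +
        sgn (j * dg a) • (act (e' a) * act (br y (e a)))) = 0 := by
      rcases zmod_two_cases j with rfl | rfl
      -- For even `y` the factor `sgn (dg a)` of the Casimir operator has to be fed into the
      -- bilinear form, which composition with `par` does. For odd `y` it is already present in the
      -- invariance condition.
      · have := ht.invariant_apply hy
          ((LinearMap.mul ℂ (Module.End ℂ M)).compl₁₂ (act ∘ₗ par) act)
        rw [← this]
        refine Finset.sum_congr rfl fun a _ => ?_
        simp only [LinearMap.compl₁₂_apply, LinearMap.comp_apply, h.par_br, mem_homog.1 hy,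
          mem_homog.1 (ht.left_mem a), map_smul, zero_mul, sgn_zero, one_smul, smul_add]
        rw [add_comm]
        rfl
      · have := ht.invariant_apply hy ((LinearMap.mul ℂ (Module.End ℂ M)).compl₁₂ act act)
        rw [← this]
        refine Finset.sum_congr rfl fun a _ => ?_
        simp only [LinearMap.compl₁₂_apply, LinearMap.mul_apply', one_mul, smul_add, smul_smul,
          sgn_mul_self, one_smul]
        rw [add_comm]
    have : act y * casimir act dg e' e = casimir act dg e' e * act y + ∑ a, sgn (dg a) •
        (act (br y (e' a)) * act (e a) + sgn (j * dg a) • (act (e' a) * act (br y (e a)))) := by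
      rw [casimir, Finset.mul_sum, Finset.sum_mul, ← Finset.sum_add_distrib]
      refine Finset.sum_congr rfl fun a _ => ?_
      rw [mul_smul_comm, step, smul_add, smul_mul_assoc]
    rw [this, zero, add_zero]
  have e0 := key 0 (comp 0 x) (comp_mem 0 x)
  have e1 := key 1 (comp 1 x) (comp_mem 1 x)
  have : casimir act dg e' e * act x = act x * casimir act dg e' e := by
    rw [← comp_add_comp x, map_add, mul_add, add_mul, e0, e1]
  exact congrArg (fun X : Module.End ℂ M => X f) this

theorem casimir_par (h : IsLieModule br act) (ht : IsInvariantTensor br dg e' e) (f : M) :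
    casimir act dg e' e (par f) = par (casimir act dg e' e f) := by
  simp only [casimir, LinearMap.sum_apply, map_sum]
  refine Finset.sum_congr rfl fun a _ => ?_
  simp only [LinearMap.smul_apply, Module.End.mul_apply, map_smul, h.par_act,
    mem_homog.1 (ht.left_mem a), mem_homog.1 (ht.right_mem a)]
  simp only [smul_smul, sgn_mul_self, mul_one]

end CasimirCommute

/-! ### Descendants of primitive vectors of `osp(1|2)` -/

section Descendants

variable {V : Type*} [AddCommGroup V] [Module ℂ V] {E F H A B : Module.End ℂ V}

/-- The vectors `J₋ᵏ J₅^μ v_n` obtained from nonzero vectors `v_n` of weight `n / 2` which are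
killed by `J₊` and `J₄` are linearly independent. -/
theorem linearIndependent_osp_descendants
    (hEF : E * F = F * E + (2 : ℂ) • H) (hHF : H * F = F * H - F)
    (hHB : H * B = B * H - (1 / 2 : ℂ) • B) (hEB : E * B = B * E + A)
    (hAB : A * B = -(B * A) - (1 / 2 : ℂ) • H) (N : ℕ) {v : ℕ → V} (hv0 : ∀ n ≤ N, v n ≠ 0)
    (hE : ∀ n ≤ N, E (v n) = 0) (hA : ∀ n ≤ N, A (v n) = 0)
    (hH : ∀ n ≤ N, H (v n) = ((n : ℂ) / 2) • v n) :
    LinearIndependent ℂ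
      (fun t : {t : ℕ × ℕ × ℕ // t.1 ≤ N ∧ t.2.1 ≤ 1 ∧ t.2.1 + t.2.2 ≤ t.1} =>
        (F ^ t.1.2.2 * B ^ t.1.2.1) (v t.1.1)) := by
  have app : ∀ {X Y : Module.End ℂ V}, X = Y → ∀ w, X w = Y w := fun h w => by rw [h]
  let ι := {s : ℕ × ℕ // s.1 ≤ N ∧ s.2 ≤ 1 ∧ s.2 ≤ s.1}
  let u : ι → V := fun s => (B ^ s.1.2) (v s.1.1)
  let d : ι → ℕ := fun s => s.1.1 - s.1.2
  have hAB' : ∀ n ≤ N, A (B (v n)) = (-((n : ℂ) / 4)) • v n := fun n hn => by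
    have := app hAB (v n)
    simp only [Module.End.mul_apply, LinearMap.sub_apply, LinearMap.neg_apply,
      LinearMap.smul_apply, hA n hn, hH n hn, map_zero] at this
    rw [this]; module
  have hvi : LinearIndependent ℂ fun n : {n : ℕ // n ≤ N} => v n := by
    refine Module.End.eigenvectors_linearIndependent' H (fun n : {n : ℕ // n ≤ N} => (n.1 : ℂ) / 2)
      (fun a b hab => Subtype.ext ?_) _ fun n =>
        ⟨Module.End.mem_eigenspace_iff.2 (hH n n.2), hv0 n n.2⟩
    simpa using hab
  have hcases : ∀ s : ι, s.1.2 = 0 ∨ s.1.2 = 1 := fun s => by have := s.2.2.1; omega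
  -- `A` kills each v_n and sends B v_n to -(n/4) v_n, with n ≥ 1 whenever B v_n occurs. So applying
  -- `A` isolates the coefficients with `μ = 1`, after which those with `μ = 0` are read off
  -- directly.
  have hui : LinearIndependent ℂ u := by
    rw [linearIndependent_iff']
    intro T g hg
    have h1 : ∀ s ∈ T, s.1.2 = 1 → g s = 0 := by
      intro s hs hs1
      obtain ⟨f, hf1, hf0⟩ := exists_coordinate hvi ⟨s.1.1, s.2.1⟩
      have e := congrArg (fun w => f (A w)) hg
      simp only [map_sum, map_smul, map_zero, smul_eq_mul] at e
      rw [Finset.sum_eq_single s ?_ fun h => absurd hs h] at e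
      · simp only [u, hs1, pow_one, hAB' _ s.2.1, map_smul, hf1, smul_eq_mul, mul_one] at e
        have h1 : s.1.1 ≠ 0 := by have := s.2.2.2; omega
        refine (mul_eq_zero.1 e).resolve_right (neg_ne_zero.2 (div_ne_zero ?_ (by norm_num)))
        exact_mod_cast h1
      · intro r _ hrs
        rcases hcases r with h | h
        · simp [u, h, hA _ r.2.1]
        · have hne : (⟨r.1.1, r.2.1⟩ : {n : ℕ // n ≤ N}) ≠ ⟨s.1.1, s.2.1⟩ := fun h' =>
            hrs (Subtype.ext (Prod.ext (congrArg Subtype.val h') (h.trans hs1.symm)))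
          simp only [u, h, pow_one, hAB' _ r.2.1, map_smul, hf0 _ hne, smul_zero, mul_zero]
    intro s hs
    rcases hcases s with hs0 | hs1
    · obtain ⟨f, hf1, hf0⟩ := exists_coordinate hvi ⟨s.1.1, s.2.1⟩
      have e := congrArg f hg
      simp only [map_sum, map_smul, map_zero, smul_eq_mul] at e
      rw [Finset.sum_eq_single s ?_ fun h => absurd hs h] at e
      · simpa only [u, hs0, pow_zero, Module.End.one_apply, hf1, mul_one] using e
      · intro r hr hrs
        rcases hcases r with h | h
        · have hne : (⟨r.1.1, r.2.1⟩ : {n : ℕ // n ≤ N}) ≠ ⟨s.1.1, s.2.1⟩ := fun h' =>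
            hrs (Subtype.ext (Prod.ext (congrArg Subtype.val h') (h.trans hs0.symm)))
          simp only [u, h, pow_zero, Module.End.one_apply, hf0 _ hne, mul_zero]
        · rw [h1 r hr h, zero_mul]
    · exact h1 s hs hs1
  have hEu : ∀ s, E (u s) = 0 := fun s => by
    rcases hcases s with h | h
    · simp only [u, h, pow_zero, Module.End.one_apply, hE _ s.2.1]
    · have := app hEB (v s.1.1)
      simp only [Module.End.mul_apply, LinearMap.add_apply, hE _ s.2.1, hA _ s.2.1, map_zero,
        add_zero] at this
      simpa only [u, h, pow_one] using this
  have hHu : ∀ s, H (u s) = ((d s : ℂ) / 2) • u s := fun s => by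
    rcases hcases s with h | h
    · simp only [u, d, h, pow_zero, Module.End.one_apply, hH _ s.2.1, Nat.sub_zero]
    · have := app hHB (v s.1.1)
      simp only [Module.End.mul_apply, LinearMap.sub_apply, LinearMap.smul_apply, hH _ s.2.1,
        map_smul] at this
      have h1 : 1 ≤ s.1.1 := by have := s.2.2.2; omega
      simp only [u, d, h, pow_one, this, Nat.cast_sub h1]
      push_cast; module
  have := linearIndependent_descendants hEF hHF hEu hHu hui
    (fun t : {t : ℕ × ℕ × ℕ // t.1 ≤ N ∧ t.2.1 ≤ 1 ∧ t.2.1 + t.2.2 ≤ t.1} =>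
      (⟨(t.1.1, t.1.2.1), t.2.1, t.2.2.1, by have := t.2.2.2; simp only; omega⟩ : ι))
    (fun t => t.1.2.2) (fun t => by have := t.2.2.2; simp only [d]; omega)
    (fun a b h h' => by
      have h1 : (a.1.1, a.1.2.1) = (b.1.1, b.1.2.1) := congrArg Subtype.val h
      exact Subtype.ext (Prod.ext (Prod.mk.inj h1).1 (Prod.ext (Prod.mk.inj h1).2 h')))
  exact this

end Descendants

/-! ### Noncommutative harmonics -/

section Indices

instance (q : ℕ) : Fintype (IdxS q) :=
  Fintype.ofInjective
    (fun t => ((⟨t.1.1, by have := t.2.1; omega⟩, ⟨t.1.2.1, by have := t.2.2.1; omega⟩,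
      ⟨t.1.2.2, by have := t.2.1; have := t.2.2.2; omega⟩) :
        Fin (2 * q + 1) × Fin 2 × Fin (2 * q + 1))) fun t t' h => by
    simp only [Prod.mk.injEq, Fin.mk.injEq] at h
    exact Subtype.ext (Prod.ext h.1 (Prod.ext h.2.1 h.2.2))

instance (q : ℕ) : Fintype (IdxSb q) :=
  Fintype.ofInjective
    (fun t => ((⟨t.1.1, by have := t.2.1; omega⟩, ⟨t.1.2, by have := t.2.1; have := t.2.2; omega⟩) :
        Fin (q + 1) × Fin (2 * q + 1))) fun t t' h => by
    simp only [Prod.mk.injEq, Fin.mk.injEq] at h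
    exact Subtype.ext (Prod.ext h.1 h.2)

/-- A square of side 2q + 1 is cut along its diagonal: one half (with the diagonal) labels `μ = 0`,
the other `μ = 1`. Only this inequality is needed, the converse being implied by linear
independence. -/
theorem le_card_idxS (q : ℕ) : (2 * q + 1) * (2 * q + 1) ≤ Fintype.card (IdxS q) := by
  let f : Fin (2 * q + 1) × Fin (2 * q + 1) → IdxS q := fun s =>
    ⟨if s.2 ≤ s.1 then (s.1, 0, s.2) else (s.2, 1, s.1), by
      have h1 := s.1.2
      have h2 := s.2.2
      split_ifs with h <;> simp only [Fin.le_def] at h ⊢ <;> omega⟩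
  have hf : Function.Injective f := fun s s' h => by
    have h := congrArg Subtype.val h
    simp only [f] at h
    split_ifs at h with h1 h2 h2 <;> simp only [Prod.mk.injEq] at h
    · exact Prod.ext (Fin.ext h.1) (Fin.ext h.2.2)
    · omega
    · omega
    · exact Prod.ext (Fin.ext h.2.2) (Fin.ext h.1)
  simpa using Fintype.card_le_of_injective f hf

/-- Here the two halves of the square give the indices with k ≤ j and with j < k ≤ 2j. -/
theorem le_card_idxSb (q : ℕ) : (q + 1) * (q + 1) ≤ Fintype.card (IdxSb q) := by
  let f : Fin (q + 1) × Fin (q + 1) → IdxSb q := fun s =>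
    ⟨if s.2 ≤ s.1 then (s.1, s.2) else (s.2, s.1 + s.2 + 1), by
      have h1 := s.1.2
      have h2 := s.2.2
      split_ifs with h <;> simp only [Fin.le_def] at h ⊢ <;> omega⟩
  have hf : Function.Injective f := fun s s' h => by
    have h := congrArg Subtype.val h
    simp only [f] at h
    split_ifs at h with h1 h2 h2 <;> simp only [Prod.mk.injEq] at h <;>
      simp only [Fin.le_def] at h1 h2
    · exact Prod.ext (Fin.ext h.1) (Fin.ext h.2)
    · omega
    · omega
    · exact Prod.ext (Fin.ext (by omega)) (Fin.ext h.1)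
  simpa using Fintype.card_le_of_injective f hf

theorem normS_ne_zero (n μ k : ℕ) : normS n μ k ≠ 0 := by
  unfold normS
  have : 0 < √(4 ^ μ * (n - μ - k).factorial / (n.factorial * k.factorial) : ℝ) := by positivity
  exact_mod_cast this.ne'

theorem normSb_ne_zero (j k : ℕ) : normSb j k ≠ 0 := by
  unfold normSb
  have : 0 < √((2 * j - k).factorial / ((2 * j).factorial * k.factorial) : ℝ) := by positivity
  exact_mod_cast this.ne'

end Indices

/-! ### Nonvanishing of the highest weight operators. -/

section RaisePow

theorem get_raise_pow {n : ℕ} (v : Fin n → ℂ) (a m : ℕ) : get ((raise n ^ a) v) m =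
    (∏ t ∈ Finset.range a, ((m : ℂ) + t + 1) * (n - 1 - m - t)) * get v (m + a) := by
  induction a generalizing m with
  | zero => simp
  | succ a ih =>
    rw [pow_succ', Module.End.mul_apply, get_raise, ih, Finset.prod_range_succ']
    have : ∏ t ∈ Finset.range a, (((m + 1 : ℕ) : ℂ) + t + 1) * (n - 1 - (m + 1 : ℕ) - t) =
        ∏ t ∈ Finset.range a, ((m : ℂ) + (t + 1 : ℕ) + 1) * (n - 1 - m - (t + 1 : ℕ)) :=
      Finset.prod_congr rfl fun t _ => by push_cast; ring
    rw [this, show m + 1 + a = m + (a + 1) by ring]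
    push_cast; ring

theorem raise_coeff_ne_zero {q a : ℕ} (ha : a ≤ q) :
    ∏ t ∈ Finset.range a, (((0 : ℕ) : ℂ) + t + 1) * ((q + 1 : ℕ) - 1 - (0 : ℕ) - t) ≠ 0 := by
  refine Finset.prod_ne_zero_iff.2 fun t ht => mul_ne_zero ?_ ?_
  · rw [Nat.cast_zero, zero_add]; exact_mod_cast t.succ_ne_zero
  · have h := Finset.mem_range.1 ht
    have : (((q + 1 : ℕ) : ℂ) - 1 - (0 : ℕ) - t) = ((q - t : ℕ) : ℂ) := by
      rw [Nat.cast_sub (by omega)]; push_cast; ring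
    rw [this]
    exact_mod_cast (by omega : q - t ≠ 0)

/-- The `a`-th basis vector. -/
def basisVec (n a : ℕ) : Fin n → ℂ := fun i => if (i : ℕ) = a then 1 else 0

theorem get_basisVec (n a m : ℕ) : get (basisVec n a) m = if m < n then if m = a then 1 else 0 else 0 :=
  get_of_nat (fun m => if m = a then 1 else 0) m

theorem raise_pow_ne_zero {q a : ℕ} (ha : a ≤ q) : raise (q + 1) ^ a ≠ 0 := by
  intro h
  have h1 := get_raise_pow (n := q + 1) (basisVec (q + 1) a) a 0
  rw [h, get_basisVec, if_pos (by omega), if_pos (by omega), mul_one] at h1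
  exact raise_coeff_ne_zero ha (h1.symm.trans (by unfold get; split_ifs <;> rfl))

theorem Jplus_pow_fst {q : ℕ} (a : ℕ) (v : V q) :
    ((Jplus q ^ a) v).1 = (raise (q + 1) ^ a) v.1 := by
  induction a with
  | zero => rfl
  | succ a ih =>
    rw [pow_succ', pow_succ', Module.End.mul_apply, Module.End.mul_apply, Jplus_fst, ih]

theorem Jplus_pow_ne_zero {q a : ℕ} (ha : a ≤ q) : Jplus q ^ a ≠ 0 := by
  intro h
  refine raise_pow_ne_zero ha (LinearMap.ext fun v => ?_)
  have := Jplus_pow_fst a ((v, 0) : V q)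
  rw [h] at this
  exact this.symm

/-- `J₊ᵃ ((J₃ - ¾) J₄ + J₊ J₅)`. -/
def oddHigh (q a : ℕ) : S q := Jplus q ^ a * ((J3 q - (3 / 4 : ℂ) • 1) * J4 q + Jplus q * J5 q)

/-- On the even factor of V the bracketed operator multiplies the m-th coordinate by -((q -
m)/4)(q/2 + 1/4). The basis vector of index a < q is therefore not killed, and `Jplus q ^ a` moves
it to a nonzero coordinate 0. -/
theorem oddHigh_ne_zero {q a : ℕ} (ha : a + 1 ≤ q) : oddHigh q a ≠ 0 := by
  intro h
  let v : V q := (0, basisVec q a)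
  have h1 : ((oddHigh q a) v).1 = (raise (q + 1) ^ a)
      (((J3 q - (3 / 4 : ℂ) • 1) * J4 q + Jplus q * J5 q) v).1 := Jplus_pow_fst a _
  have h2 : ∀ m, get (((J3 q - (3 / 4 : ℂ) • 1) * J4 q + Jplus q * J5 q) v).1 m =
      -(((q : ℂ) - m) / 4) * (q / 2 + 1 / 4) * get v.2 m := fun m => by
    simp only [LinearMap.add_apply, Module.End.mul_apply, LinearMap.sub_apply,
      LinearMap.smul_apply, Module.End.one_apply, V.add_fst, V.sub_fst, V.smul_fst, get_add,
      get_sub, get_smul, J3_fst, Jplus_fst, get_weight, get_raise, get_J4_fst, get_J5_fst]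
    simp
    ring
  have h3 := congrArg (fun w => get w 0) h1
  simp only [get_raise_pow, h2] at h3
  rw [h] at h3
  have h4 : get v.2 (0 + a) = 1 := by
    change get (basisVec q a) (0 + a) = 1
    rw [get_basisVec, if_pos (by omega), if_pos (by omega)]
  rw [h4, mul_one] at h3
  have h5 : get ((0 : S q) v).1 0 = 0 := by unfold get; split_ifs <;> rfl
  rw [h5] at h3
  refine mul_ne_zero (raise_coeff_ne_zero (by omega : a ≤ q)) (mul_ne_zero (neg_ne_zero.2
    (div_ne_zero ?_ (by norm_num))) ?_) h3.symm
  · have : (q : ℂ) - (0 + a : ℕ) = ((q - a : ℕ) : ℂ) := by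
      rw [Nat.cast_sub (by omega)]; simp
    rw [this]
    exact_mod_cast (by omega : q - a ≠ 0)
  · have : (q : ℂ) / 2 + 1 / 4 = ((2 * q + 1 : ℕ) : ℂ) / 4 := by push_cast; ring
    rw [this]
    exact div_ne_zero (by exact_mod_cast (by omega : 2 * q + 1 ≠ 0)) (by norm_num)

end RaisePow

/-! ### Commutation relations of the highest weight operators. -/

section HighestWeight

theorem commut_Jplus_pow (q a : ℕ) :
    J3 q * Jplus q ^ a = Jplus q ^ a * J3 q + (a : ℂ) • Jplus q ^ a := by
  induction a with
  | zero => simp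
  | succ a ih =>
    rw [pow_succ, ← mul_assoc, ih, add_mul, mul_assoc, J3_Jplus, smul_mul_assoc, mul_add,
      ← mul_assoc]
    push_cast; module

theorem J4_Jplus_pow (q a : ℕ) : J4 q * Jplus q ^ a = Jplus q ^ a * J4 q :=
  Commute.pow_right (Jplus_J4 q).symm a

theorem par_pow (q a : ℕ) : par (Jplus q ^ a) = Jplus q ^ a := by
  induction a with
  | zero => ext v; simp [par_end, par_par]
  | succ a ih => rw [pow_succ, par_mul, ih, par_Jplus]

/-- In terms of graded commutators: X is odd of weight 1/2 and annihilated by the adjoint actions of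
J₊ and J₄, the latter being an anticommutator because both are odd. -/
theorem oddHigh_relations (q : ℕ) {X : S q}
    (hX : X = (J3 q - (3 / 4 : ℂ) • 1) * J4 q + Jplus q * J5 q) :
    par X = -X ∧ Jplus q * X = X * Jplus q ∧ J3 q * X = X * J3 q + (1 / 2 : ℂ) • X ∧
      J4 q * X = -(X * J4 q) := by
  have hX' : X = J3 q * J4 q - (3 / 4 : ℂ) • J4 q + Jplus q * J5 q := by
    rw [hX, sub_mul, smul_mul_assoc, one_mul]
  have assoc : ∀ {X Y Z : S q}, X * Y = Z → ∀ W, X * (Y * W) = Z * W := fun h W => by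
    rw [← mul_assoc, h]
  have r2 := assoc (J3_J4 q)
  have r3 := assoc (Jplus_J4 q)
  have r4 := assoc (Jplus_J5 q)
  have r5 := assoc (J4_J4 q)
  have r6 := assoc (J5_J4 q)
  have r7 := assoc (J3_J5 q)
  refine ⟨?_, ?_, ?_, ?_⟩
  · rw [hX']
    simp only [map_add, map_sub, map_smul, par_mul, par_J3, par_J4, par_J5, par_Jplus, mul_neg]
    module
  all_goals
    rw [hX']
    simp only [mul_add, mul_sub, add_mul, sub_mul, mul_smul_comm, smul_mul_assoc, mul_assoc,
      J3_Jplus, J3_J4, Jplus_J4, Jplus_J5, J4_J4, r2, r3, r4, r5, r6, r7, neg_mul]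
    module

end HighestWeight

/-! ### The noncommutative harmonics form bases. -/

section HarmonicBasis

/-- The adjoint actions of `J₊`, `J₋`, `J₃`, `J₄` and `J₅` satisfy the relations of `osp(1|2)`. -/
theorem ad_relations (q : ℕ) :
    superComm (Jplus q) * superComm (Jminus q) =
      superComm (Jminus q) * superComm (Jplus q) + (2 : ℂ) • superComm (J3 q) ∧
    superComm (J3 q) * superComm (Jminus q) =
      superComm (Jminus q) * superComm (J3 q) - superComm (Jminus q) ∧
    superComm (J3 q) * superComm (J5 q) =
      superComm (J5 q) * superComm (J3 q) - (1 / 2 : ℂ) • superComm (J5 q) ∧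
    superComm (Jplus q) * superComm (J5 q) =
      superComm (J5 q) * superComm (Jplus q) + superComm (J4 q) ∧
    superComm (J4 q) * superComm (J5 q) =
      -(superComm (J5 q) * superComm (J4 q)) - (1 / 2 : ℂ) • superComm (J3 q) := by
  have key : ∀ {i j : ZMod 2} {x y : Osp}, x ∈ homog Osp i → y ∈ homog Osp j →
      superComm (rep q x) * superComm (rep q y) = sgn (i * j) •
        (superComm (rep q y) * superComm (rep q x)) + superComm (rep q (Osp.bracket x y)) := by
    intro i j x y hx hy
    have hx' : rep q x ∈ homog (S q) i := by rw [mem_homog, par_rep, mem_homog.1 hx, map_smul]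
    have hy' : rep q y ∈ homog (S q) j := by rw [mem_homog, par_rep, mem_homog.1 hy, map_smul]
    rw [rep_bracket]
    exact isLieModule_end.act_mul hx' hy'
  have f := isOspFrame
  have e1 := key f.E_mem f.F_mem
  have e2 := key f.H_mem f.F_mem
  have e3 := key f.H_mem f.B_mem
  have e4 := key f.E_mem f.B_mem
  have e5 := key f.A_mem f.B_mem
  simp only [f.EF, f.HF, f.HB, f.EB, f.AB, map_neg, map_smul, rep_oE, rep_oF, rep_oH, rep_oA,
    rep_oB, zero_mul, mul_one, sgn_zero, sgn_one, one_smul,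
    ← sub_eq_add_neg] at e1 e2 e3 e4 e5
  exact ⟨e1, e2, e3, e4, by linear_combination (norm := module) e5⟩

theorem highNS_even_coeff_ne_zero {q a : ℕ} :
    ((√(2 ^ a * (2 * a - 1).doubleFactorial * (q - a).factorial /
      (a.factorial * (q + a).factorial)) : ℝ) : ℂ) ≠ 0 := by
  have h1 : (0 : ℝ) < (2 * a - 1).doubleFactorial := by exact_mod_cast Nat.doubleFactorial_pos _
  have : 0 < √(2 ^ a * (2 * a - 1).doubleFactorial * (q - a).factorial /
      (a.factorial * (q + a).factorial) : ℝ) := by positivity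
  exact_mod_cast this.ne'

theorem highNS_odd_coeff_ne_zero {q a : ℕ} :
    ((1 / (q + 1 / 2) * √(2 ^ (a + 4) * (2 * a + 1).doubleFactorial *
      (q - a - 1).factorial / (a.factorial * (q + a + 1).factorial)) : ℝ) : ℂ) ≠ 0 := by
  have h1 : (0 : ℝ) < (2 * a + 1).doubleFactorial := by exact_mod_cast Nat.doubleFactorial_pos _
  have : 0 < 1 / (q + 1 / 2) * √(2 ^ (a + 4) * (2 * a + 1).doubleFactorial *
      (q - a - 1).factorial / (a.factorial * (q + a + 1).factorial) : ℝ) := by positivity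
  exact_mod_cast this.ne'

/-- Up to a nonzero factor, the highest weight harmonics are `J₊ᵃ` and
`J₊ᵃ ((J₃ - ¾) J₄ + J₊ J₅)`. -/
theorem highNS_cases (q n : ℕ) : ∃ c : ℂ, c ≠ 0 ∧
    ((n = 2 * (n / 2) ∧ highNS q n = c • Jplus q ^ (n / 2)) ∨
      (n = 2 * (n / 2) + 1 ∧ highNS q n = c • oddHigh q (n / 2))) := by
  unfold highNS
  split_ifs with h
  · exact ⟨_, highNS_even_coeff_ne_zero, Or.inl ⟨by rcases h with ⟨r, rfl⟩; omega, rfl⟩⟩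
  · refine ⟨_, highNS_odd_coeff_ne_zero, Or.inr ⟨?_, rfl⟩⟩
    rw [Nat.not_even_iff_odd] at h
    rcases h with ⟨r, rfl⟩
    omega

theorem highNS_ne_zero {q n : ℕ} (hn : n ≤ 2 * q) : highNS q n ≠ 0 := by
  obtain ⟨c, hc, ⟨h1, h⟩ | ⟨h1, h⟩⟩ := highNS_cases q n <;> rw [h]
  · exact smul_ne_zero hc (Jplus_pow_ne_zero (by omega))
  · exact smul_ne_zero hc (oddHigh_ne_zero (by omega))

/-- This provides one highest weight vector for each superspin n/2, the input for both the
independence of the harmonics and the Casimir eigenvalues. -/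
theorem ad_highNS (q n : ℕ) : superComm (Jplus q) (highNS q n) = 0 ∧
    superComm (J4 q) (highNS q n) = 0 ∧
    superComm (J3 q) (highNS q n) = ((n : ℂ) / 2) • highNS q n := by
  have hcomm : ∀ a, Jplus q * Jplus q ^ a = Jplus q ^ a * Jplus q := fun a =>
    (Commute.refl (Jplus q)).pow_right a
  obtain ⟨c, -, ⟨h1, h⟩ | ⟨h1, h⟩⟩ := highNS_cases q n <;> rw [h] <;>
    simp only [map_smul] <;>
    simp only [superComm_even (par_Jplus q), superComm_even (par_J3 q), superComm_odd (par_J4 q)]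
  · set a := n / 2
    have hn : (n : ℂ) = 2 * a := by rw [h1]; push_cast; ring
    refine ⟨?_, ?_, ?_⟩
    · rw [hcomm, sub_self, smul_zero]
    · rw [par_pow, J4_Jplus_pow, sub_self, smul_zero]
    · rw [commut_Jplus_pow, hn]; module
  · set a := n / 2
    have hn : (n : ℂ) = 2 * a + 1 := by rw [h1]; push_cast; ring
    obtain ⟨X, hX⟩ : ∃ X, X = (J3 q - (3 / 4 : ℂ) • 1) * J4 q + Jplus q * J5 q := ⟨_, rfl⟩
    have hodd : oddHigh q a = Jplus q ^ a * X := by rw [hX]; rfl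
    obtain ⟨r1, r2, r3, r4⟩ := oddHigh_relations q hX
    rw [hodd]
    refine ⟨?_, ?_, ?_⟩
    · rw [← mul_assoc, hcomm, mul_assoc, r2, mul_assoc, sub_self, smul_zero]
    · rw [par_mul, par_pow, r1, ← mul_assoc, J4_Jplus_pow, mul_assoc, r4]
      simp [mul_assoc]
    · rw [← mul_assoc, commut_Jplus_pow, add_mul, mul_assoc, r3, mul_add, smul_mul_assoc,
        mul_smul_comm, mul_assoc, hn]
      module

theorem linearIndependent_harmNS (q : ℕ) : LinearIndependent ℂ (harmNS q) := by
  obtain ⟨e1, e2, e3, e4, e5⟩ := ad_relations q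
  have := linearIndependent_osp_descendants e1 e2 e3 e4 e5 (2 * q) (v := highNS q)
    (fun n hn => highNS_ne_zero hn) (fun n _ => (ad_highNS q n).1) (fun n _ => (ad_highNS q n).2.1)
    (fun n _ => (ad_highNS q n).2.2)
  exact this.units_smul fun t => Units.mk0 _ (normS_ne_zero t.1.1 t.1.2.1 t.1.2.2)

instance (q : ℕ) : FiniteDimensional ℂ (V q) :=
  inferInstanceAs (FiniteDimensional ℂ ((Fin (q + 1) → ℂ) × (Fin q → ℂ)))

theorem finrank_S (q : ℕ) : Module.finrank ℂ (S q) = (2 * q + 1) * (2 * q + 1) := by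
  have : Module.finrank ℂ (V q) = 2 * q + 1 := by
    change Module.finrank ℂ ((Fin (q + 1) → ℂ) × (Fin q → ℂ)) = _
    simp; ring
  have e := Module.finrank_linearMap ℂ ℂ (V q) (V q)
  rw [this] at e
  exact e

instance (q : ℕ) : Nonempty (IdxS q) := ⟨⟨(0, 0, 0), by simp⟩⟩
instance (q : ℕ) : Nonempty (IdxSb q) := ⟨⟨(0, 0), by simp⟩⟩

/-- The basis of noncommutative superspherical harmonics. -/
def basisNS (q : ℕ) : Module.Basis (IdxS q) ℂ (S q) :=
  basisOfLinearIndependentOfCardEqFinrank (linearIndependent_harmNS q)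
    (le_antisymm ((linearIndependent_harmNS q).fintype_card_le_finrank)
      ((finrank_S q).trans_le (le_card_idxS q)))

theorem basisNS_apply (q : ℕ) (t : IdxS q) : basisNS q t = harmNS q t := by
  simp [basisNS]

theorem ad_relations_sl2 (q : ℕ) :
    commut (Sb q) (raise (q + 1)) * commut (Sb q) (lower (q + 1)) =
      commut (Sb q) (lower (q + 1)) * commut (Sb q) (raise (q + 1)) +
        (2 : ℂ) • commut (Sb q) (weight (q + 1)) ∧
    commut (Sb q) (weight (q + 1)) * commut (Sb q) (lower (q + 1)) =
      commut (Sb q) (lower (q + 1)) * commut (Sb q) (weight (q + 1)) -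
        commut (Sb q) (lower (q + 1)) := by
  have key := fun x y => (isLieModule_sl2 q).act_mul (i := 0) (j := 0) (w := x) (y := y)
    (mem_homog_zero.2 rfl) (mem_homog_zero.2 rfl)
  have f := isFrame_sl2
  have e1 := key sE sF
  have e2 := key sH sF
  have ad : ∀ x, adSb q x = commut (Sb q) (repb q x) := fun _ => rfl
  simp only [f.EF, f.HF, map_neg, map_smul, ad, repb_sE, repb_sF, repb_sH, zero_mul, sgn_zero,
    one_smul, ← sub_eq_add_neg] at e1 e2
  exact ⟨e1, e2⟩

theorem ad_raise_pow (q a : ℕ) : commut (Sb q) (raise (q + 1)) (raise (q + 1) ^ a) = 0 := by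
  rw [commut_apply, ((Commute.refl (raise (q + 1))).pow_right a).eq, sub_self]

theorem ad_weight_raise_pow (q a : ℕ) :
    commut (Sb q) (weight (q + 1)) (raise (q + 1) ^ a) = (a : ℂ) • raise (q + 1) ^ a := by
  have : weight (q + 1) * raise (q + 1) ^ a =
      raise (q + 1) ^ a * weight (q + 1) + (a : ℂ) • raise (q + 1) ^ a := by
    induction a with
    | zero => simp
    | succ a ih =>
      rw [pow_succ, ← mul_assoc, ih, add_mul, mul_assoc, weight_raise, smul_mul_assoc, mul_add,
        ← mul_assoc]
      push_cast; module
  rw [commut_apply, this, add_sub_cancel_left]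

theorem linearIndependent_harmNSb (q : ℕ) : LinearIndependent ℂ (harmNSb q) := by
  obtain ⟨e1, e2⟩ := ad_relations_sl2 q
  have hw := ad_weight_raise_pow q
  have hi : LinearIndependent ℂ fun j : {j : ℕ // j ≤ q} => raise (q + 1) ^ j.1 :=
    Module.End.eigenvectors_linearIndependent' (commut (Sb q) (weight (q + 1)))
      (fun j : {j : ℕ // j ≤ q} => (j.1 : ℂ)) (fun a b hab => Subtype.ext (by simpa using hab)) _
      fun j => ⟨Module.End.mem_eigenspace_iff.2 (hw j), raise_pow_ne_zero j.2⟩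
  have := linearIndependent_descendants e1 e2 (d := fun j : {j : ℕ // j ≤ q} => 2 * j.1)
    (fun j => ad_raise_pow q j.1)
    (fun j => by rw [hw]; congr 1; push_cast; ring) hi
    (fun t : IdxSb q => ⟨t.1.1, t.2.1⟩) (fun t => t.1.2) (fun t => t.2.2)
    (fun a b h h' => Subtype.ext (Prod.ext (congrArg Subtype.val h) h'))
  have hne : ∀ t : IdxSb q, normSb t.1.1 t.1.2 * ((√(2 ^ t.1.1 * (2 * t.1.1 + 1).doubleFactorial *
      (q + 1) * (q - t.1.1).factorial / (t.1.1.factorial * (q + t.1.1 + 1).factorial)) : ℝ) : ℂ) ≠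
      0 := fun t => by
    refine mul_ne_zero (normSb_ne_zero _ _) ?_
    have h1 : (0 : ℝ) < (2 * t.1.1 + 1).doubleFactorial := by
      exact_mod_cast Nat.doubleFactorial_pos _
    have : 0 < √(2 ^ t.1.1 * (2 * t.1.1 + 1).doubleFactorial *
      (q + 1) * (q - t.1.1).factorial / (t.1.1.factorial * (q + t.1.1 + 1).factorial) : ℝ) := by
      positivity
    exact_mod_cast this.ne'
  have e : harmNSb q = (fun t => Units.mk0 _ (hne t)) •
      fun t => (commut (Sb q) (lower (q + 1)) ^ t.1.2) (raise (q + 1) ^ t.1.1) := by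
    funext t
    simp only [harmNSb, map_smul, Pi.smul_apply', Units.smul_mk0, smul_smul]
  rw [e]
  exact this.units_smul _

theorem finrank_Sb (q : ℕ) : Module.finrank ℂ (Sb q) = (q + 1) * (q + 1) := by
  have e := Module.finrank_linearMap ℂ ℂ (Vb q) (Vb q)
  simpa using e

/-- The basis of noncommutative spherical harmonics. -/
def basisNSb (q : ℕ) : Module.Basis (IdxSb q) ℂ (Sb q) :=
  basisOfLinearIndependentOfCardEqFinrank (linearIndependent_harmNSb q)
    (le_antisymm ((linearIndependent_harmNSb q).fintype_card_le_finrank)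
      ((finrank_Sb q).trans_le (le_card_idxSb q)))

theorem basisNSb_apply (q : ℕ) (t : IdxSb q) : basisNSb q t = harmNSb q t := by
  simp [basisNSb]

end HarmonicBasis

/-! ### Casimir eigenvalues and reduction to constant coefficients. -/

section CasimirSpectrum

theorem casimir_pow_apply {L M : Type*} [AddCommGroup L] [Module ℂ L] [SuperSpace L]
    [AddCommGroup M] [Module ℂ M] [SuperSpace M] {br : L →ₗ[ℂ] L →ₗ[ℂ] L}
    {act : L →ₗ[ℂ] Module.End ℂ M} {α : Type} [Fintype α] {dg : α → ZMod 2} {e' e : α → L}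
    (h : IsLieModule br act) (ht : IsInvariantTensor br dg e' e) (x : L) (k : ℕ) {c : ℂ} {f : M}
    (hf : casimir act dg e' e f = c • f) :
    casimir act dg e' e ((act x ^ k) f) = c • (act x ^ k) f := by
  induction k with
  | zero => exact hf
  | succ k ih => rw [pow_succ', Module.End.mul_apply, casimir_act h ht, ih, map_smul]

/-- On a vector of weight n/2 killed by J₊ and J₄, the operator H² + (EF + FE)/2 + AB - BA is n²/4 +
n/2 - n/4. -/
theorem casimir_highNS {q : ℕ} (n : ℕ) :
    casimir (adS q) ![0, 0, 0, 1, 1] ![(1 / 2 : ℂ) • oE, (1 / 2 : ℂ) • oF, oH, -oA, oB]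
      ![oF, oE, oH, oB, oA] (highNS q n) = ((n : ℂ) * (n + 1) / 4) • highNS q n := by
  obtain ⟨e1, e2, e3, e4, e5⟩ := ad_relations q
  obtain ⟨h1, h2, h3⟩ := ad_highNS q n
  have r1 := LinearMap.congr_fun e1 (highNS q n)
  have r5 := LinearMap.congr_fun e5 (highNS q n)
  simp only [Module.End.mul_apply, LinearMap.add_apply, LinearMap.sub_apply, LinearMap.neg_apply,
    LinearMap.smul_apply, h1, h2, h3, map_zero, zero_add, neg_zero, zero_sub] at r1 r5
  have ad : ∀ x, adS q x = superComm (rep q x) := fun _ => rfl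
  simp only [casimir, Fin.sum_univ_five, LinearMap.add_apply, LinearMap.smul_apply,
    Module.End.mul_apply, ad]
  simp [sgn_zero, sgn_one, rep_oE, rep_oF, rep_oH, rep_oA, rep_oB, h1, h2, h3, r1, r5]
  module

theorem casimir_descendant {q : ℕ} (hq : 1 ≤ q) (n μ k : ℕ) :
    casimir (adS q) ![0, 0, 0, 1, 1] ![(1 / 2 : ℂ) • oE, (1 / 2 : ℂ) • oF, oH, -oA, oB]
      ![oF, oE, oH, oB, oA] ((superComm (Jminus q) ^ k * superComm (J5 q) ^ μ) (highNS q n)) =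
      ((n : ℂ) * (n + 1) / 4) • (superComm (Jminus q) ^ k * superComm (J5 q) ^ μ) (highNS q n) := by
  have key : ∀ {α : Type} [Fintype α] {dg : α → ZMod 2} {e' e : α → Osp} {c : ℂ},
      IsInvariantTensor Osp.bracket dg e' e →
      casimir (adS q) dg e' e (highNS q n) = c • highNS q n →
      casimir (adS q) dg e' e ((superComm (Jminus q) ^ k * superComm (J5 q) ^ μ) (highNS q n)) =
        c • (superComm (Jminus q) ^ k * superComm (J5 q) ^ μ) (highNS q n) := by
    intro α _ dg e' e c ht hc
    have hF : adS q oF = superComm (Jminus q) := congrArg superComm (rep_oF q)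
    have hB : adS q oB = superComm (J5 q) := congrArg superComm (rep_oB q)
    rw [← hF, ← hB, Module.End.mul_apply]
    exact casimir_pow_apply (isLieModule_osp hq) ht oF k
      (casimir_pow_apply (isLieModule_osp hq) ht oB μ hc)
  exact key isOspFrame.isInvariantTensor (casimir_highNS n)

theorem adS_one (q : ℕ) (x : Osp) : adS q x 1 = 0 := by
  change superComm (rep q x) 1 = 0
  have h1 : par (1 : S q) = 1 := LinearMap.ext fun v => par_par v
  rw [superComm_apply, h1, comp_zero_apply, comp_one_apply, mul_one, one_mul, one_mul]
  module

/-- The index of the constant harmonic. -/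
def idxS₀ (q : ℕ) : IdxS q := ⟨(0, 0, 0), by simp⟩

/-- The index of the constant harmonic. -/
def idxSb₀ (q : ℕ) : IdxSb q := ⟨(0, 0), by simp⟩

theorem basisNS_idxS₀ (q : ℕ) : ∃ c : ℂ, basisNS q (idxS₀ q) = c • 1 := by
  obtain ⟨c, -, ⟨-, h⟩ | ⟨h, -⟩⟩ := highNS_cases q 0
  · refine ⟨normS 0 0 0 * c, ?_⟩
    rw [Nat.zero_div, pow_zero] at h
    rw [basisNS_apply, mul_smul, ← h]
    simp only [harmNS, idxS₀, pow_zero, mul_one, Module.End.one_apply]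
  · omega

/-- The eigenvalue n(n + 1)/4 vanishes only for n = 0, where the index set leaves only the
constants. -/
theorem isReduction_osp {q : ℕ} (hq : 1 ≤ q) :
    IsReduction Osp.bracket (adS q) ((basisNS q).coord (idxS₀ q)) (basisNS q (idxS₀ q)) := by
  have hL := isLieModule_osp hq
  have ht := isOspFrame.isInvariantTensor
  obtain ⟨c, hc⟩ := basisNS_idxS₀ q
  refine isReduction_of_diagonal hL ht (basisNS q) (c := fun t => (t.1.1 : ℂ) * (t.1.1 + 1) / 4)
    (fun t => ?_) (fun t => ?_) (fun x => ?_) ?_ (casimir_act hL ht) (casimir_par hL ht)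
  · rw [basisNS_apply, harmNS, map_smul, casimir_descendant hq, smul_comm]
  · have hne : (t.1.1 : ℂ) + 1 ≠ 0 := Nat.cast_add_one_ne_zero _
    simp only [div_eq_zero_iff, mul_eq_zero, hne, or_false, Nat.cast_eq_zero,
      OfNat.ofNat_ne_zero]
    refine ⟨fun h => ?_, fun h => by rw [h]; rfl⟩
    have := t.2.2.2
    exact Subtype.ext (Prod.ext h (Prod.ext (by change t.1.2.1 = 0; omega)
      (by change t.1.2.2 = 0; omega)))
  · rw [hc, map_smul]
    rw [adS_one, smul_zero]
  · rw [hc, map_smul]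
    exact congrArg (c • ·) (LinearMap.ext fun v => par_par v)

theorem casimir_raise_pow (q a : ℕ) :
    casimir (adSb q) (0 : Fin 3 → ZMod 2) ![(1 / 2 : ℂ) • sE, (1 / 2 : ℂ) • sF, sH] ![sF, sE, sH]
      (raise (q + 1) ^ a) = ((a : ℂ) * (a + 1)) • raise (q + 1) ^ a := by
  have r1 := LinearMap.congr_fun (ad_relations_sl2 q).1 (raise (q + 1) ^ a)
  have h1 := ad_raise_pow q a
  have h3 := ad_weight_raise_pow q a
  simp only [Module.End.mul_apply, LinearMap.add_apply, LinearMap.smul_apply, h1, h3, map_zero,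
    zero_add] at r1
  have ad : ∀ x, adSb q x = commut (Sb q) (repb q x) := fun _ => rfl
  simp only [casimir, Fin.sum_univ_three, LinearMap.add_apply, LinearMap.smul_apply,
    Module.End.mul_apply, ad]
  simp [sgn_zero, repb_sE, repb_sF, repb_sH, h1, h3, r1]
  module

theorem casimir_descendant_sl2 (q a k : ℕ) :
    casimir (adSb q) (0 : Fin 3 → ZMod 2) ![(1 / 2 : ℂ) • sE, (1 / 2 : ℂ) • sF, sH] ![sF, sE, sH]
      ((commut (Sb q) (lower (q + 1)) ^ k) (raise (q + 1) ^ a)) =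
      ((a : ℂ) * (a + 1)) • (commut (Sb q) (lower (q + 1)) ^ k) (raise (q + 1) ^ a) := by
  have hF : adSb q sF = commut (Sb q) (lower (q + 1)) := congrArg (commut (Sb q)) (repb_sF q)
  rw [← hF]
  exact casimir_pow_apply (isLieModule_sl2 q) isFrame_sl2.isInvariantTensor sF k
    (casimir_raise_pow q a)

theorem basisNSb_idxSb₀ (q : ℕ) : ∃ c : ℂ, basisNSb q (idxSb₀ q) = c • 1 := by
  rw [basisNSb_apply]
  unfold harmNSb idxSb₀
  simp only [pow_zero, Module.End.one_apply, smul_smul]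
  exact ⟨_, rfl⟩

theorem isReduction_sl2 (q : ℕ) :
    IsReduction Sl2.bracket (adSb q) ((basisNSb q).coord (idxSb₀ q))
      (basisNSb q (idxSb₀ q)) := by
  have hL := isLieModule_sl2 q
  have ht := isFrame_sl2.isInvariantTensor
  refine isReduction_of_diagonal hL ht (basisNSb q) (c := fun t => (t.1.1 : ℂ) * (t.1.1 + 1))
    (fun t => ?_) (fun t => ?_) (fun x => ?_) rfl (casimir_act hL ht) (casimir_par hL ht)
  · rw [basisNSb_apply, harmNSb, map_smul, map_smul, map_smul, casimir_descendant_sl2,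
      smul_comm _ ((t.1.1 : ℂ) * (t.1.1 + 1)), smul_comm _ ((t.1.1 : ℂ) * (t.1.1 + 1))]
  · have hne : (t.1.1 : ℂ) + 1 ≠ 0 := Nat.cast_add_one_ne_zero _
    simp only [mul_eq_zero, hne, or_false, Nat.cast_eq_zero]
    refine ⟨fun h => ?_, fun h => by rw [h]; rfl⟩
    have := t.2.2
    exact Subtype.ext (Prod.ext h (by change t.1.2 = 0; omega))
  · obtain ⟨c, hc⟩ := basisNSb_idxSb₀ q
    rw [hc, map_smul]
    change c • commut (Sb q) (repb q x) 1 = 0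
    rw [commut_apply, mul_one, one_mul, sub_self, smul_zero]

end CasimirSpectrum

/-! ### Spherical harmonics -/

section Sphere

open MvPolynomial

/-- The derivation underlying `Jb`. -/
def rot (i : Fin 3) : Derivation ℂ Poly Poly :=
  (-Complex.I) • ((X (i + 1) : Poly) • pderiv (i + 2) - (X (i + 2) : Poly) • pderiv (i + 1))

theorem rot_apply (i : Fin 3) (f : Poly) : rot i f = Jb i f := rfl

/-- The derivation underlying `Jbminus`. -/
def rotMinus : Derivation ℂ Poly Poly := rot 0 - Complex.I • rot 1

/-- The derivation `J₁ + i J₂`. -/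
def rotPlus : Derivation ℂ Poly Poly := rot 0 + Complex.I • rot 1

theorem rotMinus_apply (f : Poly) : rotMinus f = Jbminus f := rfl

theorem rot_eq (i : Fin 3) (f : Poly) :
    rot i f = -C Complex.I * (X (i + 1) * pderiv (i + 2) f - X (i + 2) * pderiv (i + 1) f) := by
  change (-Complex.I) • (X (i + 1) * pderiv (i + 2) f - X (i + 2) * pderiv (i + 1) f) = _
  rw [smul_eq_C_mul, map_neg]

theorem C_I_mul_self : (C Complex.I : Poly) * C Complex.I = -1 := by
  rw [← map_mul, Complex.I_mul_I, map_neg, map_one]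

theorem rot_zero (f : Poly) :
    rot 0 f = -C Complex.I * (X 1 * pderiv 2 f - X 2 * pderiv 1 f) := rot_eq 0 f

theorem rot_one (f : Poly) :
    rot 1 f = -C Complex.I * (X 2 * pderiv 0 f - X 0 * pderiv 2 f) := rot_eq 1 f

theorem rot_two (f : Poly) :
    rot 2 f = -C Complex.I * (X 0 * pderiv 1 f - X 1 * pderiv 0 f) := rot_eq 2 f

theorem rotMinus_eq (f : Poly) : rotMinus f = rot 0 f - C Complex.I * rot 1 f := by
  rw [← smul_eq_C_mul]; rfl

theorem rotPlus_eq (f : Poly) : rotPlus f = rot 0 f + C Complex.I * rot 1 f := by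
  rw [← smul_eq_C_mul]; rfl

theorem rotMinus_X (k : Fin 3) :
    rotMinus (X k) = (![-X 2, C Complex.I * X 2, X 0 - C Complex.I * X 1] : Fin 3 → Poly) k := by
  have hI := C_I_mul_self
  fin_cases k <;>
    simp [rotMinus_eq, rot_zero, rot_one, pderiv_X] <;>
    grind

theorem rotPlus_X (k : Fin 3) :
    rotPlus (X k) = (![X 2, C Complex.I * X 2, -xplus] : Fin 3 → Poly) k := by
  have hI := C_I_mul_self
  fin_cases k <;>
    simp [rotPlus_eq, rot_zero, rot_one, pderiv_X, xplus] <;>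
    grind

theorem rot_two_X (k : Fin 3) :
    rot 2 (X k) = (![C Complex.I * X 1, -C Complex.I * X 0, 0] : Fin 3 → Poly) k := by
  fin_cases k <;>
    simp [rot_two, pderiv_X]

theorem derivation_C_mul (D : Derivation ℂ Poly Poly) (c : ℂ) (f : Poly) :
    D (C c * f) = C c * D f := by
  rw [← smul_eq_C_mul, D.map_smul, smul_eq_C_mul]

theorem rotPlus_xplus : rotPlus xplus = 0 := by
  have hI := C_I_mul_self
  rw [xplus, map_add, derivation_C_mul, rotPlus_X, rotPlus_X]
  simp
  linear_combination X 2 * hI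

theorem rotMinus_xplus : rotMinus xplus = C (-2) * X 2 := by
  have hI := C_I_mul_self
  rw [xplus, map_add, derivation_C_mul, rotMinus_X, rotMinus_X]
  have h2 : (C 2 : Poly) = 2 := map_ofNat C 2
  simp [h2]
  linear_combination X 2 * hI

theorem rot_two_xplus : rot 2 xplus = xplus := by
  have hI := C_I_mul_self
  rw [xplus, map_add, derivation_C_mul, rot_two_X, rot_two_X]
  simp
  linear_combination (-X 0) * hI

theorem rotPlus_rotMinus : ⁅rotPlus, rotMinus⁆ = (2 : ℂ) • rot 2 := by
  have hI := C_I_mul_self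
  refine derivation_ext fun k => ?_
  rw [Derivation.commutator_apply, rotPlus_X, rotMinus_X, Derivation.smul_apply, rot_two_X,
    smul_eq_C_mul]
  have h2 : (C 2 : Poly) = 2 := map_ofNat C 2
  fin_cases k <;> simp [rotPlus_X, rotMinus_X, xplus, h2] <;> grind

theorem rot_two_rotMinus : ⁅rot 2, rotMinus⁆ = -rotMinus := by
  have hI := C_I_mul_self
  refine derivation_ext fun k => ?_
  rw [Derivation.commutator_apply, rot_two_X, rotMinus_X, Derivation.neg_apply, rotMinus_X]
  fin_cases k <;> simp [rot_two_X, rotMinus_X] <;> grind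

theorem derivation_pow (D : Derivation ℂ Poly Poly) (f : Poly) (a : ℕ) :
    D (f ^ a) = (a : ℂ) • (f ^ (a - 1) * D f) := by
  rw [D.leibniz_pow, smul_eq_mul, Nat.cast_smul_eq_nsmul ℂ]

/-- The harmonic polynomials `J₋ᵏ (x¹ + i x²)ᵃ`. -/
def harm (a k : ℕ) : Poly := (Jbminus ^ k) (xplus ^ a)

theorem harm_zero (a : ℕ) : harm a 0 = xplus ^ a := rfl

theorem harm_succ (a k : ℕ) : harm a (k + 1) = Jbminus (harm a k) := by
  rw [harm, pow_succ', Module.End.mul_apply]; rfl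

theorem Jbminus_pow_harm (a k l : ℕ) : (Jbminus ^ l) (harm a k) = harm a (k + l) := by
  rw [harm, harm, ← Module.End.mul_apply, ← pow_add, add_comm]

theorem harm_one (a : ℕ) : harm (a + 1) 1 = ((-2 : ℂ) * (a + 1)) • (xplus ^ a * X 2) := by
  rw [harm_succ, harm_zero, ← rotMinus_apply, derivation_pow, rotMinus_xplus, Nat.add_sub_cancel,
    ← smul_eq_C_mul, mul_smul_comm, smul_smul]
  push_cast
  congr 1
  ring

/-- This writes the coefficient of θ⁴ in the odd highest weight harmonics as a descendant, so that
all coefficients are expressed by `harm`. -/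
theorem xplus_pow_mul_X (a : ℕ) :
    xplus ^ a * X 2 = (-(1 / (2 * ((a : ℂ) + 1)))) • harm (a + 1) 1 := by
  have : ((a : ℂ) + 1) ≠ 0 := Nat.cast_add_one_ne_zero a
  rw [harm_one, smul_smul]
  have h : -(1 / (2 * ((a : ℂ) + 1))) * (-2 * (a + 1)) = 1 := by field_simp
  rw [h, one_smul]

theorem isHomogeneous_rot {a : ℕ} {f : Poly} (hf : f.IsHomogeneous a) (i : Fin 3) :
    (rot i f).IsHomogeneous a := by
  have key : ∀ k l : Fin 3, (X k * pderiv l f : Poly).IsHomogeneous a := fun k l => by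
    rcases a with _ | a
    · rw [← totalDegree_zero_iff_isHomogeneous, totalDegree_eq_zero_iff_eq_C] at hf
      rw [hf, pderiv_C, mul_zero]
      exact isHomogeneous_zero _ _ _
    · rw [add_comm]
      exact (isHomogeneous_X ℂ k).mul hf.pderiv
  rw [rot_eq, ← map_neg]
  exact ((key _ _).sub (key _ _)).C_mul _

theorem isHomogeneous_xplus : xplus.IsHomogeneous 1 :=
  (isHomogeneous_X ℂ 0).add ((isHomogeneous_X ℂ 1).C_mul _)

theorem isHomogeneous_harm (a k : ℕ) : (harm a k).IsHomogeneous a := by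
  induction k with
  | zero =>
    have := isHomogeneous_xplus.pow a
    rwa [one_mul] at this
  | succ k ih =>
    rw [harm_succ, ← rotMinus_apply, rotMinus_eq]
    exact (isHomogeneous_rot ih 0).sub ((isHomogeneous_rot ih 1).C_mul _)

/-- The squared radius. -/
def radiusSq : Poly := X 0 ^ 2 + X 1 ^ 2 + X 2 ^ 2

theorem isHomogeneous_radiusSq : radiusSq.IsHomogeneous 2 :=
  ((isHomogeneous_X_pow _ 2).add (isHomogeneous_X_pow _ 2)).add (isHomogeneous_X_pow _ 2)

theorem Jbminus_radiusSq_mul (f : Poly) : Jbminus (radiusSq * f) = radiusSq * Jbminus f := by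
  have h : rotMinus radiusSq = 0 := by
    simp [radiusSq, pow_two, rotMinus_X]
    ring
  rw [← rotMinus_apply, rotMinus.leibniz, h, smul_zero, add_zero, smul_eq_mul, rotMinus_apply]

theorem Jbminus_pow_radiusSq_mul (f : Poly) (k : ℕ) :
    (Jbminus ^ k) (radiusSq * f) = radiusSq * (Jbminus ^ k) f := by
  induction k with
  | zero => rfl
  | succ k ih => rw [pow_succ', Module.End.mul_apply, ih, Jbminus_radiusSq_mul]; rfl

/-- The iterated Leibniz rule has only three terms because J₋³ kills `g`. It is used for `g =
xplus`, which has spin one. -/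
theorem Jbminus_pow_mul (f g : Poly) (hg : Jbminus (Jbminus (Jbminus g)) = 0) (n : ℕ) :
    (Jbminus ^ (n + 2)) (f * g) = (Jbminus ^ (n + 2)) f * g +
      ((n : ℂ) + 2) • ((Jbminus ^ (n + 1)) f * Jbminus g) +
      (((n : ℂ) + 2) * (n + 1) / 2) • ((Jbminus ^ n) f * Jbminus (Jbminus g)) := by
  have L : ∀ u v : Poly, Jbminus (u * v) = Jbminus u * v + u * Jbminus v := fun u v => by
    rw [← rotMinus_apply, rotMinus.leibniz, smul_eq_mul, smul_eq_mul, rotMinus_apply,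
      rotMinus_apply]; ring
  have S : ∀ m (u : Poly), Jbminus ((Jbminus ^ m) u) = (Jbminus ^ (m + 1)) u := fun m u => by
    rw [pow_succ', Module.End.mul_apply]
  induction n with
  | zero =>
    have : (Jbminus ^ 2) (f * g) = Jbminus (Jbminus (f * g)) := rfl
    rw [zero_add, this, L, map_add, L, L]
    have : (Jbminus ^ 2) f = Jbminus (Jbminus f) := rfl
    rw [zero_add, pow_one, pow_zero, this]
    simp only [Nat.cast_zero, Module.End.one_apply]
    module
  | succ n ih =>
    rw [← S, ih, map_add, map_add, map_smul, map_smul, L, L, L, hg, S, S, S, mul_zero,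
      add_zero]
    push_cast
    module

/-- Of the 2(a + 1) + 1 lowering operators on x₊^a x₊ at most two act on the last factor, so at
least 2a + 1 act on x₊^a, and induction on a applies. -/
theorem harm_eq_zero {a k : ℕ} (h : 2 * a < k) : harm a k = 0 := by
  have h3 : Jbminus (Jbminus (Jbminus xplus)) = 0 := by
    simp only [← rotMinus_apply]
    simp [rotMinus_xplus, rotMinus_X]
    rw [← mul_assoc, C_I_mul_self]; simp
  have key : ∀ a, harm a (2 * a + 1) = 0 := by
    intro a
    induction a with
    | zero => simp [harm, ← rotMinus_apply]
    | succ a ih =>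
      have e : ∀ m, 2 * a < m → (Jbminus ^ m) (xplus ^ a) = 0 := fun m hm => by
        obtain ⟨r, rfl⟩ := Nat.exists_eq_add_of_lt hm
        have := Jbminus_pow_harm a (2 * a + 1) r
        rw [ih, map_zero] at this
        rw [this, harm]; congr 2; omega
      rw [harm, pow_succ xplus, show 2 * (a + 1) + 1 = (2 * a + 1) + 2 by ring, Jbminus_pow_mul _ _ h3,
        e _ (by omega), e _ (by omega), e _ (by omega)]
      simp
  obtain ⟨r, rfl⟩ := Nat.exists_eq_add_of_lt h
  rw [show 2 * a + r + 1 = 2 * a + 1 + r by ring, ← Jbminus_pow_harm, key, map_zero]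

theorem hasDerivAt_eval {γ : ℝ → Fin 3 → ℂ} {γ' : Fin 3 → ℂ} {t : ℝ}
    (h : ∀ k, HasDerivAt (fun s => γ s k) (γ' k) t) (f : Poly) :
    HasDerivAt (fun s => eval (γ s) f) (∑ k, γ' k * eval (γ t) (pderiv k f)) t := by
  induction f using MvPolynomial.induction_on with
  | C a => simpa using hasDerivAt_const t a
  | add p q hp hq => simpa [mul_add, Finset.sum_add_distrib] using hp.fun_add hq
  | mul_X p k hp =>
    have e : (fun s => eval (γ s) (p * X k)) = fun s => eval (γ s) p * γ s k := by
      funext s; simp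
    rw [e]
    refine (hp.fun_mul (h k)).congr_deriv ?_
    simp only [Derivation.leibniz, smul_eq_mul, pderiv_X, map_add, map_mul, eval_X, mul_add,
      Finset.sum_add_distrib, Finset.sum_mul]
    have A : ∑ x, γ' x * (eval (γ t) p * eval (γ t) (Pi.single (M := fun _ => Poly) x 1 k)) =
        eval (γ t) p * γ' k := by
      rw [Finset.sum_eq_single k]
      · rw [Pi.single_eq_same, map_one]; ring
      · intro l _ hl
        rw [Pi.single_eq_of_ne hl.symm, map_zero, mul_zero, mul_zero]
      · simp
    rw [A, add_comm]
    congr 1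
    exact Finset.sum_congr rfl fun l _ => by ring

/-- Restriction to the sphere as a linear map. -/
def restrictSbL (ρ : ℝ) : Poly →ₗ[ℂ] (sphere ρ → ℂ) where
  toFun := restrictSb ρ
  map_add' f g := by funext y; simp [restrictSb]
  map_smul' c f := by funext y; simp [restrictSb]

theorem fin_three_cases (i k : Fin 3) : k = i ∨ k = i + 1 ∨ k = i + 2 := by
  revert i k; decide

theorem sum_fin_three {A : Type*} [AddCommMonoid A] (i : Fin 3) (u : Fin 3 → A) :
    ∑ k, u k = u i + u (i + 1) + u (i + 2) := by
  rw [← Equiv.sum_comp (Equiv.addLeft i), Fin.sum_univ_three]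
  simp

/-- The derivatives of a polynomial that vanishes on the sphere along tangent vectors vanish. -/
theorem eval_pderiv_of_curve {ρ : ℝ} {f : Poly} (hf : restrictSb ρ f = 0) {g : ℝ → Fin 3 → ℝ}
    {g' : Fin 3 → ℝ} (hg : ∀ t, g t ∈ sphere ρ) (hd : ∀ k, HasDerivAt (fun s => g s k) (g' k) 0) :
    ∑ k, ((g' k : ℝ) : ℂ) * eval (fun l => ((g 0 l : ℝ) : ℂ)) (pderiv k f) = 0 := by
  have h0 : (fun s => eval (fun k => ((g s k : ℝ) : ℂ)) f) = fun _ => 0 :=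
    funext fun s => by
      have := congrFun hf ⟨g s, hg s⟩
      rwa [restrictSb, Pi.zero_apply] at this
  have h1 := hasDerivAt_eval (γ := fun s k => ((g s k : ℝ) : ℂ))
    (fun k => HasDerivAt.ofReal_comp (hd k)) f
  rw [h0] at h1
  exact h1.unique (hasDerivAt_const _ _)

/-- The rotation by the angle `t` around the axis `i`. -/
def rotate (i : Fin 3) (y : Fin 3 → ℝ) (t : ℝ) (k : Fin 3) : ℝ :=
  if k = i + 1 then Real.cos t * y (i + 1) - Real.sin t * y (i + 2)
  else if k = i + 2 then Real.sin t * y (i + 1) + Real.cos t * y (i + 2) else y i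

/-- Up to the factor -i the operator is the derivative along the rotations about axis `i`, and these
preserve the sphere. Hence the angular momentum operators descend to functions on the sphere. -/
theorem restrictSb_Jb {ρ : ℝ} {f : Poly} (hf : restrictSb ρ f = 0) (i : Fin 3) :
    restrictSb ρ (Jb i f) = 0 := by
  funext ⟨y, hy⟩
  have h12 : i + 2 ≠ i + 1 := by revert i; decide
  have h01 : i ≠ i + 1 := by revert i; decide
  have h02 : i ≠ i + 2 := by revert i; decide
  have g0 : rotate i y 0 = y := by
    funext k
    rcases fin_three_cases i k with h | h | h <;>
      simp only [rotate, h, h01, h02, h12, if_true, if_false] <;> simp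
  have hg : ∀ t, rotate i y t ∈ sphere ρ := fun t => by
    have hy : ∑ k, y k ^ 2 = ρ ^ 2 := hy
    change ∑ k, rotate i y t k ^ 2 = ρ ^ 2
    rw [← hy, sum_fin_three i, sum_fin_three i]
    simp only [rotate, h01, h02, h12, if_true, if_false]
    linear_combination (y (i + 1) ^ 2 + y (i + 2) ^ 2) * Real.sin_sq_add_cos_sq t
  have hd : ∀ k, HasDerivAt (fun s => rotate i y s k)
      (if k = i + 1 then -y (i + 2) else if k = i + 2 then y (i + 1) else 0) 0 := fun k => by
    simp only [rotate]
    split_ifs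
    · simpa using ((Real.hasDerivAt_cos 0).mul_const (y (i + 1))).fun_sub
        ((Real.hasDerivAt_sin 0).mul_const (y (i + 2)))
    · simpa using ((Real.hasDerivAt_sin 0).mul_const (y (i + 1))).fun_add
        ((Real.hasDerivAt_cos 0).mul_const (y (i + 2)))
    · exact hasDerivAt_const _ _
  have h2 := eval_pderiv_of_curve hf hg hd
  rw [sum_fin_three i, g0] at h2
  simp only [h01, h02, h12, if_true, if_false, Complex.ofReal_neg, Complex.ofReal_zero] at h2
  rw [restrictSb, Pi.zero_apply, ← rot_apply, rot_eq]
  simp only [map_mul, map_sub, map_neg, eval_C, eval_X]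
  linear_combination (-Complex.I) * h2

end Sphere

/-! ### Linear independence of the spherical harmonics. -/

section SphereIndependence

open MvPolynomial

theorem Jbminus_relations :
    (Jb 0 + Complex.I • Jb 1) * Jbminus = Jbminus * (Jb 0 + Complex.I • Jb 1) + (2 : ℂ) • Jb 2 ∧
    Jb 2 * Jbminus = Jbminus * Jb 2 - Jbminus := by
  have e1 := fun f => DFunLike.congr_fun rotPlus_rotMinus f
  have e2 := fun f => DFunLike.congr_fun rot_two_rotMinus f
  simp only [Derivation.commutator_apply] at e1 e2
  exact ⟨LinearMap.ext fun f => sub_eq_iff_eq_add'.1 (e1 f),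
    LinearMap.ext fun f => (sub_eq_iff_eq_add'.1 (e2 f)).trans (sub_eq_add_neg _ _).symm⟩

theorem Jb_two_xplus_pow (a : ℕ) : Jb 2 (xplus ^ a) = (a : ℂ) • xplus ^ a := by
  rw [← rot_apply, derivation_pow, rot_two_xplus]
  rcases a with _ | a
  · simp
  · rw [Nat.add_sub_cancel, ← pow_succ]

theorem Jbplus_xplus_pow (a : ℕ) : (Jb 0 + Complex.I • Jb 1) (xplus ^ a) = 0 := by
  have : rotPlus (xplus ^ a) = 0 := by rw [derivation_pow, rotPlus_xplus, mul_zero, smul_zero]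
  exact this

theorem restrictSb_xplus_pow_ne_zero {ρ : ℝ} (hρ : 0 < ρ) (a : ℕ) :
    restrictSb ρ (xplus ^ a) ≠ 0 := fun h => by
  have hy : ![ρ, 0, 0] ∈ sphere ρ := by
    change ∑ k, ![ρ, 0, 0] k ^ 2 = ρ ^ 2
    simp [Fin.sum_univ_three]
  have := congrFun h ⟨_, hy⟩
  rw [restrictSb, Pi.zero_apply] at this
  simp [xplus] at this
  exact hρ.ne' this.1

/-- The harmonic polynomials are linearly independent as functions on the sphere. -/
theorem linearIndependent_harm {ρ : ℝ} (hρ : 0 < ρ) :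
    LinearIndependent ℂ fun t : {t : ℕ × ℕ // t.2 ≤ 2 * t.1} =>
      restrictSb ρ (harm t.1.1 t.1.2) := by
  set K := LinearMap.ker (restrictSbL ρ) with hK
  -- The polynomials that vanish on the sphere form a submodule, so the theory of primitive vectors
  -- applies to the quotient, which embeds into the functions on the sphere.
  have stable : ∀ i, K ≤ K.comap (Jb i) := fun i f hf => restrictSb_Jb hf i
  have hE : K ≤ K.comap (Jb 0 + Complex.I • Jb 1) := fun f hf =>
    K.add_mem (stable 0 hf) (K.smul_mem _ (stable 1 hf))
  have hF : K ≤ K.comap Jbminus := fun f hf =>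
    K.sub_mem (stable 0 hf) (K.smul_mem _ (stable 1 hf))
  obtain ⟨r1, r2⟩ := Jbminus_relations
  have q1 : K.mapQ K _ hE * K.mapQ K _ hF =
      K.mapQ K _ hF * K.mapQ K _ hE + (2 : ℂ) • K.mapQ K _ (stable 2) := by
    refine LinearMap.ext fun x => ?_
    obtain ⟨f, rfl⟩ := K.mkQ_surjective x
    exact congrArg K.mkQ (LinearMap.congr_fun r1 f)
  have q2 : K.mapQ K _ (stable 2) * K.mapQ K _ hF =
      K.mapQ K _ hF * K.mapQ K _ (stable 2) - K.mapQ K _ hF := by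
    refine LinearMap.ext fun x => ?_
    obtain ⟨f, rfl⟩ := K.mkQ_surjective x
    exact congrArg K.mkQ (LinearMap.congr_fun r2 f)
  have hw : ∀ a : ℕ, K.mapQ K _ (stable 2) (K.mkQ (xplus ^ a)) = (a : ℂ) • K.mkQ (xplus ^ a) :=
    fun a => by rw [← map_smul, ← Jb_two_xplus_pow]; rfl
  have hi : LinearIndependent ℂ fun a : ℕ => K.mkQ (xplus ^ a) :=
    Module.End.eigenvectors_linearIndependent' (K.mapQ K _ (stable 2)) (fun a : ℕ => (a : ℂ))
      Nat.cast_injective _ fun a => ⟨Module.End.mem_eigenspace_iff.2 (hw a), fun h =>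
        restrictSb_xplus_pow_ne_zero hρ a ((Submodule.Quotient.mk_eq_zero K).1 h)⟩
  have := linearIndependent_descendants q1 q2 (d := fun a : ℕ => 2 * a)
    (fun a => (congrArg K.mkQ (Jbplus_xplus_pow a)).trans (map_zero _))
    (fun a => by rw [hw]; congr 1; push_cast; ring) hi
    (fun t : {t : ℕ × ℕ // t.2 ≤ 2 * t.1} => t.1.1) (fun t => t.1.2) (fun t => t.2)
    (fun a b h h' => Subtype.ext (Prod.ext h h'))
  have e : ∀ a k, ((K.mapQ K _ hF) ^ k) (K.mkQ (xplus ^ a)) = K.mkQ (harm a k) := fun a k => by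
    induction k with
    | zero => rfl
    | succ k ih => rw [pow_succ', Module.End.mul_apply, ih, harm_succ]; rfl
  simp only [e] at this
  exact (this.map' (K.liftQ (restrictSbL ρ) le_rfl)
    (Submodule.ker_liftQ_eq_bot _ _ _ le_rfl) :)

/-- The coefficient of a harmonic polynomial, as a functional on the functions on the sphere. -/
theorem exists_harm_coefficient {ρ : ℝ} (hρ : 0 < ρ) (a k : ℕ) :
    ∃ φ : (sphere ρ → ℂ) →ₗ[ℂ] ℂ, ∀ b l,
      φ (restrictSb ρ (harm b l)) = if b = a ∧ l = k ∧ k ≤ 2 * a then 1 else 0 := by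
  by_cases hk : k ≤ 2 * a
  · obtain ⟨φ, h1, h2⟩ := exists_coordinate (linearIndependent_harm hρ) ⟨(a, k), hk⟩
    refine ⟨φ, fun b l => ?_⟩
    by_cases hl : l ≤ 2 * b
    · by_cases h : b = a ∧ l = k
      · obtain ⟨rfl, rfl⟩ := h
        simpa [hk] using h1
      · rw [if_neg (fun h' => h ⟨h'.1, h'.2.1⟩)]
        exact h2 ⟨(b, l), hl⟩ fun h' => h (by simpa using h')
    · rw [harm_eq_zero (by omega), if_neg (by omega)]
      exact (congrArg φ (map_zero (restrictSbL ρ))).trans (map_zero φ)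
  · exact ⟨0, fun b l => by simp [hk]⟩

theorem highSb_coeff_ne_zero {ρ : ℝ} (hρ : 0 < ρ) (a : ℕ) :
    ((√((2 * a + 1).factorial) / (2 ^ a * a.factorial * ρ ^ a) : ℝ) : ℂ) ≠ 0 := by
  have : 0 < √((2 * a + 1).factorial : ℝ) / (2 ^ a * a.factorial * ρ ^ a) := by positivity
  exact_mod_cast this.ne'

theorem harmSb_eq (ρ : ℝ) (q : ℕ) (t : IdxSb q) : harmSb ρ q t =
    (normSb t.1.1 t.1.2 * ((√((2 * t.1.1 + 1).factorial) /
      (2 ^ t.1.1 * t.1.1.factorial * ρ ^ t.1.1) : ℝ) : ℂ)) • restrictSb ρ (harm t.1.1 t.1.2) := by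
  rw [harmSb, map_smul, smul_smul]
  exact map_smul (restrictSbL ρ) _ _

theorem linearIndependent_harmSb {ρ : ℝ} (hρ : 0 < ρ) (q : ℕ) :
    LinearIndependent ℂ (harmSb ρ q) := by
  have h := (linearIndependent_harm hρ).comp
    (fun t : IdxSb q => (⟨t.1, t.2.2⟩ : {t : ℕ × ℕ // t.2 ≤ 2 * t.1}))
    (fun a b hab => Subtype.ext (Subtype.mk.inj hab))
  have e : harmSb ρ q = (fun t : IdxSb q => Units.mk0 _ (mul_ne_zero (normSb_ne_zero t.1.1 t.1.2)
      (highSb_coeff_ne_zero hρ t.1.1))) • fun t : IdxSb q => restrictSb ρ (harm t.1.1 t.1.2) :=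
    funext fun t => harmSb_eq ρ q t
  rw [e]
  exact h.units_smul _

end SphereIndependence

/-! ### Superspherical harmonics -/

section Superharmonics

open MvPolynomial

theorem mulX_apply (k : Fin 3) (f : SPoly) :
    mulX k f = ![X k * f 0, X k * f 1, X k * f 2, X k * f 3] := by
  funext i; fin_cases i <;> rfl

theorem dX_apply (k : Fin 3) (f : SPoly) :
    dX k f = ![pderiv k (f 0), pderiv k (f 1), pderiv k (f 2), pderiv k (f 3)] := by
  funext i; fin_cases i <;> rfl

theorem JXminus_apply (f : SPoly) :
    JXminus f = ![Jbminus (f 0), Jbminus (f 1), Jbminus (f 2) + f 1, Jbminus (f 3)] := by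
  have hI : Complex.I * (2⁻¹ * Complex.I) = -2⁻¹ := by
    linear_combination (2⁻¹ : ℂ) * Complex.I_mul_I
  funext i
  fin_cases i <;>
    simp [JXminus, JX, mulX_apply, dX_apply, mulTheta, dTheta, pauli, Fin.sum_univ_two, Jbminus, Jb,
      smul_smul, hI] <;> module

/-- The polynomial `x¹ - i x²`. -/
def xminus : Poly := X 0 - C Complex.I * X 1

theorem JTheta_one_apply (f : SPoly) :
    JTheta 1 f = (1 / 2 : ℂ) • ![-(xminus * f 2 + X 2 * f 1),
      xminus * f 3 - (pderiv 0 (f 0) - C Complex.I * pderiv 1 (f 0)),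
      pderiv 2 (f 0) - X 2 * f 3,
      -(pderiv 0 (f 2) - C Complex.I * pderiv 1 (f 2) + pderiv 2 (f 1))] := by
  funext i
  fin_cases i <;>
    simp [JTheta, mulX_apply, dX_apply, mulTheta, dTheta, pauli, Fin.sum_univ_two, Fin.sum_univ_three,
      Complex.I_mul_I, xminus, ← smul_eq_C_mul, sub_mul] <;>
    module

/-- Besides the orbital part, J₋ adds the coefficient of θ⁴ to that of θ⁵. This spin part commutes
with the orbital one and squares to zero, so it enters at most once, in k ways. -/
theorem JXminus_pow_apply (f : SPoly) (k : ℕ) :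
    (JXminus ^ k) f = ![(Jbminus ^ k) (f 0), (Jbminus ^ k) (f 1),
      (Jbminus ^ k) (f 2) + (k : ℂ) • (Jbminus ^ (k - 1)) (f 1), (Jbminus ^ k) (f 3)] := by
  have S : ∀ m (u : Poly), Jbminus ((Jbminus ^ m) u) = (Jbminus ^ (m + 1)) u := fun m u => by
    rw [pow_succ', Module.End.mul_apply]
  induction k with
  | zero => funext i; fin_cases i <;> simp
  | succ k ih =>
    rw [pow_succ', Module.End.mul_apply, ih, JXminus_apply]
    have : Jbminus ((k : ℂ) • (Jbminus ^ (k - 1)) (f 1)) = (k : ℂ) • (Jbminus ^ k) (f 1) := by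
      rcases k with _ | k
      · simp
      · rw [map_smul, S, Nat.add_sub_cancel]
    funext i
    fin_cases i
    · exact S _ _
    · exact S _ _
    · change Jbminus (_ + _) + _ = _
      rw [map_add, this, S]
      simp only [Nat.cast_add, Nat.cast_one, Nat.add_sub_cancel, Fin.reduceFinMk, Matrix.cons_val]
      module
    · exact S _ _

theorem harmonic_even (a k : ℕ) :
    (JXminus ^ k) ![xplus ^ a, 0, 0, 0] = ![harm a k, 0, 0, 0] := by
  rw [JXminus_pow_apply]
  simp [harm]

theorem harmonic_odd (a k : ℕ) :
    (JXminus ^ k) ![0, xplus ^ a * X 2, xplus ^ a * xplus, 0] =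
      ![0, (-(1 / (2 * ((a : ℂ) + 1)))) • harm (a + 1) (k + 1),
        (1 - k / (2 * ((a : ℂ) + 1))) • harm (a + 1) k, 0] := by
  have h : (k : ℂ) • (Jbminus ^ (k - 1)) (xplus ^ a * X 2) =
      (-(k / (2 * ((a : ℂ) + 1)))) • harm (a + 1) k := by
    rcases k with _ | k
    · simp
    · rw [Nat.add_sub_cancel, xplus_pow_mul_X, map_smul, Jbminus_pow_harm, smul_smul, add_comm 1 k]
      congr 1; ring
  have h' : (Jbminus ^ k) (xplus ^ a * X 2) =
      (-(1 / (2 * ((a : ℂ) + 1)))) • harm (a + 1) (k + 1) := by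
    rw [xplus_pow_mul_X, map_smul, Jbminus_pow_harm, add_comm 1 k]
  rw [JXminus_pow_apply]
  simp only [Matrix.cons_val, map_zero, h, h', ← pow_succ]
  congr 3
  change harm (a + 1) k + _ = _
  rw [sub_smul, one_smul, neg_smul, sub_eq_add_neg]

theorem pderiv_xplus : pderiv 0 xplus = 1 ∧ pderiv 1 xplus = C Complex.I ∧ pderiv 2 xplus = 0 := by
  refine ⟨?_, ?_, ?_⟩ <;> simp [xplus, pderiv_X]

theorem JTheta_one_even (a : ℕ) :
    JTheta 1 ![xplus ^ a, 0, 0, 0] = (-(a : ℂ)) • ![0, xplus ^ (a - 1), 0, 0] := by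
  obtain ⟨h0, h1, h2⟩ := pderiv_xplus
  have e : pderiv 0 (xplus ^ a) - C Complex.I * pderiv 1 (xplus ^ a) =
      (2 * a : ℂ) • xplus ^ (a - 1) := by
    rw [derivation_pow, derivation_pow, h0, h1, mul_smul_comm, mul_comm (xplus ^ (a - 1)) (C _),
      ← mul_assoc, C_I_mul_self]
    simp only [mul_one, neg_mul, one_mul]
    module
  have e2 : pderiv 2 (xplus ^ a) = 0 := by rw [derivation_pow, h2, mul_zero, smul_zero]
  rw [JTheta_one_apply]
  simp only [Matrix.cons_val, e, e2]
  funext i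
  fin_cases i <;> simp [smul_smul]

theorem harmonic_even_descendant (a k : ℕ) :
    (JXminus ^ k) (JTheta 1 ![xplus ^ (a + 1), 0, 0, 0]) = (-((a : ℂ) + 1)) •
      ![0, harm a k, (k : ℂ) • harm a (k - 1), 0] := by
  rw [JTheta_one_even, map_smul, JXminus_pow_apply]
  simp [harm]

/-- The coefficient without θ arises from (x¹ - i x²) x₊ + (x³)² being the squared radius. On the
sphere it is constant, so the body is again a multiple of x₊^a. -/
theorem JTheta_one_odd (a : ℕ) :
    JTheta 1 ![0, xplus ^ a * X 2, xplus ^ a * xplus, 0] =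
      ![(-(1 / 2 : ℂ)) • (radiusSq * xplus ^ a), 0, 0, (-((2 * a + 3) / 2 : ℂ)) • xplus ^ a] := by
  obtain ⟨h0, h1, h2⟩ := pderiv_xplus
  have e : pderiv 0 (xplus ^ (a + 1)) - C Complex.I * pderiv 1 (xplus ^ (a + 1)) =
      (2 * (a + 1) : ℂ) • xplus ^ a := by
    rw [derivation_pow, derivation_pow, h0, h1, mul_smul_comm, mul_comm (xplus ^ (a + 1 - 1)) (C _),
      ← mul_assoc, C_I_mul_self]
    simp only [mul_one, neg_mul, one_mul, Nat.add_sub_cancel]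
    push_cast
    module
  have e2 : pderiv 2 (xplus ^ a * X 2) = xplus ^ a := by
    rw [Derivation.leibniz, derivation_pow, h2, mul_zero, smul_zero, smul_zero, add_zero,
      pderiv_X_self, smul_eq_mul, mul_one]
  have e3 : xminus * (xplus ^ a * xplus) + X 2 * (xplus ^ a * X 2) = radiusSq * xplus ^ a := by
    have hI := C_I_mul_self
    rw [xminus, radiusSq]
    have : (X 0 - C Complex.I * X 1) * xplus = X 0 ^ 2 + X 1 ^ 2 := by
      rw [xplus]
      linear_combination (-X 1 ^ 2) * hI
    linear_combination xplus ^ a * this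
  rw [JTheta_one_apply]
  simp only [Matrix.cons_val, ← pow_succ, e, e2]
  rw [pow_succ, e3]
  funext i
  fin_cases i <;> simp [smul_smul]
  module

theorem harmonic_odd_descendant (a k : ℕ) :
    (JXminus ^ k) (JTheta 1 ![0, xplus ^ a * X 2, xplus ^ a * xplus, 0]) =
      ![(-(1 / 2 : ℂ)) • (radiusSq * harm a k), 0, 0, (-((2 * a + 3) / 2 : ℂ)) • harm a k] := by
  rw [JTheta_one_odd, JXminus_pow_apply]
  simp only [Matrix.cons_val, map_zero, map_smul, Jbminus_pow_radiusSq_mul, smul_zero,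
    add_zero]
  rfl

end Superharmonics

/-! ### Points of the supersphere -/

section Points

open MvPolynomial

variable {L : ℕ}

theorem evalPoly_smul (f : Poly) (c : Fin 3 → ℂ) (u : CL L) :
    evalPoly f (fun k => c k • u) =
      ∑ m ∈ f.support, (f.coeff m * ∏ k, c k ^ m k) • u ^ (m 0 + m 1 + m 2) := by
  rw [evalPoly]
  refine Finset.sum_congr rfl fun m _ => ?_
  rw [smul_pow, smul_pow, smul_pow, smul_mul_smul_comm, smul_mul_smul_comm, smul_smul, ← pow_add,
    ← pow_add, Fin.prod_univ_three]

theorem evalPoly_smul_one (f : Poly) (c : Fin 3 → ℂ) :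
    evalPoly f (fun k => c k • (1 : CL L)) = eval c f • 1 := by
  rw [evalPoly_smul, eval_eq', Finset.sum_smul]
  exact Finset.sum_congr rfl fun m _ => by rw [one_pow]

theorem evalPoly_smul_of_isHomogeneous {f : Poly} {a : ℕ} (hf : f.IsHomogeneous a)
    (c : Fin 3 → ℂ) (u : CL L) : evalPoly f (fun k => c k • u) = eval c f • u ^ a := by
  rw [evalPoly_smul, eval_eq', Finset.sum_smul]
  refine Finset.sum_congr rfl fun m hm => ?_
  have h := hf (mem_support_iff.1 hm)
  change Finsupp.weight (fun _ => 1) m = a at h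
  rw [← Finsupp.degree_eq_weight_one, Finsupp.degree_eq_sum, Fin.sum_univ_three] at h
  rw [h]

/-- If `u` acts as 1 on `z`, a nilpotent correction in the coordinates is invisible after
multiplication by `z`. -/
theorem evalPoly_smul_mul {f : Poly} {c : Fin 3 → ℂ} {u z : CL L} (h : u * z = z) :
    evalPoly f (fun k => c k • u) * z = eval c f • z := by
  have h' : ∀ n : ℕ, u ^ n * z = z := fun n => by
    induction n with
    | zero => rw [pow_zero, one_mul]
    | succ n ih => rw [pow_succ, mul_assoc, h, ih]
  rw [evalPoly_smul, eval_eq', Finset.sum_mul, Finset.sum_smul]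
  exact Finset.sum_congr rfl fun m _ => by rw [smul_mul_assoc, h']

/-- The generators of the Grassmann algebra. -/
def gen (k : Fin L) : CL L := ExteriorAlgebra.ι ℂ (Pi.single k (1 : ℂ))

theorem gen_mul_self (k : Fin L) : gen k * gen k = 0 := ExteriorAlgebra.ι_sq_zero _

theorem gen_mul_gen_mul_left (k l : Fin L) : gen k * gen l * gen k = 0 := by
  have h : gen k * gen l + gen l * gen k = 0 := ExteriorAlgebra.ι_add_mul_swap _ _
  rw [eq_neg_of_add_eq_zero_left h, neg_mul, mul_assoc, gen_mul_self, mul_zero, neg_zero]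

theorem gen_mul_gen_mul_right (k l : Fin L) : gen k * gen l * gen l = 0 := by
  rw [mul_assoc, gen_mul_self, mul_zero]

theorem gen_mem_BL (k : Fin L) : gen k ∈ BL L := Algebra.subset_adjoin ⟨k, rfl⟩

theorem gen_mem_CLpart (k : Fin L) : gen k ∈ CLpart L 1 := CliffordAlgebra.ι_mem_evenOdd_one _ _

theorem gen_mul_gen_mem_CLpart (k l : Fin L) : gen k * gen l ∈ CLpart L 0 :=
  CliffordAlgebra.ι_mul_ι_mem_evenOdd_zero _ _ _

theorem one_mem_CLpart : (1 : CL L) ∈ CLpart L 0 :=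
  SetLike.one_mem_graded (CliffordAlgebra.evenOdd (0 : QuadraticForm ℂ (Fin L → ℂ)))

theorem ofReal_smul_mem_BL (r : ℝ) {z : CL L} (hz : z ∈ BL L) : ((r : ℝ) : ℂ) • z ∈ BL L := by
  have : ((r : ℝ) : ℂ) • z = r • z := algebraMap_smul ℂ r z
  rw [this]
  exact (BL L).smul_mem hz r

theorem algebraMap_ofReal (r : ℝ) : algebraMap ℝ (CL L) r = ((r : ℝ) : ℂ) • 1 := by
  rw [IsScalarTower.algebraMap_apply ℝ ℂ (CL L), Algebra.algebraMap_eq_smul_one]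
  rfl

/-- The even element `1 - ρ⁻² ξ_k ξ_l` of the Grassmann algebra. -/
def shrink (ρ : ℝ) (k l : Fin L) : CL L := 1 - ((1 / ρ ^ 2 : ℝ) : ℂ) • (gen k * gen l)

theorem shrink_pow (ρ : ℝ) (k l : Fin L) (a : ℕ) :
    shrink ρ k l ^ a = 1 - ((a : ℂ) * ((1 / ρ ^ 2 : ℝ) : ℂ)) • (gen k * gen l) := by
  have h : gen k * gen l * (gen k * gen l) = 0 := by
    rw [← mul_assoc, gen_mul_gen_mul_left, zero_mul]
  induction a with
  | zero => simp
  | succ a ih =>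
    rw [pow_succ, ih, shrink, sub_mul, mul_sub, mul_sub, smul_mul_smul_comm, h, smul_zero, one_mul,
      one_mul, mul_one]
    push_cast
    module

theorem shrink_mul {ρ : ℝ} {k l : Fin L} {z : CL L} (h : gen k * gen l * z = 0) :
    shrink ρ k l * z = z := by
  rw [shrink, sub_mul, one_mul, smul_mul_assoc, h, smul_zero, sub_zero]

/-- ρ² (1 - ρ⁻² ξ_k ξ_l)² = ρ² - 2 ξ_k ξ_l compensates the odd term 2 θ⁴ θ⁵. -/
theorem point_mem_supersphere {ρ : ℝ} (hρ : 0 < ρ) (k l : Fin L) {y : Fin 3 → ℝ}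
    (hy : y ∈ sphere ρ) :
    ((fun r => ((y r : ℝ) : ℂ) • shrink ρ k l, ![gen k, gen l]) :
      (Fin 3 → CL L) × (Fin 2 → CL L)) ∈ supersphere L ρ := by
  have hy : ∑ r, y r ^ 2 = ρ ^ 2 := hy
  refine ⟨fun r => ⟨ofReal_smul_mem_BL _ ((BL L).sub_mem (BL L).one_mem (ofReal_smul_mem_BL _
    ((BL L).mul_mem (gen_mem_BL k) (gen_mem_BL l)))), ?_⟩, fun α => ?_, ?_⟩
  · exact Submodule.smul_mem _ _ (Submodule.sub_mem _ one_mem_CLpart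
      (Submodule.smul_mem _ _ (gen_mul_gen_mem_CLpart k l)))
  · fin_cases α
    · exact ⟨gen_mem_BL k, gen_mem_CLpart k⟩
    · exact ⟨gen_mem_BL l, gen_mem_CLpart l⟩
  · have e : ∑ r, (((y r : ℝ) : ℂ) • shrink ρ k l) ^ 2 = ((ρ ^ 2 : ℝ) : ℂ) • shrink ρ k l ^ 2 := by
      rw [← hy]
      push_cast
      rw [Finset.sum_smul]
      exact Finset.sum_congr rfl fun r _ => smul_pow _ _ _
    have hρ' : (ρ : ℂ) ≠ 0 := by exact_mod_cast hρ.ne'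
    change ∑ r, (((y r : ℝ) : ℂ) • shrink ρ k l) ^ 2 + 2 * (gen k * gen l) = _
    rw [e, shrink_pow, algebraMap_ofReal, smul_sub, smul_smul, two_mul]
    have h2 : ((ρ ^ 2 : ℝ) : ℂ) * (((2 : ℕ) : ℂ) * ((1 / ρ ^ 2 : ℝ) : ℂ)) = 2 := by
      push_cast; field_simp
    rw [h2]
    module

/-- With a single odd coordinate present the term θ⁴ θ⁵ vanishes, and no correction of the even
coordinates is needed. -/
theorem realPoint_mem_supersphere {ρ : ℝ} (α : Fin 2) {θ : CL L} (h : θ ∈ BL L)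
    (h' : θ ∈ CLpart L 1) {y : Fin 3 → ℝ} (hy : y ∈ sphere ρ) :
    ((fun r => ((y r : ℝ) : ℂ) • 1, Pi.single α θ) : (Fin 3 → CL L) × (Fin 2 → CL L)) ∈
      supersphere L ρ := by
  have hy : ∑ r, y r ^ 2 = ρ ^ 2 := hy
  refine ⟨fun r => ⟨ofReal_smul_mem_BL _ (BL L).one_mem, Submodule.smul_mem _ _ one_mem_CLpart⟩,
    fun β => ?_, ?_⟩
  · change Pi.single (M := fun _ => CL L) α θ β ∈ _ ∧ Pi.single (M := fun _ => CL L) α θ β ∈ _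
    rw [Pi.single_apply]
    split_ifs
    · exact ⟨h, h'⟩
    · exact ⟨(BL L).zero_mem, Submodule.zero_mem _⟩
  · change ∑ r, (((y r : ℝ) : ℂ) • (1 : CL L)) ^ 2 + 2 * (Pi.single (M := fun _ => CL L) α θ 0 *
      Pi.single (M := fun _ => CL L) α θ 1) = _
    have e : Pi.single (M := fun _ => CL L) α θ 0 * Pi.single (M := fun _ => CL L) α θ 1 = 0 := by
      fin_cases α <;> simp
    rw [e, mul_zero, add_zero, algebraMap_ofReal, ← hy]
    push_cast
    rw [Finset.sum_smul]
    exact Finset.sum_congr rfl fun r _ => by rw [smul_pow, one_pow]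

theorem algebraMapInv_gen (k : Fin L) : ExteriorAlgebra.algebraMapInv (gen k) = 0 := by
  simp [ExteriorAlgebra.algebraMapInv, gen]

theorem exists_linear_coefficient (k : Fin L) :
    ∃ κ : CL L →ₗ[ℂ] ℂ, κ 1 = 0 ∧ κ (gen k) = 1 := by
  let κ : CL L →ₗ[ℂ] ℂ := LinearMap.proj k ∘ₗ ExteriorAlgebra.ιInv
  have hκ : κ (gen k) = 1 := by
    rw [LinearMap.comp_apply, gen, ExteriorAlgebra.ι_leftInverse]
    simp
  refine ⟨κ - κ 1 • ExteriorAlgebra.algebraMapInv.toLinearMap, ?_, ?_⟩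
  · simp
  · rw [LinearMap.sub_apply, LinearMap.smul_apply, AlgHom.toLinearMap_apply, algebraMapInv_gen, hκ,
      smul_zero, sub_zero]

/-- The functional is the determinant in the coordinates `k` and `l` on bivectors, extended by zero
to the other degrees. -/
theorem exists_quadratic_coefficient {k l : Fin L} (hkl : k ≠ l) :
    ∃ κ : CL L →ₗ[ℂ] ℂ, κ 1 = 0 ∧ (∀ r, κ (gen r) = 0) ∧ κ (gen k * gen l) = 1 := by
  let d : (Fin L → ℂ) [⋀^Fin 2]→ₗ[ℂ] ℂ :=
    Matrix.detRowAlternating.compLinearMap (LinearMap.funLeft ℂ ℂ ![k, l])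
  let F : ∀ i, (Fin L → ℂ) [⋀^Fin i]→ₗ[ℂ] ℂ := Pi.single 2 d
  refine ⟨ExteriorAlgebra.liftAlternating F, ?_, fun r => ?_, ?_⟩
  · rw [ExteriorAlgebra.liftAlternating_one]
    simp [F]
  · rw [gen, ExteriorAlgebra.liftAlternating_ι]
    simp [F]
  · have e : gen k * gen l = ExteriorAlgebra.ιMulti ℂ 2 ![Pi.single k (1 : ℂ), Pi.single l 1] := by
      simp [ExteriorAlgebra.ιMulti_apply, gen]
    rw [e, ExteriorAlgebra.liftAlternating_apply_ιMulti]
    have : F 2 = d := Pi.single_eq_same _ _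
    rw [this]
    change Matrix.det (Matrix.of fun i => LinearMap.funLeft ℂ ℂ ![k, l]
      ((![Pi.single k (1 : ℂ), Pi.single l 1] : Fin 2 → Fin L → ℂ) i)) = 1
    rw [Matrix.det_fin_two]
    simp [LinearMap.funLeft_apply, hkl, hkl.symm]

end Points

/-! ### Recovering the coefficients of a superfunction, and its body. -/

section Components

open MvPolynomial

variable {L : ℕ} {ρ : ℝ}

/-- The coefficients of a superpolynomial on the sphere can be recovered from its restriction to the
supersphere. -/
theorem exists_components (hL : 2 ≤ L) (hρ : 0 < ρ) :
    ∃ G₀ G₁ G₂ G₃ : (supersphere L ρ → CL L) →ₗ[ℂ] (sphere ρ → ℂ),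
      (∀ f, G₁ (restrictS L ρ f) = restrictSb ρ (f 1)) ∧
      (∀ f, G₂ (restrictS L ρ f) = restrictSb ρ (f 2)) ∧
      ∀ (f : SPoly) (a : ℕ), (f 0).IsHomogeneous a → G₀ (restrictS L ρ f) = restrictSb ρ (f 0) ∧
        G₃ (restrictS L ρ f) = restrictSb ρ (f 3) -
          ((a : ℂ) * ((1 / ρ ^ 2 : ℝ) : ℂ)) • restrictSb ρ (f 0) := by
  let k : Fin L := ⟨0, by omega⟩
  let l : Fin L := ⟨1, by omega⟩
  have hkl : k ≠ l := fun h => by simpa [k, l] using congrArg Fin.val h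
  obtain ⟨κ₁, h1, h1k⟩ := exists_linear_coefficient k
  obtain ⟨κ₂, h2, h2g, h2kl⟩ := exists_quadratic_coefficient hkl
  let κ₀ : CL L →ₗ[ℂ] ℂ := ExteriorAlgebra.algebraMapInv.toLinearMap
  have h0 : κ₀ 1 = 1 := map_one ExteriorAlgebra.algebraMapInv
  have h0g : ∀ r, κ₀ (gen r) = 0 := algebraMapInv_gen
  have h0kl : κ₀ (gen k * gen l) = 0 := by
    change ExteriorAlgebra.algebraMapInv (gen k * gen l) = 0
    rw [map_mul, algebraMapInv_gen, zero_mul]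
  let P : sphere ρ → supersphere L ρ := fun y => ⟨_, point_mem_supersphere hρ k l y.2⟩
  let Q : Fin 2 → sphere ρ → supersphere L ρ := fun α y =>
    ⟨_, realPoint_mem_supersphere α (gen_mem_BL k) (gen_mem_CLpart k) y.2⟩
  let G : (CL L →ₗ[ℂ] ℂ) → (sphere ρ → supersphere L ρ) →
      ((supersphere L ρ → CL L) →ₗ[ℂ] (sphere ρ → ℂ)) := fun κ p =>
    LinearMap.pi fun y => κ ∘ₗ LinearMap.proj (p y)
  -- Homogeneity of `f 0` turns the shrinking of the coordinates into the factor 1 - a ρ⁻² ξ_k ξ_l.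
  -- The other coefficients are multiplied by elements that absorb the shrinking.
  have hP : ∀ (f : SPoly) (a : ℕ) y, (f 0).IsHomogeneous a → restrictS L ρ f (P y) =
      restrictSb ρ (f 0) y • (1 - ((a : ℂ) * ((1 / ρ ^ 2 : ℝ) : ℂ)) • (gen k * gen l)) +
      restrictSb ρ (f 1) y • gen k + restrictSb ρ (f 2) y • gen l +
      restrictSb ρ (f 3) y • (gen k * gen l) := fun f a y hf => by
    have e0 := evalPoly_smul_of_isHomogeneous hf (fun r => ((y.1 r : ℝ) : ℂ)) (shrink ρ k l)
    rw [shrink_pow] at e0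
    have e1 := evalPoly_smul_mul (f := f 1) (c := fun r => ((y.1 r : ℝ) : ℂ))
      (shrink_mul (ρ := ρ) (gen_mul_gen_mul_left k l))
    have e2 := evalPoly_smul_mul (f := f 2) (c := fun r => ((y.1 r : ℝ) : ℂ))
      (shrink_mul (ρ := ρ) (gen_mul_gen_mul_right k l))
    have e3 := evalPoly_smul_mul (f := f 3) (c := fun r => ((y.1 r : ℝ) : ℂ))
      (shrink_mul (ρ := ρ) (k := k) (l := l) (z := gen k * gen l)
        (by rw [← mul_assoc, gen_mul_gen_mul_left, zero_mul]))
    exact congrArg₂ (· + ·) (congrArg₂ (· + ·) (congrArg₂ (· + ·) e0 e1) e2) e3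
  -- Here `α.succ.castSucc` is 1 or 2, the index of the coefficient of θ⁴ or θ⁵.
  have hQ : ∀ f α y, restrictS L ρ f (Q α y) =
      restrictSb ρ (f 0) y • 1 + restrictSb ρ (f α.succ.castSucc) y • gen k := fun f α y => by
    have e := fun g : Poly => evalPoly_smul_one (L := L) g (fun r => ((y.1 r : ℝ) : ℂ))
    change evalPoly (f 0) (fun r => ((y.1 r : ℝ) : ℂ) • (1 : CL L)) +
      evalPoly (f 1) (fun r => ((y.1 r : ℝ) : ℂ) • (1 : CL L)) *
        Pi.single (M := fun _ => CL L) α (gen k) 0 +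
      evalPoly (f 2) (fun r => ((y.1 r : ℝ) : ℂ) • (1 : CL L)) *
        Pi.single (M := fun _ => CL L) α (gen k) 1 +
      evalPoly (f 3) (fun r => ((y.1 r : ℝ) : ℂ) • (1 : CL L)) *
        (Pi.single (M := fun _ => CL L) α (gen k) 0 *
          Pi.single (M := fun _ => CL L) α (gen k) 1) = _
    rw [e, e, e, e]
    fin_cases α <;> simp <;> rfl
  refine ⟨G κ₀ P, G κ₁ (Q 0), G κ₁ (Q 1), G κ₂ P, fun f => ?_, fun f => ?_, fun f a hf => ⟨?_, ?_⟩⟩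
  · funext y
    change κ₁ (restrictS L ρ f (Q 0 y)) = _
    rw [hQ, map_add, map_smul, map_smul, h1, h1k]
    simp
  · funext y
    change κ₁ (restrictS L ρ f (Q 1 y)) = _
    rw [hQ, map_add, map_smul, map_smul, h1, h1k]
    simp
  · funext y
    change κ₀ (restrictS L ρ f (P y)) = _
    rw [hP f a y hf]
    simp only [map_add, map_sub, map_smul, h0, h0g, h0kl, smul_eq_mul]
    ring
  · funext y
    change κ₂ (restrictS L ρ f (P y)) = _
    rw [hP f a y hf]
    simp only [map_add, map_sub, map_smul, h2, h2g, h2kl, zero_sub,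
      smul_eq_mul, mul_one, Pi.sub_apply, Pi.smul_apply]
    ring

theorem restrictS_smul (c : ℂ) (f : SPoly) : restrictS L ρ (c • f) = c • restrictS L ρ f := by
  have h : ∀ (g : Poly) (x : Fin 3 → CL L), evalPoly (c • g) x = c • evalPoly g x := fun g x => by
    rcases eq_or_ne c 0 with rfl | hc
    · simp [evalPoly]
    · rw [evalPoly, evalPoly, support_smul_eq hc, Finset.smul_sum]
      exact Finset.sum_congr rfl fun m _ => by rw [coeff_smul, smul_assoc]
  funext s
  simp only [restrictS, Pi.smul_apply, h, smul_mul_assoc, smul_add]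

/-- The augmentation is unchanged by the grade involution, which is -1 on odd elements. -/
theorem algebraMapInv_of_mem_odd {z : CL L} (hz : z ∈ CLpart L 1) :
    ExteriorAlgebra.algebraMapInv z = 0 := by
  have h1 : CliffordAlgebra.involute z = -z := CliffordAlgebra.involute_eq_of_mem_odd hz
  have h2 : (ExteriorAlgebra.algebraMapInv (R := ℂ) (M := Fin L → ℂ)).comp
      CliffordAlgebra.involute = ExteriorAlgebra.algebraMapInv :=
    ExteriorAlgebra.hom_ext (LinearMap.ext fun m => by
      simp [ExteriorAlgebra.algebraMapInv, ExteriorAlgebra.ι])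
  have h3 := DFunLike.congr_fun h2 z
  rw [AlgHom.comp_apply, h1, map_neg] at h3
  exact self_eq_neg.1 h3.symm

/-- The body of a superpolynomial is its coefficient without Grassmann variables. -/
theorem isBodyOf_restrictS (f : SPoly) : IsBodyOf (restrictS L ρ f) (restrictSb ρ (f 0)) := by
  intro s y hy
  have h : ∀ g : Poly, ExteriorAlgebra.algebraMapInv (evalPoly g s.1.1) = restrictSb ρ g y :=
    fun g => by
      rw [evalPoly, map_sum, restrictSb, eval_eq']
      refine Finset.sum_congr rfl fun m _ => ?_
      rw [map_smul, map_mul, map_mul, map_pow, map_pow, map_pow, hy, hy, hy, Fin.prod_univ_three,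
        smul_eq_mul]
  rw [restrictS, map_add, map_add, map_add, map_mul, map_mul, map_mul, map_mul,
    algebraMapInv_of_mem_odd (s.2.2.1 0).2, algebraMapInv_of_mem_odd (s.2.2.1 1).2, h]
  simp

/-- Every point of the sphere is the body of a point of the supersphere, namely of itself with
vanishing odd coordinates. -/
theorem IsBodyOf.unique {f : supersphere L ρ → CL L} {g g' : sphere ρ → ℂ} (h : IsBodyOf f g)
    (h' : IsBodyOf f g') : g = g' := funext fun y => by
  have hs := realPoint_mem_supersphere 0 (BL L).zero_mem (Submodule.zero_mem (CLpart L 1)) y.2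
  have hε : ∀ k, ExteriorAlgebra.algebraMapInv (((y.1 k : ℝ) : ℂ) • (1 : CL L)) =
      ((y.1 k : ℝ) : ℂ) := fun k => by rw [map_smul, map_one, smul_eq_mul, mul_one]
  rw [h ⟨_, hs⟩ y hε, h' ⟨_, hs⟩ y hε]

theorem IsBodyOf.add {f f' : supersphere L ρ → CL L} {g g' : sphere ρ → ℂ} (h : IsBodyOf f g)
    (h' : IsBodyOf f' g') : IsBodyOf (f + f') (g + g') := fun s y hy => by
  rw [Pi.add_apply, Pi.add_apply, map_add, h s y hy, h' s y hy]

theorem IsBodyOf.smul {f : supersphere L ρ → CL L} {g : sphere ρ → ℂ} (c : ℂ) (h : IsBodyOf f g) :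
    IsBodyOf (c • f) (c • g) := fun s y hy => by
  rw [Pi.smul_apply, Pi.smul_apply, map_smul, h s y hy]

end Components

/-! ### Linear independence of the superspherical harmonics. -/

section SuperIndependence

open MvPolynomial

variable {L : ℕ} {ρ : ℝ}

/-- The highest weight superspherical harmonics without their normalization. -/
def superHigh (n : ℕ) : SPoly :=
  if Even n then ![xplus ^ (n / 2), 0, 0, 0]
  else ![0, xplus ^ (n / 2) * X 2, xplus ^ (n / 2) * xplus, 0]

/-- The superspherical harmonics without their normalization. -/
def superHarm (n μ k : ℕ) : SPoly := (JXminus ^ k * JTheta 1 ^ μ) (superHigh n)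

theorem highS_eq (hρ : 0 < ρ) (n : ℕ) : ∃ c : ℂ, c ≠ 0 ∧ highS ρ n = c • superHigh n := by
  unfold highS superHigh
  split_ifs
  · refine ⟨_, ?_, rfl⟩
    have : 0 < √(n.factorial : ℝ) / (2 ^ (n / 2) * (n / 2).factorial * ρ ^ (n / 2)) := by positivity
    exact_mod_cast this.ne'
  · refine ⟨_, ?_, rfl⟩
    have : 0 < √(n.factorial : ℝ) / (2 ^ (n / 2) * (n / 2).factorial * ρ ^ (n / 2 + 2)) := by
      positivity
    exact_mod_cast this.ne'

theorem harmS_eq (hρ : 0 < ρ) (n : ℕ) : ∃ c : ℂ, c ≠ 0 ∧ ∀ (q : ℕ) (t : IdxS q), t.1.1 = n →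
    harmS L ρ q t = (normS t.1.1 t.1.2.1 t.1.2.2 * c) •
      restrictS L ρ (superHarm t.1.1 t.1.2.1 t.1.2.2) := by
  obtain ⟨c, hc, h⟩ := highS_eq hρ n
  refine ⟨c, hc, fun q t ht => ?_⟩
  rw [harmS, ht, h, map_smul, smul_smul, restrictS_smul]
  rfl

theorem superHarm_even (a k : ℕ) : superHarm (2 * a) 0 k = ![harm a k, 0, 0, 0] := by
  have h1 : 2 * a / 2 = a := by omega
  rw [superHarm, superHigh, if_pos (even_two_mul a), h1, pow_zero, mul_one, harmonic_even]

theorem superHarm_even_descendant (a k : ℕ) : superHarm (2 * a + 2) 1 k =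
    (-((a : ℂ) + 1)) • ![0, harm a k, (k : ℂ) • harm a (k - 1), 0] := by
  have h1 : (2 * a + 2) / 2 = a + 1 := by omega
  have h2 : Even (2 * a + 2) := ⟨a + 1, by ring⟩
  rw [superHarm, superHigh, if_pos h2, h1, pow_one, Module.End.mul_apply, harmonic_even_descendant]

theorem superHarm_odd (a k : ℕ) : superHarm (2 * a + 1) 0 k =
    ![0, (-(1 / (2 * ((a : ℂ) + 1)))) • harm (a + 1) (k + 1),
      (1 - k / (2 * ((a : ℂ) + 1))) • harm (a + 1) k, 0] := by
  have h1 : (2 * a + 1) / 2 = a := by omega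
  have h2 : ¬Even (2 * a + 1) := Nat.not_even_two_mul_add_one a
  rw [superHarm, superHigh, if_neg h2, h1, pow_zero, mul_one, harmonic_odd]

theorem superHarm_odd_descendant (a k : ℕ) : superHarm (2 * a + 1) 1 k =
    ![(-(1 / 2 : ℂ)) • (radiusSq * harm a k), 0, 0, (-((2 * a + 3) / 2 : ℂ)) • harm a k] := by
  have h1 : (2 * a + 1) / 2 = a := by omega
  have h2 : ¬Even (2 * a + 1) := Nat.not_even_two_mul_add_one a
  rw [superHarm, superHigh, if_neg h2, h1, pow_one, Module.End.mul_apply, harmonic_odd_descendant]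

theorem restrictSb_smul (c : ℂ) (f : Poly) : restrictSb ρ (c • f) = c • restrictSb ρ f :=
  map_smul (restrictSbL ρ) c f

theorem restrictSb_zero : restrictSb ρ 0 = 0 := map_zero (restrictSbL ρ)

theorem restrictSb_radiusSq_mul (f : Poly) :
    restrictSb ρ (radiusSq * f) = ((ρ ^ 2 : ℝ) : ℂ) • restrictSb ρ f := by
  funext y
  have hy : ∑ k, y.1 k ^ 2 = ρ ^ 2 := y.2
  rw [Fin.sum_univ_three] at hy
  rw [restrictSb, map_mul, Pi.smul_apply, restrictSb, ← hy, smul_eq_mul]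
  simp [radiusSq]

theorem idxS_cases {q : ℕ} (t : IdxS q) : ∃ a k,
    (t.1 = (2 * a, 0, k) ∧ k ≤ 2 * a) ∨ (t.1 = (2 * a + 2, 1, k) ∧ k ≤ 2 * a + 1) ∨
    (t.1 = (2 * a + 1, 0, k) ∧ k ≤ 2 * a + 1) ∨ (t.1 = (2 * a + 1, 1, k) ∧ k ≤ 2 * a) := by
  obtain ⟨⟨n, μ, k⟩, hn, hμ, hk⟩ := t
  simp only at hn hμ hk
  rcases Nat.even_or_odd' n with ⟨a, rfl | rfl⟩ <;> interval_cases μ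
  · exact ⟨a, k, Or.inl ⟨rfl, by omega⟩⟩
  · rcases a with _ | a
    · omega
    · exact ⟨a, k, Or.inr (Or.inl ⟨rfl, by omega⟩)⟩
  · exact ⟨a, k, Or.inr (Or.inr (Or.inl ⟨rfl, by omega⟩))⟩
  · exact ⟨a, k, Or.inr (Or.inr (Or.inr ⟨rfl, by omega⟩))⟩

theorem linearIndependent_of_dual {ι V : Type*} [AddCommGroup V] [Module ℂ V] {v : ι → V}
    (h : ∀ i, ∃ g : V →ₗ[ℂ] ℂ, g (v i) ≠ 0 ∧ ∀ j, j ≠ i → g (v j) = 0) :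
    LinearIndependent ℂ v := by
  rw [linearIndependent_iff']
  intro s c hc i hi
  obtain ⟨g, hg, hg'⟩ := h i
  have := congrArg g hc
  rw [map_sum, map_zero, Finset.sum_eq_single i] at this
  · rw [map_smul, smul_eq_mul] at this
    exact (mul_eq_zero.1 this).resolve_right hg
  · intro j _ hj
    rw [map_smul, hg' j hj, smul_zero]
  · exact fun h => absurd hi h

/-- Decomposed by components and by `harm`, the harmonics interfere only in pairs: (2a, 0, k) with
(2a+1, 1, k) in the components 0 and 3, and (2a+2, 1, k+1) with (2a-1, 0, k) in the components 1 and
2. In each pair the coefficients are independent, which gives dual functionals. -/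
theorem linearIndependent_superHarm (hL : 2 ≤ L) (hρ : 0 < ρ) (q : ℕ) :
    LinearIndependent ℂ fun t : IdxS q =>
      restrictS L ρ (superHarm t.1.1 t.1.2.1 t.1.2.2) := by
  obtain ⟨G₀, G₁, G₂, G₃, hG₁, hG₂, hG⟩ := exists_components hL hρ
  have hρ' : (ρ : ℂ) ≠ 0 := by exact_mod_cast hρ.ne'
  have cast : ((1 / ρ ^ 2 : ℝ) : ℂ) = 1 / (ρ : ℂ) ^ 2 := by push_cast; rfl
  have T₀ : ∀ a k, G₀ (restrictS L ρ (superHarm (2 * a) 0 k)) = restrictSb ρ (harm a k) ∧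
      G₁ (restrictS L ρ (superHarm (2 * a) 0 k)) = 0 ∧
      G₂ (restrictS L ρ (superHarm (2 * a) 0 k)) = 0 ∧
      G₃ (restrictS L ρ (superHarm (2 * a) 0 k)) =
        (-(a / (ρ : ℂ) ^ 2)) • restrictSb ρ (harm a k) := fun a k => by
    rw [superHarm_even]
    obtain ⟨g0, g3⟩ := hG ![harm a k, 0, 0, 0] a (isHomogeneous_harm a k)
    rw [hG₁, hG₂, g0, g3, cast]
    simp only [Matrix.cons_val, restrictSb_zero]
    exact ⟨trivial, trivial, trivial, by module⟩
  have T₁ : ∀ a k, G₀ (restrictS L ρ (superHarm (2 * a + 2) 1 k)) = 0 ∧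
      G₁ (restrictS L ρ (superHarm (2 * a + 2) 1 k)) =
        (-((a : ℂ) + 1)) • restrictSb ρ (harm a k) ∧
      G₂ (restrictS L ρ (superHarm (2 * a + 2) 1 k)) =
        (-((a : ℂ) + 1) * k) • restrictSb ρ (harm a (k - 1)) ∧
      G₃ (restrictS L ρ (superHarm (2 * a + 2) 1 k)) = 0 := fun a k => by
    rw [superHarm_even_descendant, restrictS_smul]
    obtain ⟨g0, g3⟩ := hG ![0, harm a k, (k : ℂ) • harm a (k - 1), 0] 0 (isHomogeneous_zero _ _ _)
    rw [map_smul, map_smul, map_smul, map_smul, hG₁, hG₂, g0, g3]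
    simp only [Matrix.cons_val, restrictSb_zero, restrictSb_smul, smul_zero, smul_smul, sub_zero]
    exact ⟨trivial, trivial, trivial, trivial⟩
  have T₂ : ∀ a k, G₀ (restrictS L ρ (superHarm (2 * a + 1) 0 k)) = 0 ∧
      G₁ (restrictS L ρ (superHarm (2 * a + 1) 0 k)) =
        (-(1 / (2 * ((a : ℂ) + 1)))) • restrictSb ρ (harm (a + 1) (k + 1)) ∧
      G₂ (restrictS L ρ (superHarm (2 * a + 1) 0 k)) =
        (1 - k / (2 * ((a : ℂ) + 1))) • restrictSb ρ (harm (a + 1) k) ∧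
      G₃ (restrictS L ρ (superHarm (2 * a + 1) 0 k)) = 0 := fun a k => by
    rw [superHarm_odd]
    obtain ⟨g0, g3⟩ := hG ![0, (-(1 / (2 * ((a : ℂ) + 1)))) • harm (a + 1) (k + 1),
      (1 - k / (2 * ((a : ℂ) + 1))) • harm (a + 1) k, 0] 0 (isHomogeneous_zero _ _ _)
    rw [hG₁, hG₂, g0, g3]
    simp only [Matrix.cons_val, restrictSb_zero, restrictSb_smul, smul_zero, sub_zero]
    exact ⟨trivial, trivial, trivial, trivial⟩
  have T₃ : ∀ a k, G₀ (restrictS L ρ (superHarm (2 * a + 1) 1 k)) =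
        (-((ρ : ℂ) ^ 2 / 2)) • restrictSb ρ (harm a k) ∧
      G₁ (restrictS L ρ (superHarm (2 * a + 1) 1 k)) = 0 ∧
      G₂ (restrictS L ρ (superHarm (2 * a + 1) 1 k)) = 0 ∧
      G₃ (restrictS L ρ (superHarm (2 * a + 1) 1 k)) =
        (-((a + 1) / 2 : ℂ)) • restrictSb ρ (harm a k) := fun a k => by
    rw [superHarm_odd_descendant]
    have hom : ((-(1 / 2 : ℂ)) • (radiusSq * harm a k)).IsHomogeneous (2 + a) := by
      rw [smul_eq_C_mul]
      exact (isHomogeneous_radiusSq.mul (isHomogeneous_harm a k)).C_mul _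
    obtain ⟨g0, g3⟩ := hG ![(-(1 / 2 : ℂ)) • (radiusSq * harm a k), 0, 0,
      (-((2 * a + 3) / 2 : ℂ)) • harm a k] _ hom
    rw [hG₁, hG₂, g0, g3, cast]
    simp only [Matrix.cons_val, restrictSb_zero, restrictSb_smul, restrictSb_radiusSq_mul,
      smul_smul, ← sub_smul]
    refine ⟨?_, trivial, trivial, ?_⟩
    · congr 1; push_cast; ring
    · congr 1; push_cast; field_simp; ring
  refine linearIndependent_of_dual fun t => ?_
  obtain ⟨a, k, h⟩ := idxS_cases t
  choose φ hφ using exists_harm_coefficient hρ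
  rcases h with ⟨ht, hk⟩ | ⟨ht, hk⟩ | ⟨ht, hk⟩ | ⟨ht, hk⟩
  -- The coefficients are chosen so that (2a+1, 1, k), with components -ρ²/2 and -(a+1)/2, is
  -- killed; the value at (2a, 0, k) is (2a+1)/2.
  · refine ⟨((a + 1) / 2 : ℂ) • (φ a k ∘ₗ G₀) - ((ρ : ℂ) ^ 2 / 2) • (φ a k ∘ₗ G₃), ?_,
      fun s hs => ?_⟩
    · simp only [ht, LinearMap.sub_apply, LinearMap.smul_apply, LinearMap.comp_apply, T₀, map_smul,
        hφ, hk, smul_eq_mul]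
      have : (a + 1) / 2 * 1 - (ρ : ℂ) ^ 2 / 2 * (-(a / (ρ : ℂ) ^ 2) * 1) = (2 * a + 1) / 2 := by
        field_simp; ring
      simp only [and_self, if_true, this]
      have : (2 * a + 1 : ℂ) ≠ 0 := by exact_mod_cast Nat.succ_ne_zero (2 * a)
      simpa using this
    · have hne : s.1 ≠ t.1 := fun h => hs (Subtype.ext h)
      obtain ⟨b, l, h⟩ := idxS_cases s
      rcases h with ⟨h, -⟩ | ⟨h, -⟩ | ⟨h, -⟩ | ⟨h, -⟩ <;> rw [h, ht] at hne <;>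
        simp only [h, LinearMap.sub_apply, LinearMap.smul_apply, LinearMap.comp_apply, T₀, T₁, T₂,
          T₃, map_smul, map_zero, hφ, smul_zero, sub_zero]
      · rw [if_neg (by rintro ⟨rfl, rfl, -⟩; exact hne rfl)]
        simp
      · split_ifs with h
        · obtain ⟨rfl, rfl, -⟩ := h
          simp only [smul_eq_mul]; ring
        · simp
  · rcases k with _ | k
    -- For k = 0 there is no partner, since the θ⁴-components of the other odd family start at `harm
    -- (b + 1) 1`.
    · refine ⟨φ a 0 ∘ₗ G₁, ?_, fun s hs => ?_⟩
      · simp only [ht, LinearMap.comp_apply, T₁, map_smul, hφ, smul_eq_mul]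
        rw [if_pos ⟨trivial, trivial, Nat.zero_le _⟩, mul_one]
        exact neg_ne_zero.2 (Nat.cast_add_one_ne_zero a)
      · have hne : s.1 ≠ t.1 := fun h => hs (Subtype.ext h)
        obtain ⟨b, l, h⟩ := idxS_cases s
        rcases h with ⟨h, -⟩ | ⟨h, -⟩ | ⟨h, -⟩ | ⟨h, -⟩ <;> rw [h, ht] at hne <;>
          simp only [h, LinearMap.comp_apply, T₀, T₁, T₂, T₃, map_smul, map_zero, hφ]
        · rw [if_neg (by rintro ⟨rfl, rfl, -⟩; exact hne rfl), smul_zero]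
        · rw [if_neg (by omega), smul_zero]
    -- The combination that kills the partner (2a-1, 0, k), whose components are proportional to -1
    -- and 2a - k.
    · refine ⟨(2 * a - k : ℂ) • (φ a (k + 1) ∘ₗ G₁) + φ a k ∘ₗ G₂, ?_, fun s hs => ?_⟩
      · simp only [ht, LinearMap.add_apply, LinearMap.smul_apply, LinearMap.comp_apply, T₁,
          map_smul, hφ, smul_eq_mul, true_and, Nat.add_sub_cancel, if_pos (show k ≤ 2 * a by omega)]
        -- At the boundary k = 2a the coordinate functional for `harm a (k + 1)` is zero, but so is
        -- its coefficient.
        have e : (2 * a - k : ℂ) * (-((a : ℂ) + 1) * if k + 1 ≤ 2 * a then 1 else 0) =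
            (2 * a - k : ℂ) * -((a : ℂ) + 1) := by
          split_ifs with h
          · rw [mul_one]
          · have : k = 2 * a := by omega
            rw [this]; push_cast; ring
        rw [e]
        have h1 : (a + 1 : ℂ) ≠ 0 := Nat.cast_add_one_ne_zero a
        have h2 : (2 * a + 1 : ℂ) ≠ 0 := by exact_mod_cast Nat.succ_ne_zero (2 * a)
        have : (2 * a - k : ℂ) * -((a : ℂ) + 1) + -((a : ℂ) + 1) * ((k + 1 : ℕ) : ℂ) * 1 =
            -((a + 1) * (2 * a + 1)) := by push_cast; ring
        rw [this]
        exact neg_ne_zero.2 (mul_ne_zero h1 h2)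
      · have hne : s.1 ≠ t.1 := fun h => hs (Subtype.ext h)
        obtain ⟨b, l, h⟩ := idxS_cases s
        rcases h with ⟨h, -⟩ | ⟨h, -⟩ | ⟨h, -⟩ | ⟨h, -⟩ <;> rw [h, ht] at hne <;>
          simp only [h, LinearMap.add_apply, LinearMap.smul_apply, LinearMap.comp_apply, T₀, T₁, T₂,
            T₃, map_smul, map_zero, hφ, smul_zero, add_zero]
        · rcases l with _ | l
          · rw [if_neg (by omega)]; simp
          · rw [if_neg (by rintro ⟨rfl, h, -⟩; exact hne (by rw [h])),
              if_neg (by rintro ⟨rfl, h, -⟩; exact hne (by rw [Nat.add_sub_cancel] at h; rw [h]))]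
            simp
        · by_cases h : b + 1 = a ∧ l = k
          · obtain ⟨rfl, rfl⟩ := h
            have hb : (b + 1 : ℂ) ≠ 0 := Nat.cast_add_one_ne_zero b
            rw [if_pos (show b + 1 = b + 1 ∧ l = l ∧ l ≤ 2 * (b + 1) by omega)]
            split_ifs with h
            · simp only [smul_eq_mul]; push_cast; field_simp; ring
            · have : l = 2 * (b + 1) := by omega
              rw [this]; simp only [smul_eq_mul]; push_cast; field_simp; ring
          · rw [if_neg (by omega), if_neg (by omega)]; simp
  -- The combination that kills (2a+4, 1, k+1), whose components are proportional to 1 and k + 1.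
  · refine ⟨(k + 1 : ℂ) • (φ (a + 1) (k + 1) ∘ₗ G₁) - φ (a + 1) k ∘ₗ G₂, ?_, fun s hs => ?_⟩
    · simp only [ht, LinearMap.sub_apply, LinearMap.smul_apply, LinearMap.comp_apply, T₂,
        map_smul, hφ, smul_eq_mul, true_and, if_pos (show k ≤ 2 * (a + 1) by omega),
        if_pos (show k + 1 ≤ 2 * (a + 1) by omega)]
      have h1 : (a + 1 : ℂ) ≠ 0 := Nat.cast_add_one_ne_zero a
      have h2 : (2 * a + 3 : ℂ) ≠ 0 := by exact_mod_cast Nat.succ_ne_zero (2 * a + 2)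
      have : (k + 1 : ℂ) * (-(1 / (2 * ((a : ℂ) + 1))) * 1) - (1 - k / (2 * ((a : ℂ) + 1))) * 1 =
          -((2 * a + 3) / (2 * (a + 1))) := by field_simp; ring
      rw [this]
      exact neg_ne_zero.2 (div_ne_zero h2 (mul_ne_zero two_ne_zero h1))
    · have hne : s.1 ≠ t.1 := fun h => hs (Subtype.ext h)
      obtain ⟨b, l, h⟩ := idxS_cases s
      rcases h with ⟨h, -⟩ | ⟨h, -⟩ | ⟨h, -⟩ | ⟨h, -⟩ <;> rw [h, ht] at hne <;>
        simp only [h, LinearMap.sub_apply, LinearMap.smul_apply, LinearMap.comp_apply, T₀, T₁, T₂,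
          T₃, map_smul, map_zero, hφ, smul_zero, sub_zero]
      · rcases l with _ | l
        · rw [if_neg (by omega)]; simp
        · by_cases h : b = a + 1 ∧ l = k
          · obtain ⟨rfl, rfl⟩ := h
            rw [if_pos (by omega), if_pos (by omega)]
            simp only [smul_eq_mul]; push_cast; ring
          · rw [if_neg (by omega), if_neg (by omega)]; simp
      · have h' : ¬(b = a ∧ l = k) := fun ⟨h, h'⟩ => hne (by rw [h, h'])
        rw [if_neg (by omega), if_neg (by omega)]; simp
  -- The combination that kills (2a, 0, k), whose components are 1 and -a/ρ².
  · refine ⟨((a : ℂ) / (ρ : ℂ) ^ 2) • (φ a k ∘ₗ G₀) + φ a k ∘ₗ G₃, ?_, fun s hs => ?_⟩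
    · simp only [ht, LinearMap.add_apply, LinearMap.smul_apply, LinearMap.comp_apply, T₃, map_smul,
        hφ, hk, smul_eq_mul]
      have : (a : ℂ) / (ρ : ℂ) ^ 2 * (-((ρ : ℂ) ^ 2 / 2) * 1) + -((a + 1) / 2 : ℂ) * 1 =
          -((2 * a + 1) / 2) := by
        field_simp; ring
      simp only [and_self, if_true, this]
      have : (2 * a + 1 : ℂ) ≠ 0 := by exact_mod_cast Nat.succ_ne_zero (2 * a)
      simpa using this
    · have hne : s.1 ≠ t.1 := fun h => hs (Subtype.ext h)
      obtain ⟨b, l, h⟩ := idxS_cases s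
      rcases h with ⟨h, -⟩ | ⟨h, -⟩ | ⟨h, -⟩ | ⟨h, -⟩ <;> rw [h, ht] at hne <;>
        simp only [h, LinearMap.add_apply, LinearMap.smul_apply, LinearMap.comp_apply, T₀, T₁, T₂,
          T₃, map_smul, map_zero, hφ, smul_zero, add_zero]
      · split_ifs with h
        · obtain ⟨rfl, rfl, -⟩ := h
          simp only [smul_eq_mul]; ring
        · simp
      · rw [if_neg (by rintro ⟨rfl, rfl, -⟩; exact hne rfl)]
        simp

theorem linearIndependent_harmS (hL : 2 ≤ L) (hρ : 0 < ρ) (q : ℕ) :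
    LinearIndependent ℂ (harmS L ρ q) := by
  choose c hc h using harmS_eq (L := L) hρ
  have e : harmS L ρ q = (fun t : IdxS q => Units.mk0 _ (mul_ne_zero
      (normS_ne_zero t.1.1 t.1.2.1 t.1.2.2) (hc t.1.1))) •
      fun t : IdxS q => restrictS L ρ (superHarm t.1.1 t.1.2.1 t.1.2.2) :=
    funext fun t => h t.1.1 q t rfl
  rw [e]
  exact (linearIndependent_superHarm hL hρ q).units_smul _

end SuperIndependence

/-! ### The noncommutative body map -/

section BodyMap

open MvPolynomial

variable {L : ℕ} {ρ : ℝ} {q : ℕ}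

/-- The factorials of l + m and l - m are the same in both normalizations, so their ratio does not
depend on k. This is why the normalized body map commutes with J₋. -/
theorem normS_eq (a μ k : ℕ) : normS (2 * a + μ) μ k = normSb a k *
    ((√(4 ^ μ * (2 * a).factorial / (2 * a + μ).factorial) : ℝ) : ℂ) := by
  rw [normS, normSb, ← Complex.ofReal_mul, ← Real.sqrt_mul (by positivity), Nat.add_sub_cancel]
  congr 2
  have h1 : ((2 * a).factorial : ℝ) ≠ 0 := by positivity
  field_simp

theorem normS_ratio_ne_zero (a μ : ℕ) :
    ((√(4 ^ μ * (2 * a).factorial / (2 * a + μ).factorial) : ℝ) : ℂ) ≠ 0 := by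
  have : 0 < √(4 ^ μ * (2 * a).factorial / (2 * a + μ).factorial : ℝ) := by positivity
  exact_mod_cast this.ne'

/-- The index of the spherical harmonic that is the body of a superspherical harmonic. -/
def IdxS.body (t : IdxS q) (h : t.1.1 = 2 * (t.1.1 / 2) + t.1.2.1) : IdxSb q :=
  ⟨(t.1.1 / 2, t.1.2.2), by
    have h1 := t.2.1
    have h2 := t.2.2.2
    constructor
    · change t.1.1 / 2 ≤ q; omega
    · change t.1.2.2 ≤ 2 * (t.1.1 / 2); omega⟩

/-- The body of a superspherical harmonic is a multiple of a spherical harmonic or zero. -/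
theorem exists_body_harmS (hρ : 0 < ρ) : ∃ γ : ℕ → ℕ → ℂ, (∀ n μ, γ n μ ≠ 0) ∧
    ∀ (q : ℕ) (t : IdxS q),
      (∀ h, IsBodyOf (harmS L ρ q t) (γ t.1.1 t.1.2.1 • harmSb ρ q (t.body h))) ∧
      (¬t.1.1 = 2 * (t.1.1 / 2) + t.1.2.1 → IsBodyOf (harmS L ρ q t) 0) := by
  choose c hc hS using harmS_eq (L := L) hρ
  have hρ' : (ρ : ℂ) ≠ 0 := by exact_mod_cast hρ.ne'
  -- The factor -ρ²/2 for `μ = 1` comes from the squared radius in `superHarm_odd_descendant`,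
  -- restricted to the sphere.
  let e : ℕ → ℂ := fun μ => if μ = 0 then 1 else -((ρ : ℂ) ^ 2 / 2)
  have he : ∀ μ, e μ ≠ 0 := fun μ => by
    simp only [e]
    split_ifs
    · exact one_ne_zero
    · exact neg_ne_zero.2 (div_ne_zero (pow_ne_zero _ hρ') two_ne_zero)
  let d : ℕ → ℕ → ℂ := fun n μ =>
    ((√(4 ^ μ * (2 * (n / 2)).factorial / (2 * (n / 2) + μ).factorial) : ℝ) : ℂ)
  let C : ℕ → ℂ := fun a =>
    ((√((2 * a + 1).factorial) / (2 ^ a * a.factorial * ρ ^ a) : ℝ) : ℂ)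
  have hC : ∀ a, C a ≠ 0 := highSb_coeff_ne_zero hρ
  refine ⟨fun n μ => d n μ * c n * e μ / C (n / 2), fun n μ => div_ne_zero (mul_ne_zero
    (mul_ne_zero (normS_ratio_ne_zero _ _) (hc n)) (he μ)) (hC _), fun q t => ?_⟩
  have hb := (isBodyOf_restrictS (L := L) (ρ := ρ) (superHarm t.1.1 t.1.2.1 t.1.2.2)).smul
    (normS t.1.1 t.1.2.1 t.1.2.2 * c t.1.1)
  rw [← hS t.1.1 q t rfl] at hb
  refine ⟨fun h => ?_, fun h => ?_⟩
  · have h0 : restrictSb ρ (superHarm t.1.1 t.1.2.1 t.1.2.2 0) =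
        e t.1.2.1 • restrictSb ρ (harm (t.1.1 / 2) t.1.2.2) := by
      have hμ := t.2.2.1
      generalize t.1.2.1 = μ at *
      generalize t.1.1 = n at *
      generalize t.1.2.2 = k at *
      obtain ⟨a, ha⟩ : ∃ a, n / 2 = a := ⟨_, rfl⟩
      rw [ha] at h ⊢
      rw [h]
      interval_cases μ
      · rw [add_zero, superHarm_even]
        simp [e]
      · rw [superHarm_odd_descendant]
        simp only [Matrix.cons_val, restrictSb_smul, restrictSb_radiusSq_mul, smul_smul, e,
          one_ne_zero, if_false]
        congr 1; push_cast; ring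
    have hn : normS t.1.1 t.1.2.1 t.1.2.2 =
        normSb (t.1.1 / 2) t.1.2.2 * d t.1.1 t.1.2.1 := by
      rw [← normS_eq, ← h]
    rw [h0, smul_smul, hn] at hb
    rw [harmSb_eq, smul_smul]
    have : d t.1.1 t.1.2.1 * c t.1.1 * e t.1.2.1 / C (t.1.1 / 2) *
        (normSb (t.1.1 / 2) t.1.2.2 * C (t.1.1 / 2)) =
        normSb (t.1.1 / 2) t.1.2.2 * d t.1.1 t.1.2.1 * c t.1.1 * e t.1.2.1 := by
      have := hC (t.1.1 / 2)
      field_simp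
    rw [← this] at hb
    exact hb
  · have h0 : restrictSb ρ (superHarm t.1.1 t.1.2.1 t.1.2.2 0) = 0 := by
      obtain ⟨a, k, ht⟩ := idxS_cases t
      rcases ht with ⟨ht, -⟩ | ⟨ht, -⟩ | ⟨ht, -⟩ | ⟨ht, -⟩
      · rw [ht] at h; exact absurd (by simp) h
      · rw [ht, superHarm_even_descendant]
        simp [restrictSb_zero]
      · rw [ht, superHarm_odd]
        simp [restrictSb_zero]
      · rw [ht] at h; exact absurd (by simp; omega) h
    rwa [h0, smul_zero] at hb

end BodyMap

/-! ### Existence and uniqueness of the body map, and descendants. -/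

section BodyMapExistence

variable {L : ℕ} {ρ : ℝ} {q : ℕ}

theorem exists_body (hρ : 0 < ρ) (f : Hq L ρ q) : ∃ g : Cq ρ q, IsBodyOf f.1 g.1 := by
  obtain ⟨γ, -, hγ⟩ := exists_body_harmS (L := L) hρ
  obtain ⟨f, hf⟩ := f
  induction hf using Submodule.span_induction with
  | mem x hx =>
    obtain ⟨t, rfl⟩ := hx
    by_cases h : t.1.1 = 2 * (t.1.1 / 2) + t.1.2.1
    · exact ⟨⟨_, Submodule.smul_mem _ _ (Submodule.subset_span ⟨_, rfl⟩)⟩, (hγ q t).1 h⟩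
    · exact ⟨0, (hγ q t).2 h⟩
  | zero => exact ⟨0, fun s y _ => (map_zero _).symm⟩
  | add x y hx hy ihx ihy =>
    obtain ⟨g, hg⟩ := ihx
    obtain ⟨g', hg'⟩ := ihy
    exact ⟨g + g', hg.add hg'⟩
  | smul c x hx ih =>
    obtain ⟨g, hg⟩ := ih
    exact ⟨c • g, hg.smul c⟩

/-- The values of the noncommutative body map on the noncommutative superspherical harmonics. -/
theorem exists_bodyMap_harmNS (hρ : 0 < ρ) : ∃ γ : ℕ → ℕ → ℂ, (∀ n μ, γ n μ ≠ 0) ∧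
    ∀ (q : ℕ) (β : S q →ₗ[ℂ] Sb q), IsBodyMap L ρ q β → ∀ t : IdxS q,
      (∀ h, β (harmNS q t) = γ t.1.1 t.1.2.1 • harmNSb q (t.body h)) ∧
      (¬t.1.1 = 2 * (t.1.1 / 2) + t.1.2.1 → β (harmNS q t) = 0) := by
  obtain ⟨γ, h0, hγ⟩ := exists_body_harmS (L := L) hρ
  refine ⟨γ, h0, fun q β hβ t => ?_⟩
  obtain ⟨ψ, ψb, h1, h2, h3⟩ := hβ
  obtain ⟨g, hg, e⟩ := h3 ⟨harmS L ρ q t, Submodule.subset_span ⟨t, rfl⟩⟩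
  rw [h1] at e
  refine ⟨fun h => ?_, fun h => ?_⟩
  · rw [e, ← h2, ← map_smul]
    exact congrArg ψb (Subtype.ext (hg.unique ((hγ q t).1 h)))
  · rw [e, ← map_zero ψb]
    exact congrArg ψb (Subtype.ext (hg.unique ((hγ q t).2 h)))

/-- The harmonics are bases on all four sides, which gives ψ and ψ̂; bodies exist on the span and
are unique, so taking bodies is linear. Uniqueness holds since `exists_bodyMap_harmNS` prescribes
the values on a basis. -/
theorem existsUnique_isBodyMap (hL : 2 ≤ L) (hρ : 0 < ρ) (q : ℕ) :
    ∃! β : S q →ₗ[ℂ] Sb q, IsBodyMap L ρ q β := by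
  let bS : Module.Basis (IdxS q) ℂ (Hq L ρ q) := Module.Basis.span (linearIndependent_harmS hL hρ q)
  have hbS : ∀ t, bS t = ⟨harmS L ρ q t, Submodule.subset_span ⟨t, rfl⟩⟩ := fun t =>
    Module.Basis.span_apply (linearIndependent_harmS hL hρ q) t
  let bSb : Module.Basis (IdxSb q) ℂ (Cq ρ q) := Module.Basis.span (linearIndependent_harmSb hρ q)
  have hbSb : ∀ t, bSb t = ⟨harmSb ρ q t, Submodule.subset_span ⟨t, rfl⟩⟩ := fun t =>
    Module.Basis.span_apply (linearIndependent_harmSb hρ q) t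
  let ψ : Hq L ρ q ≃ₗ[ℂ] S q := bS.equiv (basisNS q) (Equiv.refl _)
  have hψ : ∀ t : IdxS q, ψ ⟨harmS L ρ q t, Submodule.subset_span ⟨t, rfl⟩⟩ = harmNS q t :=
    fun t => by
      rw [← hbS, Module.Basis.equiv_apply, Equiv.refl_apply, basisNS_apply]
  let ψb : Cq ρ q ≃ₗ[ℂ] Sb q := bSb.equiv (basisNSb q) (Equiv.refl _)
  have hψb : ∀ t : IdxSb q, ψb ⟨harmSb ρ q t, Submodule.subset_span ⟨t, rfl⟩⟩ = harmNSb q t :=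
    fun t => by
      rw [← hbSb, Module.Basis.equiv_apply, Equiv.refl_apply, basisNSb_apply]
  choose b hb using exists_body (L := L) (q := q) hρ
  let B : Hq L ρ q →ₗ[ℂ] Cq ρ q :=
    { toFun := b
      map_add' := fun f g => Subtype.ext ((hb (f + g)).unique ((hb f).add (hb g)))
      map_smul' := fun c f => Subtype.ext ((hb (c • f)).unique ((hb f).smul c)) }
  refine ⟨ψb.toLinearMap ∘ₗ B ∘ₗ ψ.symm.toLinearMap,
    ⟨ψ, ψb, hψ, hψb, fun f => ⟨b f, hb f, ?_⟩⟩, fun β hβ => ?_⟩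
  · simp [B]
  · obtain ⟨γ, -, hγ⟩ := exists_bodyMap_harmNS (L := L) hρ
    have hβ' : IsBodyMap L ρ q (ψb.toLinearMap ∘ₗ B ∘ₗ ψ.symm.toLinearMap) :=
      ⟨ψ, ψb, hψ, hψb, fun f => ⟨b f, hb f, by simp [B]⟩⟩
    refine (basisNS q).ext fun t => ?_
    rw [basisNS_apply]
    by_cases h : t.1.1 = 2 * (t.1.1 / 2) + t.1.2.1
    · rw [(hγ q β hβ t).1 h, (hγ q _ hβ' t).1 h]
    · rw [(hγ q β hβ t).2 h, (hγ q _ hβ' t).2 h]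

/-- The descendants `J₋ᵏ J₅^μ` of the highest weight noncommutative superspherical harmonics. -/
def descNS (q n μ k : ℕ) : S q := (superComm (Jminus q) ^ k * superComm (J5 q) ^ μ) (highNS q n)

/-- The descendants of the highest weight noncommutative spherical harmonics. -/
def descNSb (q a k : ℕ) : Sb q := (commut (Sb q) (lower (q + 1)) ^ k) (raise (q + 1) ^ a)

theorem harmNS_eq (t : IdxS q) :
    harmNS q t = normS t.1.1 t.1.2.1 t.1.2.2 • descNS q t.1.1 t.1.2.1 t.1.2.2 := rfl

theorem harmNSb_eq (q a : ℕ) : ∃ c : ℂ, ∀ t : IdxSb q, t.1.1 = a →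
    harmNSb q t = (normSb a t.1.2 * c) • descNSb q a t.1.2 := by
  refine ⟨((√(2 ^ a * (2 * a + 1).doubleFactorial * (q + 1) * (q - a).factorial /
      (a.factorial * (q + a + 1).factorial)) : ℝ) : ℂ), fun t ht => ?_⟩
  rw [harmNSb, map_smul, smul_smul, ht]
  rfl

theorem descNS_succ (n μ k : ℕ) :
    descNS q n μ (k + 1) = superComm (Jminus q) (descNS q n μ k) := by
  rw [descNS, pow_succ', mul_assoc, Module.End.mul_apply]
  rfl

theorem descNSb_succ (a k : ℕ) :
    descNSb q a (k + 1) = commut (Sb q) (lower (q + 1)) (descNSb q a k) := by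
  rw [descNSb, pow_succ', Module.End.mul_apply]
  rfl

/-- The commutator of J₊ and J₅ is J₄, which kills the highest weight vector; so J₅ produces another
primitive vector for `sl(2)`, of weight lower by 1/2. -/
theorem descNS_zero_relations {n μ : ℕ} (hμ : μ ≤ 1) :
    superComm (Jplus q) (descNS q n μ 0) = 0 ∧
    superComm (J3 q) (descNS q n μ 0) = (((n : ℂ) - μ) / 2) • descNS q n μ 0 := by
  obtain ⟨-, -, e3, e4, -⟩ := ad_relations q
  obtain ⟨h1, h2, h3⟩ := ad_highNS q n
  have r3 := LinearMap.congr_fun e3 (highNS q n)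
  have r4 := LinearMap.congr_fun e4 (highNS q n)
  simp only [Module.End.mul_apply, LinearMap.add_apply, LinearMap.sub_apply, LinearMap.smul_apply,
    h1, h2, h3, map_zero, add_zero, map_smul] at r3 r4
  interval_cases μ
  · have : descNS q n 0 0 = highNS q n := by
      rw [descNS, pow_zero, pow_zero, mul_one, Module.End.one_apply]
    rw [this, h1, h3]
    simp
  · have : descNS q n 1 0 = superComm (J5 q) (highNS q n) := by
      rw [descNS, pow_zero, pow_one, one_mul]
    rw [this, r3, r4]
    refine ⟨rfl, ?_⟩
    push_cast
    module

theorem descNS_eq_pow (n μ k : ℕ) :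
    descNS q n μ k = (superComm (Jminus q) ^ k) (descNS q n μ 0) := by
  rw [descNS, descNS, Module.End.mul_apply, pow_zero, one_mul]

theorem superComm_J3_descNS {n μ : ℕ} (hμ : μ ≤ 1) (k : ℕ) :
    superComm (J3 q) (descNS q n μ k) = (((n : ℂ) - μ) / 2 - k) • descNS q n μ k := by
  rw [descNS_eq_pow]
  exact weight_pow (ad_relations q).2.1 (descNS_zero_relations hμ).2 k

theorem superComm_Jplus_descNS {n μ : ℕ} (hμ : μ ≤ 1) (k : ℕ) :
    superComm (Jplus q) (descNS q n μ k) =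
      ((k : ℂ) * (2 * (((n : ℂ) - μ) / 2) - k + 1)) • descNS q n μ (k - 1) := by
  rw [descNS_eq_pow, descNS_eq_pow n μ (k - 1)]
  exact raise_pow (ad_relations q).1 (ad_relations q).2.1 (descNS_zero_relations hμ).1
    (descNS_zero_relations hμ).2 k

theorem descNS_eq_zero {n μ k : ℕ} (hμ : μ ≤ 1) (hk : n < μ + k) :
    descNS q n μ k = 0 := by
  rw [descNS_eq_pow]
  by_cases h0 : descNS q n μ 0 = 0
  · rw [h0, map_zero]
  · obtain ⟨m, hm, hz⟩ := primitive_weight (ad_relations q).1 (ad_relations q).2.1 h0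
      (descNS_zero_relations hμ).1 (descNS_zero_relations hμ).2
    have : n = m + μ := by
      have : (n : ℂ) = m + μ := by linear_combination hm
      exact_mod_cast this
    obtain ⟨r, rfl⟩ := Nat.exists_eq_add_of_le (show m + 1 ≤ k by omega)
    rw [add_comm, pow_add, Module.End.mul_apply, hz, map_zero]

theorem commut_weight_descNSb (a k : ℕ) :
    commut (Sb q) (weight (q + 1)) (descNSb q a k) = ((a : ℂ) - k) • descNSb q a k :=
  weight_pow (ad_relations_sl2 q).2 (ad_weight_raise_pow q a) k

theorem commut_raise_descNSb (a k : ℕ) :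
    commut (Sb q) (raise (q + 1)) (descNSb q a k) =
      ((k : ℂ) * (2 * (a : ℂ) - k + 1)) • descNSb q a (k - 1) :=
  raise_pow (ad_relations_sl2 q).1 (ad_relations_sl2 q).2 (ad_raise_pow q a)
    (ad_weight_raise_pow q a) k

theorem descNSb_eq_zero {a k : ℕ} (hk : 2 * a < k) : descNSb q a k = 0 := by
  by_cases h0 : raise (q + 1) ^ a = 0
  · rw [descNSb, h0, map_zero]
  · obtain ⟨m, hm, hz⟩ := primitive_weight (ad_relations_sl2 q).1 (ad_relations_sl2 q).2 h0
      (ad_raise_pow q a) (ad_weight_raise_pow q a)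
    have : 2 * a = m := by exact_mod_cast hm
    obtain ⟨r, rfl⟩ := Nat.exists_eq_add_of_le (show m + 1 ≤ k by omega)
    rw [descNSb, add_comm (m + 1) r, pow_add, Module.End.mul_apply, hz, map_zero]

end BodyMapExistence

/-! ### Equivariance, parity and surjectivity of the body map. -/

section BodyMapProperties

variable {L : ℕ} {ρ : ℝ} {q : ℕ} {β : S q →ₗ[ℂ] Sb q}

/-- The constant is independent of k because the ratio of the normalizations is, and beyond the
index range both descendants vanish. Hence the body map commutes with J₋. It commutes with J₃ and J₊
as well, since for `g ≠ 0` both strings have the same highest weight. -/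
theorem IsBodyMap.exists_descNS (hρ : 0 < ρ) (hβ : IsBodyMap L ρ q β) {n μ : ℕ} (hn : n ≤ 2 * q)
    (hμ : μ ≤ 1) : ∃ g : ℂ, (g = 0 ∨ n = 2 * (n / 2) + μ) ∧
      ∀ k, β (descNS q n μ k) = g • descNSb q (n / 2) k := by
  obtain ⟨γ, -, hγ⟩ := exists_bodyMap_harmNS (L := L) hρ
  obtain ⟨c, hc⟩ := harmNSb_eq q (n / 2)
  by_cases h : n = 2 * (n / 2) + μ
  · have hr := normS_ratio_ne_zero (n / 2) μ
    set r : ℂ := ((√(4 ^ μ * (2 * (n / 2)).factorial / (2 * (n / 2) + μ).factorial) : ℝ) : ℂ)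
      with hrdef
    refine ⟨γ n μ * c / r, Or.inr h, fun k => ?_⟩
    by_cases hk : μ + k ≤ n
    · let t : IdxS q := ⟨(n, μ, k), hn, hμ, hk⟩
      have h0 : normS n μ k ≠ 0 := normS_ne_zero n μ k
      have hN : normS n μ k = normSb (n / 2) k * r := by
        conv_lhs => rw [h]
        exact normS_eq (n / 2) μ k
      have e := (hγ q β hβ t).1 h
      rw [harmNS_eq, map_smul, hc _ rfl] at e
      change normS n μ k • β (descNS q n μ k) =
        γ n μ • (normSb (n / 2) k * c) • descNSb q (n / 2) k at e
      refine smul_right_injective _ h0 ?_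
      change normS n μ k • β (descNS q n μ k) = normS n μ k • _
      rw [e, smul_smul, smul_smul, hN]
      congr 1
      field_simp
    · rw [descNS_eq_zero hμ (by omega), descNSb_eq_zero (by omega), map_zero, smul_zero]
  · refine ⟨0, Or.inl rfl, fun k => ?_⟩
    by_cases hk : μ + k ≤ n
    · let t : IdxS q := ⟨(n, μ, k), hn, hμ, hk⟩
      have e := (hγ q β hβ t).2 h
      rw [harmNS_eq, map_smul, smul_eq_zero] at e
      change normS n μ k = 0 ∨ β (descNS q n μ k) = 0 at e
      rw [e.resolve_left (normS_ne_zero n μ k), zero_smul]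
    · rw [descNS_eq_zero hμ (by omega), map_zero, zero_smul]

/-- Two linear maps on the truncated supersphere agree if they agree on all descendants. -/
theorem ext_descNS {N : Type*} [AddCommGroup N] [Module ℂ N] {φ φ' : S q →ₗ[ℂ] N}
    (h : ∀ n μ k, n ≤ 2 * q → μ ≤ 1 → φ (descNS q n μ k) = φ' (descNS q n μ k)) (f : S q) :
    φ f = φ' f := by
  refine LinearMap.congr_fun ((basisNS q).ext fun t => ?_) f
  rw [basisNS_apply, harmNS_eq, map_smul, map_smul, h _ _ _ t.2.1 t.2.2.1]

theorem IsBodyMap.superComm_Jminus (hρ : 0 < ρ) (hβ : IsBodyMap L ρ q β) (f : S q) :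
    β (superComm (Jminus q) f) = commut (Sb q) (lower (q + 1)) (β f) := by
  refine ext_descNS (φ := β ∘ₗ superComm (Jminus q))
    (φ' := commut (Sb q) (lower (q + 1)) ∘ₗ β) (fun n μ k hn hμ => ?_) f
  obtain ⟨g, -, hg⟩ := hβ.exists_descNS hρ hn hμ
  simp only [LinearMap.comp_apply]
  rw [← descNS_succ, hg, hg, map_smul, descNSb_succ]

theorem IsBodyMap.superComm_J3 (hρ : 0 < ρ) (hβ : IsBodyMap L ρ q β) (f : S q) :
    β (superComm (J3 q) f) = commut (Sb q) (weight (q + 1)) (β f) := by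
  refine ext_descNS (φ := β ∘ₗ superComm (J3 q))
    (φ' := commut (Sb q) (weight (q + 1)) ∘ₗ β) (fun n μ k hn hμ => ?_) f
  obtain ⟨g, h, hg⟩ := hβ.exists_descNS hρ hn hμ
  simp only [LinearMap.comp_apply]
  rw [superComm_J3_descNS hμ, map_smul, hg, map_smul, commut_weight_descNSb]
  rcases h with rfl | h
  · simp
  · have : (n : ℂ) = 2 * (n / 2 : ℕ) + μ := by exact_mod_cast h
    rw [this]
    module

theorem IsBodyMap.superComm_Jplus (hρ : 0 < ρ) (hβ : IsBodyMap L ρ q β) (f : S q) :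
    β (superComm (Jplus q) f) = commut (Sb q) (raise (q + 1)) (β f) := by
  refine ext_descNS (φ := β ∘ₗ superComm (Jplus q))
    (φ' := commut (Sb q) (raise (q + 1)) ∘ₗ β) (fun n μ k hn hμ => ?_) f
  obtain ⟨g, h, hg⟩ := hβ.exists_descNS hρ hn hμ
  simp only [LinearMap.comp_apply]
  rw [superComm_Jplus_descNS hμ, map_smul, hg, hg, map_smul, commut_raise_descNSb]
  rcases h with rfl | h
  · simp
  · have : (n : ℂ) = 2 * (n / 2 : ℕ) + μ := by exact_mod_cast h
    rw [this]
    module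

theorem par_highNS (q n : ℕ) : par (highNS q n) = (-1 : ℂ) ^ n • highNS q n := by
  obtain ⟨c, -, ⟨h1, h⟩ | ⟨h1, h⟩⟩ := highNS_cases q n
  · rw [h, map_smul, par_pow, Even.neg_one_pow (even_iff_two_dvd.2 ⟨_, h1⟩), one_smul]
  · rw [h, map_smul, oddHigh, par_mul, par_pow, (oddHigh_relations q rfl).1,
      Odd.neg_one_pow ⟨_, h1⟩, mul_neg, smul_neg, neg_one_smul]

theorem par_descNS (q n μ k : ℕ) :
    par (descNS q n μ k) = (-1 : ℂ) ^ (n + μ) • descNS q n μ k := by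
  induction k with
  | zero =>
    induction μ with
    | zero => simpa [descNS] using par_highNS q n
    | succ μ ih =>
      have e : descNS q n (μ + 1) 0 = superComm (J5 q) (descNS q n μ 0) := by
        rw [descNS, pow_succ', pow_zero, one_mul, Module.End.mul_apply, descNS, pow_zero, one_mul]
      rw [e, par_superComm, ih, par_J5, map_smul, map_neg, LinearMap.neg_apply, ← add_assoc,
        pow_succ]
      module
  | succ k ih => rw [descNS_succ, par_superComm, ih, par_Jminus, map_smul]

/-- Only harmonics with n - μ even survive in the body, and these are even. -/
theorem IsBodyMap.apply_par (hρ : 0 < ρ) (hβ : IsBodyMap L ρ q β) (f : S q) :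
    β (par f) = par (β f) := by
  change β (par f) = β f
  refine ext_descNS (φ := β ∘ₗ par) (φ' := β) (fun n μ k hn hμ => ?_) f
  obtain ⟨g, h, hg⟩ := hβ.exists_descNS hρ hn hμ
  rw [LinearMap.comp_apply, par_descNS, map_smul, hg]
  rcases h with rfl | h
  · simp
  · have : n + μ = 2 * (n / 2 + μ) := by omega
    rw [this, pow_mul]
    simp

/-- The spherical harmonic with index (a, k) is, up to a factor, the body of the one with index (2a,
0, k). -/
theorem IsBodyMap.surjective (hρ : 0 < ρ) (hβ : IsBodyMap L ρ q β) : Function.Surjective β := by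
  obtain ⟨γ, h0, hγ⟩ := exists_bodyMap_harmNS (L := L) hρ
  rw [← LinearMap.range_eq_top, eq_top_iff, ← (basisNSb q).span_eq, Submodule.span_le]
  rintro _ ⟨s, rfl⟩
  have ha := s.2.1
  have hk := s.2.2
  let t : IdxS q := ⟨(2 * s.1.1, 0, s.1.2), by omega, by simp, by simpa using hk⟩
  have ht : t.1.1 = 2 * (t.1.1 / 2) + t.1.2.1 := by
    change 2 * s.1.1 = 2 * (2 * s.1.1 / 2) + 0; omega
  have e : t.body ht = s :=
    Subtype.ext (Prod.ext (show 2 * s.1.1 / 2 = s.1.1 by omega) rfl)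
  have e' := (hγ q β hβ t).1 ht
  rw [e] at e'
  refine ⟨(γ t.1.1 t.1.2.1)⁻¹ • harmNS q t, ?_⟩
  rw [map_smul, e', smul_smul, inv_mul_cancel₀ (h0 _ _), one_smul, basisNSb_apply]

theorem IsBodyMap.exists_unit (hρ : 0 < ρ) (hβ : IsBodyMap L ρ q β) : ∃ c : ℂ, c ≠ 0 ∧
    β (basisNS q (idxS₀ q)) = c • basisNSb q (idxSb₀ q) := by
  obtain ⟨γ, h0, hγ⟩ := exists_bodyMap_harmNS (L := L) hρ
  refine ⟨γ 0 0, h0 _ _, ?_⟩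
  have ht : (idxS₀ q).1.1 = 2 * ((idxS₀ q).1.1 / 2) + (idxS₀ q).1.2.1 := by simp [idxS₀]
  have e : (idxS₀ q).body ht = idxSb₀ q :=
    Subtype.ext (Prod.ext (Nat.zero_div 2) rfl)
  have e' := (hγ q β hβ (idxS₀ q)).1 ht
  rw [e] at e'
  rw [basisNS_apply, basisNSb_apply, e']
  rfl

end BodyMapProperties

/-! ### The body map on vector fields -/

section VectorFields

variable {L : ℕ} {ρ : ℝ} {q : ℕ} {β : S q →ₗ[ℂ] Sb q}

/-- Linear equivalences of complex vector spaces. -/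
abbrev VEquiv (U W : Type*) [AddCommGroup U] [Module ℂ U] [AddCommGroup W] [Module ℂ W] :=
  U ≃ₗ[ℂ] W

/-- Bilinear operations on a complex vector space. -/
abbrev BilinOp (U : Type*) [AddCommGroup U] [Module ℂ U] := U →ₗ[ℂ] U →ₗ[ℂ] U

/-- The isomorphism of `osp(1|2)` onto the supervector fields. -/
def ospEquiv (hq : 1 ≤ q) : VEquiv Osp (SVec q) :=
  LinearEquiv.ofInjective (adS q) (adS_injective hq)

/-- The isomorphism of `sl(2)` onto the vector fields of the truncated sphere. -/
def sl2Equiv (hq : 1 ≤ q) : VEquiv Sl2 (Vec q) :=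
  LinearEquiv.ofInjective (adSb q) (adSb_injective hq)

/-- The bracket of supervector fields, with respect to the vector space structure that enters the
grading of `SVec q`. -/
def svecBracket (q : ℕ) : BilinOp (SVec q) := SVec.bracket q

theorem coe_ospEquiv (hq : 1 ≤ q) (x : Osp) : (ospEquiv hq x).1 = adS q x := rfl

theorem coe_sl2Equiv (hq : 1 ≤ q) (x : Sl2) : (sl2Equiv hq x).1 = adSb q x := rfl

theorem coe_svecBracket (D D' : SVec q) : (svecBracket q D D').1 = superComm D.1 D'.1 := rfl

theorem ospEquiv_par (hq : 1 ≤ q) (x : Osp) : ospEquiv hq (par x) = par (ospEquiv hq x) :=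
  Subtype.ext (par_adS q x).symm

theorem ospEquiv_bracket (hq : 1 ≤ q) (x y : Osp) :
    ospEquiv hq (Osp.bracket x y) = svecBracket q (ospEquiv hq x) (ospEquiv hq y) := by
  refine Subtype.ext ?_
  rw [coe_svecBracket, coe_ospEquiv, coe_ospEquiv, coe_ospEquiv, adS_bracket]

theorem HasSphereCohomology.supersphere (hq : 1 ≤ q) {ℓ : S q →ₗ[ℂ] ℂ} {u : S q}
    (h : HasSphereCohomology Osp.bracket (adS q) oE oF oH ℓ u) :
    HasSphereCohomology (svecBracket q) (SVec.act q) (ospEquiv hq oE) (ospEquiv hq oF)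
      (ospEquiv hq oH) ℓ u := by
  refine h.transport (ospEquiv hq) (fun x => ospEquiv_par hq x) (fun x y => ?_) fun x f => ?_
  · rw [ospEquiv_bracket]
  · rfl

theorem supersphere_hasSphereCohomology (hq : 1 ≤ q) :
    HasSphereCohomology (svecBracket q) (SVec.act q) (ospEquiv hq oE) (ospEquiv hq oF)
      (ospEquiv hq oH) ((basisNS q).coord (idxS₀ q)) (basisNS q (idxS₀ q)) :=
  (osp_hasSphereCohomology hq (isReduction_osp hq)).supersphere hq

theorem adSb_bracket (x y : Sl2) :
    adSb q (Sl2.bracket x y) = commut _ (adSb q x) (adSb q y) := by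
  refine LinearMap.ext fun f => ?_
  simp only [adSb, LinearMap.comp_apply, repb_bracket, commut_apply, LinearMap.sub_apply,
    Module.End.mul_apply]
  simp only [mul_sub, sub_mul, mul_assoc]
  abel

theorem sl2Equiv_bracket (hq : 1 ≤ q) (x y : Sl2) :
    sl2Equiv hq (Sl2.bracket x y) = Vec.bracket q (sl2Equiv hq x) (sl2Equiv hq y) :=
  Subtype.ext (adSb_bracket x y)

theorem act_sl2Equiv (hq : 1 ≤ q) (x : Sl2) (f : Sb q) :
    Vec.act q (sl2Equiv hq x) f = adSb q x f := rfl

theorem sphere_hasSphereCohomology (hq : 1 ≤ q) :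
    HasSphereCohomology (Vec.bracket q) (Vec.act q) (sl2Equiv hq sE) (sl2Equiv hq sF)
      (sl2Equiv hq sH) ((basisNSb q).coord (idxSb₀ q)) (basisNSb q (idxSb₀ q)) :=
  (sl2_hasSphereCohomology (isLieModule_sl2 q) (isReduction_sl2 q)).transport (sl2Equiv hq)
    (fun _ => rfl) (sl2Equiv_bracket hq) (act_sl2Equiv hq)

/-- The inclusion of `sl(2)` as the even part of `osp(1|2)`. -/
def sl2Incl : Sl2 →ₗ[ℂ] Osp where
  toFun x := (2 * x.1 0 0) • oH + x.1 0 1 • oE + x.1 1 0 • oF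
  map_add' x y := by simp only [Submodule.coe_add, Matrix.add_apply]; module
  map_smul' c x := by
    simp only [Submodule.coe_smul, Matrix.smul_apply, smul_eq_mul, RingHom.id_apply]; module

theorem sl2Incl_apply (x : Sl2) :
    sl2Incl x = (2 * x.1 0 0) • oH + x.1 0 1 • oE + x.1 1 0 • oF := rfl

theorem sl2Incl_sE : sl2Incl sE = oE := by simp [sl2Incl_apply, sE]
theorem sl2Incl_sF : sl2Incl sF = oF := by simp [sl2Incl_apply, sF]
theorem sl2Incl_sH : sl2Incl sH = oH := by simp [sl2Incl_apply, sH]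

theorem sl2Incl_mem (x : Sl2) : sl2Incl x ∈ homog Osp 0 :=
  add_mem (add_mem (Submodule.smul_mem _ _ isOspFrame.H_mem)
    (Submodule.smul_mem _ _ isOspFrame.E_mem)) (Submodule.smul_mem _ _ isOspFrame.F_mem)

theorem IsBodyMap.apply_adS (hρ : 0 < ρ) (hβ : IsBodyMap L ρ q β) (x : Sl2) (f : S q) :
    β (adS q (sl2Incl x) f) = adSb q x (β f) := by
  have h1 : adS q (sl2Incl x) f = (2 * x.1 0 0) • superComm (J3 q) f +
      x.1 0 1 • superComm (Jplus q) f + x.1 1 0 • superComm (Jminus q) f := by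
    simp only [adS, LinearMap.comp_apply, sl2Incl_apply, map_add, map_smul, rep_oE, rep_oF, rep_oH,
      LinearMap.add_apply, LinearMap.smul_apply]
  have h2 : adSb q x (β f) = (2 * x.1 0 0) • commut (Sb q) (weight (q + 1)) (β f) +
      x.1 0 1 • commut (Sb q) (raise (q + 1)) (β f) +
      x.1 1 0 • commut (Sb q) (lower (q + 1)) (β f) := by
    simp only [adSb, LinearMap.comp_apply, repb_apply, map_add, map_smul, LinearMap.add_apply,
      LinearMap.smul_apply]
  rw [h1, h2, map_add, map_add, map_smul, map_smul, map_smul, hβ.superComm_Jplus hρ,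
    hβ.superComm_Jminus hρ, hβ.superComm_J3 hρ]

/-- The even supervector field with the same `sl(2)`-element as a vector field of the sphere. -/
def vecLift (hq : 1 ≤ q) : Vec q →ₗ[ℂ] SVecEven q :=
  ((ospEquiv hq).toLinearMap ∘ₗ sl2Incl ∘ₗ (sl2Equiv hq).symm.toLinearMap).codRestrict _ fun D => by
    rw [mem_homog_zero]
    change par (ospEquiv hq (sl2Incl ((sl2Equiv hq).symm D))) = _
    rw [← ospEquiv_par, mem_homog_zero.1 (sl2Incl_mem _)]
    rfl

theorem coe_vecLift (hq : 1 ≤ q) (D : Vec q) :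
    (vecLift hq D : SVec q) = ospEquiv hq (sl2Incl ((sl2Equiv hq).symm D)) := rfl

theorem sl2Incl_injective : Function.Injective sl2Incl := by
  rw [injective_iff_map_eq_zero]
  intro x hx
  refine repb_injective (le_refl 1) ?_
  have h1 := congrArg (fun v => (rep 1 v)) hx
  simp only [sl2Incl_apply, map_add, map_smul, rep_oE, rep_oF, rep_oH, map_zero] at h1
  rw [map_zero, repb_apply]
  refine LinearMap.ext fun v => ?_
  exact congrArg (fun X : S 1 => (X ((v, 0) : V 1)).1) h1

theorem vecLift_bijective (hq : 1 ≤ q) : Function.Bijective (vecLift (q := q) hq) := by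
  constructor
  · intro D D' h
    have := congrArg Subtype.val h
    rw [coe_vecLift, coe_vecLift] at this
    exact (sl2Equiv hq).symm.injective (sl2Incl_injective ((ospEquiv hq).injective this))
  · rintro ⟨D, hD⟩
    obtain ⟨x, rfl⟩ := (ospEquiv hq).surjective D
    have hx : x ∈ homog Osp 0 := by
      rw [mem_homog_zero] at hD ⊢
      rw [← ospEquiv_par] at hD
      exact (ospEquiv hq).injective hD
    obtain ⟨a, b, c, rfl⟩ := isOspFrame.toIsFrame.span_even hx
    refine ⟨sl2Equiv hq (a • sE + (b • sF + c • sH)), Subtype.ext ?_⟩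
    have e : sl2Incl (a • sE + (b • sF + c • sH)) = a • oE + (b • oF + c • oH) := by
      rw [map_add, map_add, map_smul, map_smul, map_smul, sl2Incl_sE, sl2Incl_sF, sl2Incl_sH]
    rw [coe_vecLift, LinearEquiv.symm_apply_apply, e]

/-- The body map intertwines the two actions of `sl(2)`, which gives existence. As it is surjective,
the values on bodies determine the vector field. -/
theorem IsBodyMap.existsUnique_isVecBodyMap (hq : 1 ≤ q) (hρ : 0 < ρ) (hβ : IsBodyMap L ρ q β) :
    ∃! βv : SVecEven q ≃ₗ[ℂ] Vec q, IsVecBodyMap β βv := by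
  let e : Vec q ≃ₗ[ℂ] SVecEven q := LinearEquiv.ofBijective (vecLift hq) (vecLift_bijective hq)
  refine ⟨e.symm, fun D f => ?_, fun βv h => LinearEquiv.ext fun D => ?_⟩
  · obtain ⟨D, rfl⟩ := e.surjective D
    obtain ⟨x, rfl⟩ := (sl2Equiv hq).surjective D
    rw [e.symm_apply_apply, coe_sl2Equiv, ← hβ.apply_adS hρ]
    change _ = β ((vecLift hq (sl2Equiv hq x) : SVec q).1 f)
    rw [coe_vecLift, LinearEquiv.symm_apply_apply, coe_ospEquiv]
  · obtain ⟨D, rfl⟩ := e.surjective D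
    obtain ⟨x, rfl⟩ := (sl2Equiv hq).surjective D
    rw [e.symm_apply_apply]
    refine Subtype.ext (LinearMap.ext fun g => ?_)
    obtain ⟨f, rfl⟩ := hβ.surjective hρ g
    rw [h, coe_sl2Equiv, ← hβ.apply_adS hρ]
    change β ((vecLift hq (sl2Equiv hq x) : SVec q).1 f) = _
    rw [coe_vecLift, LinearEquiv.symm_apply_apply, coe_ospEquiv]

theorem IsBodyMap.symm_sl2Equiv (hq : 1 ≤ q) (hρ : 0 < ρ) (hβ : IsBodyMap L ρ q β)
    {βv : SVecEven q ≃ₗ[ℂ] Vec q} (h : IsVecBodyMap β βv) (x : Sl2) :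
    (βv.symm (sl2Equiv hq x) : SVec q) = ospEquiv hq (sl2Incl x) := by
  have e : βv (vecLift hq (sl2Equiv hq x)) = sl2Equiv hq x := by
    refine Subtype.ext (LinearMap.ext fun g => ?_)
    obtain ⟨f, rfl⟩ := hβ.surjective hρ g
    rw [h, coe_vecLift, LinearEquiv.symm_apply_apply, coe_ospEquiv, hβ.apply_adS hρ]
    rfl
  rw [← e, βv.symm_apply_apply, coe_vecLift, LinearEquiv.symm_apply_apply]

theorem sl2Incl_bracket (x y : Sl2) :
    sl2Incl (Sl2.bracket x y) = Osp.bracket (sl2Incl x) (sl2Incl y) := by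
  have hf := isOspFrame.toIsFrame
  have h : (Sl2.bracket x y).1 = x.1 * y.1 - y.1 * x.1 := rfl
  simp only [sl2Incl_apply, map_add, map_smul, LinearMap.add_apply, LinearMap.smul_apply, hf.EE,
    hf.FF, hf.HH, hf.EF, hf.FE, hf.HE, hf.EH, hf.HF, hf.FH, h, Matrix.sub_apply, Matrix.mul_apply,
    Fin.sum_univ_two, Sl2.apply_one_one]
  module

end VectorFields

/-! ### The body map in cohomology -/

section BodyCohomology

/-! ### Comparison of two cohomologies of sphere type. -/

section Functoriality

variable {L M L' M' : Type*} [AddCommGroup L] [Module ℂ L] [SuperSpace L]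
  [AddCommGroup M] [Module ℂ M] [SuperSpace M] [AddCommGroup L'] [Module ℂ L'] [SuperSpace L']
  [AddCommGroup M'] [Module ℂ M'] [SuperSpace M']
  {br : L →ₗ[ℂ] L →ₗ[ℂ] L} {act : L →ₗ[ℂ] Module.End ℂ M} {E F H : L} {ℓ : M →ₗ[ℂ] ℂ} {u : M}
  {br' : L' →ₗ[ℂ] L' →ₗ[ℂ] L'} {act' : L' →ₗ[ℂ] Module.End ℂ M'} {E' F' H' : L'}
  {ℓ' : M' →ₗ[ℂ] ℂ} {u' : M'} {j : L' →ₗ[ℂ] L} {m : M →ₗ[ℂ] M'}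

/-- Modulo exact forms a cocycle is z times the generator ω₀, whose value at the frame is `u`. The
image has there the value z c u' modulo the kernel of `ℓ'`, so on detecting numbers the induced map
is multiplication by c ≠ 0. -/
theorem HasSphereCohomology.exists_map_equiv (hc : HasSphereCohomology br act E F H ℓ u)
    (hc' : HasSphereCohomology br' act' E' F' H' ℓ' u') (hj : ∀ x, j (par x) = par (j x))
    (hm : ∀ x, m (par x) = par (m x)) (hbr : ∀ x y, j (br' x y) = br (j x) (j y))
    (hact : ∀ x f, m (act (j x) f) = act' x (m f)) (hE : j E' = E) (hF : j F' = F) (hH : j H' = H)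
    {c : ℂ} (h0 : c ≠ 0) (hu : m u = c • u') (p : ℕ) :
    ∃ e : Cohomology br act p ≃ₗ[ℂ] Cohomology br' act' p, ∀ ω : Cocycles br act p,
      ∃ h : mapForm j m p ω.1 ∈ Cocycles br' act' p, e (cls br act p ω) = cls br' act' p ⟨_, h⟩ := by
  have hcyc : ∀ ω : Cocycles br act p, mapForm j m p ω.1 ∈ Cocycles br' act' p := fun ω =>
    mapForm_mem_cocycles hj hm hbr hact ω.2
  by_cases hp : p = 0 ∨ p = 3
  · obtain ⟨e, he⟩ := hc.exists_equiv hp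
    obtain ⟨e', he'⟩ := hc'.exists_equiv hp
    obtain ⟨ω₀, hω₀, -, h1⟩ := hc.exists_cocycle p hp
    have args : (fun r => j (frameArgs E' F' H' p r)) = frameArgs E F H p := by
      ext r
      unfold frameArgs
      rcases (r : ℕ) with _ | _ | _ | n <;> simp [hE, hF, hH]
    refine ⟨(e.trans (LinearEquiv.smulOfNeZero ℂ ℂ c h0)).trans e'.symm, fun ω =>
      ⟨hcyc ω, e'.injective ?_⟩⟩
    set z := ℓ (ω.1 (frameArgs E F H p)) with hz
    have hη : ω.1 - z • ω₀ ∈ Coboundaries br act p := by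
      refine (hc.exact_iff p hp _ (sub_mem ω.2 (Submodule.smul_mem _ _ hω₀))).2 ?_
      rw [Pi.sub_apply, Pi.smul_apply, map_sub, map_smul, h1, hc.apply_unit, smul_eq_mul, mul_one,
        sub_self]
    have hη' := mapForm_mem_coboundaries (act'' := act') hj hm hbr hact hη
    have hcy : mapForm j m p (ω.1 - z • ω₀) ∈ Cocycles br' act' p :=
      hcyc (ω - z • ⟨ω₀, hω₀⟩)
    have h2 := (hc'.exact_iff p hp _ hcy).1 hη'
    rw [mapForm_apply, args, Pi.sub_apply, Pi.smul_apply, map_sub, map_smul, h1, hu, map_sub,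
      map_smul, map_smul, hc'.apply_unit, smul_eq_mul, smul_eq_mul, mul_one, sub_eq_zero] at h2
    rw [LinearEquiv.trans_apply, LinearEquiv.apply_symm_apply, LinearEquiv.trans_apply, he, he']
    change _ = ℓ' (m (ω.1 fun r => j (frameArgs E' F' H' p r)))
    rw [args, h2, LinearEquiv.smulOfNeZero_apply, smul_eq_mul, mul_comm]
  · have := hc.subsingleton hp
    have := hc'.subsingleton hp
    exact ⟨LinearEquiv.ofSubsingleton _ _, fun ω => ⟨hcyc ω, Subsingleton.elim _ _⟩⟩

theorem HasSphereCohomology.nonempty_equiv (hc : HasSphereCohomology br act E F H ℓ u)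
    (hc' : HasSphereCohomology br' act' E' F' H' ℓ' u') (p : ℕ) :
    Nonempty (Cohomology br act p ≃ₗ[ℂ] Cohomology br' act' p) := by
  by_cases hp : p = 0 ∨ p = 3
  · obtain ⟨e, -⟩ := hc.exists_equiv hp
    obtain ⟨e', -⟩ := hc'.exists_equiv hp
    exact ⟨e.trans e'.symm⟩
  · have := hc.subsingleton hp
    have := hc'.subsingleton hp
    exact ⟨LinearEquiv.ofSubsingleton _ _⟩

theorem HasSphereCohomology.isCompl (hc : HasSphereCohomology br act E F H ℓ u) (p : ℕ) :
    IsCompl (cohomologyPart br act p 0) (cohomologyPart br act p 1) := by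
  rw [hc.cohomologyPart_zero, hc.cohomologyPart_one]
  exact isCompl_top_bot

/-- Both cohomologies are purely even, so every linear isomorphism respects the gradings. -/
theorem HasSphereCohomology.map_cohomologyPart (hc : HasSphereCohomology br act E F H ℓ u)
    (hc' : HasSphereCohomology br' act' E' F' H' ℓ' u') {p : ℕ}
    (e : Cohomology br act p ≃ₗ[ℂ] Cohomology br' act' p) (k : ZMod 2) :
    (cohomologyPart br act p k).map (e : _ →ₗ[ℂ] _) = cohomologyPart br' act' p k := by
  rcases zmod_two_cases k with rfl | rfl
  · rw [hc.cohomologyPart_zero, hc'.cohomologyPart_zero, Submodule.map_top, LinearEquiv.range]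
  · rw [hc.cohomologyPart_one, hc'.cohomologyPart_one, Submodule.map_bot]

end Functoriality

variable {L : ℕ} {ρ : ℝ} {q : ℕ} {β : S q →ₗ[ℂ] Sb q}

/-- Linear maps of complex vector spaces. -/
abbrev VMap (U W : Type*) [AddCommGroup U] [Module ℂ U] [AddCommGroup W] [Module ℂ W] :=
  U →ₗ[ℂ] W

/-- The inclusion of the vector fields of the sphere as the even supervector fields. -/
def vecIncl (hq : 1 ≤ q) : VMap (Vec q) (SVec q) :=
  (ospEquiv hq).toLinearMap ∘ₗ sl2Incl ∘ₗ (sl2Equiv hq).symm.toLinearMap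

theorem vecIncl_sl2Equiv (hq : 1 ≤ q) (x : Sl2) :
    vecIncl hq (sl2Equiv hq x) = ospEquiv hq (sl2Incl x) := by
  change ospEquiv hq (sl2Incl ((sl2Equiv hq).symm (sl2Equiv hq x))) = _
  rw [LinearEquiv.symm_apply_apply]

theorem vecIncl_par (hq : 1 ≤ q) (D : Vec q) : vecIncl hq (par D) = par (vecIncl hq D) := by
  change vecIncl hq D = par (ospEquiv hq (sl2Incl ((sl2Equiv hq).symm D)))
  rw [← ospEquiv_par, mem_homog_zero.1 (sl2Incl_mem _)]
  rfl

theorem vecIncl_bracket (hq : 1 ≤ q) (D D' : Vec q) :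
    vecIncl hq (Vec.bracket q D D') = svecBracket q (vecIncl hq D) (vecIncl hq D') := by
  obtain ⟨x, rfl⟩ := (sl2Equiv hq).surjective D
  obtain ⟨y, rfl⟩ := (sl2Equiv hq).surjective D'
  rw [← sl2Equiv_bracket, vecIncl_sl2Equiv, vecIncl_sl2Equiv, vecIncl_sl2Equiv, sl2Incl_bracket,
    ospEquiv_bracket]

theorem IsBodyMap.apply_act (hq : 1 ≤ q) (hρ : 0 < ρ) (hβ : IsBodyMap L ρ q β) (D : Vec q)
    (f : S q) : β (SVec.act q (vecIncl hq D) f) = Vec.act q D (β f) := by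
  obtain ⟨x, rfl⟩ := (sl2Equiv hq).surjective D
  rw [vecIncl_sl2Equiv, act_sl2Equiv, ← hβ.apply_adS hρ]
  rfl

/-- This exhibits the body map on forms as an instance of `mapForm`, to which naturality applies. -/
theorem IsBodyMap.bodyForm_eq (hq : 1 ≤ q) (hρ : 0 < ρ) (hβ : IsBodyMap L ρ q β)
    {βv : SVecEven q ≃ₗ[ℂ] Vec q} (h : IsVecBodyMap β βv) (p : ℕ) (ω : (Fin p → SVec q) → S q) :
    bodyForm β βv p ω = mapForm (vecIncl hq) β p ω := by
  funext D
  change β (ω fun r => (βv.symm (D r) : SVec q)) = β (ω fun r => vecIncl hq (D r))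
  congr 2
  funext r
  obtain ⟨x, hx⟩ := (sl2Equiv hq).surjective (D r)
  rw [← hx, hβ.symm_sl2Equiv hq hρ h, vecIncl_sl2Equiv]

theorem IsBodyMap.exists_cohomology_equiv (hq : 1 ≤ q) (hρ : 0 < ρ) (hβ : IsBodyMap L ρ q β)
    (p : ℕ) : ∃ e : Cohomology (svecBracket q) (SVec.act q) p ≃ₗ[ℂ]
        Cohomology (Vec.bracket q) (Vec.act q) p,
      ∀ ω : Cocycles (svecBracket q) (SVec.act q) p,
        ∃ h : mapForm (vecIncl hq) β p ω.1 ∈ Cocycles (Vec.bracket q) (Vec.act q) p,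
          e (cls (svecBracket q) (SVec.act q) p ω) = cls (Vec.bracket q) (Vec.act q) p ⟨_, h⟩ := by
  obtain ⟨c, h0, hu⟩ := hβ.exists_unit hρ
  refine (supersphere_hasSphereCohomology hq).exists_map_equiv (sphere_hasSphereCohomology hq)
    (fun D => vecIncl_par hq D) (fun f => hβ.apply_par hρ f) (fun D D' => ?_) (fun D f => ?_)
    ?_ ?_ ?_ h0 hu p
  · rw [vecIncl_bracket]
  · rw [hβ.apply_act hq hρ]
  · rw [vecIncl_sl2Equiv, sl2Incl_sE]
  · rw [vecIncl_sl2Equiv, sl2Incl_sF]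
  · rw [vecIncl_sl2Equiv, sl2Incl_sH]

end BodyCohomology

end

end FuzzySupersphere

/-! ### The proposition, assembled from the computed cohomologies and the body map. -/

theorem proposition7 (L : ℕ) (hL : 2 ≤ L) (ρ : ℝ) (hρ : 0 < ρ) (q : ℕ) (hq : 1 ≤ q) :
    (∃! β : FuzzySupersphere.S q →ₗ[ℂ] FuzzySupersphere.Sb q,
      FuzzySupersphere.IsBodyMap L ρ q β) ∧
    ∀ β : FuzzySupersphere.S q →ₗ[ℂ] FuzzySupersphere.Sb q, FuzzySupersphere.IsBodyMap L ρ q β →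
      (∃! βv : FuzzySupersphere.SVecEven q ≃ₗ[ℂ] FuzzySupersphere.Vec q,
        FuzzySupersphere.IsVecBodyMap β βv) ∧
      ∀ βv : FuzzySupersphere.SVecEven q ≃ₗ[ℂ] FuzzySupersphere.Vec q,
        FuzzySupersphere.IsVecBodyMap β βv → ∀ p : ℕ,
          -- the cohomology of the truncated supersphere is `ℤ₂`-graded in each degree `p`, and the
          -- map `[ω] ↦ [β ω]` is a well-defined isomorphism of graded vector spaces
          IsCompl
            (FuzzySupersphere.cohomologyPart (FuzzySupersphere.SVec.bracket q)
              (FuzzySupersphere.SVec.act q) p 0)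
            (FuzzySupersphere.cohomologyPart (FuzzySupersphere.SVec.bracket q)
              (FuzzySupersphere.SVec.act q) p 1) ∧
          (∃ Hβ : FuzzySupersphere.HS q p ≃ₗ[ℂ] FuzzySupersphere.HSb q p,
            (∀ ω : FuzzySupersphere.Cocycles (FuzzySupersphere.SVec.bracket q)
                (FuzzySupersphere.SVec.act q) p,
              ∃ h : FuzzySupersphere.bodyForm β βv p ω ∈ FuzzySupersphere.Cocycles
                  (FuzzySupersphere.Vec.bracket q) (FuzzySupersphere.Vec.act q) p,
                Hβ (FuzzySupersphere.cls (FuzzySupersphere.SVec.bracket q)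
                  (FuzzySupersphere.SVec.act q) p ω) =
                FuzzySupersphere.cls (FuzzySupersphere.Vec.bracket q)
                  (FuzzySupersphere.Vec.act q) p ⟨_, h⟩) ∧
            ∀ k : ZMod 2,
              (FuzzySupersphere.cohomologyPart (FuzzySupersphere.SVec.bracket q)
                (FuzzySupersphere.SVec.act q) p k).map (Hβ : _ →ₗ[ℂ] _) =
              FuzzySupersphere.cohomologyPart (FuzzySupersphere.Vec.bracket q)
                (FuzzySupersphere.Vec.act q) p k) ∧
          -- both cohomologies are `ℂ` in degrees `0` and `3` and vanish in all other degrees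
          (p = 0 ∨ p = 3 → Nonempty (FuzzySupersphere.HS q p ≃ₗ[ℂ] ℂ) ∧
            Nonempty (FuzzySupersphere.HSb q p ≃ₗ[ℂ] ℂ)) ∧
          (¬(p = 0 ∨ p = 3) → Subsingleton (FuzzySupersphere.HS q p) ∧
            Subsingleton (FuzzySupersphere.HSb q p)) ∧
          -- in terms of Lie (super)algebra cohomology:
          -- `H(osp(1|2); End V(q/2, 1)) ≅ H(sl(2); End V(q/2)) ≅ H(sl(2); ℂ)`
          Nonempty (FuzzySupersphere.Cohomology FuzzySupersphere.Osp.bracket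
              (FuzzySupersphere.adS q) p ≃ₗ[ℂ]
            FuzzySupersphere.Cohomology FuzzySupersphere.Sl2.bracket
              (FuzzySupersphere.adSb q) p) ∧
          Nonempty (FuzzySupersphere.Cohomology FuzzySupersphere.Sl2.bracket
              (FuzzySupersphere.adSb q) p ≃ₗ[ℂ]
            FuzzySupersphere.Cohomology FuzzySupersphere.Sl2.bracket
              (0 : FuzzySupersphere.Sl2 →ₗ[ℂ] Module.End ℂ ℂ) p) := by
  refine ⟨FuzzySupersphere.existsUnique_isBodyMap hL hρ q, fun β hβ =>
    ⟨hβ.existsUnique_isVecBodyMap hq hρ, fun βv hβv p => ?_⟩⟩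
  have hS := FuzzySupersphere.supersphere_hasSphereCohomology hq
  have hSb := FuzzySupersphere.sphere_hasSphereCohomology hq
  have hosp := FuzzySupersphere.osp_hasSphereCohomology hq (FuzzySupersphere.isReduction_osp hq)
  have hsl := FuzzySupersphere.sl2_hasSphereCohomology (FuzzySupersphere.isLieModule_sl2 q)
    (FuzzySupersphere.isReduction_sl2 q)
  have htriv := FuzzySupersphere.sl2_hasSphereCohomology (FuzzySupersphere.isLieModule_sl2 q).trivial
    (FuzzySupersphere.isReduction_trivial FuzzySupersphere.Sl2.bracket)
  obtain ⟨e, he⟩ := hβ.exists_cohomology_equiv hq hρ p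
  refine ⟨hS.isCompl p, ⟨e, fun ω => ?_, fun k => hS.map_cohomologyPart hSb e k⟩, fun hp => ?_,
    fun hp => ⟨hS.subsingleton hp, hSb.subsingleton hp⟩, hosp.nonempty_equiv hsl p,
    hsl.nonempty_equiv htriv p⟩
  · rw [hβ.bodyForm_eq hq hρ hβv]
    exact he ω
  · obtain ⟨f, -⟩ := hS.exists_equiv hp
    obtain ⟨g, -⟩ := hSb.exists_equiv hp
    exact ⟨⟨f⟩, ⟨g⟩⟩
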